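/- **Data.** Let $q=e^{h}\in\mathbb C^*$ with $q^2\neq1$; let $G^+,G^-$ be holomorphic on $\mathbb C\setminus\{0\}$ without common zero, such that $g=G^+/G^-$ satisfies $g(z)=g(z^{-1})^{-1}$; fix a region $r_1>|z|>r_2$ ($0\le r_2<r_1\le\infty$) in which $G^+$ and $G^-$ have no zeros. Below $g^{\pm1}$ denotes the Laurent expansion of $g^{\pm1}$ in this region, $G^\pm$ the Laurent expansion of $G^\pm$ on $\mathbb C\setminus\{0\}$, $\delta(u)=\sum_{n\in\mathbb Z}u^n$, and $q^{sc}=\exp(shc)$. **Completed free superalgebra.** Let $F$ be the $\mathbb Z_2$-graded algebra of all formal (possibly infinite) complex linear combinations of monomials $c^n y_1\cdots y_r$, where $c$ is central and the $y_i$ are among the generators $\bar a(l),\bar b(l)$ (even) and $x^\pm(l)$ (odd), $l\in\mathbb Z$; $F$ carries the topology of coefficientwise convergence. Let $F^{\hat\otimes N}$ be its $N$-fold completed graded tensor power (formal combinations of $N$-tuples of monomials, with $(a\otimes b)(a'\otimes b')=(-1)^{[b][a']}aa'\otimes bb'$), and $c_i$ the element $c$ of the $i$-th factor. Put $x^\pm(z)=\sum_l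 x^\pm(l)z^{-l}$, $$\varphi(z)=\exp\Big[\sum_{m\le0}\bar a(m)z^{-m}\Big]\exp\Big[\sum_{m>0}\bar a(m)z^{-m}\Big],\quad \psi(z)=\exp\Big[\sum_{m\le0}\bar b(m)z^{-m}\Big]\exp\Big[\sum_{m>0}\bar b(m)z^{-m}\Big].$$ **Relations.** $$\varphi(z)\varphi(w)=\varphi(w)\varphi(z),\quad \psi(z)\psi(w)=\psi(w)\psi(z),\quad \varphi(z)\psi(w)\varphi(z)^{-1}\psi(w)^{-1}=\frac{g(\frac zwq^{-c})}{g(\frac zwq^{c})},$$ $$\varphi(z)x^\pm(w)\varphi(z)^{-1}=g(\tfrac zwq^{\mp c/2})^{\pm1}x^\pm(w),\quad \psi(z)x^\pm(w)\psi(z)^{-1}=g(\tfrac wzq^{\mp c/2})^{\mp1}x^\pm(w),$$ $$\{x^+(z),x^-(w)\}=\tfrac1{q-q^{-1}}\big(\delta(\tfrac zwq^{-c})\psi(wq^{c/2})-\delta(\tfrac zwq^{c})\varphi(zq^{c/2})\big),$$ $$G^\mp(\tfrac zw)x^\pm(z)x^\pm(w)=-G^\pm(\tfrac zw)x^\pm(w)x^\pm(z).$$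 **The algebra.** Let $J_N\subset F^{\hat\otimes N}$ be the two-sided ideal generated by all coefficients of the two-variable formal distributions (left side minus right side) obtained from these relations, imposed in each tensor factor, by the following operations: multiplying one of the relations that involve $\varphi$ or $\psi$ on the left side (the first five) by a Laurent series in the ratio $u$ of the variables in which $g$ is expanded (in either ratio for $\varphi\varphi$, $\psi\psi$), with coefficients in $\mathbb C[[c_1,\dots,c_N]]$ and convergent for $r_1>|u|>r_2$; and then repeatedly forming sums, interchanging the variables, rescaling them by powers of the $q^{c_i/2}$, multiplying by Laurent series in $z/w$ with coefficients in $\mathbb C[[c_1,\dots,c_N]]$ that converge on $\mathbb C\setminus\{0\}$ (when the product is defined), and multiplying from the left or from the right by currents $x^\pm,\varphi^{\pm1},\psi^{\pm1}$ of any tensor factor in one of the two variables (rescaled by powers of the $q^{c_i/2}$). Put $U_q(g,\mathfrak s)=U=F/J_1$ and $U^{\hat\otimes N}=F^{\hat\otimes N}/J_N$. **Theorem.** The parities of the generators make $U$ and all $U^{\hat\otimes N}$ into $\mathbb Z_2$-graded algebras, and $U$ is a (completed) graded Hopf algebra: there are an even algebra homomorphism $\Delta:U\to U\hat\otimes U$,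 an even algebra homomorphism $\varepsilon:U\to\mathbb C$, and an even linear graded anti-homomorphism $a:U\to U$, induced by continuous maps of the completed free algebras, such that $\Delta\otimes\mathrm{id}$, $\mathrm{id}\otimes\Delta$, $\varepsilon\otimes\mathrm{id}$, $\mathrm{id}\otimes\varepsilon$ are defined on the completed tensor products $U^{\hat\otimes 2}$ and $$(\Delta\otimes\mathrm{id})\Delta=(\mathrm{id}\otimes\Delta)\Delta,\quad(\varepsilon\otimes\mathrm{id})\Delta=\mathrm{id}=(\mathrm{id}\otimes\varepsilon)\Delta,\quad m(a\otimes\mathrm{id})\Delta=\varepsilon(\cdot)1=m(\mathrm{id}\otimes a)\Delta,$$ where in the last identities $m(a\otimes\mathrm{id})$ and $m(\mathrm{id}\otimes a)$ are the continuous maps $F\hat\otimes F\to F$, evaluated on the lift of $\Delta$ and read in $U$. They are given by $$\Delta(q^c)=q^c\otimes q^c\ \ (\Delta(c)=c_1+c_2),\quad \Delta(x^+(z))=x^+(z)\otimes1+\varphi(zq^{c_1/2})\otimes x^+(zq^{c_1}),$$ $$\Delta(x^-(z))=1\otimes x^-(z)+x^-(zq^{c_2})\otimes\psi(zq^{c_2/2}),$$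 $$\Delta(\varphi(z))=\varphi(zq^{-c_2/2})\otimes\varphi(zq^{c_1/2}),\quad\Delta(\psi(z))=\psi(zq^{c_2/2})\otimes\psi(zq^{-c_1/2}),$$ $$\varepsilon(q^c)=1\ \ (\varepsilon(c)=0),\quad\varepsilon(\varphi(z))=\varepsilon(\psi(z))=1,\quad\varepsilon(x^\pm(z))=0,$$ $$a(q^c)=q^{-c}\ \ (a(c)=-c),\quad a(x^+(z))=-\varphi(zq^{-c/2})^{-1}x^+(zq^{-c}),\quad a(x^-(z))=-x^-(zq^{-c})\psi(zq^{-c/2})^{-1},$$ $$a(\varphi(z))=\varphi(z)^{-1},\quad a(\psi(z))=\psi(z)^{-1}.$$ -/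

import Mathlib

open scoped BigOperators

noncomputable section

namespace SuperCurrent

/-! ### Completed free superalgebra and its completed graded tensor powers -/

/-- The generators `ā(l)`, `b̄(l)`, `x⁺(l)`, `x⁻(l)`.
The central generator `c` is kept apart (see `Mon`). -/
inductive Letter : Type
  | a (l : ℤ) : Letter
  | b (l : ℤ) : Letter
  | xp (l : ℤ) : Letter
  | xm (l : ℤ) : Letter

/-- The generators `x⁺(l)`, `x⁻(l)` are odd, the other ones are even. -/
def Letter.isOdd : Letter → Bool
  | .a _ => false
  | .b _ => false
  | .xp _ => true
  | .xm _ => true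

/-- Monomials in `N` tensor slots: in each slot a power of the central element `c` and a word
in the remaining generators. -/
abbrev Mon (N : ℕ) : Type := Fin N → Multiplicative ℕ × FreeMonoid Letter

/-- Number of odd letters of a monomial in one slot. -/
def par (m : Multiplicative ℕ × FreeMonoid Letter) : ℕ :=
  (FreeMonoid.toList m.2).countP Letter.isOdd

/-- The sign in `(a₁ ⊗ a₂)(b₁ ⊗ b₂) = (-1)^{[a₂][b₁]} a₁ b₁ ⊗ a₂ b₂`, for any number of slots. -/
def sgn {N : ℕ} (u v : Mon N) : ℂ :=
  (-1) ^ (∑ i, ∑ j ∈ Finset.Iio i, par (u i) * par (v j))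

theorem par_mul (m n : Multiplicative ℕ × FreeMonoid Letter) : par (m * n) = par m + par n := by
  simp [par, FreeMonoid.toList_mul, List.countP_append]

theorem par_one : par 1 = 0 := by simp [par]

theorem sgn_mul_left {N : ℕ} (u v w : Mon N) : sgn (u * v) w = sgn u w * sgn v w := by
  simp only [sgn, Pi.mul_apply, par_mul, add_mul, Finset.sum_add_distrib, pow_add]

theorem sgn_mul_right {N : ℕ} (u v w : Mon N) : sgn u (v * w) = sgn u v * sgn u w := by
  simp only [sgn, Pi.mul_apply, par_mul, mul_add, Finset.sum_add_distrib, pow_add]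

theorem sgn_one_left {N : ℕ} (u : Mon N) : sgn 1 u = 1 := by
  simp [sgn, par_one]

theorem sgn_one_right {N : ℕ} (u : Mon N) : sgn u 1 = 1 := by
  simp [sgn, par_one]

theorem finite_factor_slot (w : Multiplicative ℕ × FreeMonoid Letter) :
    {p : (Multiplicative ℕ × FreeMonoid Letter) × (Multiplicative ℕ × FreeMonoid Letter) |
      p.1 * p.2 = w}.Finite := by
  obtain ⟨n, l⟩ := w
  have h1 : {p : ℕ × ℕ | p.1 + p.2 = Multiplicative.toAdd n}.Finite := by
    refine (Finset.finite_toSet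
      (Finset.HasAntidiagonal.antidiagonal (Multiplicative.toAdd n))).subset ?_
    intro p hp
    simpa using hp
  have h2 : {p : FreeMonoid Letter × FreeMonoid Letter | p.1 * p.2 = l}.Finite := by
    refine (Set.finite_range (fun k : Fin (l.toList.length + 1) =>
      (FreeMonoid.ofList (l.toList.take k), FreeMonoid.ofList (l.toList.drop k)))).subset ?_
    rintro ⟨u, v⟩ hp
    have hp' : u * v = l := hp
    subst hp'
    refine ⟨⟨u.toList.length, ?_⟩, ?_⟩
    · simp [FreeMonoid.toList_mul]
    · simp [FreeMonoid.toList_mul]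
  refine ((h1.prod h2).image (fun p => ((Multiplicative.ofAdd p.1.1, p.2.1),
    (Multiplicative.ofAdd p.1.2, p.2.2)))).subset ?_
  rintro ⟨⟨n1, l1⟩, ⟨n2, l2⟩⟩ hp
  simp only [Set.mem_ofPred_eq, Prod.mk_mul_mk, Prod.mk.injEq] at hp
  refine ⟨((Multiplicative.toAdd n1, Multiplicative.toAdd n2), (l1, l2)), ⟨?_, hp.2⟩, rfl⟩
  simp [← hp.1]

theorem finite_factor {N : ℕ} (w : Mon N) : {p : Mon N × Mon N | p.1 * p.2 = w}.Finite := by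
  have h := Set.Finite.pi' (fun i => finite_factor_slot (w i))
  refine (h.image (fun f => ((fun i => (f i).1), (fun i => (f i).2)))).subset ?_
  rintro ⟨u, v⟩ hp
  refine ⟨fun i => (u i, v i), fun i => ?_, rfl⟩
  exact congrFun hp i

/-- The finitely many factorizations of a monomial. -/
def factor {N : ℕ} (w : Mon N) : Finset (Mon N × Mon N) := (finite_factor w).toFinset

theorem mem_factor {N : ℕ} {w : Mon N} {p : Mon N × Mon N} : p ∈ factor w ↔ p.1 * p.2 = w := by
  simp [factor]

/-- The `N`-fold completed graded tensor power of the completed free superalgebra on the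
generators (with `c` central): all formal, possibly infinite, complex linear combinations of the
monomials in `Mon N`. -/
def FA (N : ℕ) : Type := Mon N → ℂ

namespace FA

variable {N : ℕ}

instance : AddCommGroup (FA N) := inferInstanceAs (AddCommGroup (Mon N → ℂ))

instance : Module ℂ (FA N) := inferInstanceAs (Module ℂ (Mon N → ℂ))

/-- The topology of coefficientwise convergence. -/
instance : TopologicalSpace (FA N) := inferInstanceAs (TopologicalSpace (Mon N → ℂ))

@[ext] theorem ext {f g : FA N} (h : ∀ w, f w = g w) : f = g := funext h

theorem add_apply (f g : FA N) (w : Mon N) : (f + g) w = f w + g w := rfl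

theorem smul_apply (t : ℂ) (f : FA N) (w : Mon N) : (t • f) w = t * f w := rfl

theorem zero_apply (w : Mon N) : (0 : FA N) w = 0 := rfl

open Classical in
/-- The formal series consisting of one monomial. -/
def mono (w : Mon N) : FA N := fun v => if v = w then 1 else 0

instance : One (FA N) := ⟨mono 1⟩

instance : Mul (FA N) := ⟨fun f g w => ∑ p ∈ factor w, sgn p.1 p.2 * f p.1 * g p.2⟩

theorem mul_apply (f g : FA N) (w : Mon N) :
    (f * g) w = ∑ p ∈ factor w, sgn p.1 p.2 * f p.1 * g p.2 := rfl

open Classical in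
theorem one_apply (w : Mon N) : (1 : FA N) w = if w = 1 then 1 else 0 := rfl

protected theorem one_mul' (f : FA N) : 1 * f = f := by
  ext w
  rw [mul_apply, Finset.sum_eq_single (1, w)]
  · simp [one_apply, sgn_one_left]
  · rintro ⟨u, v⟩ hp hne
    rw [mem_factor] at hp
    have hu : u ≠ 1 := by
      rintro rfl
      exact hne (by simpa using hp)
    simp [one_apply, hu]
  · intro h
    exact absurd (mem_factor.2 (by simp)) h

protected theorem mul_one' (f : FA N) : f * 1 = f := by
  ext w
  rw [mul_apply, Finset.sum_eq_single (w, 1)]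
  · simp [one_apply, sgn_one_right]
  · rintro ⟨u, v⟩ hp hne
    rw [mem_factor] at hp
    have hu : v ≠ 1 := by
      rintro rfl
      exact hne (by simpa using hp)
    simp [one_apply, hu]
  · intro h
    exact absurd (mem_factor.2 (by simp)) h

protected theorem mul_assoc' (f g h : FA N) : f * g * h = f * (g * h) := by
  ext w
  simp only [mul_apply, Finset.sum_mul, Finset.mul_sum]
  rw [Finset.sum_sigma', Finset.sum_sigma']
  refine Finset.sum_nbij'
    (i := fun x => ⟨(x.2.1, x.2.2 * x.1.2), (x.2.2, x.1.2)⟩)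
    (j := fun x => ⟨(x.1.1 * x.2.1, x.2.2), (x.1.1, x.2.1)⟩) ?_ ?_ ?_ ?_ ?_
  · rintro ⟨⟨a, b⟩, ⟨c, d⟩⟩ hx
    simp only [Finset.mem_sigma, mem_factor] at hx ⊢
    refine ⟨?_, trivial⟩
    rw [← hx.1, ← hx.2, mul_assoc]
  · rintro ⟨⟨a, b⟩, ⟨c, d⟩⟩ hx
    simp only [Finset.mem_sigma, mem_factor] at hx ⊢
    refine ⟨?_, trivial⟩
    rw [← hx.1, ← hx.2, mul_assoc]
  · rintro ⟨⟨a, b⟩, ⟨c, d⟩⟩ hx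
    simp only [Finset.mem_sigma, mem_factor] at hx
    obtain ⟨-, rfl⟩ := hx
    rfl
  · rintro ⟨⟨a, b⟩, ⟨c, d⟩⟩ hx
    simp only [Finset.mem_sigma, mem_factor] at hx
    obtain ⟨-, rfl⟩ := hx
    rfl
  · rintro ⟨⟨a, b⟩, ⟨c, d⟩⟩ hx
    simp only [Finset.mem_sigma, mem_factor] at hx
    obtain ⟨-, rfl⟩ := hx
    simp only [sgn_mul_left, sgn_mul_right]
    ring

instance : Ring (FA N) :=
  { (inferInstance : AddCommGroup (FA N)) with
    mul := (· * ·)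
    one := 1
    mul_assoc := FA.mul_assoc'
    one_mul := FA.one_mul'
    mul_one := FA.mul_one'
    left_distrib := fun f g h => by
      ext w
      simp only [mul_apply, add_apply, mul_add, Finset.sum_add_distrib]
    right_distrib := fun f g h => by
      ext w
      simp only [mul_apply, add_apply, mul_add, add_mul, Finset.sum_add_distrib]
    zero_mul := fun f => by
      ext w
      simp [mul_apply, zero_apply]
    mul_zero := fun f => by
      ext w
      simp [mul_apply, zero_apply] }

instance : Algebra ℂ (FA N) :=
  Algebra.ofModule
    (fun t f g => by
      ext w
      simp only [mul_apply, smul_apply, Finset.mul_sum]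
      exact Finset.sum_congr rfl fun p _ => by ring)
    (fun t f g => by
      ext w
      simp only [mul_apply, smul_apply, Finset.mul_sum]
      exact Finset.sum_congr rfl fun p _ => by ring)

/-- A generator other than `c`, in the one-slot algebra. -/
def gen (l : Letter) : FA 1 := mono fun _ => (1, FreeMonoid.of l)

/-- The element `c` of the slot `i`. -/
def cc (i : Fin N) : FA N := mono (Pi.mulSingle i (Multiplicative.ofAdd 1, 1))

open Classical in
/-- The element `exp (∑ i, t i • c_i)`. -/
def cexp (t : Fin N → ℂ) : FA N := fun w =>
  if ∀ i, (w i).2 = 1 then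
    ∏ i, t i ^ Multiplicative.toAdd (w i).1 / (Nat.factorial (Multiplicative.toAdd (w i).1) : ℂ)
  else 0

open Classical in
/-- Insertion of the slots of `FA k` as the slots `e 0, e 1, …` of `FA N`, with `1` in the
remaining slots. It is used for strictly increasing `e`. -/
def incl {k : ℕ} (e : Fin k → Fin N) (f : FA k) : FA N := fun w =>
  if ∀ j, j ∉ Set.range e → w j = 1 then f (fun i => w (e i)) else 0

/-- `1 ⊗ ⋯ ⊗ f ⊗ ⋯ ⊗ 1`, with `f` in the slot `i`. -/
def slot (i : Fin N) (f : FA 1) : FA N := incl (fun _ => i) f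

/-- The homogeneous part of degree `d` for the `ℤ/2`-grading. -/
def grade (N : ℕ) (d : ZMod 2) : Submodule ℂ (FA N) where
  carrier := {f | ∀ w, f w ≠ 0 → ((∑ i, par (w i) : ℕ) : ZMod 2) = d}
  add_mem' := fun {f g} hf hg w hw => by
    by_cases h : f w = 0
    · refine hg w fun h' => hw ?_
      rw [add_apply, h, h', add_zero]
    · exact hf w h
  zero_mem' := fun w hw => absurd rfl hw
  smul_mem' := fun t f hf w hw => by
    refine hf w fun h => hw ?_
    rw [smul_apply, h, mul_zero]

end FA

/-! ### Formal distributions -/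

/-- Product of two formal distributions (families of coefficients indexed by the exponents). -/
def conv {Γ : Type} [AddCommGroup Γ] {N : ℕ} (D E : Γ → FA N) : Γ → FA N :=
  fun p => ∑' r, D r * E (p - r)

/-- Powers of a formal distribution in one variable. -/
def convPow {N : ℕ} (D : ℤ → FA N) : ℕ → ℤ → FA N
  | 0 => fun k => if k = 0 then 1 else 0
  | n + 1 => conv (convPow D n) D

/-- Exponential of a formal distribution in one variable. -/
def convExp {N : ℕ} (D : ℤ → FA N) : ℤ → FA N :=
  fun k => ∑' n : ℕ, ((Nat.factorial n : ℂ))⁻¹ • convPow D n k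

/-! Currents are given by their coefficients: the value at `k` is the coefficient of `z ^ k`. -/

/-- `x⁺(z) = ∑ x⁺(l) z^{-l}`. -/
def xp : ℤ → FA 1 := fun k => FA.gen (.xp (-k))

/-- `x⁻(z) = ∑ x⁻(l) z^{-l}`. -/
def xm : ℤ → FA 1 := fun k => FA.gen (.xm (-k))

/-- `∑_{m ≤ 0} y(m) z^{-m}`. -/
def lowPart (y : ℤ → Letter) : ℤ → FA 1 := fun k => if 0 ≤ k then FA.gen (y (-k)) else 0

/-- `∑_{m > 0} y(m) z^{-m}`. -/
def highPart (y : ℤ → Letter) : ℤ → FA 1 := fun k => if k < 0 then FA.gen (y (-k)) else 0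

/-- `exp [∑_{m ≤ 0} y(m) z^{-m}] exp [∑_{m > 0} y(m) z^{-m}]`. -/
def vertex (y : ℤ → Letter) : ℤ → FA 1 := conv (convExp (lowPart y)) (convExp (highPart y))

/-- The inverse of `vertex y`. -/
def vertexInv (y : ℤ → Letter) : ℤ → FA 1 :=
  conv (convExp (-highPart y)) (convExp (-lowPart y))

/-- `φ(z)`. -/
def phi : ℤ → FA 1 := vertex .a

/-- `φ(z)⁻¹`. -/
def phiInv : ℤ → FA 1 := vertexInv .a

/-- `ψ(z)`. -/
def psi : ℤ → FA 1 := vertex .b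

/-- `ψ(z)⁻¹`. -/
def psiInv : ℤ → FA 1 := vertexInv .b

/-- The basic currents. -/
inductive IsCurrent : (ℤ → FA 1) → Prop
  | xp : IsCurrent xp
  | xm : IsCurrent xm
  | phi : IsCurrent phi
  | phiInv : IsCurrent phiInv
  | psi : IsCurrent psi
  | psiInv : IsCurrent psiInv

/-- Formal distributions in two variables: the value at `p` is the coefficient of
`z ^ p.1 * w ^ p.2`. -/
abbrev Dist (N : ℕ) : Type := ℤ × ℤ → FA N

/-- The `k`-th coefficient of the Laurent expansion of `f` on an annulus around `0` that contains
the circle of radius `ρ`. -/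
def laurentCoeff (f : ℂ → ℂ) (ρ : ℝ) (k : ℤ) : ℂ :=
  (2 * (Real.pi : ℂ) * Complex.I)⁻¹ * ∮ z in C(0, ρ), f z * z ^ (-k - 1)

/-! ### The data -/

/-- The parameter `q` with a logarithm `h` (so that `q ^ c = exp (h c)`), the functions `G⁺`, `G⁻`
with `g = G⁺ / G⁻`, and the region `r₁ > |z| > r₂` in which `g` and `g⁻¹` are expanded. -/
structure Datum where
  q : ℂ
  h : ℂ
  exp_h : Complex.exp h = q
  q_sq_ne_one : q ^ 2 ≠ 1
  Gp : ℂ → ℂ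
  Gm : ℂ → ℂ
  differentiableOn_Gp : DifferentiableOn ℂ Gp {0}ᶜ
  differentiableOn_Gm : DifferentiableOn ℂ Gm {0}ᶜ
  no_common_zero : ∀ z, z ≠ 0 → ¬ (Gp z = 0 ∧ Gm z = 0)
  functional_eq : ∀ z, z ≠ 0 → Gp z / Gm z = (Gp z⁻¹ / Gm z⁻¹)⁻¹
  r₂ : ℝ
  r₁ : EReal
  r₂_nonneg : 0 ≤ r₂
  /-- some radius inside the region, on which Laurent coefficients are computed -/
  ρ : ℝ
  r₂_lt : r₂ < ρ
  lt_r₁ : (ρ : EReal) < r₁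
  Gp_ne_zero : ∀ z : ℂ, r₂ < ‖z‖ → (‖z‖ : EReal) < r₁ → Gp z ≠ 0
  Gm_ne_zero : ∀ z : ℂ, r₂ < ‖z‖ → (‖z‖ : EReal) < r₁ → Gm z ≠ 0

namespace Datum

variable (P : Datum)

/-- The radii of the region of expansion. -/
def radii : Set ℝ := {r | P.r₂ < r ∧ (r : EReal) < P.r₁}

/-- Laurent coefficients of `g` in the region. -/
def gCoeff : ℤ → ℂ := laurentCoeff (fun z => P.Gp z / P.Gm z) P.ρ

/-- Laurent coefficients of `g⁻¹` in the region. -/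
def gInvCoeff : ℤ → ℂ := laurentCoeff (fun z => (P.Gp z / P.Gm z)⁻¹) P.ρ

/-- Laurent coefficients of `G⁺`. -/
def GpCoeff : ℤ → ℂ := laurentCoeff P.Gp 1

/-- Laurent coefficients of `G⁻`. -/
def GmCoeff : ℤ → ℂ := laurentCoeff P.Gm 1

variable {N : ℕ}

/-- `q ^ ((∑ i, t i • c_i) / 2)`. -/
def qPow (t : Fin N → ℤ) : FA N := FA.cexp fun i => P.h / 2 * (t i : ℂ)

/-- The current `X(z q^{(∑ s_j c_j)/2})` in the slot `i`. -/
def cur (i : Fin N) (s : Fin N → ℤ) (X : ℤ → FA 1) : ℤ → FA N :=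
  fun k => P.qPow (k • s) * FA.slot i (X k)

/-- The current `X(z q^{(∑ s_j c_j)/2})` in the slot `i`, as a distribution in `z`, `w`. -/
def curZ (i : Fin N) (s : Fin N → ℤ) (X : ℤ → FA 1) : Dist N :=
  fun p => if p.2 = 0 then P.cur i s X p.1 else 0

/-- The current `X(w q^{(∑ s_j c_j)/2})` in the slot `i`, as a distribution in `z`, `w`. -/
def curW (i : Fin N) (s : Fin N → ℤ) (X : ℤ → FA 1) : Dist N :=
  fun p => if p.1 = 0 then P.cur i s X p.2 else 0

/-- `∑ k, F k (z/w) ^ k`. -/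
def ratio (F : ℤ → FA N) : Dist N := fun p => if p.1 + p.2 = 0 then F p.1 else 0

/-- `f(z/w q^{(∑ s_j c_j)/2})` for the series `f(u) = ∑ k, γ k u ^ k`. -/
def fn (s : Fin N → ℤ) (γ : ℤ → ℂ) : Dist N := ratio fun k => γ k • P.qPow (k • s)

/-- A Laurent series `∑ k, F k u ^ k` whose coefficients are power series in the central elements
`c_i`, and which converges absolutely, coefficientwise in the `c_i`, for `|u| ∈ I`. -/
def IsScalarSeries (I : Set ℝ) (F : ℤ → FA N) : Prop :=
  (∀ k w, F k w ≠ 0 → ∀ i, (w i).2 = 1) ∧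
    ∀ w, ∀ r ∈ I, Summable fun k : ℤ => ‖F k w‖ * r ^ k

/-- Exchange relations of `φ`, `ψ` among themselves and with `x^±`. In the last two, `z` and `w`
are interchanged with respect to the usual form
`ψ(z) x^±(w) ψ(z)⁻¹ = g(w/z q^{∓c/2})^{∓1} x^±(w)`, so that in all of them the structure functions
depend on `z/w`. -/
inductive ExchangeRel : Dist 1 → Prop
  | phi_phi : ExchangeRel
      (conv (P.curZ 0 0 phi) (P.curW 0 0 phi) - conv (P.curW 0 0 phi) (P.curZ 0 0 phi))
  | psi_psi : ExchangeRel
      (conv (P.curZ 0 0 psi) (P.curW 0 0 psi) - conv (P.curW 0 0 psi) (P.curZ 0 0 psi))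
  | phi_psi : ExchangeRel
      (conv (conv (conv (P.curZ 0 0 phi) (P.curW 0 0 psi)) (P.curZ 0 0 phiInv)) (P.curW 0 0 psiInv)
        - conv (P.fn ![-2] P.gCoeff) (P.fn ![2] P.gInvCoeff))
  | phi_xp : ExchangeRel
      (conv (conv (P.curZ 0 0 phi) (P.curW 0 0 xp)) (P.curZ 0 0 phiInv)
        - conv (P.fn ![-1] P.gCoeff) (P.curW 0 0 xp))
  | phi_xm : ExchangeRel
      (conv (conv (P.curZ 0 0 phi) (P.curW 0 0 xm)) (P.curZ 0 0 phiInv)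
        - conv (P.fn ![1] P.gInvCoeff) (P.curW 0 0 xm))
  | psi_xp : ExchangeRel
      (conv (conv (P.curW 0 0 psi) (P.curZ 0 0 xp)) (P.curW 0 0 psiInv)
        - conv (P.fn ![-1] P.gInvCoeff) (P.curZ 0 0 xp))
  | psi_xm : ExchangeRel
      (conv (conv (P.curW 0 0 psi) (P.curZ 0 0 xm)) (P.curW 0 0 psiInv)
        - conv (P.fn ![1] P.gCoeff) (P.curZ 0 0 xm))

/-- The remaining relations; `P.fn ![∓2] (fun _ => 1)` is `δ(z/w q^{∓c})`. -/
inductive OtherRel : Dist 1 → Prop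
  | xp_xm : OtherRel
      (conv (P.curZ 0 0 xp) (P.curW 0 0 xm) + conv (P.curW 0 0 xm) (P.curZ 0 0 xp)
        - (P.q - P.q⁻¹)⁻¹ •
          (conv (P.fn ![-2] fun _ => 1) (P.curW 0 ![1] psi)
            - conv (P.fn ![2] fun _ => 1) (P.curZ 0 ![1] phi)))
  | xp_xp : OtherRel
      (conv (P.fn 0 P.GmCoeff) (conv (P.curZ 0 0 xp) (P.curW 0 0 xp))
        + conv (P.fn 0 P.GpCoeff) (conv (P.curW 0 0 xp) (P.curZ 0 0 xp)))
  | xm_xm : OtherRel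
      (conv (P.fn 0 P.GpCoeff) (conv (P.curZ 0 0 xm) (P.curW 0 0 xm))
        + conv (P.fn 0 P.GmCoeff) (conv (P.curW 0 0 xm) (P.curZ 0 0 xm)))

/-- The distributions that are consequences of the defining relations, imposed in each slot.
An exchange relation may be multiplied by any Laurent series in `z/w` that converges in the region
in which `g` is expanded. Any relation may be multiplied from the left and from the right by a
current in one of its variables, and by a Laurent series in `z/w` that converges on `ℂ \ {0}`;
its variables may be interchanged, and rescaled by powers of `q^{c_j/2}`. -/
inductive Null (N : ℕ) : Dist N → Prop
  | exchange (i : Fin N) (R : Dist 1) (hR : P.ExchangeRel R) (F : ℤ → FA N)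
      (hF : IsScalarSeries P.radii F) : Null N (conv (ratio F) fun p => FA.slot i (R p))
  | other (i : Fin N) (R : Dist 1) (hR : P.OtherRel R) : Null N fun p => FA.slot i (R p)
  | add (D E : Dist N) (hD : Null N D) (hE : Null N E) : Null N (D + E)
  | swap (D : Dist N) (hD : Null N D) : Null N fun p => D p.swap
  | rescale (D : Dist N) (hD : Null N D) (s t : Fin N → ℤ) :
      Null N fun p => P.qPow (p.1 • s + p.2 • t) * D p
  | scalar (D : Dist N) (hD : Null N D) (F : ℤ → FA N) (hF : IsScalarSeries (Set.Ioi 0) F)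
      (hs : ∀ p, Summable fun r => ratio F r * D (p - r)) : Null N (conv (ratio F) D)
  | left (D : Dist N) (hD : Null N D) (i : Fin N) (s : Fin N → ℤ) (X : ℤ → FA 1)
      (hX : IsCurrent X) : Null N (conv (P.curZ i s X) D)
  | right (D : Dist N) (hD : Null N D) (i : Fin N) (s : Fin N → ℤ) (X : ℤ → FA 1)
      (hX : IsCurrent X) : Null N (conv D (P.curZ i s X))

/-- The ideal of relations: generated by the coefficients of the distributions in `Null`. -/
def relIdeal (N : ℕ) : TwoSidedIdeal (FA N) :=
  TwoSidedIdeal.span {a | ∃ D : Dist N, P.Null N D ∧ ∃ p, D p = a}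

/-- `U 1` is the algebra `U_q(g, 𝔰)`, and `U N` its `N`-fold completed graded tensor power. -/
abbrev U (N : ℕ) : Type := (P.relIdeal N).ringCon.Quotient

/-- The projection to the quotient. -/
def proj (N : ℕ) : FA N →ₐ[ℂ] P.U N := RingCon.mkₐ ℂ (P.relIdeal N).ringCon

/-- The homogeneous parts of the `ℤ/2`-graded algebra `U N`. -/
def grade (N : ℕ) (d : ZMod 2) : Submodule ℂ (P.U N) :=
  (FA.grade N d).map (P.proj N).toLinearMap

/-- A homomorphism `U k → U l` that is induced by a continuous homomorphism of the completed free
algebras. -/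
structure Hom (k l : ℕ) where
  toAlgHom : P.U k →ₐ[ℂ] P.U l
  hat : FA k →A[ℂ] FA l
  toAlgHom_proj : ∀ a, toAlgHom (P.proj k a) = P.proj l (hat a)

/-- A structure of (completed) graded Hopf algebra on `U_q(g, 𝔰)`. The maps `Δ ⊗ id`, `id ⊗ Δ`,
`ε ⊗ id`, `id ⊗ ε`, `m ∘ (a ⊗ id)`, `m ∘ (id ⊗ a)` on completed tensor products are determined by
continuity and by their values on products of elements of single slots. -/
structure GradedHopfStructure where
  /-- the coproduct `Δ` -/
  comul : P.Hom 1 2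
  /-- `Δ ⊗ id` -/
  comulId : P.Hom 2 3
  /-- `id ⊗ Δ` -/
  idComul : P.Hom 2 3
  /-- the counit `ε` -/
  counit : P.U 1 →ₐ[ℂ] ℂ
  counitHat : FA 1 →A[ℂ] ℂ
  /-- `ε ⊗ id` -/
  counitId : P.Hom 2 1
  /-- `id ⊗ ε` -/
  idCounit : P.Hom 2 1
  /-- the antipode `a` -/
  antipode : P.U 1 →ₗ[ℂ] P.U 1
  antipodeHat : FA 1 →L[ℂ] FA 1
  /-- `m ∘ (a ⊗ id)` -/
  mulAntipodeId : FA 2 →L[ℂ] FA 1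
  /-- `m ∘ (id ⊗ a)` -/
  mulIdAntipode : FA 2 →L[ℂ] FA 1
  counit_proj : ∀ a, counit (P.proj 1 a) = counitHat a
  antipode_proj : ∀ a, antipode (P.proj 1 a) = P.proj 1 (antipodeHat a)
  comulId_slot_zero : ∀ a, comulId.hat (FA.slot 0 a) = FA.incl ![0, 1] (comul.hat a)
  comulId_slot_one : ∀ a, comulId.hat (FA.slot 1 a) = FA.slot 2 a
  idComul_slot_zero : ∀ a, idComul.hat (FA.slot 0 a) = FA.slot 0 a
  idComul_slot_one : ∀ a, idComul.hat (FA.slot 1 a) = FA.incl ![1, 2] (comul.hat a)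
  counitId_slot_zero : ∀ a, counitId.hat (FA.slot 0 a) = algebraMap ℂ (FA 1) (counitHat a)
  counitId_slot_one : ∀ a, counitId.hat (FA.slot 1 a) = a
  idCounit_slot_zero : ∀ a, idCounit.hat (FA.slot 0 a) = a
  idCounit_slot_one : ∀ a, idCounit.hat (FA.slot 1 a) = algebraMap ℂ (FA 1) (counitHat a)
  mulAntipodeId_mul : ∀ a b, mulAntipodeId (FA.slot 0 a * FA.slot 1 b) = antipodeHat a * b
  mulIdAntipode_mul : ∀ a b, mulIdAntipode (FA.slot 0 a * FA.slot 1 b) = a * antipodeHat b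
  comul_grade : ∀ d, ∀ u ∈ P.grade 1 d, comul.toAlgHom u ∈ P.grade 2 d
  counit_odd : ∀ u ∈ P.grade 1 1, counit u = 0
  antipode_grade : ∀ d, ∀ u ∈ P.grade 1 d, antipode u ∈ P.grade 1 d
  coassoc : comulId.toAlgHom.comp comul.toAlgHom = idComul.toAlgHom.comp comul.toAlgHom
  counit_comul : counitId.toAlgHom.comp comul.toAlgHom = AlgHom.id ℂ (P.U 1)
  comul_counit : idCounit.toAlgHom.comp comul.toAlgHom = AlgHom.id ℂ (P.U 1)
  antipode_comul : ∀ a, P.proj 1 (mulAntipodeId (comul.hat a)) =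
    algebraMap ℂ (P.U 1) (counit (P.proj 1 a))
  comul_antipode : ∀ a, P.proj 1 (mulIdAntipode (comul.hat a)) =
    algebraMap ℂ (P.U 1) (counit (P.proj 1 a))
  antipode_one : antipode 1 = 1
  antipode_mul : ∀ d e : ZMod 2, ∀ u ∈ P.grade 1 d, ∀ v ∈ P.grade 1 e,
    antipode (u * v) = ((-1 : ℂ) ^ (d.val * e.val)) • (antipode v * antipode u)

end Datum

end SuperCurrent

end

open SuperCurrent

open scoped BigOperators

noncomputable section

namespace SuperCurrent

set_option linter.unusedSectionVars false

/-! ### Degree, size and parity of monomials -/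

/-- The degree of a generator: `y(l)` has degree `-l`. -/
def Letter.deg : Letter → ℤ
  | .a l => -l
  | .b l => -l
  | .xp l => -l
  | .xm l => -l

/-- The degree of a monomial in one slot. -/
def degSlot : Multiplicative ℕ × FreeMonoid Letter →* Multiplicative ℤ :=
  (FreeMonoid.lift fun y : Letter => Multiplicative.ofAdd y.deg).comp (MonoidHom.snd _ _)

/-- The degree of a monomial. -/
def deg {N : ℕ} : Mon N →* Multiplicative ℤ where
  toFun w := ∏ i, degSlot (w i)
  map_one' := by simp
  map_mul' u v := by simp [Finset.prod_mul_distrib]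

/-- The degree of a monomial, as an integer. -/
def dg {N : ℕ} (w : Mon N) : ℤ := Multiplicative.toAdd (deg w)

/-- The number of factors of a monomial. -/
def size {N : ℕ} (w : Mon N) : ℕ :=
  ∑ i, (Multiplicative.toAdd (w i).1 + (w i).2.length)

/-- The number of odd factors of a monomial. -/
def parity {N : ℕ} (w : Mon N) : ℕ := ∑ i, par (w i)

section
variable {N : ℕ}

@[simp] theorem dg_one : dg (1 : Mon N) = 0 := by simp [dg]

@[simp] theorem dg_mul (u v : Mon N) : dg (u * v) = dg u + dg v := by simp [dg]

theorem size_one : size (1 : Mon N) = 0 := by simp [size]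

theorem size_mul (u v : Mon N) : size (u * v) = size u + size v := by
  simp only [size, ← Finset.sum_add_distrib]
  refine Finset.sum_congr rfl fun i _ => ?_
  simp [FreeMonoid.length_mul]
  ring

theorem size_eq_zero {w : Mon N} (h : size w = 0) : w = 1 := by
  funext i
  simp only [size, Finset.sum_eq_zero_iff, Finset.mem_univ, true_implies, Nat.add_eq_zero_iff] at h
  refine Prod.ext ?_ ?_
  · exact (h i).1
  · exact FreeMonoid.length_eq_zero.1 (h i).2

theorem size_pos {w : Mon N} (h : w ≠ 1) : 0 < size w :=
  Nat.pos_of_ne_zero fun h0 => h (size_eq_zero h0)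

theorem parity_one : parity (1 : Mon N) = 0 := by simp [parity, par_one]

theorem parity_mul (u v : Mon N) : parity (u * v) = parity u + parity v := by
  simp [parity, par_mul, Finset.sum_add_distrib]

theorem par_of_snd_eq_one {m : Multiplicative ℕ × FreeMonoid Letter} (h : m.2 = 1) : par m = 0 := by
  simp [par, h]

theorem dg_of_scal {w : Mon N} (h : ∀ i, (w i).2 = 1) : dg w = 0 := by
  simp [dg, deg, degSlot, h]

theorem parity_of_scal {w : Mon N} (h : ∀ i, (w i).2 = 1) : parity w = 0 := by
  simp [parity, par_of_snd_eq_one, h]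

theorem sgn_of_scal_left {u : Mon N} (h : ∀ i, (u i).2 = 1) (v : Mon N) : sgn u v = 1 := by
  simp [sgn, par_of_snd_eq_one, h]

theorem sgn_mul_self (u v : Mon N) : sgn u v * sgn u v = 1 := by
  rw [sgn, ← mul_pow]; simp

theorem sgn_fin_one (u v : Mon 1) : sgn u v = 1 := by
  have h : Finset.Iio (0 : Fin 1) = ∅ := rfl
  simp [sgn, h]

theorem sum_Iio_add_sum_Iio_swap (f : Fin N → Fin N → ℕ) (h : ∀ i, f i i = 0) :
    (∑ i, ∑ j ∈ Finset.Iio i, f i j) + ∑ i, ∑ j ∈ Finset.Iio i, f j i = ∑ i, ∑ j, f i j := by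
  have h2 : ∑ i, ∑ j ∈ Finset.Iio i, f j i = ∑ i, ∑ j ∈ Finset.Ioi i, f i j := by
    refine Finset.sum_comm' fun x y => ?_
    simp
  rw [h2, ← Finset.sum_add_distrib]
  refine Finset.sum_congr rfl fun i _ => ?_
  rw [← Finset.sum_union]
  · refine Finset.sum_subset (Finset.subset_univ _) fun j _ hj => ?_
    have : j = i := by
      simp only [Finset.mem_union, Finset.mem_Iio, Finset.mem_Ioi, not_or, not_lt] at hj
      exact le_antisymm hj.2 hj.1
    rw [this, h]
  · rw [Finset.disjoint_left]
    intro j hj hj'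
    simp only [Finset.mem_Iio, Finset.mem_Ioi] at hj hj'
    exact absurd hj (not_lt.2 hj'.le)

/-- Interchanging monomials whose letters are in different slots. -/
theorem sgn_comm_of_disjoint {u v : Mon N} (A : Set (Fin N)) (hu : ∀ i ∉ A, (u i).2 = 1)
    (hv : ∀ i ∈ A, (v i).2 = 1) : sgn u v = (-1) ^ (parity u * parity v) * sgn v u := by
  have h : sgn u v * sgn v u = (-1) ^ (parity u * parity v) := by
    rw [sgn, sgn, ← pow_add]
    congr 1
    have h3 := sum_Iio_add_sum_Iio_swap (fun i j => par (u i) * par (v j)) fun i => by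
      by_cases hi : i ∈ A
      · simp [par_of_snd_eq_one (hv i hi)]
      · simp [par_of_snd_eq_one (hu i hi)]
    rw [parity, parity, Finset.sum_mul_sum, ← h3]
    congr 1
    exact Finset.sum_congr rfl fun i _ => Finset.sum_congr rfl fun j _ => mul_comm _ _
  rw [← h, mul_assoc, sgn_mul_self, mul_one]

theorem mul_comm_of_disjoint {u v : Mon N} (A : Set (Fin N)) (hu : ∀ i ∉ A, (u i).2 = 1)
    (hv : ∀ i ∈ A, (v i).2 = 1) : u * v = v * u := by
  funext i
  refine Prod.ext (mul_comm _ _) ?_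
  by_cases hi : i ∈ A
  · simp [hv i hi]
  · simp [hu i hi]

end

/-- All letters that occur in `x` are in the slots of `A`. -/
def LettersIn {K : Type} [Zero K] {N : ℕ} (A : Set (Fin N)) (x : Mon N → K) : Prop :=
  ∀ w, x w ≠ 0 → ∀ i ∉ A, (w i).2 = 1

/-- All monomials of `x` have the parity `d`. -/
def HasParity {K : Type} [Zero K] {N : ℕ} (d : ZMod 2) (x : Mon N → K) : Prop :=
  ∀ w, x w ≠ 0 → (parity w : ZMod 2) = d

theorem LettersIn.hasParity {K : Type} [Zero K] {N : ℕ} {x : Mon N → K} (hx : LettersIn ∅ x) :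
    HasParity 0 x := fun w hw => by
  rw [parity_of_scal fun i => hx w hw i (by simp)]; simp

theorem LettersIn.mono {K : Type} [Zero K] {N : ℕ} {A B : Set (Fin N)} {x : Mon N → K}
    (h : LettersIn A x) (hAB : A ⊆ B) : LettersIn B x :=
  fun w hw i hi => h w hw i fun h' => hi (hAB h')

/-! ### Formal series over a commutative coefficient ring -/

/-- Formal combinations of monomials with coefficients in `K`. -/
def Ser (K : Type) (N : ℕ) : Type := Mon N → K

namespace Ser

variable {K : Type} [CommRing K] [Algebra ℂ K] {N : ℕ}

instance : AddCommGroup (Ser K N) := inferInstanceAs (AddCommGroup (Mon N → K))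

instance : Module ℂ (Ser K N) := inferInstanceAs (Module ℂ (Mon N → K))

@[ext] theorem ext {f g : Ser K N} (h : ∀ w, f w = g w) : f = g := funext h

theorem add_apply (f g : Ser K N) (w : Mon N) : (f + g) w = f w + g w := rfl

theorem sub_apply (f g : Ser K N) (w : Mon N) : (f - g) w = f w - g w := rfl

theorem neg_apply (f : Ser K N) (w : Mon N) : (-f) w = -f w := rfl

theorem zero_apply (w : Mon N) : (0 : Ser K N) w = 0 := rfl

theorem smul_apply (t : ℂ) (f : Ser K N) (w : Mon N) : (t • f) w = t • f w := rfl

open Classical in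
instance : One (Ser K N) := ⟨fun w => if w = 1 then 1 else 0⟩

instance : Mul (Ser K N) := ⟨fun f g w => ∑ p ∈ factor w, sgn p.1 p.2 • (f p.1 * g p.2)⟩

theorem mul_apply (f g : Ser K N) (w : Mon N) :
    (f * g) w = ∑ p ∈ factor w, sgn p.1 p.2 • (f p.1 * g p.2) := rfl

open Classical in
theorem one_apply (w : Mon N) : (1 : Ser K N) w = if w = 1 then 1 else 0 := rfl

protected theorem one_mul' (f : Ser K N) : 1 * f = f := by
  ext w
  rw [mul_apply, Finset.sum_eq_single (1, w)]
  · simp [one_apply, sgn_one_left]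
  · rintro ⟨u, v⟩ hp hne
    rw [mem_factor] at hp
    have hu : u ≠ 1 := by
      rintro rfl
      exact hne (by simpa using hp)
    simp [one_apply, hu]
  · intro h
    exact absurd (mem_factor.2 (by simp)) h

protected theorem mul_one' (f : Ser K N) : f * 1 = f := by
  ext w
  rw [mul_apply, Finset.sum_eq_single (w, 1)]
  · simp [one_apply, sgn_one_right]
  · rintro ⟨u, v⟩ hp hne
    rw [mem_factor] at hp
    have hu : v ≠ 1 := by
      rintro rfl
      exact hne (by simpa using hp)
    simp [one_apply, hu]
  · intro h
    exact absurd (mem_factor.2 (by simp)) h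

end Ser

/-- Reindexing of the sum over factorizations into three factors. -/
theorem sum_factor_assoc {N : ℕ} {M : Type*} [AddCommMonoid M] (w : Mon N)
    (F : Mon N → Mon N → Mon N → M) :
    ∑ p ∈ factor w, ∑ r ∈ factor p.1, F r.1 r.2 p.2 =
      ∑ p ∈ factor w, ∑ r ∈ factor p.2, F p.1 r.1 r.2 := by
  rw [Finset.sum_sigma', Finset.sum_sigma']
  refine Finset.sum_nbij'
    (i := fun x => ⟨(x.2.1, x.2.2 * x.1.2), (x.2.2, x.1.2)⟩)
    (j := fun x => ⟨(x.1.1 * x.2.1, x.2.2), (x.1.1, x.2.1)⟩) ?_ ?_ ?_ ?_ ?_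
  · rintro ⟨⟨a, b⟩, ⟨c, d⟩⟩ hx
    simp only [Finset.mem_sigma, mem_factor] at hx ⊢
    refine ⟨?_, trivial⟩
    rw [← hx.1, ← hx.2, mul_assoc]
  · rintro ⟨⟨a, b⟩, ⟨c, d⟩⟩ hx
    simp only [Finset.mem_sigma, mem_factor] at hx ⊢
    refine ⟨?_, trivial⟩
    rw [← hx.1, ← hx.2, mul_assoc]
  · rintro ⟨⟨a, b⟩, ⟨c, d⟩⟩ hx
    simp only [Finset.mem_sigma, mem_factor] at hx
    obtain ⟨-, rfl⟩ := hx
    rfl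
  · rintro ⟨⟨a, b⟩, ⟨c, d⟩⟩ hx
    simp only [Finset.mem_sigma, mem_factor] at hx
    obtain ⟨-, rfl⟩ := hx
    rfl
  · rintro ⟨⟨a, b⟩, ⟨c, d⟩⟩ hx
    rfl

namespace Ser

variable {K : Type} [CommRing K] [Algebra ℂ K] {N : ℕ}

protected theorem mul_assoc' (f g h : Ser K N) : f * g * h = f * (g * h) := by
  ext w
  have h1 : (f * g * h) w = ∑ p ∈ factor w, ∑ r ∈ factor p.1,
      (sgn r.1 r.2 * sgn r.1 p.2 * sgn r.2 p.2) • (f r.1 * g r.2 * h p.2) := by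
    simp only [mul_apply, Finset.sum_mul, Finset.smul_sum]
    refine Finset.sum_congr rfl fun p _ => Finset.sum_congr rfl fun r hr => ?_
    rw [← mem_factor.1 hr, sgn_mul_left, smul_mul_assoc, smul_smul]
    congr 1
    ring
  have h2 : (f * (g * h)) w = ∑ p ∈ factor w, ∑ r ∈ factor p.2,
      (sgn p.1 r.1 * sgn p.1 r.2 * sgn r.1 r.2) • (f p.1 * g r.1 * h r.2) := by
    simp only [mul_apply, Finset.mul_sum, Finset.smul_sum]
    refine Finset.sum_congr rfl fun p _ => Finset.sum_congr rfl fun r hr => ?_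
    rw [← mem_factor.1 hr, sgn_mul_right, mul_smul_comm, smul_smul, mul_assoc (f p.1)]
  rw [h1, h2]
  exact sum_factor_assoc w fun a b c => (sgn a b * sgn a c * sgn b c) • (f a * g b * h c)

instance : Ring (Ser K N) :=
  { (inferInstance : AddCommGroup (Ser K N)) with
    mul := (· * ·)
    one := 1
    mul_assoc := Ser.mul_assoc'
    one_mul := Ser.one_mul'
    mul_one := Ser.mul_one'
    left_distrib := fun f g h => by
      ext w
      simp only [mul_apply, add_apply, mul_add, smul_add, Finset.sum_add_distrib]
    right_distrib := fun f g h => by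
      ext w
      simp only [mul_apply, add_apply, add_mul, smul_add, Finset.sum_add_distrib]
    zero_mul := fun f => by
      ext w
      simp [mul_apply, zero_apply]
    mul_zero := fun f => by
      ext w
      simp [mul_apply, zero_apply] }

instance : Algebra ℂ (Ser K N) :=
  Algebra.ofModule
    (fun t f g => by
      ext w
      simp only [mul_apply, smul_apply, Finset.smul_sum, smul_mul_assoc]
      exact Finset.sum_congr rfl fun p _ => smul_comm _ _ _)
    (fun t f g => by
      ext w
      simp only [mul_apply, smul_apply, Finset.smul_sum, mul_smul_comm]
      exact Finset.sum_congr rfl fun p _ => smul_comm _ _ _)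

theorem mul_eq_of_sgn {x y : Ser K N} (t : ℂ)
    (h : ∀ u v, x u ≠ 0 → y v ≠ 0 → u * v = v * u ∧ sgn u v = t * sgn v u) :
    x * y = t • (y * x) := by
  ext w
  rw [smul_apply, mul_apply, mul_apply, Finset.smul_sum]
  refine Finset.sum_bij_ne_zero (fun p _ _ => (p.2, p.1)) ?_ ?_ ?_ ?_
  · rintro ⟨u, v⟩ hp hne
    have hx : x u ≠ 0 := fun h0 => hne (by simp [h0])
    have hy : y v ≠ 0 := fun h0 => hne (by simp [h0])
    rw [mem_factor] at hp ⊢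
    exact (h u v hx hy).1 ▸ hp
  · rintro ⟨u, v⟩ _ _ ⟨u', v'⟩ _ _ he
    simp only [Prod.mk.injEq] at he ⊢
    exact he.symm
  · rintro ⟨v, u⟩ hp hne
    have hx : x u ≠ 0 := fun h0 => hne (by simp [h0])
    have hy : y v ≠ 0 := fun h0 => hne (by simp [h0])
    obtain ⟨h1, h2⟩ := h u v hx hy
    refine ⟨(u, v), ?_, ?_, rfl⟩
    · rw [mem_factor] at hp ⊢
      exact h1.trans hp
    · simp only at hne ⊢
      rw [h2, ← smul_smul, mul_comm (x u)]
      exact hne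
  · rintro ⟨u, v⟩ hp hne
    have hx : x u ≠ 0 := fun h0 => hne (by simp [h0])
    have hy : y v ≠ 0 := fun h0 => hne (by simp [h0])
    simp only
    rw [(h u v hx hy).2, smul_smul, mul_comm (x u)]

theorem mul_comm_of_even {x y : Ser K N} (A : Set (Fin N)) (hx : LettersIn A x)
    (hy : LettersIn Aᶜ y) (hp : HasParity 0 x) : x * y = y * x := by
  rw [mul_eq_of_sgn 1, one_smul]
  intro u v hu hv
  have hv' : ∀ i ∈ A, (v i).2 = 1 := fun i hi => hy v hv i (by simpa using hi)
  refine ⟨mul_comm_of_disjoint A (hx u hu) hv', ?_⟩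
  rw [sgn_comm_of_disjoint A (hx u hu) hv']
  have : Even (parity u) := (ZMod.natCast_eq_zero_iff_even).1 (hp u hu)
  rw [(this.mul_right _).neg_one_pow]

theorem mul_anticomm_of_odd {x y : Ser K N} (A : Set (Fin N)) (hx : LettersIn A x)
    (hy : LettersIn Aᶜ y) (hp : HasParity 1 x) (hq : HasParity 1 y) : x * y = -(y * x) := by
  rw [mul_eq_of_sgn (-1), neg_one_smul]
  intro u v hu hv
  have hv' : ∀ i ∈ A, (v i).2 = 1 := fun i hi => hy v hv i (by simpa using hi)
  refine ⟨mul_comm_of_disjoint A (hx u hu) hv', ?_⟩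
  rw [sgn_comm_of_disjoint A (hx u hu) hv']
  have h1 : Odd (parity u) := (ZMod.natCast_eq_one_iff_odd).1 (hp u hu)
  have h2 : Odd (parity v) := (ZMod.natCast_eq_one_iff_odd).1 (hq v hv)
  rw [(h1.mul h2).neg_one_pow]

/-- Series in the central elements commute with everything. -/
theorem _root_.SuperCurrent.LettersIn.commute {x : Ser K N} (hx : LettersIn ∅ x) (y : Ser K N) : x * y = y * x :=
  mul_comm_of_even ∅ hx (fun w _ i hi => by simp at hi) hx.hasParity

theorem _root_.SuperCurrent.LettersIn.mul {A : Set (Fin N)} {x y : Ser K N} (hx : LettersIn A x)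
    (hy : LettersIn A y) : LettersIn A (x * y) := by
  intro w hw i hi
  rw [mul_apply] at hw
  obtain ⟨p, hp, hne⟩ := Finset.exists_ne_zero_of_sum_ne_zero hw
  rw [← mem_factor.1 hp]
  have h1 : x p.1 ≠ 0 := fun h0 => hne (by simp [h0])
  have h2 : y p.2 ≠ 0 := fun h0 => hne (by simp [h0])
  simp [hx _ h1 i hi, hy _ h2 i hi]

theorem lettersIn_one (A : Set (Fin N)) : LettersIn A (1 : Ser K N) := by
  classical
  intro w hw i _
  rw [one_apply] at hw
  have : w = 1 := by by_contra h; simp [h] at hw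
  simp [this]

/-- A multiplicative function on monomials twists coefficients. -/
def twist (χ : Mon N →* K) : FA N →+* Ser K N where
  toFun f := fun w => f w • χ w
  map_one' := by
    classical
    ext w
    rw [FA.one_apply, one_apply]
    split_ifs with h
    · simp [h]
    · simp
  map_zero' := by ext w; exact zero_smul _ _
  map_add' f g := by ext w; exact add_smul _ _ _
  map_mul' f g := by
    ext w
    change (f * g) w • χ w = ∑ p ∈ factor w, sgn p.1 p.2 • (f p.1 • χ p.1 * g p.2 • χ p.2)
    rw [FA.mul_apply, Finset.sum_smul]
    refine Finset.sum_congr rfl fun p hp => ?_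
    rw [← mem_factor.1 hp, map_mul, smul_mul_smul_comm, smul_smul, mul_assoc]

theorem twist_apply (χ : Mon N →* K) (f : FA N) (w : Mon N) : twist χ f w = f w • χ w := rfl

end Ser

/-! ### Topology of the completed free algebras -/

namespace FA

variable {N : ℕ}

instance : T2Space (FA N) := inferInstanceAs (T2Space (Mon N → ℂ))

instance : IsTopologicalAddGroup (FA N) := inferInstanceAs (IsTopologicalAddGroup (Mon N → ℂ))

instance : ContinuousSMul ℂ (FA N) := inferInstanceAs (ContinuousSMul ℂ (Mon N → ℂ))

theorem sub_apply (f g : FA N) (w : Mon N) : (f - g) w = f w - g w := rfl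

theorem neg_apply (f : FA N) (w : Mon N) : (-f) w = -f w := rfl

theorem continuous_coeff (w : Mon N) : Continuous fun f : FA N => f w := continuous_apply w

/-- The coefficient of a monomial. -/
def coeff (w : Mon N) : FA N →L[ℂ] ℂ where
  toFun f := f w
  map_add' _ _ := rfl
  map_smul' _ _ := rfl
  cont := continuous_coeff w

@[simp] theorem coeff_apply (w : Mon N) (f : FA N) : coeff w f = f w := rfl

theorem continuous_iff {X : Type*} [TopologicalSpace X] {F : X → FA N} :
    Continuous F ↔ ∀ w, Continuous fun x => F x w := continuous_pi_iff

instance : ContinuousMul (FA N) where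
  continuous_mul := continuous_iff.2 fun w => by
    simp only [mul_apply]
    refine continuous_finsetSum _ fun p _ => ?_
    exact (continuous_const.mul ((continuous_coeff p.1).comp continuous_fst)).mul
      ((continuous_coeff p.2).comp continuous_snd)

instance : IsTopologicalRing (FA N) := {}

theorem hasSum_iff {ι : Type*} {F : ι → FA N} {f : FA N} :
    HasSum F f ↔ ∀ w, HasSum (fun i => F i w) (f w) := Pi.hasSum

theorem summable_iff {ι : Type*} {F : ι → FA N} :
    Summable F ↔ ∀ w, Summable fun i => F i w := Pi.summable

theorem sum_apply {ι : Type*} (s : Finset ι) (F : ι → FA N) (w : Mon N) :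
    (∑ i ∈ s, F i) w = ∑ i ∈ s, F i w := Finset.sum_apply w s F

theorem mono_apply_self (m : Mon N) : mono m m = 1 := by simp [mono]

theorem mono_apply_ne {m w : Mon N} (h : w ≠ m) : mono m w = 0 := by simp [mono, h]

theorem mono_one : mono (1 : Mon N) = 1 := rfl

theorem hasSum_mono (f : FA N) : HasSum (fun m => f m • mono m) f := by
  refine hasSum_iff.2 fun w => ?_
  convert hasSum_single w ?_ using 1
  · simp [smul_apply, mono_apply_self]
  · intro m hm
    simp [smul_apply, mono_apply_ne hm.symm]

theorem mono_mul (u v : Mon N) : mono u * mono v = sgn u v • mono (u * v) := by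
  ext w
  rw [mul_apply, smul_apply]
  by_cases h : w = u * v
  · subst h
    rw [Finset.sum_eq_single (u, v)]
    · simp [mono_apply_self]
    · rintro ⟨a, b⟩ _ hne
      by_cases ha : a = u
      · have hb : b ≠ v := fun hb => hne (by rw [ha, hb])
        simp [mono_apply_ne hb]
      · simp [mono_apply_ne ha]
    · intro h'
      exact absurd (mem_factor.2 (show (u, v).1 * (u, v).2 = u * v by dsimp only)) h'
  · rw [mono_apply_ne h, mul_zero]
    refine Finset.sum_eq_zero fun p hp => ?_
    by_cases ha : p.1 = u
    · have hb : p.2 ≠ v := fun hb => h (by rw [← mem_factor.1 hp, ha, hb])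
      simp [mono_apply_ne hb]
    · simp [mono_apply_ne ha]

theorem clm_ext {E : Type*} [AddCommGroup E] [Module ℂ E] [TopologicalSpace E] [T2Space E]
    {A B : FA N →L[ℂ] E} (h : ∀ m, A (mono m) = B (mono m)) : A = B := by
  ext f
  have h1 := (hasSum_mono f).mapL A
  have h2 := (hasSum_mono f).mapL B
  simp only [map_smul, h] at h1 h2
  exact h1.unique h2

theorem finite_support {l : ℕ} (A : FA N →L[ℂ] FA l) (w : Mon l) :
    {m | A (mono m) w ≠ 0}.Finite := by
  set ℓ : FA N →L[ℂ] ℂ := (coeff w).comp A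
  let f : FA N := fun m => (ℓ (mono m))⁻¹
  have h1 : HasSum (fun m => f m • ℓ (mono m)) (ℓ f) := by
    simpa only [map_smul] using (hasSum_mono f).mapL ℓ
  have h2 := h1.summable.tendsto_cofinite_zero
  have h3 := h2.eventually (Metric.ball_mem_nhds (0 : ℂ) one_pos)
  rw [Filter.eventually_cofinite] at h3
  refine h3.subset fun m hm => ?_
  have hm' : ℓ (mono m) ≠ 0 := hm
  have : f m • ℓ (mono m) = 1 := inv_mul_cancel₀ hm'
  change ¬ dist (f m • ℓ (mono m)) 0 < 1
  rw [this]
  simp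

/-- The continuous linear map with given values on monomials. -/
def ofFamily {k l : ℕ} (L : Mon k → FA l) (h : ∀ w, {m | L m w ≠ 0}.Finite) :
    FA k →L[ℂ] FA l where
  toFun f := fun w => ∑ m ∈ (h w).toFinset, f m * L m w
  map_add' f g := by
    ext w
    change ∑ m ∈ (h w).toFinset, (f m + g m) * L m w =
      ∑ m ∈ (h w).toFinset, f m * L m w + ∑ m ∈ (h w).toFinset, g m * L m w
    rw [← Finset.sum_add_distrib]
    exact Finset.sum_congr rfl fun m _ => add_mul _ _ _
  map_smul' t f := by
    ext w
    change ∑ m ∈ (h w).toFinset, t * f m * L m w = t * ∑ m ∈ (h w).toFinset, f m * L m w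
    rw [Finset.mul_sum]
    exact Finset.sum_congr rfl fun m _ => mul_assoc _ _ _
  cont := continuous_iff.2 fun w => continuous_finsetSum _ fun m _ =>
    (continuous_coeff m).mul continuous_const

theorem ofFamily_mono {k l : ℕ} (L : Mon k → FA l) (h : ∀ w, {m | L m w ≠ 0}.Finite) (m : Mon k) :
    ofFamily L h (mono m) = L m := by
  ext w
  change ∑ m' ∈ (h w).toFinset, mono m m' * L m' w = L m w
  by_cases hm : L m w = 0
  · rw [hm]
    refine Finset.sum_eq_zero fun m' hm' => ?_
    have : m' ≠ m := by
      rintro rfl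
      simp [hm] at hm'
    rw [mono_apply_ne this, zero_mul]
  · rw [Finset.sum_eq_single m, mono_apply_self, one_mul]
    · intro b _ hb
      rw [mono_apply_ne hb, zero_mul]
    · intro h'
      simp [hm] at h'

/-- Left multiplication. -/
def mulLeft (f : FA N) : FA N →L[ℂ] FA N where
  toLinearMap := LinearMap.mulLeft ℂ f
  cont := continuous_const.mul continuous_id

/-- Right multiplication. -/
def mulRight (f : FA N) : FA N →L[ℂ] FA N where
  toLinearMap := LinearMap.mulRight ℂ f
  cont := continuous_id.mul continuous_const

@[simp] theorem mulLeft_apply (f g : FA N) : mulLeft f g = f * g := rfl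

@[simp] theorem mulRight_apply (f g : FA N) : mulRight f g = g * f := rfl

/-- A continuous linear map that is multiplicative on monomials is multiplicative. -/
theorem map_mul_of_mono {k l : ℕ} (A : FA k →L[ℂ] FA l)
    (h : ∀ u v, A (mono u * mono v) = A (mono u) * A (mono v)) (f g : FA k) :
    A (f * g) = A f * A g := by
  have h1 : ∀ u (g : FA k), A (mono u * g) = A (mono u) * A g := fun u g => by
    have e : A.comp (mulLeft (mono u)) = (mulLeft (A (mono u))).comp A := clm_ext fun v => h u v
    exact congrArg (fun B => B g) e
  have e : A.comp (mulRight g) = (mulRight (A g)).comp A := clm_ext fun v => h1 v g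
  exact congrArg (fun B => B f) e

theorem mul_ne_zero_exists {f g : FA N} {w : Mon N} (h : (f * g) w ≠ 0) :
    ∃ u v, u * v = w ∧ f u ≠ 0 ∧ g v ≠ 0 := by
  rw [mul_apply] at h
  obtain ⟨p, hp, hne⟩ := Finset.exists_ne_zero_of_sum_ne_zero h
  exact ⟨p.1, p.2, mem_factor.1 hp, fun h0 => hne (by simp [h0]), fun h0 => hne (by simp [h0])⟩

theorem mul_apply_one (f g : FA N) : (f * g) 1 = f 1 * g 1 := by
  rw [mul_apply, Finset.sum_eq_single (1, 1)]
  · simp [sgn_one_left]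
  · rintro ⟨u, v⟩ hp hne
    have h := congrArg size (mem_factor.1 hp)
    rw [size_mul, size_one, Nat.add_eq_zero_iff] at h
    exact absurd (by rw [size_eq_zero (w := u) h.1, size_eq_zero (w := v) h.2]) hne
  · intro h
    exact absurd (mem_factor.2 (by simp)) h

end FA

/-! ### Homogeneous distributions -/

section Xd

variable {Γ : Type} [AddCommGroup Γ] {N : ℕ} (χ : Mon N →* Multiplicative Γ)

open Classical in
/-- The formal distribution that collects the monomials `w` of `f` at the exponent `χ w`. -/
def Xd (f : FA N) : Γ → FA N := fun r w => if r = Multiplicative.toAdd (χ w) then f w else 0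

/-- The product of `Xd χ f` with an arbitrary distribution. -/
def lmul (f : FA N) (D : Γ → FA N) : Γ → FA N := fun p w =>
  ∑ q ∈ factor w, sgn q.1 q.2 * f q.1 * D (p - Multiplicative.toAdd (χ q.1)) q.2

/-- The product of an arbitrary distribution with `Xd χ f`. -/
def rmul (D : Γ → FA N) (f : FA N) : Γ → FA N := fun p w =>
  ∑ q ∈ factor w, sgn q.1 q.2 * D (p - Multiplicative.toAdd (χ q.2)) q.1 * f q.2

theorem Xd_apply_self (f : FA N) (w : Mon N) : Xd χ f (Multiplicative.toAdd (χ w)) w = f w := by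
  simp [Xd]

theorem Xd_apply_ne (f : FA N) {r : Γ} {w : Mon N} (h : r ≠ Multiplicative.toAdd (χ w)) :
    Xd χ f r w = 0 := by
  simp [Xd, h]

theorem hasSum_lmul (f : FA N) (D : Γ → FA N) (p : Γ) :
    HasSum (fun r => Xd χ f r * D (p - r)) (lmul χ f D p) := by
  refine FA.hasSum_iff.2 fun w => ?_
  simp only [FA.mul_apply, lmul]
  refine hasSum_sum fun q _ => ?_
  convert hasSum_single (Multiplicative.toAdd (χ q.1)) ?_ using 1
  · rw [Xd_apply_self]
  · intro r hr
    rw [Xd_apply_ne χ f hr]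
    ring

theorem hasSum_rmul (f : FA N) (D : Γ → FA N) (p : Γ) :
    HasSum (fun r => D r * Xd χ f (p - r)) (rmul χ D f p) := by
  refine FA.hasSum_iff.2 fun w => ?_
  simp only [FA.mul_apply, rmul]
  refine hasSum_sum fun q _ => ?_
  convert hasSum_single (p - Multiplicative.toAdd (χ q.2)) ?_ using 1
  · rw [sub_sub_cancel, Xd_apply_self]
  · intro r hr
    rw [Xd_apply_ne χ f fun h => hr (by rw [← h, sub_sub_cancel])]
    ring

theorem conv_Xd_left (f : FA N) (D : Γ → FA N) : conv (Xd χ f) D = lmul χ f D :=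
  funext fun p => (hasSum_lmul χ f D p).tsum_eq

theorem conv_Xd_right (f : FA N) (D : Γ → FA N) : conv D (Xd χ f) = rmul χ D f :=
  funext fun p => (hasSum_rmul χ f D p).tsum_eq

theorem lmul_mul (f g : FA N) (D : Γ → FA N) : lmul χ (f * g) D = lmul χ f (lmul χ g D) := by
  funext p
  ext w
  have h1 : lmul χ (f * g) D p w = ∑ q ∈ factor w, ∑ r ∈ factor q.1,
      sgn r.1 r.2 * sgn r.1 q.2 * sgn r.2 q.2 * (f r.1 * g r.2 *
        D (p - Multiplicative.toAdd (χ r.1) - Multiplicative.toAdd (χ r.2)) q.2) := by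
    simp only [lmul, FA.mul_apply, Finset.sum_mul, Finset.mul_sum]
    refine Finset.sum_congr rfl fun q _ => Finset.sum_congr rfl fun r hr => ?_
    rw [← mem_factor.1 hr, sgn_mul_left, map_mul, toAdd_mul, sub_add_eq_sub_sub]
    ring
  have h2 : lmul χ f (lmul χ g D) p w = ∑ q ∈ factor w, ∑ r ∈ factor q.2,
      sgn q.1 r.1 * sgn q.1 r.2 * sgn r.1 r.2 * (f q.1 * g r.1 *
        D (p - Multiplicative.toAdd (χ q.1) - Multiplicative.toAdd (χ r.1)) r.2) := by
    simp only [lmul, Finset.mul_sum]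
    refine Finset.sum_congr rfl fun q _ => Finset.sum_congr rfl fun r hr => ?_
    rw [← mem_factor.1 hr, sgn_mul_right]
    ring
  rw [h1, h2]
  exact sum_factor_assoc w fun a b c => sgn a b * sgn a c * sgn b c * (f a * g b *
    D (p - Multiplicative.toAdd (χ a) - Multiplicative.toAdd (χ b)) c)

theorem rmul_mul (f g : FA N) (D : Γ → FA N) : rmul χ D (f * g) = rmul χ (rmul χ D f) g := by
  funext p
  ext w
  have h1 : rmul χ (rmul χ D f) g p w = ∑ q ∈ factor w, ∑ r ∈ factor q.1,
      sgn r.1 r.2 * sgn r.1 q.2 * sgn r.2 q.2 * (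
        D (p - Multiplicative.toAdd (χ q.2) - Multiplicative.toAdd (χ r.2)) r.1 * f r.2 *
          g q.2) := by
    simp only [rmul, Finset.sum_mul, Finset.mul_sum]
    refine Finset.sum_congr rfl fun q _ => Finset.sum_congr rfl fun r hr => ?_
    rw [← mem_factor.1 hr, sgn_mul_left]
    ring
  have h2 : rmul χ D (f * g) p w = ∑ q ∈ factor w, ∑ r ∈ factor q.2,
      sgn q.1 r.1 * sgn q.1 r.2 * sgn r.1 r.2 * (
        D (p - Multiplicative.toAdd (χ r.2) - Multiplicative.toAdd (χ r.1)) q.1 * f r.1 *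
          g r.2) := by
    simp only [rmul, FA.mul_apply, Finset.mul_sum]
    refine Finset.sum_congr rfl fun q _ => Finset.sum_congr rfl fun r hr => ?_
    rw [← mem_factor.1 hr, sgn_mul_right, map_mul, toAdd_mul,
      add_comm (Multiplicative.toAdd (χ r.1)), sub_add_eq_sub_sub]
    ring
  rw [h1, h2]
  exact (sum_factor_assoc w fun a b c => sgn a b * sgn a c * sgn b c * (
    D (p - Multiplicative.toAdd (χ c) - Multiplicative.toAdd (χ b)) a * f b * g c)).symm

theorem lmul_Xd (f g : FA N) : lmul χ f (Xd χ g) = Xd χ (f * g) := by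
  funext p
  ext w
  simp only [lmul, Xd, FA.mul_apply]
  split_ifs with h
  · refine Finset.sum_congr rfl fun q hq => ?_
    rw [if_pos (by rw [h, ← mem_factor.1 hq, map_mul, toAdd_mul, add_sub_cancel_left])]
  · refine Finset.sum_eq_zero fun q hq => ?_
    rw [if_neg, mul_zero]
    intro h'
    refine h ?_
    rw [← mem_factor.1 hq, map_mul, toAdd_mul, ← h', add_sub_cancel]

theorem conv_Xd_Xd (f g : FA N) : conv (Xd χ f) (Xd χ g) = Xd χ (f * g) := by
  rw [conv_Xd_left, lmul_Xd]

theorem lmul_add (f g : FA N) (D : Γ → FA N) : lmul χ (f + g) D = lmul χ f D + lmul χ g D := by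
  funext p
  ext w
  simp only [lmul, Pi.add_apply, FA.add_apply, ← Finset.sum_add_distrib]
  exact Finset.sum_congr rfl fun q _ => by ring

theorem rmul_add (f g : FA N) (D : Γ → FA N) : rmul χ D (f + g) = rmul χ D f + rmul χ D g := by
  funext p
  ext w
  simp only [rmul, Pi.add_apply, FA.add_apply, ← Finset.sum_add_distrib]
  exact Finset.sum_congr rfl fun q _ => by ring

theorem lmul_add_right (f : FA N) (D E : Γ → FA N) :
    lmul χ f (D + E) = lmul χ f D + lmul χ f E := by
  funext p
  ext w
  simp only [lmul, Pi.add_apply, FA.add_apply, ← Finset.sum_add_distrib]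
  exact Finset.sum_congr rfl fun q _ => by ring

theorem rmul_add_left (f : FA N) (D E : Γ → FA N) :
    rmul χ (D + E) f = rmul χ D f + rmul χ E f := by
  funext p
  ext w
  simp only [rmul, Pi.add_apply, FA.add_apply, ← Finset.sum_add_distrib]
  exact Finset.sum_congr rfl fun q _ => by ring

theorem lmul_neg (f : FA N) (D : Γ → FA N) : lmul χ (-f) D = -lmul χ f D := by
  funext p
  ext w
  simp only [lmul, Pi.neg_apply, FA.neg_apply, ← Finset.sum_neg_distrib]
  exact Finset.sum_congr rfl fun q _ => by ring

theorem rmul_neg (f : FA N) (D : Γ → FA N) : rmul χ D (-f) = -rmul χ D f := by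
  funext p
  ext w
  simp only [rmul, Pi.neg_apply, FA.neg_apply, ← Finset.sum_neg_distrib]
  exact Finset.sum_congr rfl fun q _ => by ring

theorem lmul_smul_right (f : FA N) (t : ℂ) (D : Γ → FA N) :
    lmul χ f (t • D) = t • lmul χ f D := by
  funext p
  ext w
  simp only [lmul, Pi.smul_apply, FA.smul_apply, Finset.mul_sum]
  exact Finset.sum_congr rfl fun q _ => by ring

theorem rmul_smul_left (f : FA N) (t : ℂ) (D : Γ → FA N) :
    rmul χ (t • D) f = t • rmul χ D f := by
  funext p
  ext w
  simp only [rmul, Pi.smul_apply, FA.smul_apply, Finset.mul_sum]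
  exact Finset.sum_congr rfl fun q _ => by ring

theorem Xd_one [DecidableEq Γ] : Xd χ (1 : FA N) = fun r => if r = 0 then 1 else 0 := by
  classical
  funext r
  ext w
  by_cases hw : w = 1
  · subst hw
    by_cases hr : r = 0 <;> simp [Xd, hr, FA.zero_apply]
  · by_cases hr : r = 0 <;> simp [Xd, hr, FA.one_apply, hw, FA.zero_apply]

theorem lmul_one (D : Γ → FA N) : lmul χ 1 D = D := by
  classical
  rw [← conv_Xd_left, Xd_one]
  funext p
  rw [conv, tsum_eq_single 0]
  · simp
  · intro r hr
    simp [hr]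

theorem rmul_one (D : Γ → FA N) : rmul χ D 1 = D := by
  classical
  rw [← conv_Xd_right, Xd_one]
  funext p
  rw [conv, tsum_eq_single p]
  · simp
  · intro r hr
    simp [sub_eq_zero, Ne.symm hr]

theorem Xd_add (f g : FA N) : Xd χ (f + g) = Xd χ f + Xd χ g := by
  funext r
  ext w
  by_cases h : r = Multiplicative.toAdd (χ w) <;> simp [Xd, h, FA.add_apply]

theorem Xd_neg (f : FA N) : Xd χ (-f) = -Xd χ f := by
  funext r
  ext w
  by_cases h : r = Multiplicative.toAdd (χ w) <;> simp [Xd, h, FA.neg_apply]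

theorem Xd_smul (t : ℂ) (f : FA N) : Xd χ (t • f) = t • Xd χ f := by
  funext r
  ext w
  by_cases h : r = Multiplicative.toAdd (χ w) <;> simp [Xd, h, FA.smul_apply]

theorem Xd_injective : Function.Injective (Xd χ) := fun f g h => by
  ext w
  rw [← Xd_apply_self χ f, h, Xd_apply_self]

theorem hasSum_Xd {ι : Type*} {F : ι → FA N} {f : FA N} (h : HasSum F f) (r : Γ) :
    HasSum (fun i => Xd χ (F i) r) (Xd χ f r) := by
  refine FA.hasSum_iff.2 fun w => ?_
  by_cases hr : r = Multiplicative.toAdd (χ w)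
  · simpa [Xd, hr] using FA.hasSum_iff.1 h w
  · simp [Xd, hr]

end Xd

/-! ### Exponentials -/

namespace FA

variable {N : ℕ}

/-- The exponential series. -/
def fexp (f : FA N) : FA N := ∑' n : ℕ, ((Nat.factorial n : ℂ))⁻¹ • f ^ n

theorem le_size_of_pow_ne_zero {f : FA N} (hf : f 1 = 0) {n : ℕ} {w : Mon N}
    (h : (f ^ n) w ≠ 0) : n ≤ size w := by
  induction n generalizing w with
  | zero => exact Nat.zero_le _
  | succ n ih =>
    rw [pow_succ] at h
    obtain ⟨u, v, rfl, hu, hv⟩ := mul_ne_zero_exists h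
    have hv1 : v ≠ 1 := by
      rintro rfl
      exact hv hf
    have := ih hu
    have := size_pos hv1
    rw [size_mul]
    omega

theorem hasSum_fexp {f : FA N} (hf : f 1 = 0) :
    HasSum (fun n : ℕ => ((Nat.factorial n : ℂ))⁻¹ • f ^ n) (fexp f) := by
  refine Summable.hasSum (summable_iff.2 fun w => ?_)
  refine summable_of_hasFiniteSupport ((Set.finite_Iic (size w)).subset fun n hn => ?_)
  refine le_size_of_pow_ne_zero hf (w := w) fun h => hn ?_
  simp [smul_apply, h]

theorem fexp_add {f g : FA N} (hf : f 1 = 0) (hg : g 1 = 0) (h : f * g = g * f) :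
    fexp (f + g) = fexp f * fexp g := by
  have hs : Summable fun x : ℕ × ℕ => (((Nat.factorial x.1 : ℂ))⁻¹ • f ^ x.1) *
      (((Nat.factorial x.2 : ℂ))⁻¹ • g ^ x.2) := by
    refine summable_iff.2 fun w => summable_of_hasFiniteSupport
      (((Set.finite_Iic (size w)).prod (Set.finite_Iic (size w))).subset fun x hx => ?_)
    rw [Function.mem_support, smul_mul_smul_comm, smul_apply] at hx
    obtain ⟨u, v, rfl, hu, hv⟩ := mul_ne_zero_exists (right_ne_zero_of_mul hx)
    have h1 := le_size_of_pow_ne_zero hf hu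
    have h2 := le_size_of_pow_ne_zero hg hv
    rw [Set.mem_prod, Set.mem_Iic, Set.mem_Iic, size_mul]
    omega
  rw [fexp, fexp, fexp, (hasSum_fexp hf).summable.tsum_mul_tsum_eq_tsum_sum_antidiagonal
    (hasSum_fexp hg).summable hs]
  refine tsum_congr fun n => ?_
  rw [Commute.add_pow' h, Finset.smul_sum]
  refine Finset.sum_congr rfl fun p hp => ?_
  rw [smul_mul_smul_comm, ← Nat.cast_smul_eq_nsmul ℂ, smul_smul]
  congr 1
  rw [Finset.HasAntidiagonal.mem_antidiagonal] at hp
  subst hp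
  have := Nat.add_choose_mul_factorial_mul_factorial p.1 p.2
  have h1 : ((p.1.factorial : ℂ)) ≠ 0 := Nat.cast_ne_zero.2 (Nat.factorial_ne_zero _)
  have h2 : ((p.2.factorial : ℂ)) ≠ 0 := Nat.cast_ne_zero.2 (Nat.factorial_ne_zero _)
  have h3 : (((p.1 + p.2).factorial : ℂ)) ≠ 0 := Nat.cast_ne_zero.2 (Nat.factorial_ne_zero _)
  rw [Nat.choose_symm_add]
  field_simp
  rw [← this]
  push_cast
  ring

theorem fexp_zero : fexp (0 : FA N) = 1 := by
  rw [fexp, tsum_eq_single 0]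
  · simp
  · intro n hn
    simp [hn]

theorem fexp_mul_neg {f : FA N} (hf : f 1 = 0) : fexp f * fexp (-f) = 1 := by
  rw [← fexp_add hf (by rw [neg_apply, hf, neg_zero]) (by simp), add_neg_cancel, fexp_zero]

theorem fexp_neg_mul {f : FA N} (hf : f 1 = 0) : fexp (-f) * fexp f = 1 := by
  rw [← fexp_add (by rw [neg_apply, hf, neg_zero]) hf (by simp), neg_add_cancel, fexp_zero]

theorem map_fexp {l : ℕ} (A : FA N →L[ℂ] FA l) {f : FA N} {g : FA l} (hf : f 1 = 0)
    (hg : g 1 = 0) (h : ∀ n, A (f ^ n) = g ^ n) : A (fexp f) = fexp g := by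
  have h1 := (hasSum_fexp hf).mapL A
  simp only [map_smul, h] at h1
  exact h1.unique (hasSum_fexp hg)

theorem convPow_Xd (f : FA N) (n : ℕ) : convPow (Xd deg f) n = Xd deg (f ^ n) := by
  induction n with
  | zero => rw [pow_zero, Xd_one]; rfl
  | succ n ih => rw [convPow, ih, conv_Xd_Xd, pow_succ]

theorem convExp_Xd {f : FA N} (hf : f 1 = 0) : convExp (Xd deg f) = Xd deg (fexp f) := by
  funext k
  have := hasSum_Xd deg (hasSum_fexp hf) k
  rw [convExp, ← this.tsum_eq]
  exact tsum_congr fun n => by rw [convPow_Xd, Xd_smul, Pi.smul_apply]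

end FA

/-! ### Continuous maps between completed free algebras -/

namespace FA

variable {N k l : ℕ}

theorem apply_eq_sum (A : FA k →L[ℂ] FA l) (f : FA k) (w : Mon l) :
    A f w = ∑ m ∈ (finite_support A w).toFinset, f m * A (mono m) w := by
  have h : A = ofFamily (fun m => A (mono m)) (finite_support A) :=
    clm_ext fun m => (ofFamily_mono (fun m => A (mono m)) (finite_support A) m).symm
  conv_lhs => rw [h]
  rfl

theorem exists_of_apply_ne_zero (A : FA k →L[ℂ] FA l) {f : FA k} {w : Mon l} (h : A f w ≠ 0) :
    ∃ m, f m ≠ 0 ∧ A (mono m) w ≠ 0 := by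
  rw [apply_eq_sum] at h
  obtain ⟨m, _, hm⟩ := Finset.exists_ne_zero_of_sum_ne_zero h
  exact ⟨m, left_ne_zero_of_mul hm, right_ne_zero_of_mul hm⟩

/-- Maps that preserve the degree. -/
def DegPres (A : FA k →L[ℂ] FA l) : Prop := ∀ m w, A (mono m) w ≠ 0 → dg w = dg m

/-- Maps that preserve series in the central elements. -/
def ScalPres (A : FA k →L[ℂ] FA l) : Prop := ∀ f : FA k, LettersIn ∅ f → LettersIn ∅ (A f)

/-- Maps that preserve the parity. -/
def ParPres (A : FA k →L[ℂ] FA l) : Prop :=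
  ∀ m w, A (mono m) w ≠ 0 → (parity w : ZMod 2) = parity m

theorem DegPres.map_Xd {Γ : Type} [AddCommGroup Γ] {A : FA k →L[ℂ] FA l} (hA : DegPres A)
    (ψ : Multiplicative ℤ →* Multiplicative Γ) (f : FA k) (r : Γ) :
    A (Xd (ψ.comp deg) f r) = Xd (ψ.comp deg) (A f) r := by
  ext w
  rw [apply_eq_sum]
  have e : ∀ m, A (mono m) w ≠ 0 → ψ.comp deg m = ψ.comp deg w := fun m hm => by
    have := hA m w hm
    simp only [dg] at this
    simp only [MonoidHom.comp_apply]
    rw [Multiplicative.toAdd.injective this]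
  by_cases h : r = Multiplicative.toAdd (ψ.comp deg w)
  · rw [h, Xd_apply_self, apply_eq_sum]
    refine Finset.sum_congr rfl fun m hm => ?_
    rw [← e m (by simpa using hm), Xd_apply_self]
  · rw [Xd_apply_ne _ _ h]
    refine Finset.sum_eq_zero fun m hm => ?_
    rw [Xd_apply_ne, zero_mul]
    rwa [e m (by simpa using hm)]

theorem DegPres.map_comp {A : FA k →L[ℂ] FA l} (hA : DegPres A) (f : FA k) (r : ℤ) :
    A (Xd deg f r) = Xd deg (A f) r :=
  hA.map_Xd (MonoidHom.id _) f r

theorem ParPres.map {A : FA k →L[ℂ] FA l} (hA : ParPres A) {d : ZMod 2} {f : FA k}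
    (hf : HasParity d f) : HasParity d (A f) := fun w hw => by
  obtain ⟨m, hm, h⟩ := exists_of_apply_ne_zero A hw
  rw [hA m w h, hf m hm]

/-! Insertion of slots -/

/-- Insertion of the slots of a monomial. -/
def emb (e : Fin k → Fin N) (he : Function.Injective e) : Mon k →* Mon N where
  toFun m := Function.extend e m 1
  map_one' := by
    funext j
    by_cases h : ∃ i, e i = j
    · obtain ⟨i, rfl⟩ := h
      rw [he.extend_apply]; rfl
    · rw [Function.extend_apply' _ _ _ h]
  map_mul' u v := by
    funext j
    rw [Pi.mul_apply]
    by_cases h : ∃ i, e i = j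
    · obtain ⟨i, rfl⟩ := h
      rw [he.extend_apply, he.extend_apply, he.extend_apply]; rfl
    · rw [Function.extend_apply' _ _ _ h, Function.extend_apply' _ _ _ h,
        Function.extend_apply' _ _ _ h, Pi.one_apply, mul_one]

theorem emb_apply (e : Fin k → Fin N) (he : Function.Injective e) (m : Mon k) (i : Fin k) :
    emb e he m (e i) = m i := he.extend_apply m 1 i

theorem emb_apply_of_notMem (e : Fin k → Fin N) (he : Function.Injective e) (m : Mon k) {j : Fin N}
    (h : j ∉ Set.range e) : emb e he m j = 1 := Function.extend_apply' _ _ _ h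

theorem sum_emb {M : Type*} [AddCommMonoid M] (e : Fin k → Fin N) (he : Function.Injective e)
    (F : Fin N → M) (hF : ∀ j ∉ Set.range e, F j = 0) : ∑ j, F j = ∑ i, F (e i) := by
  symm
  refine Finset.sum_of_injOn e he.injOn (fun _ _ => Finset.mem_coe.2 (Finset.mem_univ _)) ?_
    fun _ _ => rfl
  intro j _ hj
  exact hF j fun ⟨i, hi⟩ => hj ⟨i, by simp, hi⟩

theorem sgn_emb (e : Fin k → Fin N) (he : StrictMono e) (u v : Mon k) :
    sgn (emb e he.injective u) (emb e he.injective v) = sgn u v := by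
  simp only [sgn]
  congr 1
  rw [sum_emb e he.injective]
  · refine Finset.sum_congr rfl fun i _ => ?_
    have hI : ∀ {n : ℕ} (a : Fin n), Finset.Iio a = Finset.univ.filter (· < a) := fun a => by
      ext; simp
    rw [hI, hI, Finset.sum_filter, Finset.sum_filter, sum_emb e he.injective]
    · refine Finset.sum_congr rfl fun j _ => ?_
      simp only [emb_apply, he.lt_iff_lt]
    · intro j hj
      simp [emb_apply_of_notMem e he.injective v hj, par_one]
  · intro j hj
    simp [emb_apply_of_notMem e he.injective u hj, par_one]

theorem dg_emb (e : Fin k → Fin N) (he : Function.Injective e) (m : Mon k) :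
    dg (emb e he m) = dg m := by
  have h : ∀ n (w : Mon n), dg w = ∑ i, Multiplicative.toAdd (degSlot (w i)) := fun n w => by
    simp [dg, deg, toAdd_prod]
  rw [h, h, sum_emb e he]
  · simp only [emb_apply]
  · intro j hj
    simp [emb_apply_of_notMem e he m hj]

theorem parity_emb (e : Fin k → Fin N) (he : Function.Injective e) (m : Mon k) :
    parity (emb e he m) = parity m := by
  rw [parity, parity, sum_emb e he]
  · simp only [emb_apply]
  · intro j hj
    simp [emb_apply_of_notMem e he m hj, par_one]

theorem eq_emb_iff (e : Fin k → Fin N) (he : Function.Injective e) (m : Mon k) (w : Mon N) :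
    w = emb e he m ↔ (∀ j, j ∉ Set.range e → w j = 1) ∧ (fun i => w (e i)) = m := by
  constructor
  · rintro rfl
    exact ⟨fun j hj => emb_apply_of_notMem e he m hj, funext fun i => emb_apply e he m i⟩
  · rintro ⟨h1, rfl⟩
    funext j
    by_cases h : j ∈ Set.range e
    · obtain ⟨i, rfl⟩ := h
      rw [emb_apply]
    · rw [emb_apply_of_notMem e he _ h, h1 j h]

theorem incl_mono (e : Fin k → Fin N) (he : Function.Injective e) (m : Mon k) :
    incl e (mono m) = mono (emb e he m) := by
  classical
  ext w
  simp only [incl, mono]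
  by_cases h : w = emb e he m
  · have h' := (eq_emb_iff e he m w).1 h
    rw [if_pos h, if_pos h'.1, if_pos h'.2]
  · rw [if_neg h]
    split_ifs with h1 h2
    · exact absurd ((eq_emb_iff e he m w).2 ⟨h1, h2⟩) h
    · rfl
    · rfl

/-- `incl`, as a continuous linear map. -/
def inclL (e : Fin k → Fin N) : FA k →L[ℂ] FA N where
  toFun := incl e
  map_add' f g := by
    classical
    ext w
    simp only [incl, add_apply]
    split_ifs <;> simp
  map_smul' t f := by
    classical
    ext w
    simp only [incl, smul_apply, RingHom.id_apply]
    split_ifs <;> simp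
  cont := continuous_iff.2 fun w => by
    classical
    by_cases h : ∀ j, j ∉ Set.range e → w j = 1
    · simpa only [incl, if_pos h] using continuous_coeff _
    · simpa only [incl, if_neg h] using continuous_const

/-- A continuous linear map that is multiplicative, as a continuous homomorphism. -/
def homOfCLM (A : FA k →L[ℂ] FA l) (h1 : A 1 = 1) (hm : ∀ f g, A (f * g) = A f * A g) :
    FA k →A[ℂ] FA l where
  toAlgHom := AlgHom.ofLinearMap A.toLinearMap h1 hm
  cont := A.cont

/-- `incl`, as a continuous homomorphism. -/
def inclHom (e : Fin k → Fin N) (he : StrictMono e) : FA k →A[ℂ] FA N :=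
  homOfCLM (inclL e)
    (by
      change incl e (mono 1) = mono 1
      rw [incl_mono e he.injective, map_one])
    (map_mul_of_mono _ fun u v => by
      change incl e _ = incl e _ * incl e _
      rw [mono_mul, incl_mono e he.injective, incl_mono e he.injective, mono_mul, sgn_emb e he]
      change inclL e _ = _
      rw [map_smul]
      change sgn u v • incl e _ = _
      rw [incl_mono e he.injective, map_mul])

@[simp] theorem inclHom_apply (e : Fin k → Fin N) (he : StrictMono e) (f : FA k) :
    inclHom e he f = incl e f := rfl

theorem strictMono_const (i : Fin N) : StrictMono fun _ : Fin 1 => i :=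
  fun a b h => absurd h (by simp [Subsingleton.elim a b])

/-- `slot i`, as a continuous homomorphism. -/
def slotHom (i : Fin N) : FA 1 →A[ℂ] FA N := inclHom (fun _ => i) (strictMono_const i)

@[simp] theorem slotHom_apply (i : Fin N) (f : FA 1) : slotHom i f = slot i f := rfl

/-- The continuous linear map underlying a continuous homomorphism. -/
def toCLM (Φ : FA k →A[ℂ] FA l) : FA k →L[ℂ] FA l where
  toLinearMap := Φ.toAlgHom.toLinearMap
  cont := Φ.cont

@[simp] theorem toCLM_apply (Φ : FA k →A[ℂ] FA l) (f : FA k) : toCLM Φ f = Φ f := rfl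

theorem toCLM_injective {Φ Ψ : FA k →A[ℂ] FA l} (h : toCLM Φ = toCLM Ψ) : Φ = Ψ := by
  refine ContinuousAlgHom.ext fun f => ?_
  exact congrArg (fun A : FA k →L[ℂ] FA l => A f) h

theorem inclHom_degPres (e : Fin k → Fin N) (he : StrictMono e) :
    DegPres (toCLM (inclHom e he)) := fun m w h => by
  rw [toCLM_apply, inclHom_apply, incl_mono e he.injective] at h
  have : w = emb e he.injective m := by
    by_contra h'
    exact h (mono_apply_ne h')
  rw [this, dg_emb]

theorem inclHom_parPres (e : Fin k → Fin N) (he : StrictMono e) :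
    ParPres (toCLM (inclHom e he)) := fun m w h => by
  rw [toCLM_apply, inclHom_apply, incl_mono e he.injective] at h
  have : w = emb e he.injective m := by
    by_contra h'
    exact h (mono_apply_ne h')
  rw [this, parity_emb]

theorem slot_lettersIn (i : Fin N) (f : FA 1) : LettersIn {i} (slot i f) := by
  classical
  intro w hw j hj
  have : ∀ j, j ∉ Set.range (fun _ : Fin 1 => i) → w j = 1 := by
    by_contra h
    exact hw (if_neg h)
  rw [this j (by rintro ⟨_, rfl⟩; exact hj rfl)]
  rfl

@[simp] theorem slot_fin_one (f : FA 1) : slot (0 : Fin 1) f = f := by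
  classical
  ext w
  rw [slot, incl, if_pos]
  · congr 1
    funext i
    rw [Subsingleton.elim i 0]
  · intro j hj
    exact absurd ⟨0, Subsingleton.elim _ _⟩ hj

theorem incl_slot (e : Fin k → Fin N) (he : StrictMono e) (i : Fin k) (f : FA 1) :
    incl e (slot i f) = slot (e i) f := by
  have h : (inclL e).comp (inclL fun _ : Fin 1 => i) = inclL fun _ : Fin 1 => e i := by
    refine clm_ext fun m => ?_
    change incl e (incl _ _) = incl _ _
    rw [incl_mono _ (strictMono_const i).injective, incl_mono _ he.injective,
      incl_mono _ (strictMono_const (e i)).injective]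
    congr 1
    rw [eq_emb_iff]
    constructor
    · intro j hj
      by_cases hj' : j ∈ Set.range e
      · obtain ⟨a, rfl⟩ := hj'
        rw [emb_apply, emb_apply_of_notMem]
        rintro ⟨x, hx⟩
        exact hj ⟨x, congrArg e hx⟩
      · rw [emb_apply_of_notMem _ _ _ hj']
    · funext a
      rw [emb_apply e, emb_apply (fun _ : Fin 1 => i)]
  exact congrArg (fun A : FA 1 →L[ℂ] FA N => A f) h

/-! Extension of maps from generators -/

/-- The monomial `c^n y_1 ⋯ y_r` in one slot. -/
def mon1 (m : Multiplicative ℕ × FreeMonoid Letter) : Mon 1 := fun _ => m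

theorem mon1_mul (m n : Multiplicative ℕ × FreeMonoid Letter) : mon1 (m * n) = mon1 m * mon1 n :=
  rfl

theorem mono_mon1_mul (m n : Multiplicative ℕ × FreeMonoid Letter) :
    mono (mon1 (m * n)) = mono (mon1 m) * mono (mon1 n) := by
  rw [mono_mul, sgn_fin_one, one_smul, mon1_mul]

theorem mon1_zero (m : Mon 1) : m = mon1 (m 0) := funext fun i => by
  rw [Subsingleton.elim i 0]; rfl

theorem gen_eq (y : Letter) : gen y = mono (mon1 (1, FreeMonoid.of y)) := rfl

theorem cc_eq : cc (0 : Fin 1) = mono (mon1 (Multiplicative.ofAdd 1, 1)) := by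
  rw [cc]
  congr 1
  funext i
  rw [Subsingleton.elim i 0]
  simp [mon1]

theorem mono_mon1_induction {p : (Multiplicative ℕ × FreeMonoid Letter) → Prop} (h1 : p 1)
    (hc : ∀ m, p m → p ((Multiplicative.ofAdd 1, 1) * m))
    (hy : ∀ y m, p (1, m) → p (1, FreeMonoid.of y * m)) (m) : p m := by
  obtain ⟨n, w⟩ := m
  have h0 : p (1, w) := by
    induction w using FreeMonoid.recOn with
    | one => exact h1
    | of_mul y m ih => exact hy y m ih
  have : ∀ n : ℕ, p (Multiplicative.ofAdd n, w) := fun n => by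
    induction n with
    | zero => exact h0
    | succ n ih =>
      have := hc _ ih
      rwa [Prod.mk_mul_mk, one_mul, ← ofAdd_add, add_comm] at this
  exact this (Multiplicative.toAdd n)

theorem hom_ext {Φ Ψ : FA 1 →A[ℂ] FA l} (hc : Φ (cc 0) = Ψ (cc 0))
    (hy : ∀ y, Φ (gen y) = Ψ (gen y)) : Φ = Ψ := by
  refine toCLM_injective (clm_ext fun m => ?_)
  rw [mon1_zero m]
  generalize m 0 = m
  rw [toCLM_apply, toCLM_apply]
  induction m using mono_mon1_induction with
  | h1 => exact (map_one Φ).trans (map_one Ψ).symm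
  | hc m ih => rw [mono_mon1_mul, map_mul, map_mul, ih, ← cc_eq, hc]
  | hy y m ih =>
    have : ((1, FreeMonoid.of y * m) : Multiplicative ℕ × FreeMonoid Letter) =
      (1, FreeMonoid.of y) * (1, m) := by simp
    rw [this, mono_mon1_mul, map_mul, map_mul, ih, ← gen_eq, hy]

/-- Images of the generators of the one-slot algebra under a degree preserving homomorphism. -/
structure LiftData (l : ℕ) where
  T : Letter → FA l
  c : FA l
  T_one : ∀ y, T y 1 = 0
  T_deg : ∀ y w, T y w ≠ 0 → dg w = y.deg
  c_one : c 1 = 0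
  c_scal : LettersIn ∅ c
  comm : ∀ y, c * T y = T y * c

namespace LiftData

variable (D : LiftData l)

/-- The image of a monomial. -/
def val (m : Multiplicative ℕ × FreeMonoid Letter) : FA l :=
  D.c ^ Multiplicative.toAdd m.1 * FreeMonoid.lift D.T m.2

theorem val_one : D.val 1 = 1 := by simp [val]

theorem val_mul (m n : Multiplicative ℕ × FreeMonoid Letter) :
    D.val (m * n) = D.val m * D.val n := by
  have h : ∀ w, D.c * FreeMonoid.lift D.T w = FreeMonoid.lift D.T w * D.c := fun w => by
    induction w using FreeMonoid.recOn with
    | one => simp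
    | of_mul y m ih => 
      rw [map_mul, FreeMonoid.lift_eval_of, ← mul_assoc, D.comm, mul_assoc, ih, mul_assoc]
  have h' := (Commute.pow_left (show Commute D.c (FreeMonoid.lift D.T m.2) from h _)
    (Multiplicative.toAdd n.1)).eq
  simp only [val, Prod.fst_mul, Prod.snd_mul, toAdd_mul, pow_add, map_mul]
  rw [mul_assoc, mul_assoc, ← mul_assoc _ _ (FreeMonoid.lift D.T n.2), h', mul_assoc]

theorem val_c : D.val (Multiplicative.ofAdd 1, 1) = D.c := by simp [val]

theorem val_letter (y : Letter) : D.val (1, FreeMonoid.of y) = D.T y := by simp [val]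

theorem finite_val (w : Mon l) : {m | D.val m w ≠ 0}.Finite := by
  generalize hs : size w = s
  induction s using Nat.strong_induction_on generalizing w with
  | _ s ih =>
    have key : {m | D.val m w ≠ 0} ⊆ {1} ∪ ⋃ p ∈ factor w, ⋃ (_ : p.1 ≠ 1),
        (((fun m => (Multiplicative.ofAdd 1, 1) * m) '' {m | D.val m p.2 ≠ 0}) ∪
        ⋃ y ∈ ({.a (-dg p.1), .b (-dg p.1), .xp (-dg p.1), .xm (-dg p.1)} : Set Letter),
          (fun m => (1, FreeMonoid.of y) * m) '' {m | D.val m p.2 ≠ 0}) := by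
      intro m hm
      induction m using mono_mon1_induction with
      | h1 => exact Or.inl rfl
      | hc m _ =>
        rw [Set.mem_ofPred_eq, val_mul, val_c] at hm
        obtain ⟨u, v, huv, hu, hv⟩ := mul_ne_zero_exists hm
        refine Or.inr ?_
        simp only [Set.mem_iUnion]
        refine ⟨(u, v), mem_factor.2 huv, ?_, Or.inl ⟨m, hv, rfl⟩⟩
        rintro rfl
        exact hu D.c_one
      | hy y m _ =>
        have e : ((1, FreeMonoid.of y * m) : Multiplicative ℕ × FreeMonoid Letter) =
          (1, FreeMonoid.of y) * (1, m) := by simp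
        rw [Set.mem_ofPred_eq, e, val_mul, val_letter] at hm
        obtain ⟨u, v, huv, hu, hv⟩ := mul_ne_zero_exists hm
        refine Or.inr ?_
        simp only [Set.mem_iUnion]
        refine ⟨(u, v), mem_factor.2 huv, ?_, Or.inr ?_⟩
        · rintro rfl
          exact hu (D.T_one y)
        · simp only [Set.mem_iUnion]
          refine ⟨y, ?_, (1, m), hv, e.symm⟩
          have := D.T_deg y u hu
          cases y <;> simp [this, Letter.deg]
    refine Set.Finite.subset ?_ key
    refine (Set.finite_singleton _).union ?_
    refine Set.Finite.biUnion (factor w).finite_toSet fun p hp => Set.finite_iUnion fun h1 => ?_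
    have hlt : size p.2 < s := by
      rw [← hs, ← mem_factor.1 hp, size_mul]
      have := size_pos h1
      omega
    have hfin := ih _ hlt p.2 rfl
    refine (hfin.image _).union (Set.Finite.biUnion (by simp) fun y _ => hfin.image _)

theorem finite_val' (w : Mon l) : {m : Mon 1 | D.val (m 0) w ≠ 0}.Finite := by
  refine ((D.finite_val w).image mon1).subset fun m hm => ⟨m 0, hm, (mon1_zero m).symm⟩

/-- The continuous homomorphism with given values on generators. -/
def hom : FA 1 →A[ℂ] FA l :=
  homOfCLM (ofFamily (fun m => D.val (m 0)) D.finite_val')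
    (by
      change ofFamily _ _ (mono 1) = 1
      rw [ofFamily_mono]
      exact D.val_one)
    (map_mul_of_mono _ fun u v => by
      rw [mono_mul, sgn_fin_one, one_smul, ofFamily_mono, ofFamily_mono, ofFamily_mono]
      exact D.val_mul _ _)

theorem hom_mono (m : Mon 1) : D.hom (mono m) = D.val (m 0) := ofFamily_mono _ _ m

theorem hom_gen (y : Letter) : D.hom (gen y) = D.T y := by
  rw [gen_eq, hom_mono]
  exact D.val_letter y

theorem hom_cc : D.hom (cc 0) = D.c := by
  rw [cc_eq, hom_mono]
  exact D.val_c

/-- A property of monomials that holds for the images of the generators. -/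
theorem hom_support {p : Mon 1 → Mon l → Prop} (h1 : p 1 1)
    (hmul : ∀ a b u v, p a u → p b v → p (a * b) (u * v))
    (hc : ∀ w, D.c w ≠ 0 → p (mon1 (Multiplicative.ofAdd 1, 1)) w)
    (hy : ∀ y w, D.T y w ≠ 0 → p (mon1 (1, FreeMonoid.of y)) w) (m : Mon 1) (w : Mon l)
    (h : D.hom (mono m) w ≠ 0) : p m w := by
  classical
  rw [hom_mono] at h
  rw [mon1_zero m]
  generalize m 0 = m at h ⊢
  induction m using mono_mon1_induction generalizing w with
  | h1 =>
    rw [val_one, one_apply] at h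
    have : w = 1 := by by_contra h'; simp [h'] at h
    rw [this]
    exact h1
  | hc m ih =>
    rw [val_mul, val_c] at h
    obtain ⟨u, v, rfl, hu, hv⟩ := mul_ne_zero_exists h
    exact hmul _ _ _ _ (hc u hu) (ih v hv)
  | hy y m ih =>
    have e : ((1, FreeMonoid.of y * m) : Multiplicative ℕ × FreeMonoid Letter) =
      (1, FreeMonoid.of y) * (1, m) := by simp
    rw [e, val_mul, val_letter] at h
    obtain ⟨u, v, rfl, hu, hv⟩ := mul_ne_zero_exists h
    rw [e]
    exact hmul _ _ _ _ (hy y u hu) (ih v hv)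

theorem degPres : DegPres (toCLM D.hom) := fun m w h =>
  D.hom_support (p := fun m w => dg w = dg m) (by simp)
    (fun a b u v h1 h2 => by rw [dg_mul, dg_mul, h1, h2])
    (fun w hw => by
      rw [dg_of_scal fun i => D.c_scal w hw i (by simp)]
      simp [dg, deg, degSlot, mon1])
    (fun y w hw => by
      rw [D.T_deg y w hw]
      simp [dg, deg, degSlot, mon1]) m w h

theorem scalPres : ScalPres (toCLM D.hom) := fun f hf w hw i _ => by
  obtain ⟨m, hm, h⟩ := exists_of_apply_ne_zero _ hw
  refine D.hom_support (p := fun m w => (∀ i, (m i).2 = 1) → ∀ i, (w i).2 = 1) (by simp)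
    (fun a b u v h1 h2 h i => ?_) (fun w hw _ i => D.c_scal w hw i (by simp))
    (fun y w hw h => ?_) m w h (fun i => hf m hm i (by simp)) i
  · have ha : ∀ i, (a i).2 = 1 ∧ (b i).2 = 1 := fun i => by
      have := congrArg FreeMonoid.length (h i)
      rw [Pi.mul_apply, Prod.snd_mul, FreeMonoid.length_mul, FreeMonoid.length_one,
        Nat.add_eq_zero_iff] at this
      exact ⟨FreeMonoid.length_eq_zero.1 this.1, FreeMonoid.length_eq_zero.1 this.2⟩
    rw [Pi.mul_apply, Prod.snd_mul, h1 (fun i => (ha i).1), h2 (fun i => (ha i).2), one_mul]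
  · exact absurd (congrArg FreeMonoid.length (h 0)) (by simp [mon1])

theorem parPres (hT : ∀ y w, D.T y w ≠ 0 → (parity w : ZMod 2) = if y.isOdd then 1 else 0) :
    ParPres (toCLM D.hom) := fun m w h =>
  D.hom_support (p := fun m w => (parity w : ZMod 2) = parity m) (by simp [parity_one])
    (fun a b u v h1 h2 => by rw [parity_mul, parity_mul, Nat.cast_add, Nat.cast_add, h1, h2])
    (fun w hw => by
      rw [parity_of_scal fun i => D.c_scal w hw i (by simp)]
      simp [parity, par, mon1])
    (fun y w hw => by
      rw [hT y w hw]
      cases y <;> simp [parity, par, mon1, Letter.isOdd]) m w h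

end LiftData

end FA

theorem Ser.mul_supercomm {K : Type} [CommRing K] [Algebra ℂ K] {N : ℕ} {x y : Ser K N}
    (A : Set (Fin N)) {a b : ℕ} (hx : LettersIn A x) (hy : LettersIn Aᶜ y) (hp : HasParity a x)
    (hq : HasParity b y) : x * y = ((-1 : ℂ) ^ (a * b)) • (y * x) := by
  refine Ser.mul_eq_of_sgn _ fun u v hu hv => ?_
  have hv' : ∀ i ∈ A, (v i).2 = 1 := fun i hi => hy v hv i (by simpa using hi)
  refine ⟨mul_comm_of_disjoint A (hx u hu) hv', ?_⟩
  rw [sgn_comm_of_disjoint A (hx u hu) hv']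
  congr 1
  rw [neg_one_pow_congr]
  have h1 := hp u hu
  have h2 := hq v hv
  rw [← ZMod.natCast_eq_zero_iff_even, ← ZMod.natCast_eq_zero_iff_even]
  push_cast
  rw [h1, h2]

namespace FA

variable {N k l : ℕ}

/-- The completed free algebra, as an algebra of series over `ℂ`. -/
def toSer : FA N →+* Ser ℂ N := Ser.twist 1

theorem toSer_apply (f : FA N) (w : Mon N) : toSer f w = f w := by
  simp [toSer, Ser.twist_apply]

theorem toSer_injective : Function.Injective (toSer : FA N → Ser ℂ N) := fun f g h => by
  ext w
  rw [← toSer_apply f w, h, toSer_apply]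

theorem toSer_smul (t : ℂ) (f : FA N) : toSer (t • f) = t • toSer f := by
  ext w
  rw [Ser.smul_apply, toSer_apply, toSer_apply, smul_apply, smul_eq_mul]

theorem toSer_eq (f : FA N) : (toSer f : Mon N → ℂ) = f := funext (toSer_apply f)

theorem mul_supercomm {x y : FA N}
    (A : Set (Fin N)) {a b : ℕ} (hx : LettersIn A x) (hy : LettersIn Aᶜ y) (hp : HasParity a x)
    (hq : HasParity b y) : x * y = ((-1 : ℂ) ^ (a * b)) • (y * x) := by
  apply toSer_injective
  rw [toSer_smul, map_mul, map_mul]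
  rw [← toSer_eq x] at hx hp
  rw [← toSer_eq y] at hy hq
  exact Ser.mul_supercomm A hx hy hp hq

theorem _root_.SuperCurrent.LettersIn.commuteFA {x : FA N} (hx : LettersIn ∅ x) (y : FA N) :
    x * y = y * x := by
  apply toSer_injective
  rw [map_mul, map_mul]
  rw [← toSer_eq x] at hx
  exact hx.commute _

theorem lettersIn_mul {A : Set (Fin N)} {x y : FA N} (hx : LettersIn A x) (hy : LettersIn A y) :
    LettersIn A (x * y) := fun w hw i hi => by
  obtain ⟨u, v, rfl, hu, hv⟩ := mul_ne_zero_exists hw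
  simp [hx _ hu i hi, hy _ hv i hi]

theorem lettersIn_add {A : Set (Fin N)} {x y : FA N} (hx : LettersIn A x) (hy : LettersIn A y) :
    LettersIn A (x + y) := fun w hw i hi => by
  by_cases h : x w = 0
  · exact hy w (fun h' => hw (by rw [add_apply, h, h', add_zero])) i hi
  · exact hx w h i hi

theorem hasParity_mul {d e : ZMod 2} {x y : FA N} (hx : HasParity d x) (hy : HasParity e y) :
    HasParity (d + e) (x * y) := fun w hw => by
  obtain ⟨u, v, rfl, hu, hv⟩ := mul_ne_zero_exists hw
  rw [parity_mul, Nat.cast_add, hx u hu, hy v hv]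

theorem hasParity_add {d : ZMod 2} {x y : FA N} (hx : HasParity d x) (hy : HasParity d y) :
    HasParity d (x + y) := fun w hw => by
  by_cases h : x w = 0
  · exact hy w (fun h' => hw (by rw [add_apply, h, h', add_zero]))
  · exact hx w h

theorem hasParity_neg {d : ZMod 2} {x : FA N} (hx : HasParity d x) :
    HasParity d (-x) := fun w hw => hx w fun h => hw (by rw [neg_apply, h, neg_zero])

theorem lettersIn_neg {A : Set (Fin N)} {x : FA N} (hx : LettersIn A x) :
    LettersIn A (-x) := fun w hw => hx w fun h => hw (by rw [neg_apply, h, neg_zero])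

theorem hasParity_one : HasParity 0 (1 : FA N) := fun w hw => by
  classical
  rw [one_apply] at hw
  have : w = 1 := by by_contra h'; simp [h'] at hw
  rw [this, parity_one, Nat.cast_zero]

theorem hasParity_mono (m : Mon N) : HasParity (parity m) (mono m) := fun w hw => by
  have : w = m := by
    by_contra h'
    exact hw (mono_apply_ne h')
  rw [this]

theorem hasParity_fexp {f : FA N} (hf : HasParity 0 f) : HasParity 0 (fexp f) := fun w hw => by
  by_contra h
  refine hw ?_
  have hpow : ∀ n, ∀ g : FA N, g = f ^ n → HasParity 0 g := fun n => by
    induction n with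
    | zero => rintro g rfl; exact hasParity_one
    | succ n ih =>
      rintro g rfl
      have := hasParity_mul (ih _ rfl) hf
      rwa [add_zero] at this
  by_cases hs : Summable fun n : ℕ => ((Nat.factorial n : ℂ))⁻¹ • f ^ n
  · refine (hasSum_iff.1 hs.hasSum w).unique ?_
    convert hasSum_zero with n
    rw [smul_apply]
    have : (f ^ n) w = 0 := by
      by_contra h'
      exact h (hpow n _ rfl w h')
    rw [this, mul_zero]
  · rw [fexp, tsum_eq_zero_of_not_summable hs, zero_apply]

theorem LiftData.lettersIn (D : LiftData l) {A : Set (Fin l)} (hT : ∀ y, LettersIn A (D.T y))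
    (f : FA 1) : LettersIn A (D.hom f) := fun w hw => by
  obtain ⟨m, _, h⟩ := exists_of_apply_ne_zero (toCLM D.hom) hw
  exact D.hom_support (p := fun _ w => ∀ i ∉ A, (w i).2 = 1) (by simp)
    (fun a b u v h1 h2 i hi => by rw [Pi.mul_apply, Prod.snd_mul, h1 i hi, h2 i hi, one_mul])
    (fun w hw i _ => D.c_scal w hw i (by simp)) (fun y w hw => hT y w hw) m w h

/-! Maps on the two-slot algebra -/

theorem mono_fin_two (m : Mon 2) :
    slot 0 (mono (mon1 (m 0))) * slot 1 (mono (mon1 (m 1))) = mono m := by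
  rw [slot, slot, incl_mono _ (strictMono_const (0 : Fin 2)).injective,
    incl_mono _ (strictMono_const (1 : Fin 2)).injective, mono_mul]
  set u := emb (fun _ : Fin 1 => (0 : Fin 2)) (strictMono_const (0 : Fin 2)).injective (mon1 (m 0))
  set v := emb (fun _ : Fin 1 => (1 : Fin 2)) (strictMono_const (1 : Fin 2)).injective (mon1 (m 1))
  have hu0 : u 0 = m 0 := emb_apply _ (strictMono_const (0 : Fin 2)).injective (mon1 (m 0)) 0
  have hv1 : v 1 = m 1 := emb_apply _ (strictMono_const (1 : Fin 2)).injective (mon1 (m 1)) 0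
  have hu1 : u 1 = 1 := emb_apply_of_notMem _ _ _ (by simp)
  have hv0 : v 0 = 1 := emb_apply_of_notMem _ _ _ (by simp)
  have hs : sgn u v = 1 := by
    have h0 : Finset.Iio (0 : Fin 2) = ∅ := rfl
    simp [sgn, Fin.sum_univ_two, hu1, par_one, h0]
  rw [hs, one_smul]
  congr 1
  funext i
  fin_cases i
  · simp [hu0, hv0]
  · simp [hu1, hv1]

theorem sgn_fin_two (u v : Mon 2) : sgn u v = (-1) ^ (par (u 1) * par (v 0)) := by
  have h0 : Finset.Iio (0 : Fin 2) = ∅ := rfl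
  have h1 : Finset.Iio (1 : Fin 2) = {0} := rfl
  simp [sgn, Fin.sum_univ_two, h0, h1]

/-- The continuous linear map `a ⊗ b ↦ A a * B b`. -/
def pair (A B : FA 1 →L[ℂ] FA l) : FA 2 →L[ℂ] FA l :=
  ofFamily (fun m => A (mono (mon1 (m 0))) * B (mono (mon1 (m 1)))) fun w => by
    have hfin : ∀ p ∈ factor w, ({m | A (mono m) p.1 ≠ 0} ×ˢ {m | B (mono m) p.2 ≠ 0}).Finite :=
      fun p _ => (finite_support A p.1).prod (finite_support B p.2)
    refine ((Set.Finite.biUnion (factor w).finite_toSet hfin).image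
      fun x : Mon 1 × Mon 1 => (![x.1 0, x.2 0] : Mon 2)).subset fun m hm => ?_
    obtain ⟨u, v, huv, hu, hv⟩ := mul_ne_zero_exists hm
    refine ⟨(mon1 (m 0), mon1 (m 1)), Set.mem_biUnion (mem_factor.2 huv : (u, v) ∈ factor w)
      ⟨hu, hv⟩, ?_⟩
    funext i
    fin_cases i <;> rfl

theorem pair_mono (A B : FA 1 →L[ℂ] FA l) (m : Mon 2) :
    pair A B (mono m) = A (mono (mon1 (m 0))) * B (mono (mon1 (m 1))) := ofFamily_mono _ _ m

theorem pair_mul (A B : FA 1 →L[ℂ] FA l) (a b : FA 1) :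
    pair A B (slot 0 a * slot 1 b) = A a * B b := by
  have h1 : ∀ (u : Mon 1) b, pair A B (slot 0 (mono u) * slot 1 b) = A (mono u) * B b :=
    fun u b => by
    have e : ((pair A B).comp (mulLeft (slot 0 (mono u)))).comp (toCLM (slotHom 1)) =
        (mulLeft (A (mono u))).comp B := clm_ext fun v => by
      change pair A B (slot 0 (mono u) * slot 1 (mono v)) = A (mono u) * B (mono v)
      have h := mono_fin_two (![u 0, v 0] : Mon 2)
      have hu : mon1 ((![u 0, v 0] : Mon 2) 0) = u := (mon1_zero u).symm
      have hv : mon1 ((![u 0, v 0] : Mon 2) 1) = v := (mon1_zero v).symm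
      rw [hu, hv] at h
      rw [h, pair_mono, hu, hv]
    exact congrArg (fun A : FA 1 →L[ℂ] FA l => A b) e
  have e : ((pair A B).comp (mulRight (slot 1 b))).comp (toCLM (slotHom 0)) =
      (mulRight (B b)).comp A := clm_ext fun u => h1 u b
  exact congrArg (fun A : FA 1 →L[ℂ] FA l => A a) e

theorem pair_slot_zero (A B : FA 1 →L[ℂ] FA l) (hB : B 1 = 1) (a : FA 1) :
    pair A B (slot 0 a) = A a := by
  have := pair_mul A B a 1
  rwa [← slotHom_apply 1, map_one, mul_one, hB, mul_one] at this

theorem pair_slot_one (A B : FA 1 →L[ℂ] FA l) (hA : A 1 = 1) (b : FA 1) :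
    pair A B (slot 1 b) = B b := by
  have := pair_mul A B 1 b
  rwa [← slotHom_apply 0, map_one, one_mul, hA, one_mul] at this

theorem dg_fin_two (m : Mon 2) : dg m = dg (mon1 (m 0)) + dg (mon1 (m 1)) := by
  simp [dg, deg, Fin.prod_univ_two, mon1]

theorem parity_fin_two (m : Mon 2) : parity m = parity (mon1 (m 0)) + parity (mon1 (m 1)) := by
  simp [parity, Fin.sum_univ_two, mon1]

theorem pair_degPres {A B : FA 1 →L[ℂ] FA l} (hA : DegPres A) (hB : DegPres B) :
    DegPres (pair A B) := fun m w h => by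
  rw [pair_mono] at h
  obtain ⟨u, v, rfl, hu, hv⟩ := mul_ne_zero_exists h
  rw [dg_mul, hA _ _ hu, hB _ _ hv, dg_fin_two m]

theorem lettersIn_mono {A : Set (Fin N)} {m : Mon N} (h : ∀ i ∉ A, (m i).2 = 1) :
    LettersIn A (mono m) := fun w hw => by
  have : w = m := by
    by_contra h'
    exact hw (mono_apply_ne h')
  rwa [this]

theorem pair_scalPres {A B : FA 1 →L[ℂ] FA l} (hA : ScalPres A) (hB : ScalPres B) :
    ScalPres (pair A B) := fun f hf w hw i _ => by
  obtain ⟨m, hm, h⟩ := exists_of_apply_ne_zero _ hw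
  rw [pair_mono] at h
  obtain ⟨u, v, rfl, hu, hv⟩ := mul_ne_zero_exists h
  have h0 := hA _ (lettersIn_mono (m := mon1 (m 0)) fun j _ => hf m hm 0 (by simp)) u hu i (by simp)
  have h1 := hB _ (lettersIn_mono (m := mon1 (m 1)) fun j _ => hf m hm 1 (by simp)) v hv i (by simp)
  rw [Pi.mul_apply, Prod.snd_mul, h0, h1, one_mul]

/-- The continuous homomorphism `a ⊗ b ↦ Φ a * Ψ b`, for homomorphisms whose images
supercommute. -/
def pairHom (Φ Ψ : FA 1 →A[ℂ] FA l)
    (h : ∀ u v : Mon 1, Ψ (mono v) * Φ (mono u) =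
      ((-1 : ℂ) ^ (parity v * parity u)) • (Φ (mono u) * Ψ (mono v))) : FA 2 →A[ℂ] FA l :=
  homOfCLM (pair (toCLM Φ) (toCLM Ψ))
    (by
      change pair _ _ (mono 1) = 1
      rw [pair_mono]
      change Φ 1 * Ψ 1 = 1
      rw [map_one, map_one, mul_one])
    (map_mul_of_mono _ fun u v => by
      rw [mono_mul, map_smul, pair_mono, pair_mono, pair_mono, Pi.mul_apply, Pi.mul_apply,
        mono_mon1_mul, mono_mon1_mul]
      simp only [toCLM_apply, map_mul]
      have e : sgn u v = (-1) ^ (parity (mon1 (u 1)) * parity (mon1 (v 0))) := by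
        rw [sgn_fin_two]
        simp [parity, mon1]
      have h' := h (mon1 (v 0)) (mon1 (u 1))
      rw [mul_assoc, mul_assoc, ← mul_assoc (Ψ _) (Φ _), h', e]
      simp only [smul_mul_assoc, mul_smul_comm, mul_assoc])

theorem pairHom_slot_zero (Φ Ψ : FA 1 →A[ℂ] FA l) (h) (a : FA 1) :
    pairHom Φ Ψ h (slot 0 a) = Φ a :=
  pair_slot_zero (toCLM Φ) (toCLM Ψ) (map_one Ψ) a

theorem pairHom_slot_one (Φ Ψ : FA 1 →A[ℂ] FA l) (h) (a : FA 1) :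
    pairHom Φ Ψ h (slot 1 a) = Ψ a :=
  pair_slot_one (toCLM Φ) (toCLM Ψ) (map_one Φ) a

/-! The counit -/

/-- The images of the generators under the counit. -/
def epsData (l : ℕ) : LiftData l where
  T _ := 0
  c := 0
  T_one _ := rfl
  T_deg _ _ h := absurd rfl h
  c_one := rfl
  c_scal _ h := absurd rfl h
  comm _ := by simp

/-- The counit, with values in the algebra `FA l`. -/
def eps (l : ℕ) : FA 1 →A[ℂ] FA l := (epsData l).hom

/-- The counit. -/
def counitHat : FA 1 →A[ℂ] ℂ where
  toAlgHom := AlgHom.ofLinearMap (coeff (1 : Mon 1)).toLinearMap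
    (by
      change (1 : FA 1) 1 = 1
      simp [one_apply]) mul_apply_one
  cont := continuous_coeff 1

theorem counitHat_apply (a : FA 1) : counitHat a = a 1 := rfl

theorem eps_apply (a : FA 1) : eps l a = algebraMap ℂ (FA l) (counitHat a) := by
  have e : toCLM (eps l) = ((1 : ℂ →L[ℂ] ℂ).smulRight (1 : FA l)).comp (coeff 1) := by
    refine clm_ext fun m => ?_
    rw [mon1_zero m]
    generalize m 0 = m
    change (epsData l).hom _ = (mono (mon1 m) (1 : Mon 1)) • (1 : FA l)
    rw [LiftData.hom_mono]
    change (epsData l).val m = _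
    have hne : ∀ a b, a ≠ (1 : Mon 1) → (1 : Mon 1) ≠ a * b := fun a b ha h => by
      have := congrArg size h
      rw [size_one, size_mul] at this
      have := size_pos ha
      omega
    induction m using mono_mon1_induction with
    | h1 =>
      rw [LiftData.val_one]
      change _ = (mono (1 : Mon 1) 1) • (1 : FA l)
      rw [mono_apply_self, one_smul]
    | hc m _ =>
      rw [LiftData.val_mul, LiftData.val_c, mon1_mul, mono_apply_ne, zero_smul]
      · exact zero_mul _
      · refine hne _ _ fun h => ?_
        have := congrArg size h
        rw [size_one] at this
        simp [size, mon1] at this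
    | hy y m _ =>
      have e : ((1, FreeMonoid.of y * m) : Multiplicative ℕ × FreeMonoid Letter) =
        (1, FreeMonoid.of y) * (1, m) := by simp
      rw [e, LiftData.val_mul, LiftData.val_letter, mon1_mul, mono_apply_ne, zero_smul]
      · exact zero_mul _
      · refine hne _ _ fun h => ?_
        have := congrArg size h
        rw [size_one] at this
        simp [size, mon1] at this
  have := congrArg (fun A : FA 1 →L[ℂ] FA l => A a) e
  rw [Algebra.algebraMap_eq_smul_one]
  exact this

/-! Exponentials of central elements -/

theorem cc_mul_apply (i : Fin N) (f : FA N) (v : Mon N) :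
    (cc i * f) (Pi.mulSingle i (Multiplicative.ofAdd 1, 1) * v) = f v := by
  rw [mul_apply, Finset.sum_eq_single (Pi.mulSingle i (Multiplicative.ofAdd 1, 1), v)]
  · rw [cc, mono_apply_self, sgn_of_scal_left]
    · ring
    · intro j
      by_cases h : j = i
      · subst h; simp
      · simp [Pi.mulSingle_eq_of_ne h]
  · rintro ⟨a, b⟩ hp hne
    have ha : a ≠ Pi.mulSingle i (Multiplicative.ofAdd 1, 1) := by
      rintro rfl
      refine hne ?_
      have := mem_factor.1 hp
      dsimp only at this
      rw [mul_left_cancel this]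
    rw [cc, mono_apply_ne ha]
    ring
  · intro h
    exact absurd (mem_factor.2 (by dsimp only)) h

theorem cc_mul_apply_of_zero (i : Fin N) (f : FA N) {w : Mon N}
    (h : Multiplicative.toAdd (w i).1 = 0) : (cc i * f) w = 0 := by
  by_contra hne
  obtain ⟨u, v, rfl, hu, hv⟩ := mul_ne_zero_exists hne
  have : u = Pi.mulSingle i (Multiplicative.ofAdd 1, 1) := by
    by_contra h'
    exact hu (mono_apply_ne h')
  subst this
  simp at h

theorem cc_scal (i : Fin N) : LettersIn ∅ (cc i) := lettersIn_mono fun j _ => by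
  by_cases h : j = i
  · subst h; simp
  · simp [Pi.mulSingle_eq_of_ne h]

theorem cc_one (i : Fin N) : cc i 1 = 0 := by
  refine mono_apply_ne fun h => ?_
  have := congrArg (fun w : Mon N => Multiplicative.toAdd (w i).1) h
  simp at this

theorem slot_cc (i : Fin N) : slot i (cc 0) = cc i := by
  rw [cc_eq, slot, incl_mono _ (strictMono_const i).injective, cc]
  congr 1
  symm
  rw [eq_emb_iff]
  constructor
  · intro j hj
    rw [Pi.mulSingle_eq_of_ne]
    rintro rfl
    exact hj ⟨0, rfl⟩
  · funext a
    simp [mon1]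

theorem exists_eq_mulSingle_mul {i : Fin N} {w : Mon N} (h : Multiplicative.toAdd (w i).1 ≠ 0) :
    ∃ v : Mon N, w = Pi.mulSingle i (Multiplicative.ofAdd 1, 1) * v := by
  classical
  obtain ⟨n, hn⟩ := Nat.exists_eq_succ_of_ne_zero h
  refine ⟨Function.update w i (Multiplicative.ofAdd n, (w i).2), ?_⟩
  funext j
  by_cases hj : j = i
  · subst hj
    rw [Pi.mul_apply, Pi.mulSingle_eq_same, Function.update_self, Prod.mk_mul_mk, one_mul,
      ← ofAdd_add, add_comm]
    refine Prod.ext ?_ rfl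
    exact Multiplicative.toAdd.injective hn
  · rw [Pi.mul_apply, Pi.mulSingle_eq_of_ne hj, one_mul, Function.update_of_ne hj]

theorem cexp_mulSingle_mul (t : Fin N → ℂ) (i : Fin N) (v : Mon N) :
    ((Multiplicative.toAdd (v i).1 : ℕ) + 1 : ℂ) *
      cexp t (Pi.mulSingle i (Multiplicative.ofAdd 1, 1) * v) = t i * cexp t v := by
  classical
  set w : Mon N := Pi.mulSingle i (Multiplicative.ofAdd 1, 1) * v with hw
  have hi : w i = (Multiplicative.ofAdd 1 * (v i).1, (v i).2) := by simp [hw, Prod.mul_def]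
  have hj : ∀ j, j ≠ i → w j = v j := fun j h => by simp [hw, Pi.mulSingle_eq_of_ne h]
  have h2 : ∀ j, (w j).2 = (v j).2 := fun j => by
    by_cases h : j = i
    · subst h; rw [hi]
    · rw [hj j h]
  simp only [cexp, h2]
  split_ifs with hsc
  · rw [← Finset.mul_prod_erase _ _ (Finset.mem_univ i),
      ← Finset.mul_prod_erase Finset.univ (fun i => t i ^ Multiplicative.toAdd (v i).1 /
        (Nat.factorial (Multiplicative.toAdd (v i).1) : ℂ)) (Finset.mem_univ i)]
    have : ∏ j ∈ Finset.univ.erase i, t j ^ Multiplicative.toAdd (w j).1 /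
        (Nat.factorial (Multiplicative.toAdd (w j).1) : ℂ) = ∏ j ∈ Finset.univ.erase i,
        t j ^ Multiplicative.toAdd (v j).1 /
        (Nat.factorial (Multiplicative.toAdd (v j).1) : ℂ) :=
      Finset.prod_congr rfl fun j hj' => by rw [hj j (Finset.ne_of_mem_erase hj')]
    rw [this, hi, ← mul_assoc, ← mul_assoc]
    congr 1
    simp only [toAdd_mul, toAdd_ofAdd]
    rw [add_comm 1, Nat.factorial_succ, pow_succ]
    have h1 : ((Nat.factorial (Multiplicative.toAdd (v i).1) : ℂ)) ≠ 0 :=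
      Nat.cast_ne_zero.2 (Nat.factorial_ne_zero _)
    have h3 : ((Multiplicative.toAdd (v i).1 : ℕ) + 1 : ℂ) ≠ 0 := Nat.cast_add_one_ne_zero _
    push_cast
    field_simp
  · rw [mul_zero, mul_zero]

theorem sum_smul_cc_one (t : Fin N → ℂ) : (∑ i, t i • cc i : FA N) 1 = 0 := by
  rw [sum_apply]
  exact Finset.sum_eq_zero fun i _ => by rw [smul_apply, cc_one, mul_zero]

theorem pow_sum_smul_cc (t : Fin N → ℂ) (n : ℕ) (w : Mon N) :
    (((∑ i, t i • cc i : FA N)) ^ n) w =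
      if ∑ i, Multiplicative.toAdd (w i).1 = n then (Nat.factorial n : ℂ) * cexp t w else 0 := by
  classical
  induction n generalizing w with
  | zero =>
    rw [pow_zero, one_apply]
    by_cases hw : w = 1
    · subst hw
      simp [cexp]
    · rw [if_neg hw]
      split_ifs with h
      · simp only [Finset.sum_eq_zero_iff, Finset.mem_univ, true_implies] at h
        rw [cexp, if_neg, mul_zero]
        intro h2
        exact hw (funext fun i => Prod.ext (h i) (h2 i))
      · rfl
  | succ n ih =>
    rw [pow_succ', Finset.sum_mul, sum_apply]
    have hterm : ∀ i, ((t i • cc i) * (∑ i, t i • cc i : FA N) ^ n) w =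
        if ∑ i, Multiplicative.toAdd (w i).1 = n + 1 then
          ((Multiplicative.toAdd (w i).1 : ℕ) : ℂ) * ((Nat.factorial n : ℂ) * cexp t w) else 0 := by
      intro i
      rw [smul_mul_assoc, smul_apply]
      by_cases h0 : Multiplicative.toAdd (w i).1 = 0
      · rw [cc_mul_apply_of_zero i _ h0, h0]
        simp
      · obtain ⟨v, rfl⟩ := exists_eq_mulSingle_mul h0
        rw [cc_mul_apply, ih]
        have hs : ∑ j, Multiplicative.toAdd
            ((Pi.mulSingle i (Multiplicative.ofAdd 1, 1) * v : Mon N) j).1 =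
            1 + ∑ j, Multiplicative.toAdd (v j).1 := by
          simp only [Pi.mul_apply, Prod.fst_mul, toAdd_mul, Finset.sum_add_distrib]
          congr 1
          rw [Finset.sum_eq_single i]
          · simp
          · intro j _ hj
            rw [Pi.mulSingle_eq_of_ne hj]; rfl
          · simp
        have hi : Multiplicative.toAdd
            ((Pi.mulSingle i (Multiplicative.ofAdd 1, 1) * v : Mon N) i).1 =
            Multiplicative.toAdd (v i).1 + 1 := by
          simp [add_comm]
        rw [hs, hi]
        by_cases h : ∑ j, Multiplicative.toAdd (v j).1 = n
        · rw [if_pos h, if_pos (by omega)]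
          have := cexp_mulSingle_mul t i v
          push_cast
          linear_combination -(Nat.factorial n : ℂ) * this
        · rw [if_neg h, if_neg (by omega), mul_zero]
    simp only [hterm]
    split_ifs with h
    · rw [← Finset.sum_mul, ← Nat.cast_sum, h, Nat.factorial_succ]
      push_cast
      ring
    · simp

theorem cexp_eq_fexp (t : Fin N → ℂ) : cexp t = fexp (∑ i, t i • cc i) := by
  ext w
  refine ((hasSum_iff.1 (hasSum_fexp (sum_smul_cc_one t)) w).unique ?_).symm
  convert hasSum_single (∑ i, Multiplicative.toAdd (w i).1) ?_ using 1
  · rw [smul_apply, pow_sum_smul_cc, if_pos rfl, inv_mul_cancel_left₀]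
    exact Nat.cast_ne_zero.2 (Nat.factorial_ne_zero _)
  · intro n hn
    rw [smul_apply, pow_sum_smul_cc, if_neg (Ne.symm hn), mul_zero]

theorem cexp_scal (t : Fin N → ℂ) : LettersIn ∅ (cexp t) := fun w hw i _ => by
  classical
  by_contra h
  exact hw (if_neg fun h' => h (h' i))

theorem sum_cc_scal (t : Fin N → ℂ) : LettersIn ∅ (∑ i, t i • cc i : FA N) := fun w hw => by
  rw [sum_apply] at hw
  obtain ⟨i, _, hi⟩ := Finset.exists_ne_zero_of_sum_ne_zero hw
  exact cc_scal i w (right_ne_zero_of_mul hi)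

theorem cexp_add (s t : Fin N → ℂ) : cexp (s + t) = cexp s * cexp t := by
  rw [cexp_eq_fexp, cexp_eq_fexp, cexp_eq_fexp, ← fexp_add (sum_smul_cc_one s) (sum_smul_cc_one t)
    ((sum_cc_scal s).commuteFA _), ← Finset.sum_add_distrib]
  simp only [Pi.add_apply, add_smul]

theorem cexp_zero : cexp (0 : Fin N → ℂ) = 1 := by
  rw [cexp_eq_fexp]
  simp [fexp_zero]

theorem map_cexp {A : FA k →L[ℂ] FA l} (h1 : A 1 = 1)
    (hmul : ∀ f g : FA k, LettersIn ∅ f → A (f * g) = A f * A g) (s : Fin k → ℂ) (t : Fin l → ℂ)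
    (h : A (∑ i, s i • cc i) = ∑ i, t i • cc i) : A (cexp s) = cexp t := by
  rw [cexp_eq_fexp, cexp_eq_fexp]
  refine map_fexp A (sum_smul_cc_one s) (sum_smul_cc_one t) fun n => ?_
  induction n with
  | zero => rw [pow_zero, pow_zero, h1]
  | succ n ih => rw [pow_succ', pow_succ', hmul _ _ (sum_cc_scal s), ih, h]

end FA

/-! ### Laurent series -/

section Laurent

open Complex MeasureTheory

theorem circleIntegral_zpow {ρ : ℝ} (hρ : 0 < ρ) (n : ℤ) :
    (∮ z in C(0, ρ), z ^ n) = if n = -1 then 2 * Real.pi * I else 0 := by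
  split_ifs with h
  · have := circleIntegral.integral_sub_center_inv (0 : ℂ) hρ.ne'
    simpa [h] using this
  · simpa using circleIntegral.integral_sub_zpow_of_ne h 0 0 ρ

theorem two_pi_I_ne_zero' : (2 * (Real.pi : ℂ) * I) ≠ 0 := by
  simp [Real.pi_ne_zero]

theorem ne_zero_of_mem_sphere {ρ : ℝ} (hρ : 0 < ρ) {z : ℂ} (hz : z ∈ Metric.sphere (0 : ℂ) ρ) :
    z ≠ 0 := by
  rintro rfl
  simp at hz
  exact hρ.ne hz

theorem summable_mul_zpow {a : ℤ → ℂ} {z : ℂ} (h : Summable fun k : ℤ => ‖a k‖ * ‖z‖ ^ k) :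
    Summable fun k : ℤ => a k * z ^ k :=
  Summable.of_norm (by simpa [norm_mul, norm_zpow] using h)

/-- The coefficients of an absolutely convergent Laurent series are determined by its sum. -/
theorem laurentCoeff_of_hasSum {ρ : ℝ} (hρ : 0 < ρ) {a : ℤ → ℂ} {f : ℂ → ℂ}
    (ha : Summable fun k : ℤ => ‖a k‖ * ρ ^ k)
    (hf : ∀ z, ‖z‖ = ρ → HasSum (fun k => a k * z ^ k) (f z)) (k : ℤ) :
    laurentCoeff f ρ k = a k := by
  have key : HasSum (fun n : ℤ => ∮ z in C(0, ρ), a n * z ^ (n - k - 1))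
      (∮ z in C(0, ρ), f z * z ^ (-k - 1)) := by
    refine intervalIntegral.hasSum_integral_of_dominated_convergence
      (fun n _ => ρ * (‖a n‖ * ρ ^ n * ρ ^ (-k - 1))) ?_ ?_ ?_ ?_ ?_
    · intro n
      refine Continuous.aestronglyMeasurable ?_
      have h1 : Continuous fun θ => circleMap 0 ρ θ := continuous_circleMap 0 ρ
      have h2 : Continuous fun θ => deriv (circleMap 0 ρ) θ := by
        simp only [deriv_circleMap]
        exact h1.mul continuous_const
      refine h2.smul (continuous_const.mul (h1.zpow₀ _ fun θ => Or.inl ?_))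
      exact circleMap_ne_center hρ.ne'
    · intro n
      refine Filter.Eventually.of_forall fun θ _ => ?_
      have hne : ρ ≠ 0 := hρ.ne'
      simp only [norm_smul, norm_mul, norm_zpow, deriv_circleMap, norm_circleMap_zero,
        abs_of_pos hρ, norm_I, mul_one]
      rw [mul_assoc (‖a n‖), ← zpow_add₀ hne]
      ring_nf
      exact le_refl _
    · refine Filter.Eventually.of_forall fun θ _ => ?_
      exact (ha.mul_right _).mul_left _
    · exact intervalIntegrable_const
    · refine Filter.Eventually.of_forall fun θ _ => ?_
      have hz : ‖circleMap 0 ρ θ‖ = ρ := by simp [abs_of_pos hρ]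
      have hne : circleMap 0 ρ θ ≠ 0 := circleMap_ne_center hρ.ne'
      have := ((hf _ hz).mul_right (circleMap 0 ρ θ ^ (-k - 1))).const_smul
        (deriv (circleMap 0 ρ) θ)
      have e : ∀ n : ℤ, a n * circleMap 0 ρ θ ^ (n - k - 1) =
          a n * circleMap 0 ρ θ ^ n * circleMap 0 ρ θ ^ (-k - 1) := fun n => by
        rw [mul_assoc, ← zpow_add₀ hne]
        ring_nf
      simp only [e]
      exact this
  have h2 : ∀ n : ℤ, (∮ z in C(0, ρ), a n * z ^ (n - k - 1)) =
      if n = k then a k * (2 * Real.pi * I) else 0 := fun n => by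
    have : (∮ z in C(0, ρ), a n * z ^ (n - k - 1)) = a n • ∮ z in C(0, ρ), z ^ (n - k - 1) := by
      rw [← circleIntegral.integral_smul]; rfl
    rw [this, circleIntegral_zpow hρ]
    by_cases h : n = k
    · subst h; simp
    · rw [if_neg h, if_neg (by omega), smul_zero]
  simp only [h2] at key
  have h3 := key.unique (hasSum_ite_eq k (a k * (2 * Real.pi * I)))
  rw [laurentCoeff, h3, mul_comm (a k), inv_mul_cancel_left₀ two_pi_I_ne_zero']

variable {J : Set ℝ} {f : ℂ → ℂ}

theorem continuousOn_of_radii {r : ℝ} (hr : r ∈ J) (hf : DifferentiableOn ℂ f {z | ‖z‖ ∈ J}) :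
    ContinuousOn f (Metric.sphere (0 : ℂ) r) :=
  hf.continuousOn.mono fun z hz => by
    simp only [mem_sphere_iff_norm, sub_zero] at hz
    simpa [hz] using hr

theorem laurentCoeff_eq_of_radii (hJo : IsOpen J) (hJc : J.OrdConnected) (hJ0 : ∀ r ∈ J, 0 < r)
    (hf : DifferentiableOn ℂ f {z | ‖z‖ ∈ J}) {r r' : ℝ} (hr : r ∈ J) (hr' : r' ∈ J) (k : ℤ) :
    laurentCoeff f r k = laurentCoeff f r' k := by
  wlog hle : r ≤ r' generalizing r r'
  · exact (this hr' hr (le_of_not_ge hle)).symm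
  have hU : IsOpen {z : ℂ | ‖z‖ ∈ J} := hJo.preimage continuous_norm
  have hmem : ∀ z ∈ Metric.closedBall (0 : ℂ) r' \ Metric.ball 0 r, ‖z‖ ∈ J := fun z hz => by
    simp only [Set.mem_sdiff, mem_closedBall_iff_norm, mem_ball_iff_norm, sub_zero, not_lt] at hz
    exact hJc.out hr hr' ⟨hz.2, hz.1⟩
  have hd : ∀ z, ‖z‖ ∈ J → DifferentiableAt ℂ (fun z => f z * z ^ (-k)) z := fun z hz => by
    have hz0 : z ≠ 0 := norm_pos_iff.1 (hJ0 _ hz)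
    exact (hf.differentiableAt (hU.mem_nhds hz)).mul (differentiableAt_zpow.2 (Or.inl hz0))
  have h := Complex.circleIntegral_sub_center_inv_smul_eq_of_differentiable_on_annulus_off_countable
    (hJ0 r hr) hle (c := 0) (f := fun z => f z * z ^ (-k)) Set.countable_empty
    (fun z hz => (hd z (hmem z hz)).continuousAt.continuousWithinAt)
    (fun z hz => hd z (hmem z ⟨Metric.ball_subset_closedBall hz.1.1,
      fun h' => hz.1.2 (Metric.ball_subset_closedBall h')⟩))
  have e : ∀ s ∈ J, (∮ z in C(0, s), (z - 0)⁻¹ • (f z * z ^ (-k))) =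
      ∮ z in C(0, s), f z * z ^ (-k - 1) := fun s hs => by
    refine circleIntegral.integral_congr (hJ0 s hs).le fun z hz => ?_
    have hz0 := ne_zero_of_mem_sphere (hJ0 s hs) hz
    simp only [sub_zero, smul_eq_mul]
    rw [zpow_sub_one₀ hz0]
    ring
  rw [e _ hr, e _ hr'] at h
  rw [laurentCoeff, laurentCoeff, h]

theorem norm_laurentCoeff_le {r : ℝ} (hr0 : 0 < r) (hf : ContinuousOn f (Metric.sphere (0 : ℂ) r)) :
    ∃ M : ℝ, 0 ≤ M ∧ ∀ k, ‖laurentCoeff f r k‖ ≤ M * r ^ (-k) := by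
  obtain ⟨M, hM⟩ := (isCompact_sphere (0 : ℂ) r).exists_bound_of_continuousOn hf
  refine ⟨max M 0, le_max_right _ _, fun k => ?_⟩
  have h := circleIntegral.norm_two_pi_i_inv_smul_integral_le_of_norm_le_const (c := 0) hr0.le
    (f := fun z => f z * z ^ (-k - 1)) (C := max M 0 * r ^ (-k - 1)) fun z hz => by
      rw [norm_mul, norm_zpow]
      have : ‖z‖ = r := by simpa using hz
      rw [this]
      exact mul_le_mul_of_nonneg_right ((hM z hz).trans (le_max_left _ _)) (by positivity)
  refine h.trans (le_of_eq ?_)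
  rw [zpow_sub_one₀ hr0.ne']
  field_simp

/-- A two-sided sequence with geometric bounds on both sides. -/
theorem summable_of_bounds {b : ℤ → ℝ} (hb : ∀ k, 0 ≤ b k) {r s t M M' : ℝ} (hs : 0 < s)
    (hsr : s < r) (hrt : r < t) (h1 : ∀ k, b k ≤ M * t ^ (-k)) (h2 : ∀ k, b k ≤ M' * s ^ (-k)) :
    Summable fun k : ℤ => b k * r ^ k := by
  have hr : 0 < r := hs.trans hsr
  have ht : 0 < t := hr.trans hrt
  refine Summable.of_nat_of_neg ?_ ?_
  · refine Summable.of_nonneg_of_le (fun n => mul_nonneg (hb _) (by positivity)) (fun n => ?_)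
      ((summable_geometric_of_lt_one (by positivity) ((div_lt_one ht).2 hrt)).mul_left M)
    calc b n * r ^ (n : ℤ) ≤ M * t ^ (-(n : ℤ)) * r ^ (n : ℤ) :=
          mul_le_mul_of_nonneg_right (h1 n) (by positivity)
      _ = M * (r / t) ^ n := by
          rw [zpow_neg, zpow_natCast, zpow_natCast, div_pow]; field_simp
  · refine Summable.of_nonneg_of_le (fun n => mul_nonneg (hb _) (by positivity)) (fun n => ?_)
      ((summable_geometric_of_lt_one (by positivity) ((div_lt_one hr).2 hsr)).mul_left M')
    calc b (-n) * r ^ (-(n : ℤ)) ≤ M' * s ^ (-(-(n : ℤ))) * r ^ (-(n : ℤ)) :=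
          mul_le_mul_of_nonneg_right (h2 _) (by positivity)
      _ = M' * (s / r) ^ n := by
          rw [neg_neg, zpow_neg, zpow_natCast, zpow_natCast, div_pow]; field_simp

theorem exists_lt_mem {J : Set ℝ} (hJo : IsOpen J) {r : ℝ} (hr : r ∈ J) : ∃ s ∈ J, s < r := by
  obtain ⟨ε, hε, h⟩ := Metric.isOpen_iff.1 hJo r hr
  exact ⟨r - ε / 2, h (by rw [Metric.mem_ball, Real.dist_eq]; rw [abs_lt]; constructor <;> linarith),
    by linarith⟩

theorem exists_gt_mem {J : Set ℝ} (hJo : IsOpen J) {r : ℝ} (hr : r ∈ J) : ∃ s ∈ J, r < s := by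
  obtain ⟨ε, hε, h⟩ := Metric.isOpen_iff.1 hJo r hr
  exact ⟨r + ε / 2, h (by rw [Metric.mem_ball, Real.dist_eq]; rw [abs_lt]; constructor <;> linarith),
    by linarith⟩

theorem summable_laurentCoeff (hJo : IsOpen J) (hJc : J.OrdConnected) (hJ0 : ∀ r ∈ J, 0 < r)
    (hf : DifferentiableOn ℂ f {z | ‖z‖ ∈ J}) {r₀ : ℝ} (hr₀ : r₀ ∈ J) (r : ℝ) (hr : r ∈ J) :
    Summable fun k : ℤ => ‖laurentCoeff f r₀ k‖ * r ^ k := by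
  obtain ⟨s, hs, hsr⟩ := exists_lt_mem hJo hr
  obtain ⟨t, ht, hrt⟩ := exists_gt_mem hJo hr
  obtain ⟨M, _, hM⟩ := norm_laurentCoeff_le (hJ0 t ht) (continuousOn_of_radii ht hf)
  obtain ⟨M', _, hM'⟩ := norm_laurentCoeff_le (hJ0 s hs) (continuousOn_of_radii hs hf)
  refine summable_of_bounds (M := M) (M' := M') (fun k => norm_nonneg _) (hJ0 s hs) hsr hrt
    (fun k => ?_) fun k => ?_
  · rw [laurentCoeff_eq_of_radii hJo hJc hJ0 hf hr₀ ht]; exact hM k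
  · rw [laurentCoeff_eq_of_radii hJo hJc hJ0 hf hr₀ hs]; exact hM' k

theorem hasSum_laurentCoeff (hJo : IsOpen J) (hJc : J.OrdConnected) (hJ0 : ∀ r ∈ J, 0 < r)
    (hf : DifferentiableOn ℂ f {z | ‖z‖ ∈ J}) {r : ℝ} (hr : r ∈ J) {z : ℂ} (hz : ‖z‖ = r) :
    HasSum (fun k => laurentCoeff f r k * z ^ k) (f z) := by
  have hr0 := hJ0 r hr
  have : Fact (0 < 2 * Real.pi) := ⟨Real.two_pi_pos⟩
  have hcirc : ∀ x : AddCircle (2 * Real.pi), ‖(r : ℂ) * fourier 1 x‖ = r := fun x => by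
    rw [norm_mul, Complex.norm_real, fourier_one, Circle.norm_coe, mul_one, Real.norm_eq_abs,
      abs_of_pos hr0]
  let F : C(AddCircle (2 * Real.pi), ℂ) := ⟨fun x => f (r * fourier 1 x), by
    refine (continuousOn_of_radii hr hf).comp_continuous
      (continuous_const.mul (ContinuousMap.continuous _)) fun x => ?_
    simpa using hcirc x⟩
  have hexp : ∀ (n : ℤ) (θ : ℝ), (fourier n (θ : AddCircle (2 * Real.pi)) : ℂ) =
      Complex.exp (θ * I) ^ n := fun n θ => by
    rw [fourier_coe_apply, ← Complex.exp_int_mul]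
    congr 1
    have : (Real.pi : ℂ) ≠ 0 := by simp [Real.pi_ne_zero]
    push_cast
    field_simp
  have hcoef : ∀ k, fourierCoeff F k = laurentCoeff f r k * r ^ k := fun k => by
    rw [fourierCoeff_eq_intervalIntegral F k 0, laurentCoeff, circleIntegral, zero_add,
      mul_assoc, ← intervalIntegral.integral_mul_const]
    have : ∀ θ : ℝ, deriv (circleMap 0 r) θ • (f (circleMap 0 r θ) * circleMap 0 r θ ^ (-k - 1)) *
        (r : ℂ) ^ k = I * (fourier (-k) (θ : AddCircle (2 * Real.pi)) • F θ) := fun θ => by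
      have e1 : circleMap 0 r θ = r * Complex.exp (θ * I) := by simp [circleMap]
      have e2 : F θ = f (circleMap 0 r θ) := by
        change f (r * fourier 1 (θ : AddCircle (2 * Real.pi))) = _
        rw [hexp, zpow_one, e1]
      have hne : circleMap 0 r θ ≠ 0 := circleMap_ne_center hr0.ne'
      have hrne : (r : ℂ) ≠ 0 := by exact_mod_cast hr0.ne'
      rw [deriv_circleMap, e2, hexp, smul_eq_mul, smul_eq_mul, zpow_sub_one₀ hne, e1, mul_zpow,
        zpow_neg (r : ℂ)]
      field_simp
    simp only [this]
    rw [intervalIntegral.integral_const_mul]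
    rw [Complex.real_smul]
    push_cast
    field_simp
  have hsum : Summable (fourierCoeff F) := by
    have h := summable_laurentCoeff hJo hJc hJ0 hf hr r hr
    refine Summable.of_norm (h.congr fun k => ?_)
    rw [hcoef, norm_mul, norm_zpow, Complex.norm_real, Real.norm_eq_abs, abs_of_pos hr0]
  obtain ⟨θ, hθ⟩ : ∃ θ : ℝ, z = r * Complex.exp (θ * I) := ⟨Complex.arg z, by
    rw [← hz]; exact (Complex.norm_mul_exp_arg_mul_I z).symm⟩
  have h := has_pointwise_sum_fourier_series_of_summable hsum (θ : AddCircle (2 * Real.pi))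
  have e2 : F θ = f z := by
    change f (r * fourier 1 (θ : AddCircle (2 * Real.pi))) = _
    rw [hexp, zpow_one, hθ]
  rw [e2] at h
  convert h using 2 with k
  rw [hcoef, hexp, hθ, mul_zpow, smul_eq_mul, mul_assoc]

theorem summable_conv_aux {a b : ℤ → ℂ} {r : ℝ} (hr : 0 < r) (ha : Summable fun k : ℤ => ‖a k‖ * r ^ k)
    (hb : Summable fun k : ℤ => ‖b k‖ * r ^ k) :
    Summable fun p : ℤ × ℤ => ‖a p.2 * b (p.1 - p.2)‖ * r ^ p.1 := by
  have h := ha.mul_of_nonneg hb (fun k => by positivity) (fun k => by positivity)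
  let e : ℤ × ℤ ≃ ℤ × ℤ := ⟨fun p => (p.2, p.1 - p.2), fun p => (p.1 + p.2, p.1),
    fun p => by ext <;> simp, fun p => by ext <;> simp⟩
  refine ((e.summable_iff).2 h).congr fun p => ?_
  simp only [Function.comp, e, Equiv.coe_fn_mk, norm_mul]
  rw [show r ^ p.1 = r ^ p.2 * r ^ (p.1 - p.2) by rw [← zpow_add₀ hr.ne']; ring_nf]
  ring

theorem summable_conv {a b : ℤ → ℂ} {r : ℝ} (hr : 0 < r) (ha : Summable fun k : ℤ => ‖a k‖ * r ^ k)
    (hb : Summable fun k : ℤ => ‖b k‖ * r ^ k) (k : ℤ) : Summable fun j => a j * b (k - j) := by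
  have h := (summable_conv_aux hr ha hb).prod_factor k
  refine Summable.of_norm ?_
  have := h.mul_right (r ^ k)⁻¹
  refine this.congr fun j => ?_
  have : r ^ k ≠ 0 := by positivity
  field_simp

theorem summable_norm_conv {a b : ℤ → ℂ} {r : ℝ} (hr : 0 < r)
    (ha : Summable fun k : ℤ => ‖a k‖ * r ^ k) (hb : Summable fun k : ℤ => ‖b k‖ * r ^ k) :
    Summable fun k : ℤ => ‖∑' j, a j * b (k - j)‖ * r ^ k := by
  have h := (summable_conv_aux hr ha hb).prod
  refine Summable.of_nonneg_of_le (fun k => by positivity) (fun k => ?_) h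
  dsimp only
  rw [tsum_mul_right]
  exact mul_le_mul_of_nonneg_right (norm_tsum_le_tsum_norm (summable_conv hr ha hb k).norm)
    (by positivity)

theorem tsum_conv {a b : ℤ → ℂ} {r : ℝ} (hr : 0 < r)
    (ha : Summable fun k : ℤ => ‖a k‖ * r ^ k) (hb : Summable fun k : ℤ => ‖b k‖ * r ^ k) {z : ℂ}
    (hz : ‖z‖ = r) : ∑' k, (∑' j, a j * b (k - j)) * z ^ k =
      (∑' k, a k * z ^ k) * ∑' k, b k * z ^ k := by
  have hz0 : z ≠ 0 := norm_pos_iff.1 (hz ▸ hr)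
  have ha' : Summable fun k : ℤ => ‖a k * z ^ k‖ := by simpa [norm_mul, norm_zpow, hz] using ha
  have hb' : Summable fun k : ℤ => ‖b k * z ^ k‖ := by simpa [norm_mul, norm_zpow, hz] using hb
  rw [tsum_mul_tsum_of_summable_norm ha' hb']
  let e : ℤ × ℤ ≃ ℤ × ℤ := ⟨fun p => (p.2, p.1 - p.2), fun p => (p.1 + p.2, p.1),
    fun p => by ext <;> simp, fun p => by ext <;> simp⟩
  rw [← e.tsum_eq]
  have hs : Summable fun p : ℤ × ℤ => a p.2 * b (p.1 - p.2) * z ^ p.1 :=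
    Summable.of_norm (by
      simpa [norm_mul, norm_zpow, hz] using summable_conv_aux hr ha hb)
  have he : ∀ p, a (e p).1 * z ^ (e p).1 * (b (e p).2 * z ^ (e p).2) =
      a p.2 * b (p.1 - p.2) * z ^ p.1 := fun p => by
    simp only [e, Equiv.coe_fn_mk]
    rw [show z ^ p.1 = z ^ p.2 * z ^ (p.1 - p.2) by rw [← zpow_add₀ hz0]; ring_nf]
    ring
  simp only [he]
  rw [hs.tsum_prod]
  exact tsum_congr fun k => tsum_mul_right.symm

end Laurent

namespace Datum

variable (P : Datum)

theorem isOpen_radii : IsOpen P.radii :=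
  (isOpen_Ioi (a := P.r₂)).inter (isOpen_Iio.preimage continuous_coe_real_ereal)

theorem ordConnected_radii : P.radii.OrdConnected := ⟨fun _ hx _ hy _ hz =>
  ⟨hx.1.trans_le hz.1, lt_of_le_of_lt (EReal.coe_le_coe_iff.2 hz.2) hy.2⟩⟩

theorem radii_pos {r : ℝ} (hr : r ∈ P.radii) : 0 < r := P.r₂_nonneg.trans_lt hr.1

theorem rho_mem : P.ρ ∈ P.radii := ⟨P.r₂_lt, P.lt_r₁⟩

theorem rho_pos : 0 < P.ρ := P.radii_pos P.rho_mem

/-- The Laurent series that converge absolutely in the region. -/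
def lsModule : Submodule ℂ (ℤ → ℂ) where
  carrier := {a | ∀ r ∈ P.radii, Summable fun k : ℤ => ‖a k‖ * r ^ k}
  add_mem' {a b} ha hb r hr := by
    have h0 := P.radii_pos hr
    refine Summable.of_nonneg_of_le (fun k => by positivity) (fun k => ?_)
      ((ha r hr).add (hb r hr))
    rw [← add_mul]
    exact mul_le_mul_of_nonneg_right (norm_add_le _ _) (by positivity)
  zero_mem' r hr := by simp
  smul_mem' t a ha r hr := by
    refine ((ha r hr).mul_left ‖t‖).congr fun k => ?_
    rw [Pi.smul_apply, norm_smul, mul_assoc]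

/-- The ring of Laurent series that converge absolutely in the region. -/
def LS : Type := P.lsModule

instance : AddCommGroup P.LS := inferInstanceAs (AddCommGroup P.lsModule)

instance : Module ℂ P.LS := inferInstanceAs (Module ℂ P.lsModule)

namespace LS

variable {P}

/-- The coefficients of a Laurent series. -/
def coef (a : P.LS) (k : ℤ) : ℂ := a.1 k

theorem summable (a : P.LS) {r : ℝ} (hr : r ∈ P.radii) : Summable fun k => ‖a.coef k‖ * r ^ k :=
  a.2 r hr

@[ext] theorem ext {a b : P.LS} (h : ∀ k, a.coef k = b.coef k) : a = b := Subtype.ext (funext h)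

@[simp] theorem coef_add (a b : P.LS) (k : ℤ) : (a + b).coef k = a.coef k + b.coef k := rfl

@[simp] theorem coef_zero (k : ℤ) : (0 : P.LS).coef k = 0 := rfl

@[simp] theorem coef_neg (a : P.LS) (k : ℤ) : (-a).coef k = -a.coef k := rfl

@[simp] theorem coef_smul (t : ℂ) (a : P.LS) (k : ℤ) : (t • a).coef k = t * a.coef k := rfl

/-- The coefficients, as a linear map. -/
def coefL (k : ℤ) : P.LS →ₗ[ℂ] ℂ where
  toFun a := a.coef k
  map_add' _ _ := rfl
  map_smul' _ _ := rfl

theorem coef_sum {ι : Type*} (s : Finset ι) (F : ι → P.LS) (k : ℤ) :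
    (∑ i ∈ s, F i).coef k = ∑ i ∈ s, (F i).coef k := map_sum (coefL k) F s

/-- The monomial `u ^ k`. -/
def single (k : ℤ) : P.LS := ⟨Pi.single k 1, fun r _ => by
  refine summable_of_hasFiniteSupport ((Set.finite_singleton k).subset fun j hj => ?_)
  by_contra h
  exact hj (by simp [Pi.single_eq_of_ne h])⟩

theorem coef_single (k j : ℤ) : (single k : P.LS).coef j = if j = k then 1 else 0 :=
  Pi.single_apply k 1 j

instance : One P.LS := ⟨single 0⟩

instance : Mul P.LS := ⟨fun a b => ⟨fun k => ∑' j, a.coef j * b.coef (k - j), fun _ hr =>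
  summable_norm_conv (P.radii_pos hr) (a.summable hr) (b.summable hr)⟩⟩

theorem coef_one (j : ℤ) : (1 : P.LS).coef j = if j = 0 then 1 else 0 := coef_single 0 j

theorem hasSum_mul (a b : P.LS) (k : ℤ) :
    HasSum (fun j => a.coef j * b.coef (k - j)) ((a * b).coef k) :=
  (summable_conv P.rho_pos (a.summable P.rho_mem) (b.summable P.rho_mem) k).hasSum

/-- The value of a Laurent series on the circle of radius `ρ`. -/
def eval (a : P.LS) (z : Metric.sphere (0 : ℂ) P.ρ) : ℂ := ∑' k, a.coef k * (z : ℂ) ^ k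

theorem norm_coe (z : Metric.sphere (0 : ℂ) P.ρ) : ‖(z : ℂ)‖ = P.ρ := by
  simp

theorem hasSum_eval (a : P.LS) (z : Metric.sphere (0 : ℂ) P.ρ) :
    HasSum (fun k => a.coef k * (z : ℂ) ^ k) (a.eval z) :=
  (summable_mul_zpow (by rw [norm_coe]; exact a.summable P.rho_mem)).hasSum

theorem eval_injective : Function.Injective (eval : P.LS → _) := fun a b h => by
  ext k
  have key : ∀ c : P.LS, laurentCoeff (fun z => ∑' k, c.coef k * z ^ k) P.ρ k = c.coef k :=
    fun c => laurentCoeff_of_hasSum P.rho_pos (c.summable P.rho_mem)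
      (fun z hz => c.hasSum_eval ⟨z, by simpa using hz⟩) k
  rw [← key a, ← key b, laurentCoeff, laurentCoeff]
  congr 1
  refine circleIntegral.integral_congr P.rho_pos.le fun z hz => ?_
  have := congrFun h ⟨z, hz⟩
  simp only [eval] at this
  simp only [this]

theorem eval_add (a b : P.LS) : (a + b).eval = a.eval + b.eval := funext fun z => by
  refine (hasSum_eval (a + b) z).unique ?_
  simpa [add_mul] using (a.hasSum_eval z).add (b.hasSum_eval z)

theorem eval_smul (t : ℂ) (a : P.LS) : (t • a).eval = t • a.eval := funext fun z => by
  refine (hasSum_eval (t • a) z).unique ?_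
  simpa [mul_assoc] using (a.hasSum_eval z).mul_left t

theorem eval_zero : (0 : P.LS).eval = 0 := funext fun z => by simp [eval]

theorem eval_one : (1 : P.LS).eval = 1 := funext fun z => by
  refine (hasSum_eval 1 z).unique ?_
  convert hasSum_single (0 : ℤ) ?_ using 1
  · simp [coef_one]
  · intro k hk
    simp [coef_one, hk]

theorem eval_mul (a b : P.LS) : (a * b).eval = a.eval * b.eval := funext fun z =>
  tsum_conv P.rho_pos (a.summable P.rho_mem) (b.summable P.rho_mem) (norm_coe z)

instance : CommRing P.LS :=
  { (inferInstance : AddCommGroup P.LS) with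
    mul := (· * ·)
    one := 1
    mul_assoc := fun a b c => eval_injective (by simp only [eval_mul, mul_assoc])
    one_mul := fun a => eval_injective (by simp only [eval_mul, eval_one, one_mul])
    mul_one := fun a => eval_injective (by simp only [eval_mul, eval_one, mul_one])
    left_distrib := fun a b c => eval_injective (by simp only [eval_mul, eval_add, mul_add])
    right_distrib := fun a b c => eval_injective (by simp only [eval_mul, eval_add, add_mul])
    zero_mul := fun a => eval_injective (by simp only [eval_mul, eval_zero, zero_mul])
    mul_zero := fun a => eval_injective (by simp only [eval_mul, eval_zero, mul_zero])
    mul_comm := fun a b => eval_injective (by simp only [eval_mul, mul_comm]) }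

instance : Algebra ℂ P.LS :=
  Algebra.ofModule
    (fun t a b => eval_injective (by simp only [eval_mul, eval_smul, smul_mul_assoc]))
    (fun t a b => eval_injective (by simp only [eval_mul, eval_smul, mul_smul_comm]))

theorem single_add (j k : ℤ) : (single (j + k) : P.LS) = single j * single k := by
  ext n
  refine HasSum.unique ?_ (hasSum_mul _ _ n)
  convert hasSum_single j ?_ using 1
  · simp only [coef_single, if_true, one_mul]
    exact if_congr (by constructor <;> intro h <;> omega) rfl rfl
  · intro i hi
    simp [coef_single, hi]

/-- The powers of the variable. -/
def upow : Multiplicative ℤ →* P.LS where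
  toFun k := single (Multiplicative.toAdd k)
  map_one' := rfl
  map_mul' _ _ := single_add _ _

/-- Functions of the exponent by which the coefficients of Laurent series can be multiplied. -/
def IsMultiplier (P : Datum) (p : ℤ → ℂ) : Prop :=
  ∀ a ∈ P.lsModule, (fun k => p k * a k) ∈ P.lsModule

theorem isMultiplier_const (t : ℂ) : IsMultiplier P fun _ => t := fun _ ha =>
  P.lsModule.smul_mem t ha

theorem IsMultiplier.add {p p' : ℤ → ℂ} (h : IsMultiplier P p) (h' : IsMultiplier P p') :
    IsMultiplier P fun k => p k + p' k := fun a ha => by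
  have := P.lsModule.add_mem (h a ha) (h' a ha)
  convert this using 1
  funext k
  exact add_mul _ _ _

theorem IsMultiplier.mul {p p' : ℤ → ℂ} (h : IsMultiplier P p) (h' : IsMultiplier P p') :
    IsMultiplier P fun k => p k * p' k := fun a ha => by
  have := h _ (h' a ha)
  simpa only [mul_assoc] using this

theorem IsMultiplier.pow {p : ℤ → ℂ} (h : IsMultiplier P p) (n : ℕ) :
    IsMultiplier P fun k => p k ^ n := by
  induction n with
  | zero => simpa using isMultiplier_const 1
  | succ n ih => simpa only [pow_succ] using ih.mul h

theorem IsMultiplier.prod {ι : Type*} (s : Finset ι) {p : ι → ℤ → ℂ}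
    (h : ∀ i ∈ s, IsMultiplier P (p i)) : IsMultiplier P fun k => ∏ i ∈ s, p i k := by
  classical
  induction s using Finset.induction_on with
  | empty => simpa using isMultiplier_const 1
  | insert a s has ih =>
    simp only [Finset.prod_insert has]
    exact (h a (by simp)).mul (ih fun i hi => h i (by simp [hi]))

theorem nat_mul_pow_le {r t : ℝ} (hr : 0 < r) (hrt : r < t) (n : ℕ) :
    n * r ^ n ≤ (t / r - 1)⁻¹ * t ^ n := by
  have h1 : 0 < t / r - 1 := by rw [sub_pos, one_lt_div hr]; exact hrt
  have h2 := one_add_mul_le_pow (a := t / r - 1) (by linarith) n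
  rw [add_sub_cancel] at h2
  rw [inv_mul_eq_div, le_div_iff₀ h1]
  have h3 : (n : ℝ) * (t / r - 1) ≤ (t / r) ^ n := by linarith
  calc n * r ^ n * (t / r - 1) = n * (t / r - 1) * r ^ n := by ring
    _ ≤ (t / r) ^ n * r ^ n := mul_le_mul_of_nonneg_right h3 (by positivity)
    _ = t ^ n := by rw [← mul_pow, div_mul_cancel₀ _ hr.ne']

theorem isMultiplier_id : IsMultiplier P fun k => (k : ℂ) := fun a ha r hr => by
  obtain ⟨s, hs, hsr⟩ := exists_lt_mem P.isOpen_radii hr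
  obtain ⟨t, ht, hrt⟩ := exists_gt_mem P.isOpen_radii hr
  have hr0 := P.radii_pos hr
  have hs0 := P.radii_pos hs
  have ht0 := P.radii_pos ht
  have h1 : 0 ≤ (t / r - 1)⁻¹ := by
    rw [inv_nonneg, sub_nonneg, one_le_div hr0]; exact hrt.le
  have h2 : 0 ≤ (s⁻¹ / r⁻¹ - 1)⁻¹ := by
    rw [inv_nonneg, sub_nonneg, one_le_div (by positivity)]
    exact inv_anti₀ hs0 hsr.le
  refine Summable.of_nonneg_of_le (fun k => by positivity) (fun k => ?_)
    (((ha t ht).mul_left (t / r - 1)⁻¹).add ((ha s hs).mul_left (s⁻¹ / r⁻¹ - 1)⁻¹))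
  have key : |(k : ℝ)| * r ^ k ≤ (t / r - 1)⁻¹ * t ^ k + (s⁻¹ / r⁻¹ - 1)⁻¹ * s ^ k := by
    obtain ⟨n, rfl | rfl⟩ := k.eq_nat_or_neg
    · have := nat_mul_pow_le hr0 hrt n
      have h3 : 0 ≤ (s⁻¹ / r⁻¹ - 1)⁻¹ * s ^ n := mul_nonneg h2 (by positivity)
      simp only [Int.cast_natCast, zpow_natCast, abs_of_nonneg (Nat.cast_nonneg (α := ℝ) n)]
      linarith
    · have := nat_mul_pow_le (inv_pos.2 hr0) (inv_strictAnti₀ hs0 hsr) n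
      have h3 : 0 ≤ (t / r - 1)⁻¹ * (t⁻¹) ^ n := mul_nonneg h1 (by positivity)
      simp only [Int.cast_neg, Int.cast_natCast, abs_neg, zpow_neg, zpow_natCast,
        abs_of_nonneg (Nat.cast_nonneg (α := ℝ) n), ← inv_pow]
      linarith
  calc ‖(k : ℂ) * a k‖ * r ^ k = ‖a k‖ * (|(k : ℝ)| * r ^ k) := by
        rw [norm_mul, Complex.norm_intCast]; ring
    _ ≤ ‖a k‖ * ((t / r - 1)⁻¹ * t ^ k + (s⁻¹ / r⁻¹ - 1)⁻¹ * s ^ k) :=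
        mul_le_mul_of_nonneg_left key (norm_nonneg _)
    _ = _ := by ring

/-- The Laurent expansion of a function that is holomorphic in the region. -/
def ofFun (f : ℂ → ℂ) (hf : DifferentiableOn ℂ f {z | ‖z‖ ∈ P.radii}) : P.LS :=
  ⟨laurentCoeff f P.ρ, fun r hr => summable_laurentCoeff P.isOpen_radii P.ordConnected_radii
    (fun _ => P.radii_pos) hf P.rho_mem r hr⟩

theorem eval_ofFun (f : ℂ → ℂ) (hf : DifferentiableOn ℂ f {z | ‖z‖ ∈ P.radii})
    (z : Metric.sphere (0 : ℂ) P.ρ) : (ofFun f hf).eval z = f z :=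
  ((ofFun f hf).hasSum_eval z).unique (hasSum_laurentCoeff P.isOpen_radii P.ordConnected_radii
    (fun _ => P.radii_pos) hf P.rho_mem (norm_coe z))

end LS

theorem norm_mem_radii {z : ℂ} (hz : ‖z‖ ∈ P.radii) : z ≠ 0 ∧ P.Gp z ≠ 0 ∧ P.Gm z ≠ 0 :=
  ⟨norm_pos_iff.1 (P.radii_pos hz), P.Gp_ne_zero z hz.1 hz.2, P.Gm_ne_zero z hz.1 hz.2⟩

theorem differentiableOn_region {f : ℂ → ℂ} (hf : DifferentiableOn ℂ f {0}ᶜ) :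
    DifferentiableOn ℂ f {z | ‖z‖ ∈ P.radii} :=
  hf.mono fun _ hz => (P.norm_mem_radii hz).1

theorem differentiableOn_g :
    DifferentiableOn ℂ (fun z => P.Gp z / P.Gm z) {z | ‖z‖ ∈ P.radii} :=
  (P.differentiableOn_region P.differentiableOn_Gp).div
    (P.differentiableOn_region P.differentiableOn_Gm) fun _ hz => (P.norm_mem_radii hz).2.2

/-- `g`, expanded in the region. -/
def gS : P.LS := LS.ofFun (fun z => P.Gp z / P.Gm z) P.differentiableOn_g

/-- `g⁻¹`, expanded in the region. -/
def giS : P.LS := LS.ofFun (fun z => (P.Gp z / P.Gm z)⁻¹)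
  (P.differentiableOn_g.inv fun _ hz =>
    div_ne_zero (P.norm_mem_radii hz).2.1 (P.norm_mem_radii hz).2.2)

theorem coef_gS : P.gS.coef = P.gCoeff := rfl

theorem coef_giS : P.giS.coef = P.gInvCoeff := rfl

theorem differentiableOn_punctured {f : ℂ → ℂ} (hf : DifferentiableOn ℂ f {0}ᶜ) :
    DifferentiableOn ℂ f {z | ‖z‖ ∈ Set.Ioi 0} :=
  hf.mono fun _ hz => norm_pos_iff.1 hz

theorem summable_entire {f : ℂ → ℂ} (hf : DifferentiableOn ℂ f {0}ᶜ) (r : ℝ) (hr : 0 < r) :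
    Summable fun k : ℤ => ‖laurentCoeff f 1 k‖ * r ^ k :=
  summable_laurentCoeff isOpen_Ioi Set.ordConnected_Ioi (fun _ h => h)
    (differentiableOn_punctured hf) (r₀ := 1) (show (0 : ℝ) < 1 from one_pos) r hr

theorem hasSum_entire {f : ℂ → ℂ} (hf : DifferentiableOn ℂ f {0}ᶜ) {z : ℂ} (hz : z ≠ 0) :
    HasSum (fun k => laurentCoeff f 1 k * z ^ k) (f z) := by
  have h := hasSum_laurentCoeff isOpen_Ioi Set.ordConnected_Ioi (fun _ h => h)
    (differentiableOn_punctured hf) (r := ‖z‖) (norm_pos_iff.2 hz) rfl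
  convert h using 3 with k
  exact laurentCoeff_eq_of_radii isOpen_Ioi Set.ordConnected_Ioi (fun _ h => h)
    (differentiableOn_punctured hf) (show (0 : ℝ) < 1 from one_pos) (norm_pos_iff.2 hz) k

/-- The Laurent series of a function that is holomorphic on `ℂ \ {0}`. -/
def entS (f : ℂ → ℂ) (hf : DifferentiableOn ℂ f {0}ᶜ) : P.LS :=
  ⟨laurentCoeff f 1, fun r hr => summable_entire hf r (P.radii_pos hr)⟩

/-- The Laurent series of `f(1/u)`, for a function `f` that is holomorphic on `ℂ \ {0}`. -/
def entInvS (f : ℂ → ℂ) (hf : DifferentiableOn ℂ f {0}ᶜ) : P.LS :=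
  ⟨fun k => laurentCoeff f 1 (-k), fun r hr => by
    have := (Equiv.neg ℤ).summable_iff.2 (summable_entire hf r⁻¹ (inv_pos.2 (P.radii_pos hr)))
    refine this.congr fun k => ?_
    simp⟩

theorem eval_entS (f : ℂ → ℂ) (hf : DifferentiableOn ℂ f {0}ᶜ) (z : Metric.sphere (0 : ℂ) P.ρ) :
    (P.entS f hf).eval z = f z :=
  ((P.entS f hf).hasSum_eval z).unique
    (hasSum_entire hf (ne_zero_of_mem_sphere P.rho_pos z.2))

theorem eval_entInvS (f : ℂ → ℂ) (hf : DifferentiableOn ℂ f {0}ᶜ)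
    (z : Metric.sphere (0 : ℂ) P.ρ) : (P.entInvS f hf).eval z = f (z : ℂ)⁻¹ := by
  refine ((P.entInvS f hf).hasSum_eval z).unique ?_
  have := (Equiv.neg ℤ).hasSum_iff.2
    (hasSum_entire hf (inv_ne_zero (ne_zero_of_mem_sphere P.rho_pos z.2)))
  convert this using 2 with k
  simp [LS.coef, entInvS]

/-- `G⁺`. -/
def GpS : P.LS := P.entS P.Gp P.differentiableOn_Gp

/-- `G⁻`. -/
def GmS : P.LS := P.entS P.Gm P.differentiableOn_Gm

/-- `G⁺(1/u)`. -/
def GpInvS : P.LS := P.entInvS P.Gp P.differentiableOn_Gp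

/-- `G⁻(1/u)`. -/
def GmInvS : P.LS := P.entInvS P.Gm P.differentiableOn_Gm

theorem sphere_mem (z : Metric.sphere (0 : ℂ) P.ρ) : ‖(z : ℂ)‖ ∈ P.radii := by
  rw [LS.norm_coe]; exact P.rho_mem

theorem gS_mul_giS : P.gS * P.giS = 1 := LS.eval_injective <| by
  funext z
  have h := P.norm_mem_radii (P.sphere_mem z)
  rw [LS.eval_mul, LS.eval_one, Pi.mul_apply, gS, giS, LS.eval_ofFun, LS.eval_ofFun]
  exact mul_inv_cancel₀ (div_ne_zero h.2.1 h.2.2)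

theorem GmS_mul_gS : P.GmS * P.gS = P.GpS := LS.eval_injective <| by
  funext z
  have h := P.norm_mem_radii (P.sphere_mem z)
  rw [LS.eval_mul, Pi.mul_apply, gS, GmS, GpS, LS.eval_ofFun, eval_entS, eval_entS]
  exact mul_div_cancel₀ _ h.2.2

theorem GpInvS_mul_gS : P.GpInvS * P.gS = P.GmInvS := LS.eval_injective <| by
  funext z
  have h := P.norm_mem_radii (P.sphere_mem z)
  rw [LS.eval_mul, Pi.mul_apply, gS, GmInvS, GpInvS, LS.eval_ofFun, eval_entInvS, eval_entInvS]
  have h1 : P.Gp z / P.Gm z ≠ 0 := div_ne_zero h.2.1 h.2.2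
  have h2 := P.functional_eq z h.1
  rw [h2] at h1 ⊢
  have h3 : P.Gp (z : ℂ)⁻¹ ≠ 0 := fun h0 => h1 (by simp [h0])
  rw [inv_div, mul_div_cancel₀ _ h3]

theorem GpS_mul_giS : P.GpS * P.giS = P.GmS := by
  rw [← GmS_mul_gS, mul_assoc, gS_mul_giS, mul_one]

theorem GmInvS_mul_giS : P.GmInvS * P.giS = P.GpInvS := by
  rw [← GpInvS_mul_gS, mul_assoc, gS_mul_giS, mul_one]

end Datum

/-! ### Scaling of the variables by powers of the central elements -/

namespace Datum

variable (P : Datum) {N k l : ℕ}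

theorem qPow_add (s t : Fin N → ℤ) : P.qPow (s + t) = P.qPow s * P.qPow t := by
  rw [qPow, qPow, qPow, ← FA.cexp_add]
  congr 1
  funext i
  simp [mul_add]

theorem qPow_zero : P.qPow (0 : Fin N → ℤ) = 1 := by
  rw [qPow, ← FA.cexp_zero]
  congr 1
  funext i
  simp

theorem qPow_scal (s : Fin N → ℤ) : LettersIn ∅ (P.qPow s) := FA.cexp_scal _

theorem qPow_comm (s : Fin N → ℤ) (f : FA N) : P.qPow s * f = f * P.qPow s :=
  (P.qPow_scal s).commuteFA f

theorem isMultiplier_qPow (s t : Fin N → ℤ) (d : ℤ) (w : Mon N) :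
    LS.IsMultiplier P fun k => P.qPow (k • s + (d - k) • t) w := by
  classical
  by_cases hw : ∀ i, (w i).2 = 1
  · simp only [qPow, FA.cexp, if_pos hw]
    refine LS.IsMultiplier.prod _ fun i _ => ?_
    simp only [div_eq_mul_inv]
    refine LS.IsMultiplier.mul (LS.IsMultiplier.pow ?_ _) (LS.isMultiplier_const _)
    refine LS.IsMultiplier.mul (LS.isMultiplier_const _) ?_
    have := (LS.isMultiplier_id (P := P)).mul (LS.isMultiplier_const ((s i - t i : ℤ) : ℂ))
    have := this.add (LS.isMultiplier_const ((d * t i : ℤ) : ℂ))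
    convert this using 2 with k
    simp only [Pi.add_apply, Pi.smul_apply, smul_eq_mul]
    push_cast
    ring
  · simp only [qPow, FA.cexp, if_neg hw]
    exact LS.isMultiplier_const 0

theorem mul_apply_of_scal {f g : FA N} (hf : LettersIn ∅ f) (w : Mon N) :
    (f * g) w = ∑ q ∈ factor w, f q.1 * g q.2 := by
  rw [FA.mul_apply]
  refine Finset.sum_congr rfl fun q _ => ?_
  by_cases h : f q.1 = 0
  · simp [h]
  · rw [sgn_of_scal_left fun i => hf _ h i (by simp), one_mul]

theorem scal_mul_Xd {Γ : Type} [AddCommGroup Γ] (ψ : Multiplicative ℤ →* Multiplicative Γ)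
    {f : FA N} (hf : LettersIn ∅ f) (g : FA N) (r : Γ) :
    f * Xd (ψ.comp deg) g r = Xd (ψ.comp deg) (f * g) r := by
  ext w
  have h1 : ∀ q ∈ factor w, f q.1 ≠ 0 → ψ.comp deg q.2 = ψ.comp deg w := fun q hq h => by
    have : deg q.1 = 1 := Multiplicative.toAdd.injective
      (dg_of_scal fun i => hf _ h i (by simp))
    rw [← mem_factor.1 hq, map_mul, MonoidHom.comp_apply _ _ q.1, this, map_one, one_mul]
  by_cases h : r = Multiplicative.toAdd (ψ.comp deg w)
  · subst h
    rw [Xd_apply_self, mul_apply_of_scal hf, mul_apply_of_scal hf]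
    refine Finset.sum_congr rfl fun q hq => ?_
    by_cases h0 : f q.1 = 0
    · simp [h0]
    · rw [← h1 q hq h0, Xd_apply_self]
  · rw [Xd_apply_ne _ _ h, mul_apply_of_scal hf]
    refine Finset.sum_eq_zero fun q hq => ?_
    by_cases h0 : f q.1 = 0
    · simp [h0]
    · rw [Xd_apply_ne, mul_zero]
      rwa [h1 q hq h0]

/-- The value of `f(z q^{s c / 2})` at `z = 1`. -/
def scaleFun (s : Fin N → ℤ) (f : FA N) : FA N :=
  fun w => (P.qPow (dg w • s) * f) w

theorem Xd_comp_scaleFun {Γ : Type} [AddCommGroup Γ] (ψ : Multiplicative ℤ →* Multiplicative Γ)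
    (s : Fin N → ℤ) (τ : Γ → (Fin N → ℤ))
    (hτ : ∀ r : ℤ, τ (Multiplicative.toAdd (ψ (Multiplicative.ofAdd r))) = r • s)
    (f : FA N) (r : Γ) :
    Xd (ψ.comp deg) (P.scaleFun s f) r = P.qPow (τ r) * Xd (ψ.comp deg) f r := by
  rw [scal_mul_Xd _ (P.qPow_scal _)]
  ext w
  by_cases h : r = Multiplicative.toAdd (ψ.comp deg w)
  · subst h
    rw [Xd_apply_self, Xd_apply_self]
    have : τ (Multiplicative.toAdd (ψ.comp deg w)) = dg w • s := hτ (dg w)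
    rw [this]
    rfl
  · rw [Xd_apply_ne _ _ h, Xd_apply_ne _ _ h]

theorem Xd_deg_scaleFun (s : Fin N → ℤ) (f : FA N) (r : ℤ) :
    Xd deg (P.scaleFun s f) r = P.qPow (r • s) * Xd deg f r :=
  P.Xd_comp_scaleFun (MonoidHom.id _) s (fun r => r • s) (fun _ => rfl) f r

theorem scaleFun_apply (s : Fin N → ℤ) (f : FA N) (w : Mon N) :
    P.scaleFun s f w = (P.qPow (dg w • s) * f) w := rfl

theorem scaleFun_one (s : Fin N → ℤ) : P.scaleFun s (1 : FA N) = 1 := by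
  apply Xd_injective deg
  funext r
  rw [P.Xd_deg_scaleFun, Xd_one]
  by_cases h : r = 0
  · simp [h, qPow_zero]
  · simp [h]

theorem scaleFun_zero (s : Fin N → ℤ) : P.scaleFun s (0 : FA N) = 0 := by
  apply FA.ext
  intro w
  rw [scaleFun_apply, mul_zero]

theorem scaleFun_add (s : Fin N → ℤ) (f g : FA N) :
    P.scaleFun s (f + g) = P.scaleFun s f + P.scaleFun s g := by
  apply FA.ext
  intro w
  rw [FA.add_apply, scaleFun_apply, scaleFun_apply, scaleFun_apply, mul_add, FA.add_apply]

theorem scaleFun_mul (s : Fin N → ℤ) (f g : FA N) :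
    P.scaleFun s (f * g) = P.scaleFun s f * P.scaleFun s g := by
  apply Xd_injective deg
  funext r
  rw [P.Xd_deg_scaleFun, ← lmul_Xd, ← lmul_Xd]
  have e : ∀ j : ℤ, Xd deg (P.scaleFun s f) j * Xd deg (P.scaleFun s g) (r - j) =
      P.qPow (r • s) * (Xd deg f j * Xd deg g (r - j)) := fun j => by
    have hr : r • s = j • s + (r - j) • s := by rw [← add_smul, add_sub_cancel]
    rw [P.Xd_deg_scaleFun, P.Xd_deg_scaleFun, hr, P.qPow_add, mul_assoc, mul_assoc,
      ← mul_assoc (Xd deg f j), ← P.qPow_comm ((r - j) • s), mul_assoc]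
  have h := hasSum_lmul deg (P.scaleFun s f) (Xd deg (P.scaleFun s g)) r
  simp only [e] at h
  exact ((hasSum_lmul deg f (Xd deg g) r).mul_left (P.qPow (r • s))).unique h

/-- Scaling of the variable. -/
def scale (s : Fin N → ℤ) : FA N →+* FA N where
  toFun := P.scaleFun s
  map_one' := P.scaleFun_one s
  map_zero' := P.scaleFun_zero s
  map_add' := P.scaleFun_add s
  map_mul' := P.scaleFun_mul s

theorem Xd_scale (s : Fin N → ℤ) (f : FA N) (r : ℤ) :
    Xd deg (P.scale s f) r = P.qPow (r • s) * Xd deg f r := P.Xd_deg_scaleFun s f r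

theorem scale_scale (s t : Fin N → ℤ) (f : FA N) : P.scale s (P.scale t f) = P.scale (s + t) f := by
  apply Xd_injective deg
  funext r
  rw [P.Xd_scale, P.Xd_scale, P.Xd_scale, ← mul_assoc, ← P.qPow_add, smul_add]

theorem scale_zero (f : FA N) : P.scale 0 f = f := by
  apply Xd_injective deg
  funext r
  rw [P.Xd_scale, smul_zero, P.qPow_zero, one_mul]

theorem scale_apply_ne {s : Fin N → ℤ} {f : FA N} {w : Mon N} (h : P.scale s f w ≠ 0) :
    ∃ u v, u * v = w ∧ (∀ i, (u i).2 = 1) ∧ f v ≠ 0 := by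
  obtain ⟨u, v, huv, hu, hv⟩ := FA.mul_ne_zero_exists h
  exact ⟨u, v, huv, fun i => P.qPow_scal _ u hu i (by simp), hv⟩

theorem scale_lettersIn {A : Set (Fin N)} {f : FA N} (hf : LettersIn A f) (s : Fin N → ℤ) :
    LettersIn A (P.scale s f) := fun w hw i hi => by
  obtain ⟨u, v, rfl, hu, hv⟩ := P.scale_apply_ne hw
  rw [Pi.mul_apply, Prod.snd_mul, hu i, hf v hv i hi, one_mul]

theorem scale_hasParity {d : ZMod 2} {f : FA N} (hf : HasParity d f) (s : Fin N → ℤ) :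
    HasParity d (P.scale s f) := fun w hw => by
  obtain ⟨u, v, rfl, hu, hv⟩ := P.scale_apply_ne hw
  rw [parity_mul, parity_of_scal hu, zero_add, hf v hv]

theorem scale_one_apply {f : FA N} (hf : f 1 = 0) (s : Fin N → ℤ) : P.scale s f 1 = 0 := by
  change (P.qPow (dg (1 : Mon N) • s) * f : FA N) 1 = 0
  rw [FA.mul_apply_one, hf, mul_zero]

/-- The current `f` in the slot `i`, with scaled variable, at `z = 1`. -/
def cu (i : Fin N) (s : Fin N → ℤ) (f : FA 1) : FA N := P.scale s (FA.slot i f)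

theorem slot_Xd {Γ : Type} [AddCommGroup Γ] (ψ : Multiplicative ℤ →* Multiplicative Γ)
    (i : Fin N) (f : FA 1) (r : Γ) :
    FA.slot i (Xd (ψ.comp deg) f r) = Xd (ψ.comp deg) (FA.slot i f) r :=
  (FA.inclHom_degPres (fun _ => i) (FA.strictMono_const i)).map_Xd ψ f r

theorem cur_Xd (i : Fin N) (s : Fin N → ℤ) (f : FA 1) : P.cur i s (Xd deg f) = Xd deg (P.cu i s f) := by
  funext r
  rw [cur, cu, P.Xd_scale]
  congr 1
  exact slot_Xd (MonoidHom.id _) i f r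

/-- The degree, in the first variable. -/
def degZ : Mon N →* Multiplicative (ℤ × ℤ) :=
  (AddMonoidHom.toMultiplicative (AddMonoidHom.inl ℤ ℤ)).comp deg

/-- The degree, in the second variable. -/
def degW : Mon N →* Multiplicative (ℤ × ℤ) :=
  (AddMonoidHom.toMultiplicative (AddMonoidHom.inr ℤ ℤ)).comp deg

theorem toAdd_degZ (w : Mon N) : Multiplicative.toAdd (degZ w) = (dg w, 0) := rfl

theorem toAdd_degW (w : Mon N) : Multiplicative.toAdd (degW w) = (0, dg w) := rfl

theorem Xd_degZ (f : FA N) (p : ℤ × ℤ) : Xd degZ f p = if p.2 = 0 then Xd deg f p.1 else 0 := by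
  ext w
  by_cases h : p = Multiplicative.toAdd (degZ w)
  · subst h
    rw [Xd_apply_self, toAdd_degZ, if_pos rfl]
    exact (Xd_apply_self deg f w).symm
  · rw [Xd_apply_ne _ _ h]
    split_ifs with h2
    · rw [Xd_apply_ne]
      intro h1
      exact h (Prod.ext h1 h2)
    · rfl

theorem Xd_degW (f : FA N) (p : ℤ × ℤ) : Xd degW f p = if p.1 = 0 then Xd deg f p.2 else 0 := by
  ext w
  by_cases h : p = Multiplicative.toAdd (degW w)
  · subst h
    rw [Xd_apply_self, toAdd_degW, if_pos rfl]
    exact (Xd_apply_self deg f w).symm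
  · rw [Xd_apply_ne _ _ h]
    split_ifs with h2
    · rw [Xd_apply_ne]
      intro h1
      exact h (Prod.ext h2 h1)
    · rfl

theorem curZ_Xd (i : Fin N) (s : Fin N → ℤ) (f : FA 1) :
    P.curZ i s (Xd deg f) = Xd degZ (P.cu i s f) := by
  funext p
  rw [Xd_degZ, curZ, cur_Xd]

theorem curW_Xd (i : Fin N) (s : Fin N → ℤ) (f : FA 1) :
    P.curW i s (Xd deg f) = Xd degW (P.cu i s f) := by
  funext p
  rw [Xd_degW, curW, cur_Xd]

/-! ### Products of distributions whose structure functions converge in the region -/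

/-- Homogeneous series with coefficients in the ring of Laurent series. -/
abbrev R (N : ℕ) : Type := Ser P.LS N

variable {P}

/-- The distribution of a series with coefficients in the ring of Laurent series in `z/w`. -/
def ev (x : P.R N) : Dist N := fun p w => if p.1 + p.2 = dg w then (x w).coef p.1 else 0

theorem ev_apply_self (x : P.R N) (w : Mon N) (k : ℤ) : ev x (k, dg w - k) w = (x w).coef k := by
  simp [ev]

theorem ev_apply_of_eq (x : P.R N) {w : Mon N} {p : ℤ × ℤ} (h : p.1 + p.2 = dg w) :
    ev x p w = (x w).coef p.1 := if_pos h

theorem ev_apply_ne (x : P.R N) {w : Mon N} {p : ℤ × ℤ} (h : p.1 + p.2 ≠ dg w) :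
    ev x p w = 0 := if_neg h

theorem ev_injective : Function.Injective (ev : P.R N → Dist N) := fun x y h => by
  ext w k
  rw [← ev_apply_self, h, ev_apply_self]

theorem ev_add (x y : P.R N) : ev (x + y) = ev x + ev y := by
  funext p
  ext w
  simp only [ev, Pi.add_apply, FA.add_apply, Ser.add_apply, LS.coef_add]
  split_ifs <;> simp

theorem ev_neg (x : P.R N) : ev (-x) = -ev x := by
  funext p
  ext w
  simp only [ev, Pi.neg_apply, FA.neg_apply, Ser.neg_apply, LS.coef_neg]
  split_ifs <;> simp

theorem ev_sub (x y : P.R N) : ev (x - y) = ev x - ev y := by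
  rw [sub_eq_add_neg, sub_eq_add_neg, ev_add, ev_neg]

theorem ev_zero : ev (0 : P.R N) = 0 := by
  funext p
  ext w
  simp only [ev, Pi.zero_apply, FA.zero_apply, Ser.zero_apply, LS.coef_zero, ite_self]

theorem ev_smul (t : ℂ) (x : P.R N) : ev (t • x) = t • ev x := by
  funext p
  ext w
  simp only [ev, Pi.smul_apply, FA.smul_apply, Ser.smul_apply, LS.coef_smul]
  split_ifs <;> simp

theorem hasSum_ev_mul (x y : P.R N) (p : ℤ × ℤ) :
    HasSum (fun r => ev x r * ev y (p - r)) (ev (x * y) p) := by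
  refine FA.hasSum_iff.2 fun w => ?_
  simp only [FA.mul_apply]
  by_cases hp : p.1 + p.2 = dg w
  · rw [ev_apply_of_eq _ hp, Ser.mul_apply, LS.coef_sum]
    refine hasSum_sum fun q hq => ?_
    have hq' : dg q.1 + dg q.2 = dg w := by rw [← mem_factor.1 hq, dg_mul]
    rw [LS.coef_smul]
    simp only [mul_assoc]
    refine HasSum.mul_left _ ?_
    let e : ℤ → ℤ × ℤ := fun k => (k, dg q.1 - k)
    have he : Function.Injective e := fun a b h => congrArg Prod.fst h
    have h0 : ∀ r ∉ Set.range e, ev x r q.1 * ev y (p - r) q.2 = 0 := fun r hr => by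
      rw [ev_apply_ne, zero_mul]
      intro h
      exact hr ⟨r.1, Prod.ext rfl (by simp only [e]; omega)⟩
    rw [← he.hasSum_iff h0]
    convert LS.hasSum_mul (x q.1) (y q.2) p.1 using 2 with k
    simp only [Function.comp, e]
    rw [ev_apply_self, ev_apply_of_eq]
    · rfl
    · simp only [Prod.fst_sub, Prod.snd_sub]
      omega
  · rw [ev_apply_ne _ hp]
    convert hasSum_zero with r
    refine Finset.sum_eq_zero fun q hq => ?_
    have hq' : dg q.1 + dg q.2 = dg w := by rw [← mem_factor.1 hq, dg_mul]
    by_cases h1 : r.1 + r.2 = dg q.1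
    · rw [ev_apply_ne y, mul_zero]
      simp only [Prod.fst_sub, Prod.snd_sub]
      omega
    · rw [ev_apply_ne x h1]
      ring

theorem ev_mul (x y : P.R N) : ev (x * y) = conv (ev x) (ev y) :=
  funext fun p => (hasSum_ev_mul x y p).tsum_eq.symm

/-- `f(z)`. -/
def zeta : FA N →+* P.R N := Ser.twist (LS.upow.comp deg)

/-- `f(w)`. -/
def omega : FA N →+* P.R N := Ser.twist 1

theorem ev_zeta (f : FA N) : ev (zeta f : P.R N) = Xd degZ f := by
  funext p
  ext w
  simp only [ev, Xd, toAdd_degZ, zeta, Ser.twist_apply, MonoidHom.comp_apply, LS.coef_smul,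
    LS.upow, MonoidHom.coe_mk, OneHom.coe_mk, LS.coef_single, Prod.ext_iff]
  change (if p.1 + p.2 = dg w then f w * (if p.1 = dg w then 1 else 0) else 0) = _
  by_cases h1 : p.1 = dg w
  · by_cases h2 : p.2 = 0
    · simp [h1, h2]
    · simp [h1, h2]
  · simp [h1]

theorem ev_omega (f : FA N) : ev (omega f : P.R N) = Xd degW f := by
  funext p
  ext w
  simp only [ev, Xd, toAdd_degW, omega, Ser.twist_apply, MonoidHom.one_apply, LS.coef_smul,
    LS.coef_one, Prod.ext_iff]
  by_cases h1 : p.1 = 0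
  · by_cases h2 : p.2 = dg w
    · simp [h1, h2]
    · simp [h1, h2]
  · simp [h1]

theorem zeta_ne {f : FA N} {w : Mon N} (h : (zeta f : P.R N) w ≠ 0) : f w ≠ 0 := fun h0 =>
  h (by rw [zeta, Ser.twist_apply, h0, zero_smul])

theorem omega_ne {f : FA N} {w : Mon N} (h : (omega f : P.R N) w ≠ 0) : f w ≠ 0 := fun h0 =>
  h (by rw [omega, Ser.twist_apply, h0, zero_smul])

theorem zeta_lettersIn {A : Set (Fin N)} {f : FA N} (hf : LettersIn A f) :
    LettersIn A (zeta f : P.R N) := fun w hw => hf w (zeta_ne hw)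

theorem omega_lettersIn {A : Set (Fin N)} {f : FA N} (hf : LettersIn A f) :
    LettersIn A (omega f : P.R N) := fun w hw => hf w (omega_ne hw)

theorem zeta_hasParity {d : ZMod 2} {f : FA N} (hf : HasParity d f) :
    HasParity d (zeta f : P.R N) := fun w hw => hf w (zeta_ne hw)

theorem omega_hasParity {d : ZMod 2} {f : FA N} (hf : HasParity d f) :
    HasParity d (omega f : P.R N) := fun w hw => hf w (omega_ne hw)

/-- Distributions that are homogeneous. -/
def Homog (D : Dist N) : Prop := ∀ p w, D p w ≠ 0 → p.1 + p.2 = dg w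

theorem ev_homog (x : P.R N) : Homog (ev x) := fun p w h => by
  by_contra h'
  exact h (ev_apply_ne x h')

/-- The series with given homogeneous coefficients. -/
def toR (D : Dist N) (h : ∀ w, (fun k => D (k, dg w - k) w) ∈ P.lsModule) : P.R N :=
  fun w => ⟨fun k => D (k, dg w - k) w, h w⟩

theorem ev_toR {D : Dist N} (hD : Homog D)
    (h : ∀ w, (fun k => D (k, dg w - k) w) ∈ P.lsModule) : ev (toR D h) = D := by
  funext p
  ext w
  by_cases hp : p.1 + p.2 = dg w
  · rw [ev_apply_of_eq _ hp]
    change D (p.1, dg w - p.1) w = _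
    congr 1
    rw [← hp, add_sub_cancel_left]
  · rw [ev_apply_ne _ hp]
    by_contra h'
    exact hp (hD p w (Ne.symm h'))

theorem coef_mem (x : P.R N) (w : Mon N) : (x w).coef ∈ P.lsModule := (x w).2

/-- Series in the central elements. -/
theorem ratio_homog {F : ℤ → FA N} (hF : ∀ k, LettersIn ∅ (F k)) : Homog (ratio F) :=
  fun p w h => by
  by_cases hp : p.1 + p.2 = 0
  · rw [ratio, if_pos hp] at h
    rw [hp, dg_of_scal fun i => hF _ w h i (by simp)]
  · rw [ratio, if_neg hp] at h
    exact absurd rfl h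

theorem scalar_mem {F : ℤ → FA N} (hF : IsScalarSeries P.radii F) (w : Mon N) :
    (fun k => ratio F (k, dg w - k) w) ∈ P.lsModule := by
  by_cases h : ∀ i, (w i).2 = 1
  · have : (fun k => ratio F (k, dg w - k) w) = fun k => F k w := by
      funext k
      rw [dg_of_scal h, ratio]
      simp
    rw [this]
    exact hF.2 w
  · have : (fun k => ratio F (k, dg w - k) w) = 0 := by
      funext k
      by_contra h'
      rw [ratio] at h'
      split_ifs at h' with h''
      · exact h (hF.1 _ w h')
      · exact h' rfl
    rw [this]
    exact zero_mem _

/-- A scalar series, as an element of the ring of series over Laurent series. -/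
def scalR (F : ℤ → FA N) (hF : IsScalarSeries P.radii F) : P.R N := toR (ratio F) (scalar_mem hF)

theorem ev_scalR (F : ℤ → FA N) (hF : IsScalarSeries P.radii F) : ev (scalR F hF) = ratio F :=
  ev_toR (ratio_homog fun k w hw i _ => hF.1 k w hw i) _

theorem scalR_scal (F : ℤ → FA N) (hF : IsScalarSeries P.radii F) : LettersIn ∅ (scalR F hF) :=
  fun w hw i _ => by
  by_contra h
  refine hw (LS.ext fun k => ?_)
  by_contra h'
  change ratio F (k, dg w - k) w ≠ 0 at h'
  rw [ratio] at h'
  split_ifs at h' with h''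
  · exact h (hF.1 _ w h' i)
  · exact h' rfl

theorem ratio_of_eq {F : ℤ → FA N} {p : ℤ × ℤ} (h : p.1 + p.2 = 0) : ratio F p = F p.1 := if_pos h

theorem ratio_of_ne {F : ℤ → FA N} {p : ℤ × ℤ} (h : p.1 + p.2 ≠ 0) : ratio F p = 0 := if_neg h

/-- The coefficients of the powers of `z/w`. -/
def coeffs (x : P.R N) (k : ℤ) : FA N := fun w => (x w).coef k

theorem coeffs_apply (x : P.R N) (k : ℤ) (w : Mon N) : coeffs x k w = (x w).coef k := rfl

theorem coeffs_isScalarSeries {x : P.R N} (hx : LettersIn ∅ x) :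
    IsScalarSeries P.radii (coeffs x) := by
  refine ⟨fun k w h i => hx w (fun h0 => h ?_) i (by simp), fun w => coef_mem x w⟩
  rw [coeffs_apply, h0, LS.coef_zero]

theorem ev_of_scal {x : P.R N} (hx : LettersIn ∅ x) : ev x = ratio (coeffs x) := by
  funext p
  ext w
  by_cases h0 : x w = 0
  · have h1 : ev x p w = 0 := by
      by_cases hp : p.1 + p.2 = dg w
      · rw [ev_apply_of_eq _ hp, h0, LS.coef_zero]
      · exact ev_apply_ne _ hp
    rw [h1]
    by_cases hp : p.1 + p.2 = 0
    · rw [ratio_of_eq hp, coeffs_apply, h0, LS.coef_zero]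
    · rw [ratio_of_ne hp, FA.zero_apply]
  · have hd := dg_of_scal fun i => hx w h0 i (by simp)
    by_cases hp : p.1 + p.2 = 0
    · rw [ev_apply_of_eq _ (hp.trans hd.symm), ratio_of_eq hp, coeffs_apply]
    · rw [ev_apply_ne _ (by rwa [hd]), ratio_of_ne hp, FA.zero_apply]

end Datum

namespace Datum

variable {P : Datum} {N k l : ℕ}

theorem rescale_mem (s t : Fin N → ℤ) (x : P.R N) (w : Mon N) :
    (fun k => (P.qPow (k • s + (dg w - k) • t) * ev x (k, dg w - k)) w) ∈ P.lsModule := by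
  have e : (fun k => (P.qPow (k • s + (dg w - k) • t) * ev x (k, dg w - k)) w) =
      ∑ q ∈ factor w, fun k => P.qPow (k • s + (dg w - k) • t) q.1 * ev x (k, dg w - k) q.2 := by
    funext k
    rw [mul_apply_of_scal (P.qPow_scal _), Finset.sum_apply]
  rw [e]
  refine sum_mem fun q hq => ?_
  by_cases h : ∀ i, (q.1 i).2 = 1
  · have hd : dg q.2 = dg w := by rw [← mem_factor.1 hq, dg_mul, dg_of_scal h, zero_add]
    have e2 : (fun k => P.qPow (k • s + (dg w - k) • t) q.1 * ev x (k, dg w - k) q.2) =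
        fun k => P.qPow (k • s + (dg w - k) • t) q.1 * (x q.2).coef k := by
      funext k
      rw [← hd, ev_apply_self]
    rw [e2]
    exact P.isMultiplier_qPow s t (dg w) q.1 _ (coef_mem x q.2)
  · have e2 : (fun k => P.qPow (k • s + (dg w - k) • t) q.1 * ev x (k, dg w - k) q.2) = 0 := by
      funext k
      have : P.qPow (k • s + (dg w - k) • t) q.1 = 0 := by
        by_contra h0
        exact h fun i => P.qPow_scal _ _ h0 i (by simp)
      rw [this, zero_mul, Pi.zero_apply]
    rw [e2]
    exact zero_mem _

/-- Rescaling of both variables, on series. -/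
def thetaFun (s t : Fin N → ℤ) (x : P.R N) : P.R N :=
  toR (fun p => P.qPow (p.1 • s + p.2 • t) * ev x p) (rescale_mem s t x)

theorem ev_thetaFun (s t : Fin N → ℤ) (x : P.R N) :
    ev (thetaFun s t x) = fun p => P.qPow (p.1 • s + p.2 • t) * ev x p := by
  refine ev_toR (fun p w h => ?_) _
  obtain ⟨u, v, rfl, hu, hv⟩ := FA.mul_ne_zero_exists h
  rw [dg_mul, dg_of_scal fun i => P.qPow_scal _ u hu i (by simp), zero_add]
  exact ev_homog x p v hv

theorem Xd_degZ_scale (s : Fin N → ℤ) (f : FA N) (p : ℤ × ℤ) :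
    Xd degZ (P.scale s f) p = P.qPow (p.1 • s) * Xd degZ f p := by
  rw [Xd_degZ, Xd_degZ]
  split_ifs
  · rw [P.Xd_scale]
  · rw [mul_zero]

theorem Xd_degW_scale (s : Fin N → ℤ) (f : FA N) (p : ℤ × ℤ) :
    Xd degW (P.scale s f) p = P.qPow (p.2 • s) * Xd degW f p := by
  rw [Xd_degW, Xd_degW]
  split_ifs
  · rw [P.Xd_scale]
  · rw [mul_zero]

theorem thetaFun_zeta (s t : Fin N → ℤ) (f : FA N) :
    thetaFun s t (zeta f : P.R N) = zeta (P.scale s f) := by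
  apply ev_injective
  funext p
  rw [ev_thetaFun, ev_zeta, ev_zeta, Xd_degZ_scale]
  by_cases h : p.2 = 0
  · simp only [h, zero_smul, add_zero]
  · simp only [Xd_degZ, if_neg h, mul_zero]

theorem thetaFun_omega (s t : Fin N → ℤ) (f : FA N) :
    thetaFun s t (omega f : P.R N) = omega (P.scale t f) := by
  apply ev_injective
  funext p
  rw [ev_thetaFun, ev_omega, ev_omega, Xd_degW_scale]
  by_cases h : p.1 = 0
  · simp only [h, zero_smul, zero_add]
  · simp only [Xd_degW, if_neg h, mul_zero]

theorem qPow_mul_mul (s t : Fin N → ℤ) (f g : FA N) :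
    P.qPow s * f * (P.qPow t * g) = P.qPow (s + t) * (f * g) := by
  rw [P.qPow_add, mul_assoc, mul_assoc, ← mul_assoc f, ← P.qPow_comm t, mul_assoc]

theorem thetaFun_mul (s t : Fin N → ℤ) (x y : P.R N) :
    thetaFun s t (x * y) = thetaFun s t x * thetaFun s t y := by
  apply ev_injective
  funext p
  rw [ev_thetaFun]
  refine HasSum.unique ?_ (hasSum_ev_mul (thetaFun s t x) (thetaFun s t y) p)
  have e : ∀ r : ℤ × ℤ, ev (thetaFun s t x) r * ev (thetaFun s t y) (p - r) =
      P.qPow (p.1 • s + p.2 • t) * (ev x r * ev y (p - r)) := fun r => by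
    rw [ev_thetaFun, ev_thetaFun]
    simp only [qPow_mul_mul]
    congr 2
    rw [Prod.fst_sub, Prod.snd_sub, sub_smul, sub_smul]
    abel
  simp only [e]
  exact (hasSum_ev_mul x y p).mul_left _

theorem thetaFun_add (s t : Fin N → ℤ) (x y : P.R N) :
    thetaFun s t (x + y) = thetaFun s t x + thetaFun s t y := by
  apply ev_injective
  funext p
  simp only [ev_add, Pi.add_apply, ev_thetaFun, mul_add]

/-- Rescaling of both variables. -/
def theta (s t : Fin N → ℤ) : P.R N →+* P.R N where
  toFun := thetaFun s t
  map_one' := by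
    have h := thetaFun_zeta (P := P) s t (1 : FA N)
    simpa only [map_one] using h
  map_zero' := by
    have h := thetaFun_zeta (P := P) s t (0 : FA N)
    simpa only [map_zero] using h
  map_add' := thetaFun_add s t
  map_mul' := thetaFun_mul s t

theorem ev_theta (s t : Fin N → ℤ) (x : P.R N) :
    ev (theta s t x) = fun p => P.qPow (p.1 • s + p.2 • t) * ev x p := ev_thetaFun s t x

theorem theta_zeta (s t : Fin N → ℤ) (f : FA N) :
    theta s t (zeta f : P.R N) = zeta (P.scale s f) := thetaFun_zeta s t f

theorem theta_omega (s t : Fin N → ℤ) (f : FA N) :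
    theta s t (omega f : P.R N) = omega (P.scale t f) := thetaFun_omega s t f

theorem theta_theta (s t s' t' : Fin N → ℤ) (x : P.R N) :
    theta s t (theta s' t' x) = theta (s + s') (t + t') x := by
  apply ev_injective
  funext p
  simp only [ev_theta, ← mul_assoc, ← P.qPow_add]
  congr 2
  rw [smul_add, smul_add]
  abel

theorem theta_zero (x : P.R N) : theta 0 0 x = x := by
  apply ev_injective
  funext p
  simp only [ev_theta, smul_zero, add_zero, P.qPow_zero, one_mul]

theorem ev_ne_zero {x : P.R N} {w : Mon N} (h : x w ≠ 0) : ∃ p, ev x p w ≠ 0 := by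
  by_contra! h0
  exact h (LS.ext fun k => by rw [← ev_apply_self, h0, LS.coef_zero])

theorem ne_zero_of_ev {x : P.R N} {w : Mon N} {p : ℤ × ℤ} (h : ev x p w ≠ 0) : x w ≠ 0 := fun h0 =>
  h (by rw [ev_apply_of_eq x (ev_homog x p w h), h0, LS.coef_zero])

theorem lettersIn_of_ev {A : Set (Fin N)} {x : P.R N} (h : ∀ p, LettersIn A (ev x p)) :
    LettersIn A x := fun w hw => by
  obtain ⟨p, hp⟩ := ev_ne_zero hw
  exact h p w hp

theorem ev_lettersIn {A : Set (Fin N)} {x : P.R N} (h : LettersIn A x) (p : ℤ × ℤ) :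
    LettersIn A (ev x p) := fun w hw => h w (ne_zero_of_ev hw)

theorem ev_hasParity {d : ZMod 2} {x : P.R N} (h : HasParity d x) (p : ℤ × ℤ) :
    HasParity d (ev x p) := fun w hw => h w (ne_zero_of_ev hw)

theorem theta_scal {x : P.R N} (h : LettersIn ∅ x) (s t : Fin N → ℤ) :
    LettersIn ∅ (theta s t x) := lettersIn_of_ev fun p => by
  rw [ev_theta]
  exact FA.lettersIn_mul (P.qPow_scal _) (ev_lettersIn h p)

/-! ### Scalar series -/

open Classical in
/-- The constant series. -/
def cstFun (γ : P.LS) : P.R N := fun w => if w = 1 then γ else 0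

theorem cstFun_one_apply (γ : P.LS) : (cstFun γ : P.R N) 1 = γ := if_pos rfl

theorem cstFun_apply_ne (γ : P.LS) {w : Mon N} (h : w ≠ 1) : (cstFun γ : P.R N) w = 0 := if_neg h

theorem cstFun_add (a b : P.LS) : (cstFun (a + b) : P.R N) = cstFun a + cstFun b := by
  apply Ser.ext
  intro w
  rw [Ser.add_apply]
  by_cases h : w = 1
  · subst h
    simp only [cstFun_one_apply]
  · simp only [cstFun_apply_ne _ h, add_zero]

theorem cstFun_mul (a b : P.LS) : (cstFun (a * b) : P.R N) = cstFun a * cstFun b := by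
  apply Ser.ext
  intro w
  rw [Ser.mul_apply]
  by_cases h : w = 1
  · subst h
    rw [Finset.sum_eq_single (1, 1)]
    · simp only [cstFun_one_apply, sgn_one_left, one_smul]
    · rintro ⟨u, v⟩ hp hne
      by_cases hu : u = 1
      · have hv : v ≠ 1 := fun hv => hne (by rw [hu, hv])
        simp only [cstFun_apply_ne _ hv, mul_zero, smul_zero]
      · simp only [cstFun_apply_ne _ hu, zero_mul, smul_zero]
    · intro h'
      exact absurd (mem_factor.2 (by simp)) h'
  · rw [cstFun_apply_ne _ h]
    symm
    refine Finset.sum_eq_zero fun q hq => ?_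
    by_cases hu : q.1 = 1
    · have hv : q.2 ≠ 1 := fun hv => h (by rw [← mem_factor.1 hq, hu, hv, one_mul])
      simp only [cstFun_apply_ne _ hv, mul_zero, smul_zero]
    · simp only [cstFun_apply_ne _ hu, zero_mul, smul_zero]

/-- The constant series, as a ring homomorphism. -/
def cst : P.LS →+* P.R N where
  toFun := cstFun
  map_one' := rfl
  map_zero' := by
    apply Ser.ext
    intro w
    by_cases h : w = 1
    · subst h
      rw [cstFun_one_apply, Ser.zero_apply]
    · rw [cstFun_apply_ne _ h, Ser.zero_apply]
  map_add' := cstFun_add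
  map_mul' := cstFun_mul

theorem ev_cst (γ : P.LS) : ev (cst γ : P.R N) = ratio fun k => γ.coef k • (1 : FA N) := by
  classical
  funext p
  ext w
  by_cases h : w = 1
  · subst h
    by_cases hp : p.1 + p.2 = 0
    · rw [ev_apply_of_eq _ (by rw [dg_one, hp]), ratio_of_eq hp, FA.smul_apply, FA.one_apply,
        if_pos rfl, mul_one]
      exact congrArg (fun a : P.LS => a.coef p.1) (cstFun_one_apply γ)
    · rw [ev_apply_ne _ (by rwa [dg_one]), ratio_of_ne hp, FA.zero_apply]
  · have h0 : (cst γ : P.R N) w = 0 := cstFun_apply_ne γ h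
    have h1 : ev (cst γ : P.R N) p w = 0 := by
      by_contra h2
      exact ne_zero_of_ev h2 h0
    rw [h1]
    by_cases hp : p.1 + p.2 = 0
    · rw [ratio_of_eq hp, FA.smul_apply, FA.one_apply, if_neg h, mul_zero]
    · rw [ratio_of_ne hp, FA.zero_apply]

/-- The scalar `γ(z/w q^{t c / 2})`. -/
def sc (t : Fin N → ℤ) : P.LS →+* P.R N := (theta t 0).comp cst

theorem ev_sc (t : Fin N → ℤ) (γ : P.LS) : ev (sc t γ : P.R N) = P.fn t γ.coef := by
  funext p
  rw [sc, RingHom.comp_apply, ev_theta, ev_cst, fn]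
  by_cases hp : p.1 + p.2 = 0
  · simp only [ratio_of_eq hp, smul_zero, add_zero, mul_smul_comm, mul_one]
  · simp only [ratio_of_ne hp, mul_zero]

theorem theta_sc (s t u : Fin N → ℤ) (γ : P.LS) :
    theta s t (sc u γ : P.R N) = sc (s - t + u) γ := by
  apply ev_injective
  funext p
  rw [ev_theta, ev_sc, ev_sc, fn, fn]
  by_cases hp : p.1 + p.2 = 0
  · simp only [ratio_of_eq hp, mul_smul_comm, ← P.qPow_add]
    congr 2
    rw [show p.2 = -p.1 by omega, smul_add, smul_sub, neg_smul]
    abel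
  · simp only [ratio_of_ne hp, mul_zero]

theorem sc_scal (t : Fin N → ℤ) (γ : P.LS) : LettersIn ∅ (sc t γ : P.R N) := by
  classical
  refine theta_scal (fun w hw i _ => ?_) _ _
  have : w = 1 := by
    by_contra h
    exact hw (cstFun_apply_ne γ h)
  rw [this]
  rfl

/-! ### Action of continuous maps -/

/-- The map of series induced by a continuous linear map. -/
def mapR (A : FA k →L[ℂ] FA l) (x : P.R k) : P.R l := fun w =>
  ∑ m ∈ (FA.finite_support A w).toFinset, A (FA.mono m) w • x m

theorem mapR_apply (A : FA k →L[ℂ] FA l) (x : P.R k) (w : Mon l) :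
    mapR A x w = ∑ m ∈ (FA.finite_support A w).toFinset, A (FA.mono m) w • x m := rfl

theorem ev_mapR {A : FA k →L[ℂ] FA l} (hA : FA.DegPres A) (x : P.R k) (p : ℤ × ℤ) :
    ev (mapR A x) p = A (ev x p) := by
  ext w
  rw [FA.apply_eq_sum]
  by_cases hp : p.1 + p.2 = dg w
  · rw [ev_apply_of_eq _ hp, mapR_apply, LS.coef_sum]
    refine Finset.sum_congr rfl fun m hm => ?_
    have hd := hA m w (by simpa using hm)
    rw [ev_apply_of_eq _ (hp.trans hd), LS.coef_smul, mul_comm]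
  · rw [ev_apply_ne _ hp]
    symm
    refine Finset.sum_eq_zero fun m hm => ?_
    have hd := hA m w (by simpa using hm)
    rw [ev_apply_ne _ (fun h => hp (h.trans hd.symm)), zero_mul]

theorem mapR_add {A : FA k →L[ℂ] FA l} (hA : FA.DegPres A) (x y : P.R k) :
    mapR A (x + y) = mapR A x + mapR A y := by
  apply ev_injective
  funext p
  rw [ev_add, Pi.add_apply, ev_mapR hA, ev_mapR hA, ev_mapR hA, ev_add, Pi.add_apply, map_add]

theorem mapR_sub {A : FA k →L[ℂ] FA l} (hA : FA.DegPres A) (x y : P.R k) :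
    mapR A (x - y) = mapR A x - mapR A y := by
  apply ev_injective
  funext p
  rw [ev_sub, Pi.sub_apply, ev_mapR hA, ev_mapR hA, ev_mapR hA, ev_sub, Pi.sub_apply, map_sub]

theorem mapR_zeta {A : FA k →L[ℂ] FA l} (hA : FA.DegPres A) (f : FA k) :
    mapR A (zeta f : P.R k) = zeta (A f) := by
  apply ev_injective
  funext p
  rw [ev_mapR hA, ev_zeta, ev_zeta]
  exact hA.map_Xd _ f p

theorem mapR_omega {A : FA k →L[ℂ] FA l} (hA : FA.DegPres A) (f : FA k) :
    mapR A (omega f : P.R k) = omega (A f) := by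
  apply ev_injective
  funext p
  rw [ev_mapR hA, ev_omega, ev_omega]
  exact hA.map_Xd _ f p

theorem mapR_mul {A : FA k →L[ℂ] FA l} (hA : FA.DegPres A) {x y : P.R k}
    (h : ∀ r s, A (ev x r * ev y s) = A (ev x r) * A (ev y s)) :
    mapR A (x * y) = mapR A x * mapR A y := by
  apply ev_injective
  funext p
  rw [ev_mapR hA]
  refine HasSum.unique ?_ (hasSum_ev_mul (mapR A x) (mapR A y) p)
  simp only [ev_mapR hA, ← h]
  exact (hasSum_ev_mul x y p).mapL A

theorem mapR_mul_anti {A : FA k →L[ℂ] FA l} (hA : FA.DegPres A) {x y : P.R k} (t : ℂ)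
    (h : ∀ r s, A (ev x r * ev y s) = t • (A (ev y s) * A (ev x r))) :
    mapR A (x * y) = t • (mapR A y * mapR A x) := by
  apply ev_injective
  funext p
  rw [ev_mapR hA, ev_smul, Pi.smul_apply]
  refine HasSum.unique ?_ ((hasSum_ev_mul (mapR A y) (mapR A x) p).const_smul t)
  rw [← (Equiv.subLeft p).hasSum_iff]
  have e : ∀ r, ((fun r => t • (ev (mapR A y) r * ev (mapR A x) (p - r))) ∘ (Equiv.subLeft p)) r =
      A (ev x r * ev y (p - r)) := fun r => by
    simp only [Function.comp_apply, Equiv.subLeft_apply, sub_sub_cancel, ev_mapR hA, h]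
  rw [funext e]
  exact (hasSum_ev_mul x y p).mapL A

theorem mapR_sc {A : FA k →L[ℂ] FA l} (hA : FA.DegPres A) {s : Fin k → ℤ} {t : Fin l → ℤ}
    (h : ∀ n : ℤ, A (P.qPow (n • s)) = P.qPow (n • t)) (γ : P.LS) :
    mapR A (sc s γ : P.R k) = sc t γ := by
  apply ev_injective
  funext p
  rw [ev_mapR hA, ev_sc, ev_sc, fn, fn]
  by_cases hp : p.1 + p.2 = 0
  · simp only [ratio_of_eq hp, map_smul, h]
  · simp only [ratio_of_ne hp, map_zero]

end Datum

/-! ### Generating currents -/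

namespace FA

variable {N k l : ℕ}

open Classical in
/-- The current `∑ y(l) z^{-l}` at `z = 1`. -/
def tot (y : ℤ → Letter) : FA 1 := fun w =>
  if ∃ l, w = mon1 (1, FreeMonoid.of (y l)) then 1 else 0

theorem dg_mon1_of (y : Letter) : dg (mon1 (1, FreeMonoid.of y)) = y.deg := by
  simp [dg, deg, degSlot, mon1]

theorem parity_mon1_of (y : Letter) :
    parity (mon1 (1, FreeMonoid.of y)) = if y.isOdd then 1 else 0 := by
  simp [parity, par, mon1, List.countP_cons]

theorem Xd_tot {y : ℤ → Letter} (hy : ∀ l, (y l).deg = -l) (r : ℤ) :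
    Xd deg (tot y) r = gen (y (-r)) := by
  classical
  have hd : ∀ l, dg (mon1 (1, FreeMonoid.of (y l))) = -l := fun l => by rw [dg_mon1_of, hy]
  ext w
  rw [gen_eq]
  by_cases h : w = mon1 (1, FreeMonoid.of (y (-r)))
  · have hr : r = Multiplicative.toAdd (deg w) := by
      have := hd (-r)
      rw [neg_neg, ← h] at this
      exact this.symm
    rw [← h, mono_apply_self, hr, Xd_apply_self, tot, if_pos ⟨_, h⟩]
  · rw [mono_apply_ne h]
    by_cases hr : r = Multiplicative.toAdd (deg w)
    · rw [hr, Xd_apply_self, tot, if_neg]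
      rintro ⟨l, rfl⟩
      have h2 : r = -l := hr.trans (hd l)
      exact h (by rw [h2, neg_neg])
    · rw [Xd_apply_ne _ _ hr]

theorem tot_ne {y : ℤ → Letter} {w : Mon 1} (h : tot y w ≠ 0) :
    ∃ l, w = mon1 (1, FreeMonoid.of (y l)) := by
  classical
  by_contra h'
  exact h (if_neg h')

theorem tot_one (y : ℤ → Letter) : tot y 1 = 0 := by
  by_contra h
  obtain ⟨l, hl⟩ := tot_ne h
  have := congrArg size hl
  simp [size, mon1] at this

theorem tot_hasParity {y : ℤ → Letter} {d : ZMod 2} (hy : ∀ l, (if (y l).isOdd then 1 else 0) = d) :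
    HasParity d (tot y) := fun w hw => by
  obtain ⟨l, rfl⟩ := tot_ne hw
  rw [parity_mon1_of, ← hy l]
  split_ifs <;> simp

open Classical in
/-- The part of a series whose degrees are in `S`. -/
def part (S : Set ℤ) (f : FA N) : FA N := fun w => if dg w ∈ S then f w else 0

theorem part_apply_of_mem {S : Set ℤ} (f : FA N) {w : Mon N} (h : dg w ∈ S) :
    part S f w = f w := if_pos h

theorem part_apply_of_notMem {S : Set ℤ} (f : FA N) {w : Mon N} (h : dg w ∉ S) :
    part S f w = 0 := if_neg h

theorem part_ne {S : Set ℤ} {f : FA N} {w : Mon N} (h : part S f w ≠ 0) : f w ≠ 0 := by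
  by_cases hw : dg w ∈ S
  · rwa [part_apply_of_mem _ hw] at h
  · exact absurd (part_apply_of_notMem _ hw) h

open Classical in
theorem Xd_part (S : Set ℤ) (f : FA N) (r : ℤ) :
    Xd deg (part S f) r = if r ∈ S then Xd deg f r else 0 := by
  ext w
  by_cases h : r = Multiplicative.toAdd (deg w)
  · subst h
    rw [Xd_apply_self]
    split_ifs with h
    · rw [Xd_apply_self, part_apply_of_mem _ h]
    · rw [part_apply_of_notMem _ h, zero_apply]
  · rw [Xd_apply_ne _ _ h]
    split_ifs
    · rw [Xd_apply_ne _ _ h]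
    · rfl

theorem part_one_apply (S : Set ℤ) {f : FA N} (hf : f 1 = 0) : part S f 1 = 0 := by
  by_contra h
  exact part_ne h hf

theorem part_add (S : Set ℤ) (f g : FA N) : part S (f + g) = part S f + part S g := by
  ext w
  rw [add_apply]
  by_cases h : dg w ∈ S
  · simp only [part_apply_of_mem _ h, add_apply]
  · simp only [part_apply_of_notMem _ h, add_zero]

theorem part_neg (S : Set ℤ) (f : FA N) : part S (-f) = -part S f := by
  ext w
  rw [neg_apply]
  by_cases h : dg w ∈ S
  · simp only [part_apply_of_mem _ h, neg_apply]
  · simp only [part_apply_of_notMem _ h, neg_zero]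

theorem part_zero (S : Set ℤ) : part S (0 : FA N) = 0 := by
  ext w
  by_contra h
  exact part_ne h rfl

theorem part_hasParity {d : ZMod 2} (S : Set ℤ) {f : FA N} (hf : HasParity d f) :
    HasParity d (part S f) := fun w hw => hf w (part_ne hw)

theorem part_lettersIn {A : Set (Fin N)} (S : Set ℤ) {f : FA N} (hf : LettersIn A f) :
    LettersIn A (part S f) := fun w hw => hf w (part_ne hw)

theorem DegPres.map_part {A : FA k →L[ℂ] FA l} (hA : DegPres A) (S : Set ℤ) (f : FA k) :
    A (part S f) = part S (A f) := by
  apply Xd_injective deg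
  funext r
  rw [← hA.map_comp, Xd_part, Xd_part, ← hA.map_comp]
  split_ifs
  · rfl
  · rw [map_zero]

/-- The normally ordered exponential of a current, at `z = 1`. -/
def vert (f : FA N) : FA N := fexp (part (Set.Ici 0) f) * fexp (part (Set.Iio 0) f)

/-- The inverse of `vert f`. -/
def vertInv (f : FA N) : FA N := fexp (-part (Set.Iio 0) f) * fexp (-part (Set.Ici 0) f)

theorem vert_mul_vertInv {f : FA N} (hf : f 1 = 0) : vert f * vertInv f = 1 := by
  rw [vert, vertInv, mul_assoc, ← mul_assoc (fexp (part (Set.Iio 0) f)),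
    fexp_mul_neg (part_one_apply _ hf), one_mul, fexp_mul_neg (part_one_apply _ hf)]

theorem vertInv_mul_vert {f : FA N} (hf : f 1 = 0) : vertInv f * vert f = 1 := by
  rw [vert, vertInv, mul_assoc, ← mul_assoc (fexp (-part (Set.Ici 0) f)),
    fexp_neg_mul (part_one_apply _ hf), one_mul, fexp_neg_mul (part_one_apply _ hf)]

theorem neg_one_apply {f : FA N} (hf : f 1 = 0) : (-f) 1 = 0 := by
  rw [neg_apply, hf, neg_zero]

theorem hom_fexp (Φ : FA k →A[ℂ] FA l) {f : FA k} (hf : f 1 = 0) (hg : Φ f 1 = 0) :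
    Φ (fexp f) = fexp (Φ f) :=
  map_fexp (toCLM Φ) hf hg fun n => map_pow Φ f n

theorem hom_vert {Φ : FA k →A[ℂ] FA l} (hΦ : DegPres (toCLM Φ)) {f : FA k} (hf : f 1 = 0)
    (hg : Φ f 1 = 0) : Φ (vert f) = vert (Φ f) := by
  have h : ∀ S, Φ (part S f) = part S (Φ f) := fun S => hΦ.map_part S f
  rw [vert, map_mul, hom_fexp Φ (part_one_apply _ hf), hom_fexp Φ (part_one_apply _ hf), h, h, vert]
  all_goals
    rw [h]
    exact part_one_apply _ hg

theorem vert_zero : vert (0 : FA N) = 1 := by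
  rw [vert, part_zero, part_zero, fexp_zero, one_mul]

theorem vert_hasParity {f : FA N} (hf : HasParity 0 f) : HasParity 0 (vert f) := by
  have := hasParity_mul (hasParity_fexp (part_hasParity (Set.Ici 0) hf))
    (hasParity_fexp (part_hasParity (Set.Iio 0) hf))
  rwa [add_zero] at this

theorem vertInv_hasParity {f : FA N} (hf : HasParity 0 f) : HasParity 0 (vertInv f) := by
  have := hasParity_mul (hasParity_fexp (hasParity_neg (part_hasParity (Set.Iio 0) hf)))
    (hasParity_fexp (hasParity_neg (part_hasParity (Set.Ici 0) hf)))
  rwa [add_zero] at this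

theorem fexp_commute {f g : FA N} (hf : f 1 = 0) (hg : g 1 = 0) (h : f * g = g * f) :
    fexp f * fexp g = fexp g * fexp f := by
  rw [← fexp_add hf hg h, ← fexp_add hg hf h.symm, add_comm]

theorem vert_add {f g : FA N} (hf : f 1 = 0) (hg : g 1 = 0)
    (h : ∀ S T : Set ℤ, part S f * part T g = part T g * part S f) :
    vert (f + g) = vert f * vert g := by
  have hf' := fun S => part_one_apply S hf
  have hg' := fun S => part_one_apply S hg
  rw [vert, part_add, part_add, fexp_add (hf' _) (hg' _) (h _ _), fexp_add (hf' _) (hg' _) (h _ _),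
    vert, vert, mul_assoc, mul_assoc, ← mul_assoc (fexp (part (Set.Ici 0) g)),
    ← fexp_commute (hf' _) (hg' _) (h _ _), mul_assoc]

/-- The total of the current `φ`. -/
def phiT : FA 1 := vert (tot .a)

/-- The total of the current `φ⁻¹`. -/
def phiIT : FA 1 := vertInv (tot .a)

/-- The total of the current `ψ`. -/
def psiT : FA 1 := vert (tot .b)

/-- The total of the current `ψ⁻¹`. -/
def psiIT : FA 1 := vertInv (tot .b)

/-- The total of the current `x⁺`. -/
def xpT : FA 1 := tot .xp

/-- The total of the current `x⁻`. -/
def xmT : FA 1 := tot .xm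

theorem xp_eq : xp = Xd deg xpT := funext fun r => (Xd_tot (fun _ => rfl) r).symm

theorem xm_eq : xm = Xd deg xmT := funext fun r => (Xd_tot (fun _ => rfl) r).symm

theorem lowPart_eq {y : ℤ → Letter} (hy : ∀ l, (y l).deg = -l) :
    lowPart y = Xd deg (part (Set.Ici 0) (tot y)) := by
  funext r
  rw [Xd_part, Xd_tot hy, lowPart]
  simp only [Set.mem_Ici]

theorem highPart_eq {y : ℤ → Letter} (hy : ∀ l, (y l).deg = -l) :
    highPart y = Xd deg (part (Set.Iio 0) (tot y)) := by
  funext r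
  rw [Xd_part, Xd_tot hy, highPart]
  simp only [Set.mem_Iio]

theorem vertex_eq {y : ℤ → Letter} (hy : ∀ l, (y l).deg = -l) :
    vertex y = Xd deg (vert (tot y)) := by
  rw [vertex, lowPart_eq hy, highPart_eq hy, convExp_Xd (part_one_apply _ (tot_one y)),
    convExp_Xd (part_one_apply _ (tot_one y)), conv_Xd_Xd, vert]

theorem vertexInv_eq {y : ℤ → Letter} (hy : ∀ l, (y l).deg = -l) :
    vertexInv y = Xd deg (vertInv (tot y)) := by
  rw [vertexInv, lowPart_eq hy, highPart_eq hy, ← Xd_neg, ← Xd_neg,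
    convExp_Xd (neg_one_apply (part_one_apply _ (tot_one y))),
    convExp_Xd (neg_one_apply (part_one_apply _ (tot_one y))), conv_Xd_Xd, vertInv]

theorem phi_eq : phi = Xd deg phiT := vertex_eq fun _ => rfl

theorem phiInv_eq : phiInv = Xd deg phiIT := vertexInv_eq fun _ => rfl

theorem psi_eq : psi = Xd deg psiT := vertex_eq fun _ => rfl

theorem psiInv_eq : psiInv = Xd deg psiIT := vertexInv_eq fun _ => rfl

/-- Totals of the basic currents. -/
inductive IsTotal : FA 1 → ZMod 2 → Prop
  | xp : IsTotal xpT 1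
  | xm : IsTotal xmT 1
  | phi : IsTotal phiT 0
  | phiInv : IsTotal phiIT 0
  | psi : IsTotal psiT 0
  | psiInv : IsTotal psiIT 0

theorem IsTotal.hasParity {f : FA 1} {d : ZMod 2} (h : IsTotal f d) : HasParity d f := by
  have ha : HasParity 0 (tot .a) := tot_hasParity fun _ => rfl
  have hb : HasParity 0 (tot .b) := tot_hasParity fun _ => rfl
  cases h with
  | xp => exact tot_hasParity fun _ => rfl
  | xm => exact tot_hasParity fun _ => rfl
  | phi => exact vert_hasParity ha
  | phiInv => exact vertInv_hasParity ha
  | psi => exact vert_hasParity hb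
  | psiInv => exact vertInv_hasParity hb

theorem exists_isTotal {X : ℤ → FA 1} (h : IsCurrent X) : ∃ f d, IsTotal f d ∧ X = Xd deg f := by
  cases h with
  | xp => exact ⟨_, _, .xp, xp_eq⟩
  | xm => exact ⟨_, _, .xm, xm_eq⟩
  | phi => exact ⟨_, _, .phi, phi_eq⟩
  | phiInv => exact ⟨_, _, .phiInv, phiInv_eq⟩
  | psi => exact ⟨_, _, .psi, psi_eq⟩
  | psiInv => exact ⟨_, _, .psiInv, psiInv_eq⟩

theorem IsTotal.isCurrent {f : FA 1} {d : ZMod 2} (h : IsTotal f d) : IsCurrent (Xd deg f) := by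
  cases h with
  | xp => exact xp_eq ▸ .xp
  | xm => exact xm_eq ▸ .xm
  | phi => exact phi_eq ▸ .phi
  | phiInv => exact phiInv_eq ▸ .phiInv
  | psi => exact psi_eq ▸ .psi
  | psiInv => exact psiInv_eq ▸ .psiInv

theorem phiT_mul_phiIT : phiT * phiIT = 1 := vert_mul_vertInv (tot_one _)

theorem phiIT_mul_phiT : phiIT * phiT = 1 := vertInv_mul_vert (tot_one _)

theorem psiT_mul_psiIT : psiT * psiIT = 1 := vert_mul_vertInv (tot_one _)

theorem psiIT_mul_psiT : psiIT * psiT = 1 := vertInv_mul_vert (tot_one _)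

end FA

namespace Datum

variable (P : Datum) {N k l : ℕ}

theorem scale_smul (s : Fin N → ℤ) (t : ℂ) (f : FA N) : P.scale s (t • f) = t • P.scale s f := by
  apply Xd_injective deg
  funext r
  rw [Xd_smul, P.Xd_scale, Xd_smul, Pi.smul_apply, Pi.smul_apply, P.Xd_scale, mul_smul_comm]

/-- Scaling of the variable, as a continuous homomorphism. -/
def scaleHom (s : Fin N → ℤ) : FA N →A[ℂ] FA N where
  toAlgHom := AlgHom.ofLinearMap
    { toFun := P.scale s
      map_add' := map_add _
      map_smul' := P.scale_smul s } (map_one (P.scale s)) (map_mul (P.scale s))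
  cont := FA.continuous_iff.2 fun w => by
    have h : Continuous fun f : FA N => FA.mulLeft (P.qPow (dg w • s)) f w :=
      (FA.continuous_coeff w).comp (FA.mulLeft (P.qPow (dg w • s))).cont
    exact h

theorem scaleHom_degPres (s : Fin N → ℤ) : FA.DegPres (FA.toCLM (P.scaleHom s)) := fun m w h => by
  obtain ⟨u, v, rfl, hu, hv⟩ := P.scale_apply_ne h
  have : v = m := by
    by_contra h'
    exact hv (FA.mono_apply_ne h')
  rw [dg_mul, dg_of_scal hu, zero_add, this]

/-- `cu`, as a continuous homomorphism. -/
def cuHom (i : Fin N) (s : Fin N → ℤ) : FA 1 →A[ℂ] FA N := (P.scaleHom s).comp (FA.slotHom i)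

theorem cu_mul (i : Fin N) (s : Fin N → ℤ) (f g : FA 1) :
    P.cu i s (f * g) = P.cu i s f * P.cu i s g := map_mul (P.cuHom i s) f g

theorem cu_one (i : Fin N) (s : Fin N → ℤ) : P.cu i s 1 = 1 := map_one (P.cuHom i s)

theorem slotHom_degPres (i : Fin N) : FA.DegPres (FA.toCLM (FA.slotHom i)) :=
  FA.inclHom_degPres _ _

theorem cuHom_degPres (i : Fin N) (s : Fin N → ℤ) : FA.DegPres (FA.toCLM (P.cuHom i s)) :=
  fun m w h => by
  obtain ⟨v, hv, h'⟩ := FA.exists_of_apply_ne_zero (FA.toCLM (P.scaleHom s))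
    (f := FA.slot i (FA.mono m)) h
  rw [P.scaleHom_degPres s v w h', slotHom_degPres i m v hv]

theorem slot_one_apply (i : Fin N) {f : FA 1} (hf : f 1 = 0) : FA.slot i f 1 = 0 := by
  rw [FA.slot, FA.incl]
  split_ifs
  · exact hf
  · rfl

theorem cu_one_apply (i : Fin N) (s : Fin N → ℤ) {f : FA 1} (hf : f 1 = 0) : P.cu i s f 1 = 0 :=
  P.scale_one_apply (slot_one_apply i hf) s

theorem cu_vert (i : Fin N) (s : Fin N → ℤ) {f : FA 1} (hf : f 1 = 0) :
    P.cu i s (FA.vert f) = FA.vert (P.cu i s f) :=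
  FA.hom_vert (P.cuHom_degPres i s) hf (P.cu_one_apply i s hf)

theorem cu_lettersIn (i : Fin N) (s : Fin N → ℤ) (f : FA 1) : LettersIn {i} (P.cu i s f) :=
  P.scale_lettersIn (FA.slot_lettersIn i f) s

theorem cu_hasParity (i : Fin N) (s : Fin N → ℤ) {d : ZMod 2} {f : FA 1} (hf : HasParity d f) :
    HasParity d (P.cu i s f) :=
  P.scale_hasParity ((FA.inclHom_parPres _ (FA.strictMono_const i)).map hf) s

theorem scale_cu (i : Fin N) (s t : Fin N → ℤ) (f : FA 1) :
    P.scale s (P.cu i t f) = P.cu i (s + t) f := P.scale_scale s t _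

theorem cu_zero (i : Fin N) (f : FA 1) : P.cu i 0 f = FA.slot i f := P.scale_zero _

end Datum

/-! ### Closure properties of the relations -/

section

variable {Γ : Type} [AddCommGroup Γ] {N : ℕ} (χ χ' : Mon N →* Multiplicative Γ)

theorem lmul_zero_left (D : Γ → FA N) : lmul χ 0 D = 0 := by
  funext p
  ext w
  simp [lmul, FA.zero_apply]

theorem lmul_zero_right (f : FA N) : lmul χ f (0 : Γ → FA N) = 0 := by
  funext p
  ext w
  simp [lmul, FA.zero_apply]

theorem rmul_zero_left (f : FA N) : rmul χ (0 : Γ → FA N) f = 0 := by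
  funext p
  ext w
  simp [rmul, FA.zero_apply]

theorem rmul_zero_right (D : Γ → FA N) : rmul χ D 0 = 0 := by
  funext p
  ext w
  simp [rmul, FA.zero_apply]

end

theorem conv_zero_right {Γ : Type} [AddCommGroup Γ] {N : ℕ} (D : Γ → FA N) :
    conv D (0 : Γ → FA N) = 0 := by
  funext p
  simp [conv]

namespace Datum

variable (P : Datum) {N k l : ℕ}

/-- Consequences of the defining relations, including `0`. -/
def Nl (D : Dist N) : Prop := P.Null N D ∨ D = 0

variable {P}

namespace Nl

theorem add {D E : Dist N} (hD : P.Nl D) (hE : P.Nl E) : P.Nl (D + E) := by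
  rcases hD with hD | rfl
  · rcases hE with hE | rfl
    · exact .inl (.add _ _ hD hE)
    · rw [add_zero]
      exact .inl hD
  · rwa [zero_add]

theorem zero : P.Nl (0 : Dist N) := .inr rfl

theorem swap {D : Dist N} (hD : P.Nl D) : P.Nl fun p => D p.swap := by
  rcases hD with hD | rfl
  · exact .inl (.swap _ hD)
  · exact zero

theorem rescale {D : Dist N} (hD : P.Nl D) (s t : Fin N → ℤ) :
    P.Nl fun p => P.qPow (p.1 • s + p.2 • t) * D p := by
  rcases hD with hD | rfl
  · exact .inl (.rescale _ hD s t)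
  · refine .inr (funext fun p => ?_)
    rw [Pi.zero_apply, mul_zero]

theorem scalar {D : Dist N} (hD : P.Nl D) {F : ℤ → FA N} (hF : IsScalarSeries (Set.Ioi 0) F)
    (hs : ∀ p, Summable fun r => ratio F r * D (p - r)) : P.Nl (conv (ratio F) D) := by
  rcases hD with hD | rfl
  · exact .inl (.scalar _ hD F hF hs)
  · exact .inr (conv_zero_right _)

theorem smul {D : Dist N} (hD : P.Nl D) (t : ℂ) : P.Nl (t • D) := by
  classical
  let F : ℤ → FA N := fun k => if k = 0 then t • 1 else 0
  have hF0 : ∀ r : ℤ × ℤ, r ≠ 0 → ratio F r = 0 := fun r hr => by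
    by_cases h : r.1 + r.2 = 0
    · rw [ratio_of_eq h]
      refine if_neg fun h1 => hr (Prod.ext h1 ?_)
      have h2 : r.1 = 0 := h1
      rw [h2, zero_add] at h
      exact h
    · exact ratio_of_ne h
  have hF1 : ratio F 0 = t • 1 := by
    rw [ratio_of_eq (by simp)]
    exact if_pos rfl
  have hsum : ∀ p, HasSum (fun r => ratio F r * D (p - r)) (t • D p) := fun p => by
    have := hasSum_single (f := fun r => ratio F r * D (p - r)) 0 fun r hr => by
      rw [hF0 r hr, zero_mul]
    simpa only [hF1, sub_zero, smul_mul_assoc, one_mul] using this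
  have e : t • D = conv (ratio F) D := funext fun p => (hsum p).tsum_eq.symm
  rw [e]
  refine hD.scalar ⟨fun k w h i => ?_, fun w r _ => ?_⟩ fun p => (hsum p).summable
  · by_cases hk : k = 0
    · by_contra hi
      refine h ?_
      simp only [F, if_pos hk, FA.smul_apply, FA.one_apply]
      rw [if_neg (fun hw => hi (by rw [hw]; rfl)), mul_zero]
    · exact absurd (by simp only [F, if_neg hk, FA.zero_apply]) h
  · refine summable_of_ne_finset_zero (s := {0}) fun k hk => ?_
    have : k ≠ 0 := by simpa using hk
    simp only [F, if_neg this, FA.zero_apply, norm_zero, zero_mul]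

theorem neg {D : Dist N} (hD : P.Nl D) : P.Nl (-D) := by
  have := hD.smul (-1)
  rwa [neg_one_smul] at this

end Nl

variable (P) in
/-- Currents by which all relations may be multiplied. -/
def acts (N : ℕ) : Subring (FA N) where
  carrier := {f | ∀ D : Dist N, P.Nl D → P.Nl (lmul degZ f D) ∧ P.Nl (rmul degZ D f)}
  mul_mem' {f g} hf hg D hD := by
    rw [lmul_mul, rmul_mul]
    exact ⟨(hf _ (hg _ hD).1).1, (hg _ (hf _ hD).2).2⟩
  one_mem' D hD := by
    rw [lmul_one, rmul_one]
    exact ⟨hD, hD⟩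
  add_mem' {f g} hf hg D hD := by
    rw [lmul_add, rmul_add]
    exact ⟨(hf _ hD).1.add (hg _ hD).1, (hf _ hD).2.add (hg _ hD).2⟩
  zero_mem' D hD := by
    rw [lmul_zero_left, rmul_zero_right]
    exact ⟨.zero, .zero⟩
  neg_mem' {f} hf D hD := by
    rw [lmul_neg, rmul_neg]
    exact ⟨(hf _ hD).1.neg, (hf _ hD).2.neg⟩

theorem cu_mem_acts (i : Fin N) (s : Fin N → ℤ) {f : FA 1} {d : ZMod 2} (hf : FA.IsTotal f d) :
    P.cu i s f ∈ P.acts N := fun D hD => by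
  rw [← conv_Xd_left, ← conv_Xd_right, ← P.curZ_Xd]
  rcases hD with hD | rfl
  · exact ⟨.inl (.left _ hD i s _ hf.isCurrent), .inl (.right _ hD i s _ hf.isCurrent)⟩
  · rw [P.curZ_Xd, conv_Xd_left, conv_Xd_right, lmul_zero_right, rmul_zero_left]
    exact ⟨.zero, .zero⟩

theorem scale_mem_acts {f : FA N} (hf : f ∈ P.acts N) (s : Fin N → ℤ) :
    P.scale s f ∈ P.acts N := fun D hD => by
  have h := hf _ (hD.rescale (-s) 0)
  have e : ∀ p r : ℤ × ℤ, P.qPow (p.1 • s + p.2 • (0 : Fin N → ℤ)) *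
      (P.qPow ((p - r).1 • (-s) + (p - r).2 • (0 : Fin N → ℤ)) * D (p - r)) =
      P.qPow (r.1 • s) * D (p - r) := fun p r => by
    rw [← mul_assoc, ← P.qPow_add]
    congr 2
    rw [smul_zero, smul_zero, add_zero, add_zero, Prod.fst_sub, smul_neg, sub_smul]
    abel
  constructor
  · convert h.1.rescale s 0 using 1
    funext p
    refine (hasSum_lmul degZ (P.scale s f) D p).unique ?_
    have h1 := (hasSum_lmul degZ f (fun p => P.qPow (p.1 • (-s) + p.2 • (0 : Fin N → ℤ)) * D p)
      p).mul_left (P.qPow (p.1 • s + p.2 • (0 : Fin N → ℤ)))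
    have e1 : ∀ r, P.qPow (p.1 • s + p.2 • (0 : Fin N → ℤ)) * (Xd degZ f r *
        (P.qPow ((p - r).1 • (-s) + (p - r).2 • (0 : Fin N → ℤ)) * D (p - r))) =
        Xd degZ (P.scale s f) r * D (p - r) := fun r => by
      rw [← mul_assoc, P.qPow_comm, mul_assoc, e, ← mul_assoc, Xd_degZ_scale, P.qPow_comm]
    simpa only [e1] using h1
  · convert h.2.rescale s 0 using 1
    funext p
    refine (hasSum_rmul degZ (P.scale s f) D p).unique ?_
    have h1 := (hasSum_rmul degZ f (fun p => P.qPow (p.1 • (-s) + p.2 • (0 : Fin N → ℤ)) * D p)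
      p).mul_left (P.qPow (p.1 • s + p.2 • (0 : Fin N → ℤ)))
    have e1 : ∀ r, P.qPow (p.1 • s + p.2 • (0 : Fin N → ℤ)) *
        (P.qPow (r.1 • (-s) + r.2 • (0 : Fin N → ℤ)) * D r * Xd degZ f (p - r)) =
        D r * Xd degZ (P.scale s f) (p - r) := fun r => by
      have h2 := e p (p - r)
      rw [sub_sub_cancel] at h2
      rw [← mul_assoc, h2, Xd_degZ_scale, ← mul_assoc, P.qPow_comm]
    simpa only [e1] using h1

theorem lmul_degW (f : FA N) (D : Dist N) :
    lmul degW f D = fun p => lmul degZ f (fun p => D p.swap) p.swap := rfl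

theorem rmul_degW (f : FA N) (D : Dist N) :
    rmul degW D f = fun p => rmul degZ (fun p => D p.swap) f p.swap := rfl

theorem Nl.lmulZ {D : Dist N} (hD : P.Nl D) {f : FA N} (hf : f ∈ P.acts N) :
    P.Nl (lmul degZ f D) := (hf D hD).1

theorem Nl.rmulZ {D : Dist N} (hD : P.Nl D) {f : FA N} (hf : f ∈ P.acts N) :
    P.Nl (rmul degZ D f) := (hf D hD).2

theorem Nl.lmulW {D : Dist N} (hD : P.Nl D) {f : FA N} (hf : f ∈ P.acts N) :
    P.Nl (lmul degW f D) := by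
  rw [lmul_degW]
  exact (hD.swap.lmulZ hf).swap

theorem Nl.rmulW {D : Dist N} (hD : P.Nl D) {f : FA N} (hf : f ∈ P.acts N) :
    P.Nl (rmul degW D f) := by
  rw [rmul_degW]
  exact (hD.swap.rmulZ hf).swap

theorem ev_zeta_mul (f : FA N) (x : P.R N) : ev (zeta f * x) = lmul degZ f (ev x) := by
  rw [ev_mul, ev_zeta, conv_Xd_left]

theorem ev_mul_zeta (f : FA N) (x : P.R N) : ev (x * zeta f) = rmul degZ (ev x) f := by
  rw [ev_mul, ev_zeta, conv_Xd_right]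

theorem ev_omega_mul (f : FA N) (x : P.R N) : ev (omega f * x) = lmul degW f (ev x) := by
  rw [ev_mul, ev_omega, conv_Xd_left]

theorem ev_mul_omega (f : FA N) (x : P.R N) : ev (x * omega f) = rmul degW (ev x) f := by
  rw [ev_mul, ev_omega, conv_Xd_right]

/-! ### The ring in which exchange relations are computed -/

variable (P) in
/-- Series all of whose multiples by scalar series are consequences of the relations. -/
def nul (N : ℕ) : AddSubgroup (P.R N) where
  carrier := {x | ∀ y : P.R N, LettersIn ∅ y → P.Nl (ev (y * x))}
  add_mem' {a b} ha hb y hy := by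
    rw [mul_add, ev_add]
    exact (ha y hy).add (hb y hy)
  zero_mem' y _ := by
    rw [mul_zero, ev_zero]
    exact .zero
  neg_mem' {a} ha y hy := by
    rw [mul_neg, ev_neg]
    exact (ha y hy).neg

theorem nl_of_mem_nul {x : P.R N} (hx : x ∈ P.nul N) : P.Nl (ev x) := by
  have := hx 1 (Ser.lettersIn_one _)
  rwa [one_mul] at this

theorem theta_mem_nul {x : P.R N} (hx : x ∈ P.nul N) (s t : Fin N → ℤ) :
    theta s t x ∈ P.nul N := fun y hy => by
  have h := (hx _ (theta_scal hy (-s) (-t))).rescale s t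
  have e : ev (y * theta s t x) = fun p => P.qPow (p.1 • s + p.2 • t) *
      ev (theta (-s) (-t) y * x) p := by
    rw [← ev_theta, map_mul, theta_theta, add_neg_cancel, add_neg_cancel, theta_zero]
  rwa [e]

variable (P) in
/-- Series by which `nul` may be multiplied. -/
def idl (N : ℕ) : Subring (P.R N) where
  carrier := {c | ∀ x ∈ P.nul N, c * x ∈ P.nul N ∧ x * c ∈ P.nul N}
  mul_mem' {a b} ha hb x hx := by
    rw [mul_assoc, ← mul_assoc x]
    exact ⟨(ha _ (hb _ hx).1).1, (hb _ (ha _ hx).2).2⟩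
  one_mem' x hx := by
    rw [one_mul, mul_one]
    exact ⟨hx, hx⟩
  add_mem' {a b} ha hb x hx := by
    rw [add_mul, mul_add]
    exact ⟨add_mem (ha x hx).1 (hb x hx).1, add_mem (ha x hx).2 (hb x hx).2⟩
  zero_mem' x _ := by
    rw [zero_mul, mul_zero]
    exact ⟨zero_mem _, zero_mem _⟩
  neg_mem' {a} ha x hx := by
    rw [neg_mul, mul_neg]
    exact ⟨neg_mem (ha x hx).1, neg_mem (ha x hx).2⟩

theorem zeta_mem_idl {f : FA N} (hf : f ∈ P.acts N) : (zeta f : P.R N) ∈ P.idl N := fun x hx => by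
  refine ⟨fun y hy => ?_, fun y hy => ?_⟩
  · rw [← mul_assoc, hy.commute, mul_assoc, ev_zeta_mul]
    exact (hx y hy).lmulZ hf
  · rw [← mul_assoc, ev_mul_zeta]
    exact (hx y hy).rmulZ hf

theorem omega_mem_idl {f : FA N} (hf : f ∈ P.acts N) : (omega f : P.R N) ∈ P.idl N := fun x hx => by
  refine ⟨fun y hy => ?_, fun y hy => ?_⟩
  · rw [← mul_assoc, hy.commute, mul_assoc, ev_omega_mul]
    exact (hx y hy).lmulW hf
  · rw [← mul_assoc, ev_mul_omega]
    exact (hx y hy).rmulW hf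

theorem scal_mem_idl {c : P.R N} (hc : LettersIn ∅ c) : c ∈ P.idl N := fun x hx => by
  have h : c * x ∈ P.nul N := fun y hy => by
    rw [← mul_assoc]
    exact hx _ (hy.mul hc)
  refine ⟨h, ?_⟩
  rwa [← hc.commute]

variable (P) in
/-- Congruence modulo `nul`. -/
def con (N : ℕ) : RingCon (P.idl N) where
  r a b := (a : P.R N) - b ∈ P.nul N
  iseqv :=
    { refl := fun a => by rw [sub_self]; exact zero_mem _
      symm := fun {a b} h => by rw [← neg_sub]; exact neg_mem h
      trans := fun {a b c} h h' => by
        rw [← sub_add_sub_cancel (a : P.R N) b c]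
        exact add_mem h h' }
  add' {a b c d} h h' := by
    have e : ((a + c : P.idl N) : P.R N) - ((b + d : P.idl N) : P.R N) =
        ((a : P.R N) - b) + ((c : P.R N) - d) := by
      push_cast
      abel
    rw [e]
    exact add_mem h h'
  mul' {a b c d} h h' := by
    have e : ((a * c : P.idl N) : P.R N) - ((b * d : P.idl N) : P.R N) =
        ((a : P.R N) - b) * c + b * ((c : P.R N) - d) := by
      push_cast
      noncomm_ring
    rw [e]
    exact add_mem (c.2 _ h).2 (b.2 _ h').1

variable (P) in
/-- The ring in which exchange relations are computed. -/
abbrev Q (N : ℕ) : Type := (P.con N).Quotient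

variable (P) in
/-- The projection. -/
def toQ (N : ℕ) : P.idl N →+* P.Q N := (P.con N).mk'

theorem toQ_eq_iff {a b : P.idl N} : P.toQ N a = P.toQ N b ↔ (a : P.R N) - b ∈ P.nul N :=
  RingCon.eq _

variable (P) in
/-- A current in `z`. -/
def qz (N : ℕ) : P.acts N →+* P.Q N :=
  (P.toQ N).comp ((zeta.comp (P.acts N).subtype).codRestrict (P.idl N) fun f => zeta_mem_idl f.2)

variable (P) in
/-- A current in `w`. -/
def qw (N : ℕ) : P.acts N →+* P.Q N :=
  (P.toQ N).comp ((omega.comp (P.acts N).subtype).codRestrict (P.idl N) fun f => omega_mem_idl f.2)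

/-- A structure function. -/
def qs (t : Fin N → ℤ) : P.LS →+* P.Q N :=
  (P.toQ N).comp ((sc t).codRestrict (P.idl N) fun f => scal_mem_idl (sc_scal t f))

theorem qs_commute (t : Fin N → ℤ) (γ : P.LS) (a : P.Q N) : qs t γ * a = a * qs t γ := by
  obtain ⟨c, rfl⟩ := RingCon.mk'_surjective (P.con N) a
  exact congrArg (P.toQ N) (Subtype.ext ((sc_scal t γ).commute (c : P.R N)))

end Datum

/-- Exchange of `a` and `b` with a structure function. -/
def Ex {A : Type*} [Ring A] (a b s : A) : Prop := a * b = s * (b * a)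

namespace Ex

variable {A : Type*} [Ring A] {a a' b b' c s s' t : A}

theorem mul_left (ht : ∀ x, t * x = x * t) (h : Ex a c s) (h' : Ex b c t) :
    Ex (a * b) c (s * t) := by
  unfold Ex at *
  rw [mul_assoc, h', ← mul_assoc, ← ht, mul_assoc, ← mul_assoc a, h]
  simp only [mul_assoc]
  rw [← mul_assoc t, ht, mul_assoc]

theorem mul_right (ht : ∀ x, t * x = x * t) (h : Ex a b s) (h' : Ex a c t) :
    Ex a (b * c) (s * t) := by
  unfold Ex at *
  rw [← mul_assoc, h, mul_assoc, mul_assoc, h', ← mul_assoc b, ← ht, mul_assoc, mul_assoc,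
    mul_assoc]

theorem inv_left (hs : ∀ x, s * x = x * s) (h1 : a * a' = 1) (h2 : a' * a = 1) (h3 : s' * s = 1)
    (h : Ex a b s) : Ex a' b s' := by
  unfold Ex at *
  have : a' * (a * b) * a' = a' * (s * (b * a)) * a' := by rw [h]
  rw [← mul_assoc, h2, one_mul, ← mul_assoc a', ← hs, mul_assoc, mul_assoc, mul_assoc,
    h1, mul_one] at this
  rw [this, ← mul_assoc, h3, one_mul]

theorem symm (h3 : s' * s = 1) (h : Ex a b s) : Ex b a s' := by
  unfold Ex at *
  rw [h, ← mul_assoc, h3, one_mul]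

theorem inv_right (hs : ∀ x, s * x = x * s) (hs' : ∀ x, s' * x = x * s') (h1 : b * b' = 1)
    (h2 : b' * b = 1) (h3 : s' * s = 1) (h : Ex a b s) : Ex a b' s' := by
  have h4 : s * s' = 1 := by rw [hs, h3]
  exact (inv_left hs' h1 h2 h4 (h.symm h3)).symm h3

theorem conj (h1 : a * a' = 1) : Ex a b s → a * b * a' = s * b := fun h => by
  rw [show a * b = s * (b * a) from h, mul_assoc, mul_assoc, h1, mul_one]

theorem of_conj (h2 : a' * a = 1) (h : a * b * a' = s * b) : Ex a b s := by
  rw [Ex, ← mul_assoc, ← h, mul_assoc, h2, mul_one]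

end Ex

namespace FA

variable {N k l : ℕ}

theorem map_lmul {Γ : Type} [AddCommGroup Γ] {Φ : FA k →A[ℂ] FA l} (hΦ : DegPres (toCLM Φ))
    (ψ : Multiplicative ℤ →* Multiplicative Γ) (f : FA k) (D : Γ → FA k) :
    (fun p => Φ (lmul (ψ.comp deg) f D p)) = lmul (ψ.comp deg) (Φ f) (fun p => Φ (D p)) := by
  funext p
  refine HasSum.unique ?_ (hasSum_lmul (ψ.comp deg) (Φ f) (fun p => Φ (D p)) p)
  have e : ∀ r, Xd (ψ.comp deg) (Φ f) r * Φ (D (p - r)) = Φ (Xd (ψ.comp deg) f r * D (p - r)) :=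
    fun r => by
    rw [map_mul]
    congr 1
    exact (hΦ.map_Xd ψ f r).symm
  simp only [e]
  exact (hasSum_lmul (ψ.comp deg) f D p).mapL (toCLM Φ)

theorem map_rmul {Γ : Type} [AddCommGroup Γ] {Φ : FA k →A[ℂ] FA l} (hΦ : DegPres (toCLM Φ))
    (ψ : Multiplicative ℤ →* Multiplicative Γ) (f : FA k) (D : Γ → FA k) :
    (fun p => Φ (rmul (ψ.comp deg) D f p)) = rmul (ψ.comp deg) (fun p => Φ (D p)) (Φ f) := by
  funext p
  refine HasSum.unique ?_ (hasSum_rmul (ψ.comp deg) (Φ f) (fun p => Φ (D p)) p)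
  have e : ∀ r, Φ (D r) * Xd (ψ.comp deg) (Φ f) (p - r) = Φ (D r * Xd (ψ.comp deg) f (p - r)) :=
    fun r => by
    rw [map_mul]
    congr 1
    exact (hΦ.map_Xd ψ f (p - r)).symm
  simp only [e]
  exact (hasSum_rmul (ψ.comp deg) f D p).mapL (toCLM Φ)

end FA

namespace Datum

variable {P : Datum} {N k l : ℕ}

theorem mapR_mul_hom {Φ : FA k →A[ℂ] FA l} (hΦ : FA.DegPres (FA.toCLM Φ)) (x y : P.R k) :
    mapR (FA.toCLM Φ) (x * y) = mapR (FA.toCLM Φ) x * mapR (FA.toCLM Φ) y :=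
  mapR_mul hΦ fun r s => map_mul Φ (ev x r) (ev y s)

theorem mapR_scal {A : FA k →L[ℂ] FA l} (hA : FA.DegPres A) (hA' : FA.ScalPres A) {x : P.R k}
    (hx : LettersIn ∅ x) : LettersIn ∅ (mapR A x) := lettersIn_of_ev fun p => by
  rw [ev_mapR hA]
  exact hA' _ (ev_lettersIn hx p)

theorem isScalarSeries_map {A : FA k →L[ℂ] FA l} (hA' : FA.ScalPres A) {I : Set ℝ} (hI : ∀ r ∈ I, 0 < r)
    {F : ℤ → FA k} (hF : IsScalarSeries I F) : IsScalarSeries I fun n => A (F n) := by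
  refine ⟨fun n w h i => hA' (F n) (fun w hw i _ => hF.1 n w hw i) w h i (by simp), fun w r hr => ?_⟩
  have h : Summable fun n : ℤ => ∑ m ∈ (FA.finite_support A w).toFinset,
      ‖F n m‖ * r ^ n * ‖A (FA.mono m) w‖ :=
    summable_sum fun m _ => (hF.2 m r hr).mul_right _
  refine Summable.of_norm_bounded h fun n => ?_
  have hr' : 0 ≤ r ^ n := (zpow_pos (hI r hr) n).le
  rw [Real.norm_of_nonneg (mul_nonneg (norm_nonneg _) hr')]
  change ‖A (F n) w‖ * r ^ n ≤ _
  rw [FA.apply_eq_sum]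
  refine (mul_le_mul_of_nonneg_right (norm_sum_le _ _) hr').trans ?_
  rw [Finset.sum_mul]
  refine Finset.sum_le_sum fun m _ => ?_
  rw [norm_mul]
  exact le_of_eq (by ring)

theorem map_qPow {A : FA k →L[ℂ] FA l} (h1 : A 1 = 1)
    (hmul : ∀ f g : FA k, LettersIn ∅ f → A (f * g) = A f * A g) (M : Fin k → Fin l → ℤ)
    (h : ∀ i, A (FA.cc i) = ∑ j, (M i j : ℂ) • FA.cc j) (t : Fin k → ℤ) :
    A (P.qPow t) = P.qPow (∑ i, t i • M i) := by
  refine FA.map_cexp h1 hmul _ _ ?_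
  simp only [map_sum, map_smul, h, Finset.smul_sum, smul_smul]
  rw [Finset.sum_comm]
  refine Finset.sum_congr rfl fun j _ => ?_
  rw [← Finset.sum_smul]
  congr 1
  simp only [Finset.sum_apply, Pi.smul_apply, smul_eq_mul]
  push_cast
  rw [Finset.mul_sum]
  exact Finset.sum_congr rfl fun i _ => by ring

theorem hom_qPow {Φ : FA k →A[ℂ] FA l} {M : Fin k → Fin l → ℤ}
    (h : ∀ i, Φ (FA.cc i) = ∑ j, (M i j : ℂ) • FA.cc j) (t : Fin k → ℤ) :
    Φ (P.qPow t) = P.qPow (∑ i, t i • M i) :=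
  map_qPow (A := FA.toCLM Φ) (map_one Φ) (fun f g _ => map_mul Φ f g) M h t

theorem hom_scale {Φ : FA k →A[ℂ] FA l} (hΦ : FA.DegPres (FA.toCLM Φ)) {M : Fin k → Fin l → ℤ}
    (h : ∀ i, Φ (FA.cc i) = ∑ j, (M i j : ℂ) • FA.cc j) (s : Fin k → ℤ) (f : FA k) :
    Φ (P.scale s f) = P.scale (∑ i, s i • M i) (Φ f) := by
  apply Xd_injective deg
  funext r
  have e : ∀ g : FA k, Xd deg (Φ g) r = Φ (Xd deg g r) := fun g => (hΦ.map_comp g r).symm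
  rw [e, P.Xd_scale, P.Xd_scale, map_mul, hom_qPow h, e, Finset.smul_sum]
  simp only [Pi.smul_apply, smul_eq_mul, mul_smul]

/-! ### Relations in terms of series -/

theorem curZ_fin_one (s : Fin 1 → ℤ) (f : FA 1) : P.curZ 0 s (Xd deg f) = Xd degZ (P.scale s f) := by
  rw [P.curZ_Xd, cu, FA.slot_fin_one]

theorem curW_fin_one (s : Fin 1 → ℤ) (f : FA 1) : P.curW 0 s (Xd deg f) = Xd degW (P.scale s f) := by
  rw [P.curW_Xd, cu, FA.slot_fin_one]

theorem curZ_eq_ev (f : FA 1) : P.curZ 0 0 (Xd deg f) = ev (zeta f : P.R 1) := by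
  rw [curZ_fin_one, P.scale_zero, ev_zeta]

theorem curW_eq_ev (f : FA 1) : P.curW 0 0 (Xd deg f) = ev (omega f : P.R 1) := by
  rw [curW_fin_one, P.scale_zero, ev_omega]

open FA in
/-- The exchange relations, as series. -/
inductive ExchangeSer : P.R 1 → Prop
  | phi_phi : ExchangeSer (zeta phiT * omega phiT - omega phiT * zeta phiT)
  | psi_psi : ExchangeSer (zeta psiT * omega psiT - omega psiT * zeta psiT)
  | phi_psi : ExchangeSer (zeta phiT * omega psiT * zeta phiIT * omega psiIT -
      sc ![-2] P.gS * sc ![2] P.giS)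
  | phi_xp : ExchangeSer (zeta phiT * omega xpT * zeta phiIT - sc ![-1] P.gS * omega xpT)
  | phi_xm : ExchangeSer (zeta phiT * omega xmT * zeta phiIT - sc ![1] P.giS * omega xmT)
  | psi_xp : ExchangeSer (omega psiT * zeta xpT * omega psiIT - sc ![-1] P.giS * zeta xpT)
  | psi_xm : ExchangeSer (omega psiT * zeta xmT * omega psiIT - sc ![1] P.gS * zeta xmT)

theorem ev_exchangeSer {r : P.R 1} (h : ExchangeSer r) : P.ExchangeRel (ev r) := by
  cases h with
  | phi_phi =>
    convert ExchangeRel.phi_phi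
    simp only [FA.phi_eq, curZ_eq_ev, curW_eq_ev, ← ev_mul, ← ev_sub]
  | psi_psi =>
    convert ExchangeRel.psi_psi
    simp only [FA.psi_eq, curZ_eq_ev, curW_eq_ev, ← ev_mul, ← ev_sub]
  | phi_psi =>
    convert ExchangeRel.phi_psi
    simp only [FA.phi_eq, FA.psi_eq, FA.phiInv_eq, FA.psiInv_eq, curZ_eq_ev, curW_eq_ev, ← coef_gS,
      ← coef_giS, ← ev_sc, ← ev_mul, ← ev_sub]
  | phi_xp =>
    convert ExchangeRel.phi_xp
    simp only [FA.phi_eq, FA.xp_eq, FA.phiInv_eq, curZ_eq_ev, curW_eq_ev, ← coef_gS,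
      ← ev_sc, ← ev_mul, ← ev_sub]
  | phi_xm =>
    convert ExchangeRel.phi_xm
    simp only [FA.phi_eq, FA.xm_eq, FA.phiInv_eq, curZ_eq_ev, curW_eq_ev, ← coef_giS,
      ← ev_sc, ← ev_mul, ← ev_sub]
  | psi_xp =>
    convert ExchangeRel.psi_xp
    simp only [FA.psi_eq, FA.xp_eq, FA.psiInv_eq, curZ_eq_ev, curW_eq_ev, ← coef_giS,
      ← ev_sc, ← ev_mul, ← ev_sub]
  | psi_xm =>
    convert ExchangeRel.psi_xm
    simp only [FA.psi_eq, FA.xm_eq, FA.psiInv_eq, curZ_eq_ev, curW_eq_ev, ← coef_gS,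
      ← ev_sc, ← ev_mul, ← ev_sub]

theorem exists_exchangeSer {R : Dist 1} (h : P.ExchangeRel R) :
    ∃ r : P.R 1, ExchangeSer r ∧ ev r = R := by
  cases h with
  | phi_phi =>
    refine ⟨_, .phi_phi, ?_⟩
    simp only [FA.phi_eq, curZ_eq_ev, curW_eq_ev, ← ev_mul, ← ev_sub]
  | psi_psi =>
    refine ⟨_, .psi_psi, ?_⟩
    simp only [FA.psi_eq, curZ_eq_ev, curW_eq_ev, ← ev_mul, ← ev_sub]
  | phi_psi =>
    refine ⟨_, .phi_psi, ?_⟩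
    simp only [FA.phi_eq, FA.psi_eq, FA.phiInv_eq, FA.psiInv_eq, curZ_eq_ev, curW_eq_ev, ← coef_gS,
      ← coef_giS, ← ev_sc, ← ev_mul, ← ev_sub]
  | phi_xp =>
    refine ⟨_, .phi_xp, ?_⟩
    simp only [FA.phi_eq, FA.xp_eq, FA.phiInv_eq, curZ_eq_ev, curW_eq_ev, ← coef_gS,
      ← ev_sc, ← ev_mul, ← ev_sub]
  | phi_xm =>
    refine ⟨_, .phi_xm, ?_⟩
    simp only [FA.phi_eq, FA.xm_eq, FA.phiInv_eq, curZ_eq_ev, curW_eq_ev, ← coef_giS,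
      ← ev_sc, ← ev_mul, ← ev_sub]
  | psi_xp =>
    refine ⟨_, .psi_xp, ?_⟩
    simp only [FA.psi_eq, FA.xp_eq, FA.psiInv_eq, curZ_eq_ev, curW_eq_ev, ← coef_giS,
      ← ev_sc, ← ev_mul, ← ev_sub]
  | psi_xm =>
    refine ⟨_, .psi_xm, ?_⟩
    simp only [FA.psi_eq, FA.xm_eq, FA.psiInv_eq, curZ_eq_ev, curW_eq_ev, ← coef_gS,
      ← ev_sc, ← ev_mul, ← ev_sub]

/-- The relation of `x⁺` and `x⁻`, for given series. -/
def xpxm (m s t : Fin N → ℤ) (F G X Y : FA N) : Dist N :=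
  ev (zeta X * omega Y + omega Y * zeta X : P.R N) - (P.q - P.q⁻¹)⁻¹ •
    (rmul degW (P.fn (s - t + (-2 : ℤ) • m) fun _ => 1) (P.scale (t + m) G) -
      rmul degZ (P.fn (s - t + (2 : ℤ) • m) fun _ => 1) (P.scale (s + m) F))

/-- The quadratic relation of one current, for given series. -/
def quad (γ γ' : P.LS) (X : FA N) : P.R N :=
  sc 0 γ * (zeta X * omega X) + sc 0 γ' * (omega X * zeta X)

open FA in
/-- The remaining relations, in terms of series. -/
inductive OtherSer : Dist 1 → Prop
  | xp_xm : OtherSer (P.xpxm 1 0 0 phiT psiT xpT xmT)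
  | xp_xp : OtherSer (ev (quad P.GmS P.GpS xpT))
  | xm_xm : OtherSer (ev (quad P.GpS P.GmS xmT))

theorem fn_fin_one (n : ℤ) : (![n] : Fin 1 → ℤ) = 0 - 0 + n • 1 := by
  funext i
  simp [Subsingleton.elim i 0]

theorem otherSer {R : Dist 1} (h : P.OtherRel R) : P.OtherSer R := by
  cases h with
  | xp_xm =>
    convert OtherSer.xp_xm using 1
    rw [xpxm, FA.xp_eq, FA.xm_eq, FA.phi_eq, FA.psi_eq, curZ_eq_ev, curW_eq_ev, curZ_fin_one,
      curW_fin_one, conv_Xd_right, conv_Xd_right, ← ev_mul, ← ev_mul, ← ev_add, fn_fin_one,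
      fn_fin_one, fn_fin_one]
    simp
  | xp_xp =>
    convert OtherSer.xp_xp using 1
    rw [quad, ev_add, ev_mul (sc 0 _), ev_mul (sc 0 _), ev_sc, ev_sc, FA.xp_eq, curZ_eq_ev,
      curW_eq_ev, ← ev_mul, ← ev_mul]
    rfl
  | xm_xm =>
    convert OtherSer.xm_xm using 1
    rw [quad, ev_add, ev_mul (sc 0 _), ev_mul (sc 0 _), ev_sc, ev_sc, FA.xm_eq, curZ_eq_ev,
      curW_eq_ev, ← ev_mul, ← ev_mul]
    rfl

theorem otherRel {R : Dist 1} (h : P.OtherSer R) : P.OtherRel R := by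
  cases h with
  | xp_xm =>
    convert OtherRel.xp_xm using 1
    rw [xpxm, FA.xp_eq, FA.xm_eq, FA.phi_eq, FA.psi_eq, curZ_eq_ev, curW_eq_ev, curZ_fin_one,
      curW_fin_one, conv_Xd_right, conv_Xd_right, ← ev_mul, ← ev_mul, ← ev_add, fn_fin_one,
      fn_fin_one, fn_fin_one]
    simp
  | xp_xp =>
    convert OtherRel.xp_xp using 1
    rw [quad, ev_add, ev_mul (sc 0 _), ev_mul (sc 0 _), ev_sc, ev_sc, FA.xp_eq, curZ_eq_ev,
      curW_eq_ev, ← ev_mul, ← ev_mul]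
    rfl
  | xm_xm =>
    convert OtherRel.xm_xm using 1
    rw [quad, ev_add, ev_mul (sc 0 _), ev_mul (sc 0 _), ev_sc, ev_sc, FA.xm_eq, curZ_eq_ev,
      curW_eq_ev, ← ev_mul, ← ev_mul]
    rfl

theorem hom_fn {Φ : FA 1 →A[ℂ] FA l} {m : Fin l → ℤ}
    (hc : Φ (FA.cc 0) = ∑ j, (m j : ℂ) • FA.cc j) (t : Fin 1 → ℤ) (γ : ℤ → ℂ) :
    (fun p => Φ (P.fn t γ p)) = P.fn (t 0 • m) γ := by
  have h := hom_qPow (P := P) (Φ := Φ) (M := fun _ => m) (fun i => by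
    rw [Subsingleton.elim i 0]; exact hc)
  funext p
  rw [fn, fn]
  by_cases hp : p.1 + p.2 = 0
  · rw [ratio_of_eq hp, ratio_of_eq hp, map_smul, h]
    simp [mul_smul]
  · rw [ratio_of_ne hp, ratio_of_ne hp, map_zero]

theorem mapR_sc_one {Φ : FA 1 →A[ℂ] FA l} (hΦ : FA.DegPres (FA.toCLM Φ)) {m : Fin l → ℤ}
    (hc : Φ (FA.cc 0) = ∑ j, (m j : ℂ) • FA.cc j) (t : Fin 1 → ℤ) (γ : P.LS) :
    mapR (FA.toCLM Φ) (sc t γ : P.R 1) = sc (t 0 • m) γ := by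
  apply ev_injective
  funext p
  rw [ev_mapR hΦ, ev_sc, ev_sc, ← hom_fn hc, FA.toCLM_apply]

theorem hom_scale_one {Φ : FA 1 →A[ℂ] FA l} (hΦ : FA.DegPres (FA.toCLM Φ)) {m : Fin l → ℤ}
    (hc : Φ (FA.cc 0) = ∑ j, (m j : ℂ) • FA.cc j) (s : Fin 1 → ℤ) (f : FA 1) :
    Φ (P.scale s f) = P.scale (s 0 • m) (Φ f) := by
  rw [hom_scale (M := fun _ => m) hΦ (fun i => by rw [Subsingleton.elim i 0]; exact hc)]
  simp

theorem map_rmul_degW {Φ : FA k →A[ℂ] FA l} (hΦ : FA.DegPres (FA.toCLM Φ)) (f : FA k)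
    (D : Dist k) : (fun p => Φ (rmul degW D f p)) = rmul degW (fun p => Φ (D p)) (Φ f) :=
  FA.map_rmul hΦ _ f D

theorem map_rmul_degZ {Φ : FA k →A[ℂ] FA l} (hΦ : FA.DegPres (FA.toCLM Φ)) (f : FA k)
    (D : Dist k) : (fun p => Φ (rmul degZ D f p)) = rmul degZ (fun p => Φ (D p)) (Φ f) :=
  FA.map_rmul hΦ _ f D

theorem map_lmul_degZ {Φ : FA k →A[ℂ] FA l} (hΦ : FA.DegPres (FA.toCLM Φ)) (f : FA k)
    (D : Dist k) : (fun p => Φ (lmul degZ f D p)) = lmul degZ (Φ f) (fun p => Φ (D p)) :=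
  FA.map_lmul hΦ _ f D

theorem hom_xpxm {Φ : FA 1 →A[ℂ] FA l} (hΦ : FA.DegPres (FA.toCLM Φ)) {m : Fin l → ℤ}
    (hc : Φ (FA.cc 0) = ∑ j, (m j : ℂ) • FA.cc j) (F G X Y : FA 1) :
    (fun p => Φ (P.xpxm 1 0 0 F G X Y p)) = P.xpxm m 0 0 (Φ F) (Φ G) (Φ X) (Φ Y) := by
  have h1 := mapR_add hΦ (zeta X * omega Y : P.R 1) (omega Y * zeta X)
  rw [mapR_mul_hom hΦ, mapR_mul_hom hΦ, mapR_zeta hΦ, mapR_omega hΦ,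
    FA.toCLM_apply, FA.toCLM_apply] at h1
  have h2 := map_rmul_degW hΦ (P.scale 1 G) (P.fn ((-2 : ℤ) • 1) fun _ => 1)
  have h3 := map_rmul_degZ hΦ (P.scale 1 F) (P.fn ((2 : ℤ) • 1) fun _ => 1)
  rw [hom_fn hc, hom_scale_one hΦ hc] at h2 h3
  have e2 : (((-2 : ℤ) • 1 : Fin 1 → ℤ) 0) • m = (-2 : ℤ) • m := rfl
  have e3 : (((2 : ℤ) • 1 : Fin 1 → ℤ) 0) • m = (2 : ℤ) • m := rfl
  have e1 : ((1 : Fin 1 → ℤ) 0) • m = m := one_smul _ _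
  rw [e1, e2] at h2
  rw [e1, e3] at h3
  funext p
  simp only [xpxm, Pi.sub_apply, Pi.smul_apply, map_sub, map_smul, sub_self, zero_add]
  have h1' := congrFun (congrArg ev h1) p
  rw [ev_mapR hΦ, FA.toCLM_apply] at h1'
  rw [h1', ← congrFun h2 p, ← congrFun h3 p]

theorem hom_quad {Φ : FA 1 →A[ℂ] FA l} (hΦ : FA.DegPres (FA.toCLM Φ)) {m : Fin l → ℤ}
    (hc : Φ (FA.cc 0) = ∑ j, (m j : ℂ) • FA.cc j) (γ γ' : P.LS) (X : FA 1) :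
    mapR (FA.toCLM Φ) (quad γ γ' X) = quad γ γ' (Φ X) := by
  rw [quad, mapR_add hΦ, mapR_mul_hom hΦ, mapR_mul_hom hΦ, mapR_mul_hom hΦ, mapR_mul_hom hΦ,
    mapR_sc_one hΦ hc, mapR_sc_one hΦ hc, mapR_zeta hΦ, mapR_omega hΦ, quad]
  simp

theorem rescale_fn (s t u : Fin N → ℤ) (γ : ℤ → ℂ) :
    (fun p : ℤ × ℤ => P.qPow (p.1 • s + p.2 • t) * P.fn u γ p) = P.fn (s - t + u) γ := by
  funext p
  rw [fn, fn]
  by_cases hp : p.1 + p.2 = 0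
  · simp only [ratio_of_eq hp, mul_smul_comm, ← P.qPow_add]
    congr 2
    rw [show p.2 = -p.1 by omega, smul_add, smul_sub, neg_smul]
    abel
  · simp only [ratio_of_ne hp, mul_zero]

theorem rescale_rmul_degW (s t : Fin N → ℤ) (D : Dist N) (f : FA N) :
    (fun p : ℤ × ℤ => P.qPow (p.1 • s + p.2 • t) * rmul degW D f p) =
      rmul degW (fun p => P.qPow (p.1 • s + p.2 • t) * D p) (P.scale t f) := by
  funext p
  refine ((hasSum_rmul degW f D p).mul_left _).unique ?_
  have h := hasSum_rmul degW (P.scale t f) (fun p => P.qPow (p.1 • s + p.2 • t) * D p) p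
  have e : ∀ r, P.qPow (r.1 • s + r.2 • t) * D r * Xd degW (P.scale t f) (p - r) =
      P.qPow (p.1 • s + p.2 • t) * (D r * Xd degW f (p - r)) := fun r => by
    rw [Xd_degW_scale, qPow_mul_mul]
    by_cases hr : (p - r).1 = 0
    · congr 2
      rw [Prod.fst_sub, sub_eq_zero] at hr
      rw [hr, Prod.snd_sub, sub_smul]
      abel
    · rw [Xd_degW, if_neg hr, mul_zero, mul_zero, mul_zero]
  simpa only [e] using h

theorem rescale_rmul_degZ (s t : Fin N → ℤ) (D : Dist N) (f : FA N) :
    (fun p : ℤ × ℤ => P.qPow (p.1 • s + p.2 • t) * rmul degZ D f p) =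
      rmul degZ (fun p => P.qPow (p.1 • s + p.2 • t) * D p) (P.scale s f) := by
  funext p
  refine ((hasSum_rmul degZ f D p).mul_left _).unique ?_
  have h := hasSum_rmul degZ (P.scale s f) (fun p => P.qPow (p.1 • s + p.2 • t) * D p) p
  have e : ∀ r, P.qPow (r.1 • s + r.2 • t) * D r * Xd degZ (P.scale s f) (p - r) =
      P.qPow (p.1 • s + p.2 • t) * (D r * Xd degZ f (p - r)) := fun r => by
    rw [Xd_degZ_scale, qPow_mul_mul]
    by_cases hr : (p - r).2 = 0
    · congr 2
      rw [Prod.snd_sub, sub_eq_zero] at hr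
      rw [hr, Prod.fst_sub, sub_smul]
      abel
    · rw [Xd_degZ, if_neg hr, mul_zero, mul_zero, mul_zero]
  simpa only [e] using h

theorem rescale_xpxm (m s t : Fin N → ℤ) (F G X Y : FA N) :
    (fun p : ℤ × ℤ => P.qPow (p.1 • s + p.2 • t) * P.xpxm m 0 0 F G X Y p) =
      P.xpxm m s t F G (P.scale s X) (P.scale t Y) := by
  have h1 : theta s t (zeta X * omega Y + omega Y * zeta X : P.R N) =
      zeta (P.scale s X) * omega (P.scale t Y) + omega (P.scale t Y) * zeta (P.scale s X) := by
    rw [map_add, map_mul, map_mul, theta_zeta, theta_omega]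
  have h2 := rescale_rmul_degW (P := P) s t (P.fn (0 - 0 + (-2 : ℤ) • m) fun _ => 1)
    (P.scale (0 + m) G)
  have h3 := rescale_rmul_degZ (P := P) s t (P.fn (0 - 0 + (2 : ℤ) • m) fun _ => 1)
    (P.scale (0 + m) F)
  rw [rescale_fn, P.scale_scale, sub_self, zero_add, zero_add] at h2 h3
  rw [xpxm, xpxm, ← h1, ev_theta, ← h2, ← h3, sub_self, zero_add, zero_add, zero_add]
  funext p
  simp only [Pi.sub_apply, Pi.smul_apply, mul_sub, mul_smul_comm]

end Datum

namespace Datum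

variable {P : Datum} {N k l : ℕ}

/-! ### Exchange relations in one slot -/

/-- A current in `z`, as a series. -/
def zc (f : P.acts N) : P.idl N := ⟨zeta (f : FA N), zeta_mem_idl f.2⟩

/-- A current in `w`, as a series. -/
def wc (f : P.acts N) : P.idl N := ⟨omega (f : FA N), omega_mem_idl f.2⟩

/-- A structure function, as a series. -/
def tc (t : Fin N → ℤ) (γ : P.LS) : P.idl N := ⟨sc t γ, scal_mem_idl (sc_scal t γ)⟩

theorem qz_eq (f : P.acts N) : P.qz N f = P.toQ N (zc f) := rfl

theorem qw_eq (f : P.acts N) : P.qw N f = P.toQ N (wc f) := rfl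

theorem qs_eq (t : Fin N → ℤ) (γ : P.LS) : qs t γ = P.toQ N (tc t γ) := rfl

/-- `q^{c_i/2}` as a shift. -/
abbrev sh (i : Fin N) : Fin N → ℤ := Pi.single i 1

theorem slotHom_cc (i : Fin N) :
    FA.slotHom i (FA.cc 0) = ∑ j, ((sh i j : ℤ) : ℂ) • FA.cc j := by
  rw [FA.slotHom_apply, FA.slot_cc, Finset.sum_eq_single i]
  · simp [sh]
  · intro j _ hj
    simp [sh, hj]
  · simp

/-- The current `φ` in the slot `i`, shifted. -/
def cphi (i : Fin N) (s : Fin N → ℤ) : P.acts N := ⟨P.cu i s FA.phiT, cu_mem_acts i s .phi⟩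

/-- The current `φ⁻¹` in the slot `i`, shifted. -/
def cphiI (i : Fin N) (s : Fin N → ℤ) : P.acts N := ⟨P.cu i s FA.phiIT, cu_mem_acts i s .phiInv⟩

/-- The current `ψ` in the slot `i`, shifted. -/
def cpsi (i : Fin N) (s : Fin N → ℤ) : P.acts N := ⟨P.cu i s FA.psiT, cu_mem_acts i s .psi⟩

/-- The current `ψ⁻¹` in the slot `i`, shifted. -/
def cpsiI (i : Fin N) (s : Fin N → ℤ) : P.acts N := ⟨P.cu i s FA.psiIT, cu_mem_acts i s .psiInv⟩

/-- The current `x⁺` in the slot `i`, shifted. -/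
def cxp (i : Fin N) (s : Fin N → ℤ) : P.acts N := ⟨P.cu i s FA.xpT, cu_mem_acts i s .xp⟩

/-- The current `x⁻` in the slot `i`, shifted. -/
def cxm (i : Fin N) (s : Fin N → ℤ) : P.acts N := ⟨P.cu i s FA.xmT, cu_mem_acts i s .xm⟩

theorem cphi_mul_cphiI (i : Fin N) (s : Fin N → ℤ) : cphi i s * cphiI i s = (1 : P.acts N) :=
  Subtype.ext (by
    change P.cu i s FA.phiT * P.cu i s FA.phiIT = 1
    rw [← P.cu_mul, FA.phiT_mul_phiIT, P.cu_one])

theorem cphiI_mul_cphi (i : Fin N) (s : Fin N → ℤ) : cphiI i s * cphi i s = (1 : P.acts N) :=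
  Subtype.ext (by
    change P.cu i s FA.phiIT * P.cu i s FA.phiT = 1
    rw [← P.cu_mul, FA.phiIT_mul_phiT, P.cu_one])

theorem cpsi_mul_cpsiI (i : Fin N) (s : Fin N → ℤ) : cpsi i s * cpsiI i s = (1 : P.acts N) :=
  Subtype.ext (by
    change P.cu i s FA.psiT * P.cu i s FA.psiIT = 1
    rw [← P.cu_mul, FA.psiT_mul_psiIT, P.cu_one])

theorem cpsiI_mul_cpsi (i : Fin N) (s : Fin N → ℤ) : cpsiI i s * cpsi i s = (1 : P.acts N) :=
  Subtype.ext (by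
    change P.cu i s FA.psiIT * P.cu i s FA.psiT = 1
    rw [← P.cu_mul, FA.psiIT_mul_psiT, P.cu_one])

theorem slot_mem_nul (i : Fin N) {r : P.R 1} (hr : ExchangeSer r) (s t : Fin N → ℤ) :
    theta s t (mapR (FA.toCLM (FA.slotHom i)) r) ∈ P.nul N := by
  refine theta_mem_nul (fun y hy => .inl ?_) s t
  rw [ev_mul, ev_of_scal hy]
  have e : ev (mapR (FA.toCLM (FA.slotHom i)) r) = fun p => FA.slot i (ev r p) :=
    funext fun p => ev_mapR (slotHom_degPres i) r p
  rw [e]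
  exact .exchange i _ (ev_exchangeSer hr) _ (coeffs_isScalarSeries hy)

theorem slot_phi_phi (i : Fin N) (s t : Fin N → ℤ) :
    Ex (P.qz N (cphi i s)) (P.qw N (cphi i t)) 1 := by
  have h := slot_mem_nul i (ExchangeSer.phi_phi (P := P)) s t
  have hd := slotHom_degPres i
  rw [mapR_sub hd, mapR_mul_hom hd, mapR_mul_hom hd, mapR_zeta hd, mapR_omega hd, map_sub, map_mul,
    map_mul, theta_zeta, theta_omega] at h
  rw [Ex, one_mul]
  exact (toQ_eq_iff (a := zc (cphi i s) * wc (cphi i t)) (b := wc (cphi i t) * zc (cphi i s))).2 h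

theorem slot_psi_psi (i : Fin N) (s t : Fin N → ℤ) :
    Ex (P.qz N (cpsi i s)) (P.qw N (cpsi i t)) 1 := by
  have h := slot_mem_nul i (ExchangeSer.psi_psi (P := P)) s t
  have hd := slotHom_degPres i
  rw [mapR_sub hd, mapR_mul_hom hd, mapR_mul_hom hd, mapR_zeta hd, mapR_omega hd, map_sub, map_mul,
    map_mul, theta_zeta, theta_omega] at h
  rw [Ex, one_mul]
  exact (toQ_eq_iff (a := zc (cpsi i s) * wc (cpsi i t)) (b := wc (cpsi i t) * zc (cpsi i s))).2 h

theorem slot_phi_psi (i : Fin N) (s t : Fin N → ℤ) :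
    Ex (P.qz N (cphi i s)) (P.qw N (cpsi i t))
      (qs (s - t + (-2 : ℤ) • sh i) P.gS * qs (s - t + (2 : ℤ) • sh i) P.giS) := by
  have h := slot_mem_nul i (ExchangeSer.phi_psi (P := P)) s t
  have hd := slotHom_degPres i
  rw [mapR_sub hd, mapR_mul_hom hd, mapR_mul_hom hd, mapR_mul_hom hd, mapR_mul_hom hd,
    mapR_zeta hd, mapR_omega hd, mapR_zeta hd, mapR_omega hd, mapR_sc_one hd (slotHom_cc i),
    mapR_sc_one hd (slotHom_cc i), map_sub, map_mul, map_mul, map_mul, map_mul, theta_zeta,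
    theta_omega, theta_zeta, theta_omega, theta_sc, theta_sc] at h
  have h1 : P.qz N (cphi i s) * P.qw N (cpsi i t) * P.qz N (cphiI i s) * P.qw N (cpsiI i t) =
      qs (s - t + (-2 : ℤ) • sh i) P.gS * qs (s - t + (2 : ℤ) • sh i) P.giS :=
    (toQ_eq_iff (a := zc (cphi i s) * wc (cpsi i t) * zc (cphiI i s) * wc (cpsiI i t))
      (b := tc (s - t + (-2 : ℤ) • sh i) P.gS * tc (s - t + (2 : ℤ) • sh i) P.giS)).2 h
  refine Ex.of_conj (a' := P.qz N (cphiI i s)) (by rw [← map_mul, cphiI_mul_cphi, map_one]) ?_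
  have h2 : P.qw N (cpsiI i t) * P.qw N (cpsi i t) = 1 := by
    rw [← map_mul, cpsiI_mul_cpsi, map_one]
  rw [← h1, mul_assoc (P.qz N (cphi i s) * _ * _), h2, mul_one]

theorem slot_phi_xp (i : Fin N) (s t : Fin N → ℤ) :
    Ex (P.qz N (cphi i s)) (P.qw N (cxp i t)) (qs (s - t + (-1 : ℤ) • sh i) P.gS) := by
  have h := slot_mem_nul i (ExchangeSer.phi_xp (P := P)) s t
  have hd := slotHom_degPres i
  rw [mapR_sub hd, mapR_mul_hom hd, mapR_mul_hom hd, mapR_mul_hom hd,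
    mapR_zeta hd, mapR_omega hd, mapR_zeta hd, mapR_sc_one hd (slotHom_cc i),
    map_sub, map_mul, map_mul, map_mul, theta_zeta, theta_omega, theta_zeta, theta_sc] at h
  refine Ex.of_conj (a' := P.qz N (cphiI i s)) (by rw [← map_mul, cphiI_mul_cphi, map_one]) ?_
  exact (toQ_eq_iff (a := zc (cphi i s) * wc (cxp i t) * zc (cphiI i s))
      (b := tc (s - t + (-1 : ℤ) • sh i) P.gS * wc (cxp i t))).2 h

theorem slot_phi_xm (i : Fin N) (s t : Fin N → ℤ) :
    Ex (P.qz N (cphi i s)) (P.qw N (cxm i t)) (qs (s - t + (1 : ℤ) • sh i) P.giS) := by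
  have h := slot_mem_nul i (ExchangeSer.phi_xm (P := P)) s t
  have hd := slotHom_degPres i
  rw [mapR_sub hd, mapR_mul_hom hd, mapR_mul_hom hd, mapR_mul_hom hd,
    mapR_zeta hd, mapR_omega hd, mapR_zeta hd, mapR_sc_one hd (slotHom_cc i),
    map_sub, map_mul, map_mul, map_mul, theta_zeta, theta_omega, theta_zeta, theta_sc] at h
  refine Ex.of_conj (a' := P.qz N (cphiI i s)) (by rw [← map_mul, cphiI_mul_cphi, map_one]) ?_
  exact (toQ_eq_iff (a := zc (cphi i s) * wc (cxm i t) * zc (cphiI i s))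
      (b := tc (s - t + (1 : ℤ) • sh i) P.giS * wc (cxm i t))).2 h

theorem slot_psi_xp (i : Fin N) (s t : Fin N → ℤ) :
    Ex (P.qw N (cpsi i t)) (P.qz N (cxp i s)) (qs (s - t + (-1 : ℤ) • sh i) P.giS) := by
  have h := slot_mem_nul i (ExchangeSer.psi_xp (P := P)) s t
  have hd := slotHom_degPres i
  rw [mapR_sub hd, mapR_mul_hom hd, mapR_mul_hom hd, mapR_mul_hom hd,
    mapR_zeta hd, mapR_omega hd, mapR_omega hd, mapR_sc_one hd (slotHom_cc i),
    map_sub, map_mul, map_mul, map_mul, theta_omega, theta_zeta, theta_omega, theta_sc] at h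
  refine Ex.of_conj (a' := P.qw N (cpsiI i t)) (by rw [← map_mul, cpsiI_mul_cpsi, map_one]) ?_
  exact (toQ_eq_iff (a := wc (cpsi i t) * zc (cxp i s) * wc (cpsiI i t))
      (b := tc (s - t + (-1 : ℤ) • sh i) P.giS * zc (cxp i s))).2 h

theorem slot_psi_xm (i : Fin N) (s t : Fin N → ℤ) :
    Ex (P.qw N (cpsi i t)) (P.qz N (cxm i s)) (qs (s - t + (1 : ℤ) • sh i) P.gS) := by
  have h := slot_mem_nul i (ExchangeSer.psi_xm (P := P)) s t
  have hd := slotHom_degPres i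
  rw [mapR_sub hd, mapR_mul_hom hd, mapR_mul_hom hd, mapR_mul_hom hd,
    mapR_zeta hd, mapR_omega hd, mapR_omega hd, mapR_sc_one hd (slotHom_cc i),
    map_sub, map_mul, map_mul, map_mul, theta_omega, theta_zeta, theta_omega, theta_sc] at h
  refine Ex.of_conj (a' := P.qw N (cpsiI i t)) (by rw [← map_mul, cpsiI_mul_cpsi, map_one]) ?_
  exact (toQ_eq_iff (a := wc (cpsi i t) * zc (cxm i s) * wc (cpsiI i t))
      (b := tc (s - t + (1 : ℤ) • sh i) P.gS * zc (cxm i s))).2 h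

theorem slot_xpxm (i : Fin N) (s t : Fin N → ℤ) :
    P.Nl (P.xpxm (sh i) s t (FA.slot i FA.phiT) (FA.slot i FA.psiT) (P.cu i s FA.xpT)
      (P.cu i t FA.xmT)) := by
  have h : P.Nl _ := .inl (.other (P := P) i _ (otherRel .xp_xm))
  have e := hom_xpxm (P := P) (slotHom_degPres i) (slotHom_cc i) FA.phiT FA.psiT FA.xpT FA.xmT
  simp only [FA.slotHom_apply] at e
  rw [e] at h
  have h2 := h.rescale s t
  rwa [rescale_xpxm] at h2

theorem theta_quad (γ γ' : P.LS) (s : Fin N → ℤ) (X : FA N) :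
    theta s s (quad γ γ' X) = quad γ γ' (P.scale s X) := by
  rw [quad, map_add, map_mul, map_mul, map_mul, map_mul, theta_sc, theta_sc, theta_zeta,
    theta_omega, sub_self, zero_add, quad]

theorem nl_theta {x : P.R N} (h : P.Nl (ev x)) (s t : Fin N → ℤ) : P.Nl (ev (theta s t x)) := by
  rw [ev_theta]
  exact h.rescale s t

theorem slot_quad_xp (i : Fin N) (s : Fin N → ℤ) :
    P.Nl (ev (quad P.GmS P.GpS (P.cu i s FA.xpT))) := by
  have h : P.Nl _ := .inl (.other (P := P) i _ (otherRel .xp_xp))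
  have e := hom_quad (P := P) (slotHom_degPres i) (slotHom_cc i) P.GmS P.GpS FA.xpT
  have e' : (fun p => FA.slot i (ev (quad P.GmS P.GpS FA.xpT) p)) =
      ev (quad P.GmS P.GpS (FA.slot i FA.xpT)) := by
    rw [← FA.slotHom_apply, ← e]
    exact funext fun p => (ev_mapR (slotHom_degPres i) _ p).symm
  rw [e'] at h
  have h2 := nl_theta h s s
  rwa [theta_quad] at h2

theorem slot_quad_xm (i : Fin N) (s : Fin N → ℤ) :
    P.Nl (ev (quad P.GpS P.GmS (P.cu i s FA.xmT))) := by
  have h : P.Nl _ := .inl (.other (P := P) i _ (otherRel .xm_xm))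
  have e := hom_quad (P := P) (slotHom_degPres i) (slotHom_cc i) P.GpS P.GmS FA.xmT
  have e' : (fun p => FA.slot i (ev (quad P.GpS P.GmS FA.xmT) p)) =
      ev (quad P.GpS P.GmS (FA.slot i FA.xmT)) := by
    rw [← FA.slotHom_apply, ← e]
    exact funext fun p => (ev_mapR (slotHom_degPres i) _ p).symm
  rw [e'] at h
  have h2 := nl_theta h s s
  rwa [theta_quad] at h2

/-! ### Homomorphisms that respect the relations -/

/-- Images of the currents that satisfy the defining relations. -/
structure Good (m : Fin N → ℤ) (F FI G GI X Y : P.acts N) : Prop where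
  f_fi : F * FI = 1
  fi_f : FI * F = 1
  g_gi : G * GI = 1
  gi_g : GI * G = 1
  ff : Ex (P.qz N F) (P.qw N F) 1
  gg : Ex (P.qz N G) (P.qw N G) 1
  fg : Ex (P.qz N F) (P.qw N G) (qs ((-2 : ℤ) • m) P.gS * qs ((2 : ℤ) • m) P.giS)
  fx : Ex (P.qz N F) (P.qw N X) (qs ((-1 : ℤ) • m) P.gS)
  fy : Ex (P.qz N F) (P.qw N Y) (qs ((1 : ℤ) • m) P.giS)
  gx : Ex (P.qw N G) (P.qz N X) (qs ((-1 : ℤ) • m) P.giS)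
  gy : Ex (P.qw N G) (P.qz N Y) (qs ((1 : ℤ) • m) P.gS)
  xy : P.Nl (P.xpxm m 0 0 F G X Y)
  xx : P.Nl (ev (quad P.GmS P.GpS (X : FA N)))
  yy : P.Nl (ev (quad P.GpS P.GmS (Y : FA N)))

/-- Homomorphisms of the one-slot algebra that respect the relations. -/
structure IsGood (Ψ : FA 1 →A[ℂ] FA l) (m : Fin l → ℤ) : Prop where
  deg : FA.DegPres (FA.toCLM Ψ)
  c : Ψ (FA.cc 0) = ∑ j, (m j : ℂ) • FA.cc j
  acts : ∀ f d, FA.IsTotal f d → Ψ f ∈ P.acts l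
  exch : ∀ r : P.R 1, ExchangeSer r → mapR (FA.toCLM Ψ) r ∈ P.nul l
  other : ∀ R, P.OtherSer R → P.Nl fun p => Ψ (R p)

theorem IsGood.of_good {Ψ : FA 1 →A[ℂ] FA l} {m : Fin l → ℤ} (hd : FA.DegPres (FA.toCLM Ψ))
    (hc : Ψ (FA.cc 0) = ∑ j, (m j : ℂ) • FA.cc j) {F FI G GI X Y : P.acts l}
    (h : Good m F FI G GI X Y) (hF : Ψ FA.phiT = F) (hFI : Ψ FA.phiIT = FI) (hG : Ψ FA.psiT = G)
    (hGI : Ψ FA.psiIT = GI) (hX : Ψ FA.xpT = X) (hY : Ψ FA.xmT = Y) :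
    IsGood (P := P) Ψ m where
  deg := hd
  c := hc
  acts f d hf := by
    cases hf with
    | xp => exact hX ▸ X.2
    | xm => exact hY ▸ Y.2
    | phi => exact hF ▸ F.2
    | phiInv => exact hFI ▸ FI.2
    | psi => exact hG ▸ G.2
    | psiInv => exact hGI ▸ GI.2
  exch r hr := by
    have hF1 : P.qz l F * P.qz l FI = 1 := by rw [← map_mul, h.f_fi, map_one]
    have hG1 : P.qw l G * P.qw l GI = 1 := by rw [← map_mul, h.g_gi, map_one]
    cases hr with
    | phi_phi =>
      rw [mapR_sub hd, mapR_mul_hom hd, mapR_mul_hom hd, mapR_zeta hd, mapR_omega hd]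
      simp only [FA.toCLM_apply, hF]
      have h1 := h.ff
      rw [Ex, one_mul] at h1
      exact (toQ_eq_iff (a := zc F * wc F) (b := wc F * zc F)).1 h1
    | psi_psi =>
      rw [mapR_sub hd, mapR_mul_hom hd, mapR_mul_hom hd, mapR_zeta hd, mapR_omega hd]
      simp only [FA.toCLM_apply, hG]
      have h1 := h.gg
      rw [Ex, one_mul] at h1
      exact (toQ_eq_iff (a := zc G * wc G) (b := wc G * zc G)).1 h1
    | phi_psi =>
      rw [mapR_sub hd, mapR_mul_hom hd, mapR_mul_hom hd, mapR_mul_hom hd, mapR_mul_hom hd,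
        mapR_zeta hd, mapR_omega hd, mapR_zeta hd, mapR_omega hd, mapR_sc_one hd hc,
        mapR_sc_one hd hc]
      simp only [FA.toCLM_apply, hF, hG, hFI, hGI]
      have h1 := h.fg.conj hF1
      have h2 : P.qz l F * P.qw l G * P.qz l FI * P.qw l GI =
          qs ((-2 : ℤ) • m) P.gS * qs ((2 : ℤ) • m) P.giS := by
        rw [h1, mul_assoc, hG1, mul_one]
      exact (toQ_eq_iff (a := zc F * wc G * zc FI * wc GI)
        (b := tc ((-2 : ℤ) • m) P.gS * tc ((2 : ℤ) • m) P.giS)).1 h2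
    | phi_xp =>
      rw [mapR_sub hd, mapR_mul_hom hd, mapR_mul_hom hd, mapR_mul_hom hd,
        mapR_zeta hd, mapR_omega hd, mapR_zeta hd, mapR_sc_one hd hc]
      simp only [FA.toCLM_apply, hF, hX, hFI]
      exact (toQ_eq_iff (a := zc F * wc X * zc FI) (b := tc ((-1 : ℤ) • m) P.gS * wc X)).1
        (h.fx.conj hF1)
    | phi_xm =>
      rw [mapR_sub hd, mapR_mul_hom hd, mapR_mul_hom hd, mapR_mul_hom hd,
        mapR_zeta hd, mapR_omega hd, mapR_zeta hd, mapR_sc_one hd hc]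
      simp only [FA.toCLM_apply, hF, hY, hFI]
      exact (toQ_eq_iff (a := zc F * wc Y * zc FI) (b := tc ((1 : ℤ) • m) P.giS * wc Y)).1
        (h.fy.conj hF1)
    | psi_xp =>
      rw [mapR_sub hd, mapR_mul_hom hd, mapR_mul_hom hd, mapR_mul_hom hd,
        mapR_zeta hd, mapR_omega hd, mapR_omega hd, mapR_sc_one hd hc]
      simp only [FA.toCLM_apply, hG, hX, hGI]
      exact (toQ_eq_iff (a := wc G * zc X * wc GI) (b := tc ((-1 : ℤ) • m) P.giS * zc X)).1
        (h.gx.conj hG1)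
    | psi_xm =>
      rw [mapR_sub hd, mapR_mul_hom hd, mapR_mul_hom hd, mapR_mul_hom hd,
        mapR_zeta hd, mapR_omega hd, mapR_omega hd, mapR_sc_one hd hc]
      simp only [FA.toCLM_apply, hG, hY, hGI]
      exact (toQ_eq_iff (a := wc G * zc Y * wc GI) (b := tc ((1 : ℤ) • m) P.gS * zc Y)).1
        (h.gy.conj hG1)
  other R hR := by
    cases hR with
    | xp_xm =>
      rw [hom_xpxm hd hc, hF, hG, hX, hY]
      exact h.xy
    | xp_xp =>
      have e : (fun p => Ψ (ev (quad P.GmS P.GpS FA.xpT) p)) = ev (quad P.GmS P.GpS (X : FA l)) := by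
        rw [← hX, ← hom_quad hd hc]
        exact funext fun p => (ev_mapR hd _ p).symm
      rw [e]
      exact h.xx
    | xm_xm =>
      have e : (fun p => Ψ (ev (quad P.GpS P.GmS FA.xmT) p)) = ev (quad P.GpS P.GmS (Y : FA l)) := by
        rw [← hY, ← hom_quad hd hc]
        exact funext fun p => (ev_mapR hd _ p).symm
      rw [e]
      exact h.yy

theorem isGood_slot (i : Fin N) : IsGood (P := P) (FA.slotHom i) (sh i) where
  deg := slotHom_degPres i
  c := slotHom_cc i
  acts f d hf := by
    have := cu_mem_acts (P := P) i 0 hf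
    rwa [P.cu_zero] at this
  exch r hr := by
    have := slot_mem_nul i hr 0 0
    rwa [theta_zero] at this
  other R hR := .inl (.other i R (otherRel hR))

/-! ### Transport of relations -/

theorem nl_map {Φ : FA k →A[ℂ] FA l} (hd : FA.DegPres (FA.toCLM Φ))
    (hs : FA.ScalPres (FA.toCLM Φ)) {M : Fin k → Fin l → ℤ}
    (hg : ∀ i, IsGood (P := P) (Φ.comp (FA.slotHom i)) (M i)) {D : Dist k} (hD : P.Null k D) :
    P.Nl fun p => Φ (D p) := by
  have hc : ∀ i, Φ (FA.cc i) = ∑ j, (M i j : ℂ) • FA.cc j := fun i => by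
    rw [← (hg i).c, ← FA.slot_cc]
    rfl
  have hact : ∀ (i : Fin k) (s : Fin k → ℤ) {f : FA 1} {d : ZMod 2}, FA.IsTotal f d →
      Φ (P.cu i s f) ∈ P.acts l := fun i s f d hf => by
    rw [cu, hom_scale hd hc]
    exact scale_mem_acts ((hg i).acts f d hf) _
  induction hD with
  | exchange i R hR F hF =>
    obtain ⟨r, hr, rfl⟩ := exists_exchangeSer hR
    have h := (hg i).exch r hr (mapR (FA.toCLM Φ) (scalR F hF)) (mapR_scal hd hs (scalR_scal F hF))
    convert h using 1
    have e : mapR (FA.toCLM (Φ.comp (FA.slotHom i))) r =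
        mapR (FA.toCLM Φ) (mapR (FA.toCLM (FA.slotHom i)) r) := by
      apply ev_injective
      funext p
      rw [ev_mapR (hg i).deg, ev_mapR hd, ev_mapR (slotHom_degPres i)]
      rfl
    have e2 : (fun p => FA.slot i (ev r p)) = ev (mapR (FA.toCLM (FA.slotHom i)) r) :=
      funext fun p => (ev_mapR (slotHom_degPres i) r p).symm
    rw [e, ← mapR_mul_hom hd, e2, ← ev_scalR F hF, ← ev_mul]
    exact funext fun p => (ev_mapR hd _ p).symm
  | other i R hR => exact (hg i).other R (otherSer hR)
  | add D E _ _ hD hE =>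
    have := hD.add hE
    convert this using 1
    funext p
    simp only [Pi.add_apply, map_add]
  | swap D _ hD => exact hD.swap
  | rescale D _ s t hD =>
    have := hD.rescale (∑ i, s i • M i) (∑ i, t i • M i)
    convert this using 1
    funext p
    rw [map_mul, hom_qPow hc]
    congr 2
    simp only [Pi.add_apply, Pi.smul_apply, smul_eq_mul, add_smul, mul_smul,
      Finset.sum_add_distrib, Finset.smul_sum]
  | scalar D _ F hF hsum hD =>
    have e : ∀ r, ratio (fun n => Φ (F n)) r = Φ (ratio F r) := fun r => by
      by_cases hr : r.1 + r.2 = 0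
      · rw [ratio_of_eq hr, ratio_of_eq hr]
      · rw [ratio_of_ne hr, ratio_of_ne hr, map_zero]
    have h1 : ∀ p, HasSum (fun r => ratio (fun n => Φ (F n)) r * Φ (D (p - r)))
        (Φ (conv (ratio F) D p)) := fun p => by
      simp only [e, ← map_mul]
      exact (hsum p).hasSum.mapL (FA.toCLM Φ)
    have := hD.scalar (isScalarSeries_map hs (fun r hr => hr) hF) fun p => (h1 p).summable
    convert this using 1
    exact funext fun p => (h1 p).tsum_eq.symm
  | left D _ i s X hX hD =>
    obtain ⟨f, d, hf, rfl⟩ := FA.exists_isTotal hX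
    have := hD.lmulZ (hact i s hf)
    rw [P.curZ_Xd, conv_Xd_left]
    rwa [← map_lmul_degZ hd] at this
  | right D _ i s X hX hD =>
    obtain ⟨f, d, hf, rfl⟩ := FA.exists_isTotal hX
    have := hD.rmulZ (hact i s hf)
    rw [P.curZ_Xd, conv_Xd_right]
    rwa [← map_rmul_degZ hd] at this

theorem mem_relIdeal_of_nl {D : Dist N} (h : P.Nl D) (p : ℤ × ℤ) : D p ∈ P.relIdeal N := by
  rcases h with h | rfl
  · exact TwoSidedIdeal.subset_span ⟨D, h, p, rfl⟩
  · exact zero_mem _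

theorem map_mem_relIdeal {Φ : FA k →A[ℂ] FA l} (hd : FA.DegPres (FA.toCLM Φ))
    (hs : FA.ScalPres (FA.toCLM Φ)) {M : Fin k → Fin l → ℤ}
    (hg : ∀ i, IsGood (P := P) (Φ.comp (FA.slotHom i)) (M i)) {a : FA k} (ha : a ∈ P.relIdeal k) :
    Φ a ∈ P.relIdeal l := by
  have h : P.relIdeal k ≤ TwoSidedIdeal.comap (Φ : FA k →+* FA l) (P.relIdeal l) := by
    rw [relIdeal, TwoSidedIdeal.span_le]
    rintro _ ⟨D, hD, p, rfl⟩
    exact (TwoSidedIdeal.mem_comap _).2 (mem_relIdeal_of_nl (nl_map hd hs hg hD) p)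
  exact (TwoSidedIdeal.mem_comap _).1 (h ha)

end Datum

namespace Ex

variable {A : Type*} [Ring A] {a b c s t : A}

theorem congr (h : Ex a b s) (hst : s = t) : Ex a b t := hst ▸ h

theorem add_right (h : Ex a b s) (h' : Ex a c s) : Ex a (b + c) s := by
  unfold Ex at *
  rw [mul_add, h, h', ← mul_add, add_mul]

end Ex

section

variable {Γ : Type} [AddCommGroup Γ] {N : ℕ} (χ χ' : Mon N →* Multiplicative Γ)

theorem rmul_sub_left (f : FA N) (D E : Γ → FA N) :
    rmul χ (D - E) f = rmul χ D f - rmul χ E f := by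
  have := rmul_add_left χ f D ((-1 : ℂ) • E)
  rwa [rmul_smul_left, neg_one_smul, neg_one_smul, ← sub_eq_add_neg, ← sub_eq_add_neg] at this

theorem lmul_sub_right (f : FA N) (D E : Γ → FA N) :
    lmul χ f (D - E) = lmul χ f D - lmul χ f E := by
  have := lmul_add_right χ f D ((-1 : ℂ) • E)
  rwa [lmul_smul_right, neg_one_smul, neg_one_smul, ← sub_eq_add_neg, ← sub_eq_add_neg] at this

theorem lmul_rmul (f g : FA N) (D : Γ → FA N) :
    lmul χ f (rmul χ' D g) = rmul χ' (lmul χ f D) g := by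
  funext p
  ext w
  have h1 : rmul χ' (lmul χ f D) g p w = ∑ q ∈ factor w, ∑ r ∈ factor q.1,
      sgn r.1 r.2 * sgn r.1 q.2 * sgn r.2 q.2 * (f r.1 *
        D (p - Multiplicative.toAdd (χ r.1) - Multiplicative.toAdd (χ' q.2)) r.2 * g q.2) := by
    simp only [rmul, lmul, Finset.sum_mul, Finset.mul_sum]
    refine Finset.sum_congr rfl fun q _ => Finset.sum_congr rfl fun r hr => ?_
    rw [← mem_factor.1 hr, sgn_mul_left, sub_right_comm]
    ring
  have h2 : lmul χ f (rmul χ' D g) p w = ∑ q ∈ factor w, ∑ r ∈ factor q.2,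
      sgn q.1 r.1 * sgn q.1 r.2 * sgn r.1 r.2 * (f q.1 *
        D (p - Multiplicative.toAdd (χ q.1) - Multiplicative.toAdd (χ' r.2)) r.1 * g r.2) := by
    simp only [rmul, lmul, Finset.mul_sum]
    refine Finset.sum_congr rfl fun q _ => Finset.sum_congr rfl fun r hr => ?_
    rw [← mem_factor.1 hr, sgn_mul_right]
    ring
  rw [h1, h2]
  exact (sum_factor_assoc w fun a b c => sgn a b * sgn a c * sgn b c * (f a *
    D (p - Multiplicative.toAdd (χ a) - Multiplicative.toAdd (χ' c)) b * g c)).symm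

theorem rmul_eq_lmul_of_scal (f : FA N) (D : Γ → FA N) (hD : ∀ p, LettersIn ∅ (D p)) :
    rmul χ D f = lmul χ f D := by
  funext p
  have h1 := hasSum_rmul χ f D p
  refine h1.unique ?_
  rw [← (Equiv.subLeft p).hasSum_iff]
  have e : ∀ r, ((fun r => D r * Xd χ f (p - r)) ∘ (Equiv.subLeft p)) r =
      Xd χ f r * D (p - r) := fun r => by
    simp only [Function.comp_apply, Equiv.subLeft_apply, sub_sub_cancel]
    exact (hD _).commuteFA _
  rw [funext e]
  exact hasSum_lmul χ f D p

end

theorem conv_swap {N : ℕ} (D E : Dist N) :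
    (fun p : ℤ × ℤ => conv D E p.swap) =
      conv (fun p : ℤ × ℤ => D p.swap) (fun p : ℤ × ℤ => E p.swap) := by
  funext p
  exact ((Equiv.prodComm ℤ ℤ).tsum_eq fun r : ℤ × ℤ => D r * E (p.swap - r)).symm

namespace Datum

variable {P : Datum} {N k l : ℕ}

theorem fn_scal (t : Fin N → ℤ) (γ : ℤ → ℂ) (p : ℤ × ℤ) : LettersIn ∅ (P.fn t γ p) := by
  rw [fn]
  by_cases hp : p.1 + p.2 = 0
  · rw [ratio_of_eq hp]
    intro w hw
    exact P.qPow_scal _ w fun h => hw (by rw [FA.smul_apply, h, mul_zero])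
  · rw [ratio_of_ne hp]
    exact fun w hw => absurd rfl hw

/-! ### Currents of different slots -/

theorem cross_zw {i j : Fin N} (hij : i ≠ j) {f g : P.acts N} (hf : LettersIn {i} (f : FA N))
    (hg : LettersIn {j} (g : FA N)) (h : HasParity 0 (f : FA N)) :
    Ex (P.qz N f) (P.qw N g) 1 := by
  rw [Ex, one_mul]
  have hg' : LettersIn {i}ᶜ (g : FA N) := hg.mono (by simpa using hij)
  exact congrArg (P.toQ N) (Subtype.ext (a1 := zc f * wc g) (a2 := wc g * zc f)
    (Ser.mul_comm_of_even {i} (zeta_lettersIn hf) (omega_lettersIn hg') (zeta_hasParity h)))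

theorem cross_wz {i j : Fin N} (hij : i ≠ j) {f g : P.acts N} (hf : LettersIn {i} (f : FA N))
    (hg : LettersIn {j} (g : FA N)) (h : HasParity 0 (f : FA N)) :
    Ex (P.qw N f) (P.qz N g) 1 := by
  rw [Ex, one_mul]
  have hg' : LettersIn {i}ᶜ (g : FA N) := hg.mono (by simpa using hij)
  exact congrArg (P.toQ N) (Subtype.ext (a1 := wc f * zc g) (a2 := zc g * wc f)
    (Ser.mul_comm_of_even {i} (omega_lettersIn hf) (zeta_lettersIn hg') (omega_hasParity h)))

theorem cross_odd {i j : Fin N} (hij : i ≠ j) {f g : P.acts N} (hf : LettersIn {i} (f : FA N))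
    (hg : LettersIn {j} (g : FA N)) (h : HasParity 1 (f : FA N)) (h' : HasParity 1 (g : FA N)) :
    Ex (P.qz N f) (P.qw N g) (-1) := by
  rw [Ex, neg_one_mul]
  have hg' : LettersIn {i}ᶜ (g : FA N) := hg.mono (by simpa using hij)
  exact congrArg (P.toQ N) (Subtype.ext (a1 := zc f * wc g) (a2 := -(wc g * zc f))
    (Ser.mul_anticomm_of_odd {i} (zeta_lettersIn hf) (omega_lettersIn hg') (zeta_hasParity h)
      (omega_hasParity h')))

theorem qs_g_mul_gi (t : Fin N → ℤ) : qs t P.gS * qs t P.giS = 1 := by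
  rw [← map_mul, P.gS_mul_giS, map_one]

theorem qs_gi_mul_g (t : Fin N → ℤ) : qs t P.giS * qs t P.gS = 1 := by
  rw [qs_commute, qs_g_mul_gi]

theorem mul_commute_of {a b : P.Q N} (ha : ∀ x, a * x = x * a) (hb : ∀ x, b * x = x * b)
    (x : P.Q N) : a * b * x = x * (a * b) := by
  rw [mul_assoc, hb, ← mul_assoc, ha, mul_assoc]

theorem one_commute (x : P.Q N) : 1 * x = x * 1 := by rw [one_mul, mul_one]

theorem neg_one_commute (x : P.Q N) : -1 * x = x * -1 := by simp

/-- The series of `γ` is the series of `γ'(1/u)`. -/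
def IsSwap (γ γ' : P.LS) : Prop := ∀ k, γ.coef (-k) = γ'.coef k

theorem isSwap_Gm : IsSwap P.GmS P.GmInvS := fun _ => rfl

theorem isSwap_Gp : IsSwap P.GpS P.GpInvS := fun _ => rfl

theorem ev_zeta_swap (f : FA N) : (fun p => ev (zeta f : P.R N) p.swap) = ev (omega f : P.R N) := by
  funext p
  rw [ev_zeta, ev_omega, Xd_degZ, Xd_degW]
  rfl

theorem ev_omega_swap (f : FA N) :
    (fun p => ev (omega f : P.R N) p.swap) = ev (zeta f : P.R N) := by
  funext p
  rw [ev_zeta, ev_omega, Xd_degZ, Xd_degW]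
  rfl

theorem ev_sc_swap {γ γ' : P.LS} (h : IsSwap γ γ') :
    (fun p => ev (sc 0 γ : P.R N) p.swap) = ev (sc 0 γ' : P.R N) := by
  funext p
  rw [ev_sc, ev_sc, fn, fn]
  by_cases hp : p.1 + p.2 = 0
  · have hp' : p.swap.1 + p.swap.2 = 0 := by
      rw [Prod.fst_swap, Prod.snd_swap, add_comm, hp]
    rw [ratio_of_eq hp, ratio_of_eq hp', Prod.fst_swap, ← h, show p.2 = -p.1 by omega, smul_zero,
      smul_zero]
  · have hp' : p.swap.1 + p.swap.2 ≠ 0 := by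
      rwa [Prod.fst_swap, Prod.snd_swap, add_comm]
    rw [ratio_of_ne hp, ratio_of_ne hp']

theorem ev_cross_swap {γ γ' δ δ' : P.LS} (h : IsSwap γ δ) (h' : IsSwap γ' δ') (A B : FA N) :
    (fun p => ev (sc 0 γ * (zeta A * omega B) + sc 0 γ' * (omega B * zeta A) : P.R N) p.swap) =
      ev (sc 0 δ * (omega A * zeta B) + sc 0 δ' * (zeta B * omega A) : P.R N) := by
  simp only [ev_add, ev_mul, Pi.add_apply]
  rw [← ev_sc_swap h, ← ev_sc_swap h', ← ev_zeta_swap A, ← ev_omega_swap B, ← conv_swap,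
    ← conv_swap, ← conv_swap, ← conv_swap]
  rfl

theorem quad_add {γ γ' δ δ' : P.LS} (h : IsSwap γ δ) (h' : IsSwap γ' δ') {A B : P.acts N}
    (hA : P.Nl (ev (quad γ γ' (A : FA N)))) (hB : P.Nl (ev (quad γ γ' (B : FA N))))
    (h1 : qs 0 γ * (P.qz N B * P.qw N A) + qs 0 γ' * (P.qw N A * P.qz N B) = 0)
    (h2 : qs 0 δ * (P.qw N A * P.qz N B) + qs 0 δ' * (P.qz N B * P.qw N A) = 0) :
    P.Nl (ev (quad γ γ' ((A + B : P.acts N) : FA N))) := by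
  have h3 : P.Nl (ev (sc 0 γ * (zeta (B : FA N) * omega (A : FA N)) +
      sc 0 γ' * (omega (A : FA N) * zeta (B : FA N)) : P.R N)) := by
    refine nl_of_mem_nul ?_
    rw [← map_zero (P.toQ N)] at h1
    have := (toQ_eq_iff (a := tc 0 γ * (zc B * wc A) + tc 0 γ' * (wc A * zc B)) (b := 0)).1 h1
    rwa [ZeroMemClass.coe_zero, sub_zero] at this
  have h4 : P.Nl (ev (sc 0 δ * (omega (A : FA N) * zeta (B : FA N)) +
      sc 0 δ' * (zeta (B : FA N) * omega (A : FA N)) : P.R N)) := by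
    refine nl_of_mem_nul ?_
    rw [← map_zero (P.toQ N)] at h2
    have := (toQ_eq_iff (a := tc 0 δ * (wc A * zc B) + tc 0 δ' * (zc B * wc A)) (b := 0)).1 h2
    rwa [ZeroMemClass.coe_zero, sub_zero] at this
  rw [← ev_cross_swap h h'] at h4
  have h5 := h4.swap
  simp only [Prod.swap_swap] at h5
  have h6 := ((hA.add hB).add h3).add h5
  convert h6 using 1
  have e : (fun p => ev (sc 0 γ * (zeta (A : FA N) * omega (B : FA N)) +
      sc 0 γ' * (omega (B : FA N) * zeta (A : FA N)) : P.R N) p) =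
      ev (sc 0 γ * (zeta (A : FA N) * omega (B : FA N)) +
      sc 0 γ' * (omega (B : FA N) * zeta (A : FA N)) : P.R N) := rfl
  rw [e, ← ev_add, ← ev_add, ← ev_add]
  congr 1
  simp only [quad, Subring.coe_add, map_add]
  noncomm_ring

theorem nl_of_toQ {a b : P.idl N} (h : P.toQ N a = P.toQ N b) (hb : P.Nl (ev (b : P.R N))) :
    P.Nl (ev (a : P.R N)) := by
  have := (nl_of_mem_nul (toQ_eq_iff.1 h)).add hb
  rwa [← ev_add, sub_add_cancel] at this

end Datum

namespace Datum

variable {P : Datum} {N : ℕ} {i j : Fin N}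

theorem cphi_in (i : Fin N) (s : Fin N → ℤ) : LettersIn {i} ((cphi i s : P.acts N) : FA N) :=
  P.cu_lettersIn i s _

theorem cpsi_in (i : Fin N) (s : Fin N → ℤ) : LettersIn {i} ((cpsi i s : P.acts N) : FA N) :=
  P.cu_lettersIn i s _

theorem cxp_in (i : Fin N) (s : Fin N → ℤ) : LettersIn {i} ((cxp i s : P.acts N) : FA N) :=
  P.cu_lettersIn i s _

theorem cxm_in (i : Fin N) (s : Fin N → ℤ) : LettersIn {i} ((cxm i s : P.acts N) : FA N) :=
  P.cu_lettersIn i s _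

theorem cphi_even (i : Fin N) (s : Fin N → ℤ) : HasParity 0 ((cphi i s : P.acts N) : FA N) :=
  P.cu_hasParity i s FA.IsTotal.phi.hasParity

theorem cpsi_even (i : Fin N) (s : Fin N → ℤ) : HasParity 0 ((cpsi i s : P.acts N) : FA N) :=
  P.cu_hasParity i s FA.IsTotal.psi.hasParity

theorem cxp_odd (i : Fin N) (s : Fin N → ℤ) : HasParity 1 ((cxp i s : P.acts N) : FA N) :=
  P.cu_hasParity i s FA.IsTotal.xp.hasParity

theorem cxm_odd (i : Fin N) (s : Fin N → ℤ) : HasParity 1 ((cxm i s : P.acts N) : FA N) :=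
  P.cu_hasParity i s FA.IsTotal.xm.hasParity

/-! ### The relations for the coproduct -/

variable (P) in
/-- `Δ(φ)` in the slots `i`, `j`. -/
def dphi (i j : Fin N) : P.acts N := cphi i (-sh j) * cphi j (sh i)

variable (P) in
/-- `Δ(φ)⁻¹` in the slots `i`, `j`. -/
def dphiI (i j : Fin N) : P.acts N := cphiI j (sh i) * cphiI i (-sh j)

variable (P) in
/-- `Δ(ψ)` in the slots `i`, `j`. -/
def dpsi (i j : Fin N) : P.acts N := cpsi i (sh j) * cpsi j (-sh i)

variable (P) in
/-- `Δ(ψ)⁻¹` in the slots `i`, `j`. -/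
def dpsiI (i j : Fin N) : P.acts N := cpsiI j (-sh i) * cpsiI i (sh j)

variable (P) in
/-- `Δ(x⁺)` in the slots `i`, `j`. -/
def dxp (i j : Fin N) : P.acts N := cxp i 0 + cphi i (sh i) * cxp j ((2 : ℤ) • sh i)

variable (P) in
/-- `Δ(x⁻)` in the slots `i`, `j`. -/
def dxm (i j : Fin N) : P.acts N := cxm i ((2 : ℤ) • sh j) * cpsi j (sh j) + cxm j 0

theorem mul_cancel_mid {A : Type*} [Monoid A] {a a' b b' : A} (h : a * a' = 1) (h' : b * b' = 1) :
    a * b * (b' * a') = 1 := by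
  rw [mul_assoc, ← mul_assoc b, h', one_mul, h]

theorem delta_ff (hij : i ≠ j) : Ex (P.qz N (P.dphi i j)) (P.qw N (P.dphi i j)) 1 := by
  rw [dphi, map_mul, map_mul]
  refine (Ex.mul_left (mul_commute_of one_commute one_commute)
    (Ex.mul_right one_commute (slot_phi_phi i _ _) (cross_zw hij (cphi_in i _) (cphi_in j _) (cphi_even i _)))
    (Ex.mul_right one_commute (cross_zw hij.symm (cphi_in j _) (cphi_in i _) (cphi_even j _))
      (slot_phi_phi j _ _))).congr ?_
  simp

theorem delta_gg (hij : i ≠ j) : Ex (P.qz N (P.dpsi i j)) (P.qw N (P.dpsi i j)) 1 := by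
  rw [dpsi, map_mul, map_mul]
  refine (Ex.mul_left (mul_commute_of one_commute one_commute)
    (Ex.mul_right one_commute (slot_psi_psi i _ _) (cross_zw hij (cpsi_in i _) (cpsi_in j _) (cpsi_even i _)))
    (Ex.mul_right one_commute (cross_zw hij.symm (cpsi_in j _) (cpsi_in i _) (cpsi_even j _))
      (slot_psi_psi j _ _))).congr ?_
  simp

theorem delta_fg (hij : i ≠ j) : Ex (P.qz N (P.dphi i j)) (P.qw N (P.dpsi i j))
    (qs ((-2 : ℤ) • (sh i + sh j)) P.gS * qs ((2 : ℤ) • (sh i + sh j)) P.giS) := by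
  rw [dphi, dpsi, map_mul, map_mul]
  refine (Ex.mul_left (mul_commute_of one_commute (mul_commute_of (qs_commute _ _) (qs_commute _ _)))
    (Ex.mul_right one_commute (slot_phi_psi i _ _) (cross_zw hij (cphi_in i _) (cpsi_in j _) (cphi_even i _)))
    (Ex.mul_right (mul_commute_of (qs_commute _ _) (qs_commute _ _))
      (cross_zw hij.symm (cphi_in j _) (cpsi_in i _) (cphi_even j _))
      (slot_phi_psi j _ _))).congr ?_
  have e1 : -sh j - sh j + (-2 : ℤ) • sh i = (-2 : ℤ) • (sh i + sh j) := by module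
  have e2 : -sh j - sh j + (2 : ℤ) • sh i = sh i - -sh i + (-2 : ℤ) • sh j := by module
  have e3 : sh i - -sh i + (2 : ℤ) • sh j = (2 : ℤ) • (sh i + sh j) := by module
  rw [e1, e2, e3, mul_one, one_mul, mul_assoc, ← mul_assoc (qs _ P.giS), qs_gi_mul_g, one_mul]

theorem delta_fx (hij : i ≠ j) : Ex (P.qz N (P.dphi i j)) (P.qw N (P.dxp i j))
    (qs ((-1 : ℤ) • (sh i + sh j)) P.gS) := by
  rw [dphi, dxp, map_mul, map_add, map_mul]
  refine Ex.add_right ?_ ?_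
  · refine (Ex.mul_left one_commute (slot_phi_xp i _ _)
      (cross_zw hij.symm (cphi_in j _) (cxp_in i _) (cphi_even j _))).congr ?_
    rw [mul_one]
    congr 2
    module
  · refine (Ex.mul_right (mul_commute_of one_commute (qs_commute _ _))
      (Ex.mul_left one_commute (slot_phi_phi i _ _)
        (cross_zw hij.symm (cphi_in j _) (cphi_in i _) (cphi_even j _)))
      (Ex.mul_left (qs_commute _ _) (cross_zw hij (cphi_in i _) (cxp_in j _) (cphi_even i _))
        (slot_phi_xp j _ _))).congr ?_
    rw [mul_one, one_mul, one_mul]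
    congr 2
    module

theorem delta_fy (hij : i ≠ j) : Ex (P.qz N (P.dphi i j)) (P.qw N (P.dxm i j))
    (qs ((1 : ℤ) • (sh i + sh j)) P.giS) := by
  rw [dphi, dxm, map_mul, map_add, map_mul]
  refine Ex.add_right ?_ ?_
  · refine (Ex.mul_right
      (mul_commute_of one_commute (mul_commute_of (qs_commute _ _) (qs_commute _ _)))
      (Ex.mul_left one_commute (slot_phi_xm i _ _)
        (cross_zw hij.symm (cphi_in j _) (cxm_in i _) (cphi_even j _)))
      (Ex.mul_left (mul_commute_of (qs_commute _ _) (qs_commute _ _))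
        (cross_zw hij (cphi_in i _) (cpsi_in j _) (cphi_even i _))
        (slot_phi_psi j _ _))).congr ?_
    have e1 : -sh j - (2 : ℤ) • sh j + (1 : ℤ) • sh i = sh i - sh j + (-2 : ℤ) • sh j := by module
    have e2 : sh i - sh j + (2 : ℤ) • sh j = (1 : ℤ) • (sh i + sh j) := by module
    rw [e1, e2, mul_one, one_mul, ← mul_assoc, qs_gi_mul_g, one_mul]
  · refine (Ex.mul_left (qs_commute _ _)
      (cross_zw hij (cphi_in i _) (cxm_in j _) (cphi_even i _)) (slot_phi_xm j _ _)).congr ?_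
    rw [one_mul]
    congr 2
    module

theorem delta_gx (hij : i ≠ j) : Ex (P.qw N (P.dpsi i j)) (P.qz N (P.dxp i j))
    (qs ((-1 : ℤ) • (sh i + sh j)) P.giS) := by
  rw [dpsi, dxp, map_mul, map_add, map_mul]
  refine Ex.add_right ?_ ?_
  · refine (Ex.mul_left one_commute (slot_psi_xp i _ _)
      (cross_wz hij.symm (cpsi_in j _) (cxp_in i _) (cpsi_even j _))).congr ?_
    rw [mul_one]
    congr 2
    module
  · have h := slot_phi_psi (P := P) i (sh i) (sh j)
    have h3 : qs (sh i - sh j + (2 : ℤ) • sh i) P.gS * qs (sh i - sh j + (-2 : ℤ) • sh i) P.giS *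
        (qs (sh i - sh j + (-2 : ℤ) • sh i) P.gS * qs (sh i - sh j + (2 : ℤ) • sh i) P.giS) =
        1 := by
      rw [mul_assoc, ← mul_assoc (qs _ P.giS), qs_gi_mul_g, one_mul, qs_g_mul_gi]
    refine (Ex.mul_right (mul_commute_of one_commute (qs_commute _ _))
      (Ex.mul_left one_commute (h.symm h3)
        (cross_wz hij.symm (cpsi_in j _) (cphi_in i _) (cpsi_even j _)))
      (Ex.mul_left (qs_commute _ _) (cross_wz hij (cpsi_in i _) (cxp_in j _) (cpsi_even i _))
        (slot_psi_xp j _ _))).congr ?_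
    have e1 : (2 : ℤ) • sh i - -sh i + (-1 : ℤ) • sh j = sh i - sh j + (2 : ℤ) • sh i := by module
    have e2 : sh i - sh j + (-2 : ℤ) • sh i = (-1 : ℤ) • (sh i + sh j) := by module
    rw [e1, e2, mul_one, one_mul, mul_assoc, qs_commute, mul_assoc, qs_gi_mul_g, mul_one]

theorem delta_gy (hij : i ≠ j) : Ex (P.qw N (P.dpsi i j)) (P.qz N (P.dxm i j))
    (qs ((1 : ℤ) • (sh i + sh j)) P.gS) := by
  rw [dpsi, dxm, map_mul, map_add, map_mul]
  refine Ex.add_right ?_ ?_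
  · refine (Ex.mul_right (mul_commute_of one_commute one_commute)
      (Ex.mul_left one_commute (slot_psi_xm i _ _)
        (cross_wz hij.symm (cpsi_in j _) (cxm_in i _) (cpsi_even j _)))
      (Ex.mul_left one_commute (cross_wz hij (cpsi_in i _) (cpsi_in j _) (cpsi_even i _))
        ((slot_psi_psi j _ _).symm (one_mul 1)))).congr ?_
    rw [mul_one, one_mul, mul_one]
    congr 2
    module
  · refine (Ex.mul_left (qs_commute _ _)
      (cross_wz hij (cpsi_in i _) (cxm_in j _) (cpsi_even i _)) (slot_psi_xm j _ _)).congr ?_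
    rw [one_mul]
    congr 2
    module

theorem delta_xx (hij : i ≠ j) : P.Nl (ev (quad P.GmS P.GpS (P.dxp i j : FA N))) := by
  have hx : Ex (P.qz N (cphi i (sh i) * cxp j ((2 : ℤ) • sh i))) (P.qw N (cxp i 0))
      (-qs 0 P.gS) := by
    rw [map_mul]
    refine (Ex.mul_left neg_one_commute (slot_phi_xp i _ _)
      (cross_odd hij.symm (cxp_in j _) (cxp_in i _) (cxp_odd j _) (cxp_odd i _))).congr ?_
    rw [mul_neg, mul_one]
    congr 3
    module
  refine quad_add isSwap_Gm isSwap_Gp (slot_quad_xp i 0) ?_ ?_ ?_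
  · set φ : P.acts N := cphi i (sh i)
    set x : P.acts N := cxp j ((2 : ℤ) • sh i)
    have h0 : P.Nl (ev (quad P.GmS P.GpS (x : FA N))) := slot_quad_xp j _
    have h1 := (h0.lmulW φ.2).lmulZ φ.2
    rw [← ev_omega_mul, ← ev_zeta_mul] at h1
    refine nl_of_toQ
      (a := tc 0 P.GmS * (zc (φ * x) * wc (φ * x)) + tc 0 P.GpS * (wc (φ * x) * zc (φ * x)))
      (b := zc φ * (wc φ * (tc 0 P.GmS * (zc x * wc x) + tc 0 P.GpS * (wc x * zc x)))) ?_ h1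
    simp only [map_add, map_mul, ← qz_eq, ← qw_eq, ← qs_eq]
    have c1 : P.qz N x * P.qw N φ = P.qw N φ * P.qz N x := by
      have := cross_wz hij (cphi_in i _) (cxp_in j _) (cphi_even (P := P) i (sh i))
        (g := x)
      rw [Ex, one_mul] at this
      exact this.symm
    have c2 : P.qw N x * P.qz N φ = P.qz N φ * P.qw N x := by
      have := cross_zw hij (cphi_in i _) (cxp_in j _) (cphi_even (P := P) i (sh i))
        (g := x)
      rw [Ex, one_mul] at this
      exact this.symm
    have c3 : P.qw N φ * P.qz N φ = P.qz N φ * P.qw N φ := by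
      have := slot_phi_phi (P := P) i (sh i) (sh i)
      rw [Ex, one_mul] at this
      exact this.symm
    have hs := qs_commute (P := P) (N := N) 0
    have e1 : P.qz N φ * P.qz N x * (P.qw N φ * P.qw N x) =
        P.qz N φ * P.qw N φ * (P.qz N x * P.qw N x) := by
      rw [mul_assoc, ← mul_assoc (P.qz N x), c1]
      simp only [mul_assoc]
    have e2 : P.qw N φ * P.qw N x * (P.qz N φ * P.qz N x) =
        P.qz N φ * P.qw N φ * (P.qw N x * P.qz N x) := by
      rw [mul_assoc, ← mul_assoc (P.qw N x), c2, ← c3]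
      simp only [mul_assoc]
    rw [e1, e2, ← mul_assoc (P.qz N φ), mul_add, ← mul_assoc _ (qs 0 P.GmS), ← hs,
      ← mul_assoc _ (qs 0 P.GpS), ← hs]
    simp only [mul_assoc]
  · rw [show _ * _ = _ from hx, ← mul_assoc, mul_neg, ← map_mul, P.GmS_mul_gS, neg_mul,
      neg_add_cancel]
  · rw [show P.qz N _ * _ = _ from hx, ← mul_assoc _ (-qs 0 P.gS), mul_neg, ← map_mul,
      P.GpInvS_mul_gS, neg_mul, add_neg_cancel]

theorem delta_yy (hij : i ≠ j) : P.Nl (ev (quad P.GpS P.GmS (P.dxm i j : FA N))) := by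
  have hx : Ex (P.qw N (cxm i ((2 : ℤ) • sh j) * cpsi j (sh j))) (P.qz N (cxm j 0))
      (-qs 0 P.gS) := by
    rw [map_mul]
    refine (Ex.mul_left (qs_commute _ _)
      ((cross_odd hij.symm (cxm_in j _) (cxm_in i _) (cxm_odd j _) (cxm_odd i _)).symm
        (s' := -1) (by simp)) (slot_psi_xm j _ _)).congr ?_
    rw [neg_one_mul]
    congr 3
    module
  refine quad_add isSwap_Gp isSwap_Gm ?_ (slot_quad_xm j 0) ?_ ?_
  · set ψ : P.acts N := cpsi j (sh j)
    set x : P.acts N := cxm i ((2 : ℤ) • sh j)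
    have h0 : P.Nl (ev (quad P.GpS P.GmS (x : FA N))) := slot_quad_xm i _
    have h1 := (h0.rmulW ψ.2).rmulZ ψ.2
    rw [← ev_mul_omega, ← ev_mul_zeta] at h1
    refine nl_of_toQ
      (a := tc 0 P.GpS * (zc (x * ψ) * wc (x * ψ)) + tc 0 P.GmS * (wc (x * ψ) * zc (x * ψ)))
      (b := (tc 0 P.GpS * (zc x * wc x) + tc 0 P.GmS * (wc x * zc x)) * wc ψ * zc ψ) ?_ h1
    simp only [map_add, map_mul, ← qz_eq, ← qw_eq, ← qs_eq]
    have c1 : P.qz N ψ * P.qw N x = P.qw N x * P.qz N ψ := by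
      have := cross_zw hij.symm (cpsi_in j _) (cxm_in i _) (cpsi_even (P := P) j (sh j))
        (g := x)
      rw [Ex, one_mul] at this
      exact this
    have c2 : P.qw N ψ * P.qz N x = P.qz N x * P.qw N ψ := by
      have := cross_wz hij.symm (cpsi_in j _) (cxm_in i _) (cpsi_even (P := P) j (sh j))
        (g := x)
      rw [Ex, one_mul] at this
      exact this
    have c3 : P.qz N ψ * P.qw N ψ = P.qw N ψ * P.qz N ψ := by
      have := slot_psi_psi (P := P) j (sh j) (sh j)
      rw [Ex, one_mul] at this
      exact this
    have e1 : P.qz N x * P.qz N ψ * (P.qw N x * P.qw N ψ) =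
        P.qz N x * P.qw N x * (P.qw N ψ * P.qz N ψ) := by
      rw [mul_assoc, ← mul_assoc (P.qz N ψ), c1, mul_assoc, c3]
      simp only [mul_assoc]
    have e2 : P.qw N x * P.qw N ψ * (P.qz N x * P.qz N ψ) =
        P.qw N x * P.qz N x * (P.qw N ψ * P.qz N ψ) := by
      rw [mul_assoc, ← mul_assoc (P.qw N ψ), c2]
      simp only [mul_assoc]
    rw [e1, e2, add_mul, add_mul]
    simp only [mul_assoc]
  · rw [show P.qw N _ * _ = _ from hx, ← mul_assoc _ (-qs 0 P.gS), mul_neg, ← map_mul,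
      P.GmS_mul_gS, neg_mul, add_neg_cancel]
  · rw [show _ * _ = _ from hx, ← mul_assoc, mul_neg, ← map_mul,
      P.GpInvS_mul_gS, neg_mul, neg_add_cancel]

theorem delta_xy (hij : i ≠ j) :
    P.Nl (P.xpxm (sh i + sh j) 0 0 (P.dphi i j : FA N) (P.dpsi i j : FA N) (P.dxp i j : FA N)
      (P.dxm i j : FA N)) := by
  have h1 := (slot_xpxm (P := P) i 0 ((2 : ℤ) • sh j)).rmulW (cpsi (P := P) j (sh j)).2
  have h2 := (slot_xpxm (P := P) j ((2 : ℤ) • sh i) 0).lmulZ (cphi (P := P) i (sh i)).2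
  set φ : P.acts N := cphi i (sh i) with hφ
  set ψ : P.acts N := cpsi j (sh j) with hψ
  set xi : P.acts N := cxp i 0 with hxi
  set xj : P.acts N := cxp j ((2 : ℤ) • sh i) with hxj
  set yi : P.acts N := cxm i ((2 : ℤ) • sh j) with hyi
  set yj : P.acts N := cxm j 0 with hyj
  have h3 : P.Nl (ev (zeta (φ * xj : FA N) * omega (yi * ψ : FA N) +
      omega (yi * ψ : FA N) * zeta (φ * xj : FA N) : P.R N)) := by
    refine nl_of_mem_nul ?_
    have h : P.toQ N (zc (φ * xj) * wc (yi * ψ) + wc (yi * ψ) * zc (φ * xj)) = P.toQ N 0 := by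
      simp only [map_add, map_mul, ← qz_eq, ← qw_eq, map_zero]
      have c1 : P.qz N xj * P.qw N yi = -1 * (P.qw N yi * P.qz N xj) :=
        cross_odd hij.symm (cxp_in j _) (cxm_in i _) (cxp_odd j _) (cxm_odd i _)
      have c2 : P.qw N ψ * P.qz N φ = 1 * (P.qz N φ * P.qw N ψ) :=
        cross_wz hij.symm (cpsi_in j _) (cphi_in i _) (cpsi_even j _)
      have c3 : P.qz N φ * P.qw N yi = qs _ P.giS * (P.qw N yi * P.qz N φ) := slot_phi_xm i _ _
      have c4 : P.qw N ψ * P.qz N xj = qs _ P.giS * (P.qz N xj * P.qw N ψ) := slot_psi_xp j _ _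
      have e1 : sh i - (2 : ℤ) • sh j + (1 : ℤ) • sh i =
        (2 : ℤ) • sh i - sh j + (-1 : ℤ) • sh j := by module
      rw [e1] at c3
      rw [one_mul] at c2
      rw [neg_one_mul] at c1
      set γ := qs ((2 : ℤ) • sh i - sh j + (-1 : ℤ) • sh j) P.giS with hγ
      have hg : ∀ a, γ * a = a * γ := qs_commute _ _
      have f1 : P.qz N φ * P.qz N xj * (P.qw N yi * P.qw N ψ) =
          -(γ * (P.qw N yi * P.qz N φ * P.qz N xj * P.qw N ψ)) := by
        calc P.qz N φ * P.qz N xj * (P.qw N yi * P.qw N ψ)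
            = P.qz N φ * (P.qz N xj * P.qw N yi) * P.qw N ψ := by simp only [mul_assoc]
          _ = -(P.qz N φ * P.qw N yi * P.qz N xj * P.qw N ψ) := by rw [c1]; noncomm_ring
          _ = _ := by rw [c3]; simp only [mul_assoc]
      have f2 : P.qw N yi * P.qw N ψ * (P.qz N φ * P.qz N xj) =
          γ * (P.qw N yi * P.qz N φ * P.qz N xj * P.qw N ψ) := by
        calc P.qw N yi * P.qw N ψ * (P.qz N φ * P.qz N xj)
            = P.qw N yi * (P.qw N ψ * P.qz N φ) * P.qz N xj := by simp only [mul_assoc]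
          _ = P.qw N yi * P.qz N φ * (P.qw N ψ * P.qz N xj) := by rw [c2]; simp only [mul_assoc]
          _ = P.qw N yi * P.qz N φ * γ * (P.qz N xj * P.qw N ψ) := by
            rw [c4]; simp only [mul_assoc]
          _ = _ := by rw [← hg]; simp only [mul_assoc]
      rw [f1, f2, neg_add_cancel]
    have := toQ_eq_iff.1 h
    rwa [ZeroMemClass.coe_zero, sub_zero] at this
  have key : P.xpxm (sh i + sh j) 0 0 (P.dphi i j : FA N) (P.dpsi i j : FA N) (P.dxp i j : FA N)
      (P.dxm i j : FA N) =
      rmul degW (P.xpxm (sh i) 0 ((2 : ℤ) • sh j) (FA.slot i FA.phiT) (FA.slot i FA.psiT)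
        (xi : FA N) (yi : FA N)) (ψ : FA N) +
      lmul degZ (φ : FA N) (P.xpxm (sh j) ((2 : ℤ) • sh i) 0 (FA.slot j FA.phiT)
        (FA.slot j FA.psiT) (xj : FA N) (yj : FA N)) +
      ev (zeta (φ * xj : FA N) * omega (yi * ψ : FA N) +
        omega (yi * ψ : FA N) * zeta (φ * xj : FA N) : P.R N) := by
    have hc : ∀ {a b : Fin N}, a ≠ b → ∀ {f : FA N}, LettersIn {b} f → LettersIn {a}ᶜ f :=
      fun hab f hf => hf.mono (by simpa using hab)
    have c1 : (zeta (xi : FA N) * omega (yj : FA N) : P.R N) = -(omega (yj : FA N) * zeta (xi : FA N)) :=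
      Ser.mul_anticomm_of_odd {i} (zeta_lettersIn (cxp_in i _)) (omega_lettersIn (hc hij (cxm_in j _)))
        (zeta_hasParity (cxp_odd i _)) (omega_hasParity (cxm_odd j _))
    have c2 : (omega (ψ : FA N) * zeta (xi : FA N) : P.R N) = zeta (xi : FA N) * omega (ψ : FA N) :=
      Ser.mul_comm_of_even {j} (omega_lettersIn (cpsi_in j _))
        (zeta_lettersIn (hc hij.symm (cxp_in i _))) (omega_hasParity (cpsi_even j _))
    have c3 : (zeta (φ : FA N) * omega (yj : FA N) : P.R N) = omega (yj : FA N) * zeta (φ : FA N) :=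
      Ser.mul_comm_of_even {i} (zeta_lettersIn (cphi_in i _))
        (omega_lettersIn (hc hij (cxm_in j _))) (zeta_hasParity (cphi_even i _))
    have E : (zeta (P.dxp i j : FA N) * omega (P.dxm i j : FA N) +
        omega (P.dxm i j : FA N) * zeta (P.dxp i j : FA N) : P.R N) =
        (zeta (xi : FA N) * omega (yi : FA N) + omega (yi : FA N) * zeta (xi : FA N)) *
          omega (ψ : FA N) +
        zeta (φ : FA N) * (zeta (xj : FA N) * omega (yj : FA N) +
          omega (yj : FA N) * zeta (xj : FA N)) +
        (zeta (φ * xj : FA N) * omega (yi * ψ : FA N) +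
          omega (yi * ψ : FA N) * zeta (φ * xj : FA N)) := by
      have e1 : (P.dxp i j : FA N) = xi + φ * xj := rfl
      have e2 : (P.dxm i j : FA N) = yi * ψ + yj := rfl
      rw [e1, e2, map_add, map_add, map_mul, map_mul]
      simp only [add_mul, mul_add, c1, mul_assoc]
      rw [c2]
      simp only [← mul_assoc]
      rw [c3]
      abel
    have s1 : P.scale ((2 : ℤ) • sh j + sh i) (FA.slot i FA.psiT) * (ψ : FA N) =
        P.scale (sh i + sh j) (P.dpsi i j : FA N) := by
      have e : (P.dpsi i j : FA N) = P.cu i (sh j) FA.psiT * P.cu j (-sh i) FA.psiT := rfl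
      rw [e, map_mul, P.scale_cu, P.scale_cu]
      have e3 : (2 : ℤ) • sh j + sh i = sh i + sh j + sh j := by module
      have e4 : sh i + sh j + -sh i = sh j := by module
      rw [e3, e4]
      rfl
    have s2 : (φ : FA N) * P.scale ((2 : ℤ) • sh i + sh j) (FA.slot j FA.phiT) =
        P.scale (sh i + sh j) (P.dphi i j : FA N) := by
      have e : (P.dphi i j : FA N) = P.cu i (-sh j) FA.phiT * P.cu j (sh i) FA.phiT := rfl
      rw [e, map_mul, P.scale_cu, P.scale_cu]
      have e3 : (2 : ℤ) • sh i + sh j = sh i + sh j + sh i := by module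
      have e4 : sh i + sh j + -sh j = sh i := by module
      rw [e3, e4]
      rfl
    have s3 : P.scale (0 + sh i) (FA.slot i FA.phiT) = (φ : FA N) := by rw [zero_add]; rfl
    have s4 : P.scale (0 + sh j) (FA.slot j FA.psiT) = (ψ : FA N) := by rw [zero_add]; rfl
    have t1 : 0 - (2 : ℤ) • sh j + (-2 : ℤ) • sh i = (-2 : ℤ) • (sh i + sh j) := by module
    have t2 : 0 - (2 : ℤ) • sh j + (2 : ℤ) • sh i = (2 : ℤ) • sh i + (-2 : ℤ) • sh j := by module
    have t3 : (2 : ℤ) • sh i + (2 : ℤ) • sh j = (2 : ℤ) • (sh i + sh j) := by module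
    rw [xpxm, xpxm, xpxm, rmul_sub_left, rmul_smul_left, rmul_sub_left, ← ev_mul_omega, ← rmul_mul,
      lmul_sub_right, lmul_smul_right, lmul_sub_right, ← ev_zeta_mul, s1, s3, s4, t1, t2,
      sub_zero, sub_zero, t3, lmul_rmul degZ degW, ← rmul_eq_lmul_of_scal degZ (φ : FA N) _ (fn_scal _ _),
      rmul_eq_lmul_of_scal degZ (P.scale ((2 : ℤ) • sh i + sh j) _) _ (fn_scal _ _), ← lmul_mul, s2,
      ← rmul_eq_lmul_of_scal degZ _ _ (fn_scal _ _), zero_add, zero_add, zero_add, E,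
      ev_add, ev_add]
    simp only [smul_sub]
    abel
  rw [key]
  exact (h1.add h2).add h3

theorem good_delta (hij : i ≠ j) : Good (sh i + sh j) (P.dphi i j) (P.dphiI i j) (P.dpsi i j)
    (P.dpsiI i j) (P.dxp i j) (P.dxm i j) where
  f_fi := mul_cancel_mid (cphi_mul_cphiI i _) (cphi_mul_cphiI j _)
  fi_f := mul_cancel_mid (cphiI_mul_cphi j _) (cphiI_mul_cphi i _)
  g_gi := mul_cancel_mid (cpsi_mul_cpsiI i _) (cpsi_mul_cpsiI j _)
  gi_g := mul_cancel_mid (cpsiI_mul_cpsi j _) (cpsiI_mul_cpsi i _)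
  ff := delta_ff hij
  gg := delta_gg hij
  fg := delta_fg hij
  fx := delta_fx hij
  fy := delta_fy hij
  gx := delta_gx hij
  gy := delta_gy hij
  xy := delta_xy hij
  xx := delta_xx hij
  yy := delta_yy hij

end Datum

/-! ### Homomorphisms given by their values on currents -/

namespace FA

variable {N k l : ℕ}

theorem Xd_deg_ne {f : FA N} {r : ℤ} {w : Mon N} (h : Xd deg f r w ≠ 0) : f w ≠ 0 ∧ dg w = r := by
  by_cases hr : r = Multiplicative.toAdd (deg w)
  · subst hr
    rw [Xd_apply_self] at h
    exact ⟨h, rfl⟩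
  · exact absurd (Xd_apply_ne _ _ hr) h

/-- The data of a homomorphism with given values on the currents `ā`, `b̄`, `x⁺`, `x⁻`. -/
def LiftData.ofTotals (A B X Y c : FA l) (hA : A 1 = 0) (hB : B 1 = 0) (hX : X 1 = 0)
    (hY : Y 1 = 0) (hc : c 1 = 0) (hs : LettersIn ∅ c) : LiftData l where
  T
    | .a n => Xd deg A (-n)
    | .b n => Xd deg B (-n)
    | .xp n => Xd deg X (-n)
    | .xm n => Xd deg Y (-n)
  c := c
  T_one y := by
    by_contra h
    cases y
    · exact (Xd_deg_ne h).1 hA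
    · exact (Xd_deg_ne h).1 hB
    · exact (Xd_deg_ne h).1 hX
    · exact (Xd_deg_ne h).1 hY
  T_deg y w h := by
    cases y <;> exact (Xd_deg_ne h).2
  c_one := hc
  c_scal := hs
  comm y := hs.commuteFA _

theorem LiftData.hom_tot (D : LiftData l) {y : ℤ → Letter} (hy : ∀ n, (y n).deg = -n) {f : FA l}
    (h : ∀ n, D.T (y n) = Xd deg f (-n)) : D.hom (tot y) = f := by
  apply Xd_injective deg
  funext r
  have := D.degPres.map_comp (tot y) r
  rw [toCLM_apply, toCLM_apply, Xd_tot hy, D.hom_gen, h, neg_neg] at this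
  exact this.symm

section ofTotals

variable {A B X Y c : FA l} {hA : A 1 = 0} {hB : B 1 = 0} {hX : X 1 = 0} {hY : Y 1 = 0}
  {hc : c 1 = 0} {hs : LettersIn ∅ c}

theorem LiftData.ofTotals_a : (LiftData.ofTotals A B X Y c hA hB hX hY hc hs).hom (tot .a) = A :=
  LiftData.hom_tot _ (fun _ => rfl) fun _ => rfl

theorem LiftData.ofTotals_b : (LiftData.ofTotals A B X Y c hA hB hX hY hc hs).hom (tot .b) = B :=
  LiftData.hom_tot _ (fun _ => rfl) fun _ => rfl

theorem LiftData.ofTotals_xp : (LiftData.ofTotals A B X Y c hA hB hX hY hc hs).hom xpT = X :=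
  LiftData.hom_tot _ (fun _ => rfl) fun _ => rfl

theorem LiftData.ofTotals_xm : (LiftData.ofTotals A B X Y c hA hB hX hY hc hs).hom xmT = Y :=
  LiftData.hom_tot _ (fun _ => rfl) fun _ => rfl

theorem LiftData.ofTotals_cc : (LiftData.ofTotals A B X Y c hA hB hX hY hc hs).hom (cc 0) = c :=
  LiftData.hom_cc _

theorem LiftData.ofTotals_parPres (pA : HasParity 0 A) (pB : HasParity 0 B) (pX : HasParity 1 X)
    (pY : HasParity 1 Y) :
    ParPres (toCLM (LiftData.ofTotals A B X Y c hA hB hX hY hc hs).hom) :=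
  LiftData.parPres _ fun y w h => by
    cases y
    · exact pA w (Xd_deg_ne h).1
    · exact pB w (Xd_deg_ne h).1
    · exact pX w (Xd_deg_ne h).1
    · exact pY w (Xd_deg_ne h).1

theorem LiftData.ofTotals_lettersIn {S : Set (Fin l)} (pA : LettersIn S A) (pB : LettersIn S B)
    (pX : LettersIn S X) (pY : LettersIn S Y) (f : FA 1) :
    LettersIn S ((LiftData.ofTotals A B X Y c hA hB hX hY hc hs).hom f) :=
  LiftData.lettersIn _ (fun y w h => by
    cases y
    · exact pA w (Xd_deg_ne h).1
    · exact pB w (Xd_deg_ne h).1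
    · exact pX w (Xd_deg_ne h).1
    · exact pY w (Xd_deg_ne h).1) f

end ofTotals

theorem hom_ext_tot {Φ Ψ : FA 1 →A[ℂ] FA l} (hΦ : DegPres (toCLM Φ)) (hΨ : DegPres (toCLM Ψ))
    (hc : Φ (cc 0) = Ψ (cc 0)) (ha : Φ (tot .a) = Ψ (tot .a)) (hb : Φ (tot .b) = Ψ (tot .b))
    (hx : Φ xpT = Ψ xpT) (hy : Φ xmT = Ψ xmT) : Φ = Ψ := by
  have key : ∀ {y : ℤ → Letter}, (∀ n, (y n).deg = -n) → Φ (tot y) = Ψ (tot y) →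
      ∀ n, Φ (gen (y n)) = Ψ (gen (y n)) := fun {y} hy h n => by
    have h1 := hΦ.map_comp (tot y) (-n)
    have h2 := hΨ.map_comp (tot y) (-n)
    rw [toCLM_apply, toCLM_apply, Xd_tot hy, neg_neg] at h1 h2
    rw [h1, h2, h]
  refine hom_ext hc fun y => ?_
  cases y with
  | a n => exact key (fun _ => rfl) ha n
  | b n => exact key (fun _ => rfl) hb n
  | xp n => exact key (fun _ => rfl) hx n
  | xm n => exact key (fun _ => rfl) hy n

theorem hasParity_cast {d : ZMod 2} {n : ℕ} (h : (n : ZMod 2) = d) {f : FA N}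
    (hf : HasParity d f) : HasParity (n : ZMod 2) f := h ▸ hf

theorem supercomm_of_lettersIn {Φ Ψ : FA 1 →A[ℂ] FA l} (A : Set (Fin l))
    (hΦ : ∀ f, LettersIn A (Φ f)) (hΨ : ∀ f, LettersIn Aᶜ (Ψ f)) (pΦ : ParPres (toCLM Φ))
    (pΨ : ParPres (toCLM Ψ)) (u v : Mon 1) : Ψ (mono v) * Φ (mono u) =
      ((-1 : ℂ) ^ (parity v * parity u)) • (Φ (mono u) * Ψ (mono v)) :=
  mul_supercomm Aᶜ (hΨ _) (by rw [compl_compl]; exact hΦ _) (pΨ.map (hasParity_mono v))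
    (pΦ.map (hasParity_mono u))

theorem pairHom_comp_slot_zero (Φ Ψ : FA 1 →A[ℂ] FA l) (h) :
    (pairHom Φ Ψ h).comp (slotHom 0) = Φ := by
  ext1 f
  exact pairHom_slot_zero Φ Ψ h f

theorem pairHom_comp_slot_one (Φ Ψ : FA 1 →A[ℂ] FA l) (h) :
    (pairHom Φ Ψ h).comp (slotHom 1) = Ψ := by
  ext1 f
  exact pairHom_slot_one Φ Ψ h f

theorem comp_degPres {m : ℕ} {Φ : FA k →A[ℂ] FA l} {Ψ : FA m →A[ℂ] FA k}
    (hΦ : DegPres (toCLM Φ)) (hΨ : DegPres (toCLM Ψ)) : DegPres (toCLM (Φ.comp Ψ)) :=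
  fun m w h => by
  obtain ⟨v, hv, h'⟩ := exists_of_apply_ne_zero (toCLM Φ) (f := Ψ (mono m)) h
  rw [hΦ v w h', hΨ m v hv]

theorem slotHom_fin_one : slotHom (0 : Fin 1) = ContinuousAlgHom.id ℂ (FA 1) := by
  ext1 f
  exact slot_fin_one f

end FA

namespace Datum

variable (P : Datum) {N k l : ℕ}

open FA in
/-- Homomorphisms respect the ideals of relations if they do so on each slot. -/
theorem pairHom_mem_relIdeal {Φ Ψ : FA 1 →A[ℂ] FA l} (h) {m n : Fin l → ℤ}
    (hΦ : IsGood (P := P) Φ m) (hΨ : IsGood (P := P) Ψ n) (sΦ : ScalPres (toCLM Φ))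
    (sΨ : ScalPres (toCLM Ψ)) {a : FA 2} (ha : a ∈ P.relIdeal 2) :
    pairHom Φ Ψ h a ∈ P.relIdeal l :=
  map_mem_relIdeal (Φ := pairHom Φ Ψ h) (M := ![m, n]) (pair_degPres hΦ.deg hΨ.deg) (pair_scalPres sΦ sΨ) (fun i => by
    fin_cases i
    · exact (pairHom_comp_slot_zero Φ Ψ h).symm ▸ hΦ
    · exact (pairHom_comp_slot_one Φ Ψ h).symm ▸ hΨ) ha

theorem pairHom_cc {Φ Ψ : FA 1 →A[ℂ] FA l} (h) {m n : Fin l → ℤ}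
    (hΦ : IsGood (P := P) Φ m) (hΨ : IsGood (P := P) Ψ n) (i : Fin 2) :
    FA.pairHom Φ Ψ h (FA.cc i) = ∑ j, ((![m, n] : Fin 2 → Fin l → ℤ) i j : ℂ) • FA.cc j := by
  rw [← FA.slot_cc i]
  fin_cases i
  · exact (FA.pairHom_slot_zero Φ Ψ h _).trans hΦ.c
  · exact (FA.pairHom_slot_one Φ Ψ h _).trans hΨ.c

theorem pairHom_cu {Φ Ψ : FA 1 →A[ℂ] FA l} (h) {m n : Fin l → ℤ}
    (hΦ : IsGood (P := P) Φ m) (hΨ : IsGood (P := P) Ψ n) (s : Fin 2 → ℤ) (f : FA 1) :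
    FA.pairHom Φ Ψ h (P.cu 0 s f) = P.scale (s 0 • m + s 1 • n) (Φ f) ∧
      FA.pairHom Φ Ψ h (P.cu 1 s f) = P.scale (s 0 • m + s 1 • n) (Ψ f) := by
  have key := hom_scale (P := P) (Φ := FA.pairHom Φ Ψ h) (FA.pair_degPres hΦ.deg hΨ.deg)
    (P.pairHom_cc h hΦ hΨ) s
  rw [Fin.sum_univ_two] at key
  exact ⟨(key _).trans (congrArg _ (FA.pairHom_slot_zero Φ Ψ h f)),
    (key _).trans (congrArg _ (FA.pairHom_slot_one Φ Ψ h f))⟩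

/-! ### The coproduct -/

theorem dxp_coe (i j : Fin N) : ((P.dxp i j : P.acts N) : FA N) =
    P.cu i 0 FA.xpT + P.cu i (sh i) FA.phiT * P.cu j ((2 : ℤ) • sh i) FA.xpT := rfl

theorem dxm_coe (i j : Fin N) : ((P.dxm i j : P.acts N) : FA N) =
    P.cu i ((2 : ℤ) • sh j) FA.xmT * P.cu j (sh j) FA.psiT + P.cu j 0 FA.xmT := rfl

theorem dphi_coe (i j : Fin N) : ((P.dphi i j : P.acts N) : FA N) =
    P.cu i (-sh j) FA.phiT * P.cu j (sh i) FA.phiT := rfl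

theorem dpsi_coe (i j : Fin N) : ((P.dpsi i j : P.acts N) : FA N) =
    P.cu i (sh j) FA.psiT * P.cu j (-sh i) FA.psiT := rfl

theorem add_one_apply {f g : FA N} (hf : f 1 = 0) (hg : g 1 = 0) : (f + g) 1 = 0 := by
  rw [FA.add_apply, hf, hg, add_zero]

/-- The coproduct, with values in the slots `i`, `j`. -/
def deltaData (i j : Fin N) : FA.LiftData N :=
  .ofTotals (P.cu i (-sh j) (FA.tot .a) + P.cu j (sh i) (FA.tot .a))
    (P.cu i (sh j) (FA.tot .b) + P.cu j (-sh i) (FA.tot .b)) (P.dxp i j) (P.dxm i j)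
    (FA.cc i + FA.cc j)
    (add_one_apply (P.cu_one_apply _ _ (FA.tot_one _)) (P.cu_one_apply _ _ (FA.tot_one _)))
    (add_one_apply (P.cu_one_apply _ _ (FA.tot_one _)) (P.cu_one_apply _ _ (FA.tot_one _)))
    (add_one_apply (P.cu_one_apply _ _ (FA.tot_one _))
      ((FA.mul_apply_one _ _).trans
        (mul_eq_zero_of_right _ (P.cu_one_apply _ _ (FA.tot_one _)))))
    (add_one_apply
      ((FA.mul_apply_one _ _).trans
        (mul_eq_zero_of_left (P.cu_one_apply _ _ (FA.tot_one _)) _))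
      (P.cu_one_apply _ _ (FA.tot_one _)))
    (add_one_apply (FA.cc_one i) (FA.cc_one j))
    (FA.lettersIn_add (FA.cc_scal i) (FA.cc_scal j))

/-- The coproduct, with values in the slots `i`, `j`. -/
def delta (i j : Fin N) : FA 1 →A[ℂ] FA N := (P.deltaData i j).hom

variable (i j : Fin N)

theorem delta_a : P.delta i j (FA.tot .a) =
    P.cu i (-sh j) (FA.tot .a) + P.cu j (sh i) (FA.tot .a) := FA.LiftData.ofTotals_a

theorem delta_b : P.delta i j (FA.tot .b) =
    P.cu i (sh j) (FA.tot .b) + P.cu j (-sh i) (FA.tot .b) := FA.LiftData.ofTotals_b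

theorem delta_xp : P.delta i j FA.xpT = P.dxp i j := FA.LiftData.ofTotals_xp

theorem delta_xm : P.delta i j FA.xmT = P.dxm i j := FA.LiftData.ofTotals_xm

theorem delta_cc : P.delta i j (FA.cc 0) = FA.cc i + FA.cc j := FA.LiftData.ofTotals_cc

theorem delta_degPres : FA.DegPres (FA.toCLM (P.delta i j)) := (P.deltaData i j).degPres

theorem delta_scalPres : FA.ScalPres (FA.toCLM (P.delta i j)) := (P.deltaData i j).scalPres

theorem tot_a_even : HasParity 0 (FA.tot .a) := FA.tot_hasParity fun _ => rfl

theorem tot_b_even : HasParity 0 (FA.tot .b) := FA.tot_hasParity fun _ => rfl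

theorem delta_parPres : FA.ParPres (FA.toCLM (P.delta i j)) :=
  FA.LiftData.ofTotals_parPres
    (FA.hasParity_add (P.cu_hasParity _ _ tot_a_even) (P.cu_hasParity _ _ tot_a_even))
    (FA.hasParity_add (P.cu_hasParity _ _ tot_b_even) (P.cu_hasParity _ _ tot_b_even))
    (FA.hasParity_add (cxp_odd i 0) (zero_add (1 : ZMod 2) ▸
      FA.hasParity_mul (cphi_even i _) (cxp_odd j _)))
    (FA.hasParity_add (add_zero (1 : ZMod 2) ▸ FA.hasParity_mul (cxm_odd i _) (cpsi_even j _))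
      (cxm_odd j 0))

theorem delta_lettersIn (f : FA 1) : LettersIn {i, j} (P.delta i j f) := by
  have hi : ∀ s g, LettersIn {i, j} (P.cu i s g) := fun s g => (P.cu_lettersIn i s g).mono (by simp)
  have hj : ∀ s g, LettersIn {i, j} (P.cu j s g) := fun s g => (P.cu_lettersIn j s g).mono (by simp)
  exact FA.LiftData.ofTotals_lettersIn (FA.lettersIn_add (hi _ _) (hj _ _))
    (FA.lettersIn_add (hi _ _) (hj _ _))
    (FA.lettersIn_add (hi _ _) (FA.lettersIn_mul (hi _ _) (hj _ _)))
    (FA.lettersIn_add (FA.lettersIn_mul (hi _ _) (hj _ _)) (hj _ _)) f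

variable {i j}

theorem vert_cu_add (hij : i ≠ j) (s t : Fin N → ℤ) {f : FA 1} (hf : f 1 = 0)
    (hp : HasParity 0 f) :
    FA.vert (P.cu i s f + P.cu j t f) = P.cu i s (FA.vert f) * P.cu j t (FA.vert f) := by
  rw [FA.vert_add (P.cu_one_apply _ _ hf) (P.cu_one_apply _ _ hf), P.cu_vert i s hf,
    P.cu_vert j t hf]
  intro S T
  have h := FA.mul_supercomm {i} (a := 0) (b := 0) (FA.part_lettersIn S (P.cu_lettersIn i s f))
    ((FA.part_lettersIn T (P.cu_lettersIn j t f)).mono (by simpa using hij))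
    (FA.hasParity_cast Nat.cast_zero (FA.part_hasParity S (P.cu_hasParity i s hp)))
    (FA.hasParity_cast Nat.cast_zero (FA.part_hasParity T (P.cu_hasParity j t hp)))
  rwa [mul_zero, pow_zero, one_smul] at h

theorem delta_phi (hij : i ≠ j) : P.delta i j FA.phiT = P.dphi i j := by
  have h1 : P.delta i j (FA.tot .a) 1 = 0 := by
    rw [delta_a]
    exact add_one_apply (P.cu_one_apply _ _ (FA.tot_one _)) (P.cu_one_apply _ _ (FA.tot_one _))
  rw [FA.phiT, FA.hom_vert (P.delta_degPres i j) (FA.tot_one _) h1, delta_a,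
    P.vert_cu_add hij _ _ (FA.tot_one _) tot_a_even]
  rfl

theorem delta_psi (hij : i ≠ j) : P.delta i j FA.psiT = P.dpsi i j := by
  have h1 : P.delta i j (FA.tot .b) 1 = 0 := by
    rw [delta_b]
    exact add_one_apply (P.cu_one_apply _ _ (FA.tot_one _)) (P.cu_one_apply _ _ (FA.tot_one _))
  rw [FA.psiT, FA.hom_vert (P.delta_degPres i j) (FA.tot_one _) h1, delta_b,
    P.vert_cu_add hij _ _ (FA.tot_one _) tot_b_even]
  rfl

theorem hom_inv_eq {Φ : FA k →A[ℂ] FA l} {f g : FA k} (hfg : g * f = 1) {F G : FA l}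
    (hF : Φ f = F) (hFG : F * G = 1) : Φ g = G :=
  left_inv_eq_right_inv (by rw [← hF, ← map_mul, hfg, map_one]) hFG

theorem isGood_delta (hij : i ≠ j) : IsGood (P := P) (P.delta i j) (sh i + sh j) :=
  IsGood.of_good (P.delta_degPres i j) (by
    rw [delta_cc]
    simp only [Pi.add_apply, Int.cast_add, add_smul, Finset.sum_add_distrib]
    rw [← slotHom_cc, ← slotHom_cc]
    exact congrArg₂ _ (FA.slot_cc i).symm (FA.slot_cc j).symm)
    (good_delta hij) (P.delta_phi hij)
    (hom_inv_eq FA.phiIT_mul_phiT (P.delta_phi hij) (congrArg Subtype.val (good_delta hij).f_fi))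
    (P.delta_psi hij)
    (hom_inv_eq FA.psiIT_mul_psiT (P.delta_psi hij) (congrArg Subtype.val (good_delta hij).g_gi))
    (P.delta_xp i j) (P.delta_xm i j)

theorem incl_delta (e : Fin k → Fin N) (he : StrictMono e) {i j : Fin k} (hij : i ≠ j) (f : FA 1) :
    FA.incl e (P.delta i j f) = P.delta (e i) (e j) f := by
  have hij' : e i ≠ e j := fun h => hij (he.injective h)
  have hcu : ∀ i s g, FA.inclHom e he (P.cu i s g) = P.cu (e i) (∑ n, s n • sh (e n)) g :=
    fun i s g => by
      rw [cu, hom_scale (FA.inclHom_degPres e he) (M := fun n => sh (e n))]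
      · rw [FA.inclHom_apply, FA.incl_slot e he]; rfl
      · intro n
        rw [← slotHom_cc, FA.inclHom_apply, ← FA.slot_cc, FA.incl_slot e he]; rfl
  have hsh : ∀ n, ∑ m, sh n m • sh (e m) = sh (e n) := fun n => by
    rw [Finset.sum_eq_single n]
    · simp
    · intro m _ hm; simp [hm]
    · simp
  have hn : ∀ n, ∑ m, (-sh n) m • sh (e m) = -sh (e n) := fun n => by
    rw [← hsh n, ← Finset.sum_neg_distrib]; simp only [Pi.neg_apply, neg_smul]
  have h2 : ∀ n, ∑ m, ((2 : ℤ) • sh n) m • sh (e m) = (2 : ℤ) • sh (e n) := fun n => by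
    rw [← hsh n, Finset.smul_sum]; simp only [Pi.smul_apply, smul_smul, smul_eq_mul]
  have h0 : ∑ m, (0 : Fin k → ℤ) m • sh (e m) = 0 := by simp
  have key : (FA.inclHom e he).comp (P.delta i j) = P.delta (e i) (e j) := by
    refine FA.hom_ext_tot (FA.comp_degPres (FA.inclHom_degPres e he) (P.delta_degPres i j))
      (P.delta_degPres _ _) ?_ ?_ ?_ ?_ ?_
    all_goals change FA.inclHom e he (P.delta i j _) = _
    · rw [delta_cc, delta_cc, map_add, ← FA.slot_cc i, ← FA.slot_cc j, FA.inclHom_apply,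
        FA.inclHom_apply, FA.incl_slot e he, FA.incl_slot e he, FA.slot_cc, FA.slot_cc]
    · rw [delta_a, delta_a, map_add, hcu, hcu, hn, hsh]
    · rw [delta_b, delta_b, map_add, hcu, hcu, hn, hsh]
    · rw [delta_xp, delta_xp, dxp_coe, dxp_coe, map_add, map_mul, hcu, hcu, hcu, h0, hsh, h2]
    · rw [delta_xm, delta_xm, dxm_coe, dxm_coe, map_add, map_mul, hcu, hcu, hcu, h0, hsh, h2]
  exact DFunLike.congr_fun key f

/-- `Δ ⊗ id` -/
def comulIdHat : FA 2 →A[ℂ] FA 3 :=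
  FA.pairHom (P.delta 0 1) (FA.slotHom 2) (FA.supercomm_of_lettersIn {0, 1}
    (P.delta_lettersIn 0 1) (fun f => (FA.slot_lettersIn 2 f).mono (by simp))
    (P.delta_parPres 0 1) (FA.inclHom_parPres _ _))

/-- `id ⊗ Δ` -/
def idComulHat : FA 2 →A[ℂ] FA 3 :=
  FA.pairHom (FA.slotHom 0) (P.delta 1 2) (FA.supercomm_of_lettersIn {0}
    (FA.slot_lettersIn 0) (fun f => (P.delta_lettersIn 1 2 f).mono (by
      rintro x (rfl | rfl) <;> simp))
    (FA.inclHom_parPres _ _) (P.delta_parPres 1 2))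

theorem comulIdHat_cu_zero (s : Fin 2 → ℤ) (f : FA 1) : P.comulIdHat (P.cu 0 s f) =
    P.scale (s 0 • (sh 0 + sh 1) + s 1 • sh 2) (P.delta 0 1 f) :=
  (P.pairHom_cu _ (P.isGood_delta (by decide)) (isGood_slot 2) s f).1

theorem comulIdHat_cu_one (s : Fin 2 → ℤ) (f : FA 1) : P.comulIdHat (P.cu 1 s f) =
    P.cu 2 (s 0 • (sh 0 + sh 1) + s 1 • sh 2) f :=
  (P.pairHom_cu _ (P.isGood_delta (by decide)) (isGood_slot 2) s f).2

theorem idComulHat_cu_zero (s : Fin 2 → ℤ) (f : FA 1) : P.idComulHat (P.cu 0 s f) =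
    P.cu 0 (s 0 • sh 0 + s 1 • (sh 1 + sh 2)) f :=
  (P.pairHom_cu _ (isGood_slot 0) (P.isGood_delta (by decide)) s f).1

theorem idComulHat_cu_one (s : Fin 2 → ℤ) (f : FA 1) : P.idComulHat (P.cu 1 s f) =
    P.scale (s 0 • sh 0 + s 1 • (sh 1 + sh 2)) (P.delta 1 2 f) :=
  (P.pairHom_cu _ (isGood_slot 0) (P.isGood_delta (by decide)) s f).2

theorem sh_two_zero : sh (0 : Fin 2) = ![1, 0] := by ext x; fin_cases x <;> rfl

theorem sh_two_one : sh (1 : Fin 2) = ![0, 1] := by ext x; fin_cases x <;> rfl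

theorem sh_three_zero : sh (0 : Fin 3) = ![1, 0, 0] := by ext x; fin_cases x <;> rfl

theorem sh_three_one : sh (1 : Fin 3) = ![0, 1, 0] := by ext x; fin_cases x <;> rfl

theorem sh_three_two : sh (2 : Fin 3) = ![0, 0, 1] := by ext x; fin_cases x <;> rfl

theorem coassoc_hat : P.comulIdHat.comp (P.delta 0 1) = P.idComulHat.comp (P.delta 0 1) := by
  have h01 : (0 : Fin 3) ≠ 1 := by decide
  have h12 : (1 : Fin 3) ≠ 2 := by decide
  refine FA.hom_ext_tot
    (FA.comp_degPres (FA.pair_degPres (P.delta_degPres 0 1) (slotHom_degPres 2))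
      (P.delta_degPres 0 1))
    (FA.comp_degPres (FA.pair_degPres (slotHom_degPres 0) (P.delta_degPres 1 2))
      (P.delta_degPres 0 1)) ?_ ?_ ?_ ?_ ?_
  all_goals
    change P.comulIdHat (P.delta 0 1 _) = P.idComulHat (P.delta 0 1 _)
  · rw [delta_cc, map_add, map_add, ← FA.slot_cc 0, ← FA.slot_cc 1, comulIdHat, idComulHat,
      FA.pairHom_slot_zero, FA.pairHom_slot_one, FA.pairHom_slot_zero, FA.pairHom_slot_one,
      delta_cc, delta_cc, FA.slotHom_apply, FA.slotHom_apply, FA.slot_cc, FA.slot_cc, add_assoc]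
  · simp [delta_a, comulIdHat_cu_zero, comulIdHat_cu_one, idComulHat_cu_zero, idComulHat_cu_one,
      scale_cu, sh_two_zero, sh_two_one, sh_three_zero, sh_three_one, sh_three_two, add_assoc]
  · simp [delta_b, comulIdHat_cu_zero, comulIdHat_cu_one, idComulHat_cu_zero, idComulHat_cu_one,
      scale_cu, sh_two_zero, sh_two_one, sh_three_zero, sh_three_one, sh_three_two, add_assoc]
  · simp [delta_xp, dxp_coe, delta_phi, dphi_coe, comulIdHat_cu_zero, comulIdHat_cu_one,
      idComulHat_cu_zero, idComulHat_cu_one, scale_cu, sh_two_zero, sh_three_zero,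
      sh_three_one, sh_three_two, add_assoc, mul_assoc, mul_add]
  · simp [delta_xm, dxm_coe, delta_psi, dpsi_coe, comulIdHat_cu_zero, comulIdHat_cu_one,
      idComulHat_cu_zero, idComulHat_cu_one, scale_cu, sh_two_one, sh_three_zero,
      sh_three_one, sh_three_two, add_assoc, mul_assoc, add_mul]

end Datum

namespace FA

variable {N k l : ℕ}

/-! ### The parity automorphism -/

/-- The function underlying `sg`. -/
def sgFun (a : ℕ) (f : FA N) : FA N := fun w => (-1) ^ (a * parity w) * f w

theorem sgFun_apply (a : ℕ) (f : FA N) (w : Mon N) : sgFun a f w = (-1) ^ (a * parity w) * f w := rfl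

/-- The `a`-th power of the parity automorphism. -/
def sg (a : ℕ) : FA N →A[ℂ] FA N where
  toAlgHom := AlgHom.ofLinearMap
    { toFun := sgFun a
      map_add' := fun f g => by
        ext w
        simp only [sgFun_apply, add_apply, mul_add]
      map_smul' := fun t f => by
        ext w
        simp only [sgFun_apply, smul_apply, RingHom.id_apply]
        ring }
    (by
      ext w
      change sgFun a 1 w = _
      by_cases h : w = 1
      · subst h
        simp [sgFun_apply, parity_one]
      · simp [sgFun_apply, one_apply, h])
    (fun f g => by
      ext w
      change sgFun a (f * g) w = (sgFun a f * sgFun a g) w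
      rw [sgFun_apply, mul_apply, mul_apply, Finset.mul_sum]
      refine Finset.sum_congr rfl fun p hp => ?_
      rw [← mem_factor.1 hp, sgFun_apply, sgFun_apply, parity_mul, mul_add, pow_add]
      ring)
  cont := continuous_iff.2 fun w => continuous_const.mul (coeff w).cont

theorem sg_apply (a : ℕ) (f : FA N) (w : Mon N) : sg a f w = (-1) ^ (a * parity w) * f w := rfl

theorem sg_ne {a : ℕ} {f : FA N} {w : Mon N} (h : sg a f w ≠ 0) : f w ≠ 0 := fun h' => h (by
  rw [sg_apply, h', mul_zero])

theorem sg_mono_ne {a : ℕ} {m w : Mon N} (h : sg a (mono m) w ≠ 0) : w = m := by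
  by_contra h'
  exact sg_ne h (mono_apply_ne h')

theorem sg_degPres (a : ℕ) : DegPres (toCLM (sg a : FA N →A[ℂ] FA N)) := fun _ _ h => by
  rw [sg_mono_ne h]

theorem sg_scalPres (a : ℕ) : ScalPres (toCLM (sg a : FA N →A[ℂ] FA N)) := fun _ hf w hw =>
  hf w (sg_ne hw)

theorem neg_one_pow_congr {m n : ℕ} (h : (m : ZMod 2) = n) : (-1 : ℂ) ^ m = (-1) ^ n := by
  rw [neg_one_pow_eq_pow_mod_two, neg_one_pow_eq_pow_mod_two (n := n),
    (ZMod.natCast_eq_natCast_iff' m n 2).1 h]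

theorem sg_of_hasParity {a b : ℕ} {f : FA N} (hf : HasParity (b : ZMod 2) f) :
    sg a f = ((-1 : ℂ) ^ (a * b)) • f := by
  ext w
  rw [sg_apply, smul_apply]
  by_cases h : f w = 0
  · rw [h, mul_zero, mul_zero]
  · rw [neg_one_pow_congr (n := a * b)]
    push_cast
    rw [hf w h]

theorem sg_even {a : ℕ} {f : FA N} (hf : HasParity 0 f) : sg a f = f := by
  rw [sg_of_hasParity (b := 0) (hasParity_cast Nat.cast_zero hf), mul_zero, pow_zero, one_smul]

theorem sg_one_odd {f : FA N} (hf : HasParity 1 f) : sg 1 f = -f := by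
  rw [sg_of_hasParity (b := 1) (hasParity_cast Nat.cast_one hf)]
  simp

theorem ParPres.map_sg {A : FA k →L[ℂ] FA l} (hA : ParPres A) (a : ℕ) (f : FA k) :
    A (sg a f) = sg a (A f) := by
  have e : A.comp (toCLM (sg a)) = (toCLM (sg a)).comp A := clm_ext fun m => by
    change A (sg a (mono m)) = sg a (A (mono m))
    rw [sg_of_hasParity (hasParity_mono m), map_smul,
      sg_of_hasParity (hA.map (hasParity_mono m))]
  exact congrArg (fun B => B f) e

theorem sg_zero (f : FA N) : sg 0 f = f := by
  ext w
  rw [sg_apply, zero_mul, pow_zero, one_mul]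

end FA

theorem Ex.neg_right {A : Type*} [Ring A] {a b s : A} (h : Ex a b s) : Ex a (-b) s := by
  unfold Ex at *
  rw [mul_neg, h, neg_mul, mul_neg]

namespace Datum

variable {P : Datum} {N k l : ℕ}

theorem quad_neg (γ γ' : P.LS) (X : FA N) : (quad γ γ' (-X) : P.R N) = quad γ γ' X := by
  simp only [quad, map_neg, neg_mul_neg]

theorem xpxm_neg (m s t : Fin N → ℤ) (F G X Y : FA N) :
    P.xpxm m s t F G (-X) (-Y) = P.xpxm m s t F G X Y := by
  simp only [xpxm, map_neg, neg_mul_neg]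

theorem good_slot_neg (i : Fin N) : Good (sh i) (cphi i 0) (cphiI i 0) (cpsi i 0) (cpsiI i 0)
    (-cxp i 0) (-cxm i 0 : P.acts N) where
  f_fi := cphi_mul_cphiI i 0
  fi_f := cphiI_mul_cphi i 0
  g_gi := cpsi_mul_cpsiI i 0
  gi_g := cpsiI_mul_cpsi i 0
  ff := slot_phi_phi i 0 0
  gg := slot_psi_psi i 0 0
  fg := by simpa using slot_phi_psi (P := P) i 0 0
  fx := by
    rw [map_neg]
    simpa using (slot_phi_xp (P := P) i 0 0).neg_right
  fy := by
    rw [map_neg]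
    simpa using (slot_phi_xm (P := P) i 0 0).neg_right
  gx := by
    rw [map_neg]
    simpa using (slot_psi_xp (P := P) i 0 0).neg_right
  gy := by
    rw [map_neg]
    simpa using (slot_psi_xm (P := P) i 0 0).neg_right
  xy := by
    have h := slot_xpxm (P := P) i 0 0
    rw [← P.cu_zero, ← P.cu_zero, ← xpxm_neg] at h
    exact h
  xx := by
    have h := slot_quad_xp (P := P) i 0
    rw [← quad_neg] at h
    exact h
  yy := by
    have h := slot_quad_xm (P := P) i 0
    rw [← quad_neg] at h
    exact h

theorem sg_cc (a : ℕ) (i : Fin N) : FA.sg a (FA.cc i) = FA.cc i :=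
  FA.sg_even (FA.cc_scal i).hasParity

theorem slot_hasParity (i : Fin N) {d : ZMod 2} {f : FA 1} (hf : HasParity d f) :
    HasParity d (FA.slot i f) := (FA.inclHom_parPres _ (FA.strictMono_const i)).map hf

theorem isGood_sg (i : Fin N) : IsGood (P := P) ((FA.sg 1).comp (FA.slotHom i)) (sh i) := by
  have even : ∀ {f : FA 1}, HasParity 0 f → FA.sg 1 (FA.slot i f) = P.cu i 0 f := fun hf => by
    rw [FA.sg_even (slot_hasParity i hf), P.cu_zero]
  have odd : ∀ {f : FA 1}, HasParity 1 f → FA.sg 1 (FA.slot i f) = -P.cu i 0 f := fun hf => by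
    rw [FA.sg_one_odd (slot_hasParity i hf), P.cu_zero]
  refine IsGood.of_good (FA.comp_degPres (FA.sg_degPres 1) (slotHom_degPres i)) ?_
    (good_slot_neg i) (even FA.IsTotal.phi.hasParity) (even FA.IsTotal.phiInv.hasParity)
    (even FA.IsTotal.psi.hasParity) (even FA.IsTotal.psiInv.hasParity)
    (odd FA.IsTotal.xp.hasParity) (odd FA.IsTotal.xm.hasParity)
  rw [← slotHom_cc]
  change FA.sg 1 (FA.slot i (FA.cc 0)) = FA.slot i (FA.cc 0)
  rw [FA.slot_cc, sg_cc]

theorem sg_mem_relIdeal {a : FA N} (ha : a ∈ P.relIdeal N) : FA.sg 1 a ∈ P.relIdeal N :=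
  map_mem_relIdeal (FA.sg_degPres 1) (FA.sg_scalPres 1) isGood_sg ha

theorem nl_sg {D : Dist N} (hD : P.Nl D) (a : ℕ) : P.Nl fun p => FA.sg a (D p) := by
  have h1 : P.Nl fun p => FA.sg 1 (D p) := by
    rcases hD with hD | rfl
    · exact nl_map (FA.sg_degPres 1) (FA.sg_scalPres 1) isGood_sg hD
    · exact .inr (funext fun p => map_zero _)
  rcases Nat.even_or_odd a with ha | ha
  · have e : (fun p => FA.sg a (D p)) = D := funext fun p => by
      ext w
      rw [FA.sg_apply, pow_mul, ha.neg_one_pow, one_pow, one_mul]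
    rwa [e]
  · have e : (fun p => FA.sg a (D p)) = fun p => FA.sg 1 (D p) := funext fun p => by
      ext w
      rw [FA.sg_apply, FA.sg_apply, pow_mul, ha.neg_one_pow, one_mul]
    rwa [e]

/-! ### The counit -/

theorem eps_tot (y : ℤ → Letter) : FA.eps l (FA.tot y) = 0 := by
  rw [FA.eps_apply, FA.counitHat_apply, FA.tot_one, map_zero]

theorem eps_cc : FA.eps l (FA.cc 0) = 0 := by
  rw [FA.eps_apply, FA.counitHat_apply, FA.cc_one, map_zero]

theorem eps_degPres : FA.DegPres (FA.toCLM (FA.eps l)) := (FA.epsData l).degPres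

theorem eps_scalPres : FA.ScalPres (FA.toCLM (FA.eps l)) := (FA.epsData l).scalPres

theorem eps_parPres : FA.ParPres (FA.toCLM (FA.eps l)) :=
  (FA.epsData l).parPres fun _ _ h => absurd rfl h

theorem eps_vert (y : ℤ → Letter) : FA.eps l (FA.vert (FA.tot y)) = 1 := by
  rw [FA.hom_vert eps_degPres (FA.tot_one y) (by rw [eps_tot]; rfl), eps_tot, FA.vert_zero]

theorem good_eps : Good 0 1 1 1 1 0 (0 : P.acts N) where
  f_fi := one_mul 1
  fi_f := one_mul 1
  g_gi := one_mul 1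
  gi_g := one_mul 1
  ff := by simp [Ex]
  gg := by simp [Ex]
  fg := by simp [Ex, qs_g_mul_gi]
  fx := by simp [Ex]
  fy := by simp [Ex]
  gx := by simp [Ex]
  gy := by simp [Ex]
  xy := .inr (by
    have h : rmul degW (P.fn (0 : Fin N → ℤ) fun _ => 1) 1 =
        rmul degZ (P.fn (0 : Fin N → ℤ) fun _ => 1) 1 := by rw [rmul_one, rmul_one]
    simp [xpxm, h, ev_zero])
  xx := .inr (by simp [quad, ev_zero])
  yy := .inr (by simp [quad, ev_zero])

theorem isGood_eps : IsGood (P := P) (FA.eps l) 0 :=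
  IsGood.of_good eps_degPres (by simp [eps_cc]) good_eps (eps_vert _)
    (hom_inv_eq FA.phiIT_mul_phiT (eps_vert _) (one_mul 1)) (eps_vert _)
    (hom_inv_eq FA.psiIT_mul_psiT (eps_vert _) (one_mul 1)) (eps_tot _) (eps_tot _)

theorem null_zero {D : Dist 0} (hD : P.Null 0 D) : D = 0 := by
  induction hD with
  | exchange i => exact i.elim0
  | other i => exact i.elim0
  | add D E _ _ hD hE => rw [hD, hE, add_zero]
  | swap D _ hD => rw [hD]; rfl
  | rescale D _ s t hD => rw [hD]; funext p; exact mul_zero _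
  | scalar D _ F _ _ hD => rw [hD, conv_zero_right]
  | left D _ i => exact i.elim0
  | right D _ i => exact i.elim0

theorem counitHat_eq_zero {a : FA 1} (ha : a ∈ P.relIdeal 1) : FA.counitHat a = 0 := by
  have h := map_mem_relIdeal (P := P) (Φ := FA.eps 0) (M := fun _ => 0) eps_degPres eps_scalPres
    (fun i => by
      have e : (FA.eps 0).comp (FA.slotHom i) = FA.eps 0 := by
        rw [Subsingleton.elim i 0, FA.slotHom_fin_one]; rfl
      exact e.symm ▸ isGood_eps) ha
  have h0 : P.relIdeal 0 ≤ ⊥ := by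
    rw [relIdeal, TwoSidedIdeal.span_le]
    rintro _ ⟨D, hD, p, rfl⟩
    rw [null_zero hD]
    exact zero_mem _
  have h1 := (TwoSidedIdeal.mem_bot _).1 (h0 h)
  rw [FA.eps_apply, Algebra.algebraMap_eq_smul_one] at h1
  have h2 := congrArg (fun f : FA 0 => f 1) h1
  simpa [FA.smul_apply, FA.one_apply, FA.zero_apply] using h2

theorem eps_lettersIn (f : FA 1) : LettersIn ∅ (FA.eps l f) :=
  (FA.epsData l).lettersIn (fun _ _ h => absurd rfl h) f

theorem lettersIn_univ (f : FA N) : LettersIn Set.univ f := fun _ _ _ h => absurd trivial h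

variable (P)

/-- `ε ⊗ id` -/
def counitIdHat : FA 2 →A[ℂ] FA 1 :=
  FA.pairHom (FA.eps 1) (FA.slotHom 0) (FA.supercomm_of_lettersIn ∅ eps_lettersIn
    (fun f => by rw [Set.compl_empty]; exact lettersIn_univ _) eps_parPres
    (FA.inclHom_parPres _ _))

/-- `id ⊗ ε` -/
def idCounitHat : FA 2 →A[ℂ] FA 1 :=
  FA.pairHom (FA.slotHom 0) (FA.eps 1) (FA.supercomm_of_lettersIn Set.univ
    (fun f => lettersIn_univ _) (fun f => by rw [Set.compl_univ]; exact eps_lettersIn f)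
    (FA.inclHom_parPres _ _) eps_parPres)

theorem counitIdHat_cu_zero (s : Fin 2 → ℤ) (f : FA 1) : counitIdHat (P.cu 0 s f) =
    P.scale (s 0 • 0 + s 1 • sh 0) (FA.eps 1 f) :=
  (P.pairHom_cu _ isGood_eps (isGood_slot 0) s f).1

theorem counitIdHat_cu_one (s : Fin 2 → ℤ) (f : FA 1) : counitIdHat (P.cu 1 s f) =
    P.cu 0 (s 0 • 0 + s 1 • sh 0) f :=
  (P.pairHom_cu _ isGood_eps (isGood_slot 0) s f).2

theorem idCounitHat_cu_zero (s : Fin 2 → ℤ) (f : FA 1) : idCounitHat (P.cu 0 s f) =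
    P.cu 0 (s 0 • sh 0 + s 1 • 0) f :=
  (P.pairHom_cu _ (isGood_slot 0) isGood_eps s f).1

theorem idCounitHat_cu_one (s : Fin 2 → ℤ) (f : FA 1) : idCounitHat (P.cu 1 s f) =
    P.scale (s 0 • sh 0 + s 1 • 0) (FA.eps 1 f) :=
  (P.pairHom_cu _ (isGood_slot 0) isGood_eps s f).2

theorem cu_fin_one (f : FA 1) : P.cu (0 : Fin 1) 0 f = f := by rw [P.cu_zero, FA.slot_fin_one]

theorem counit_hat : counitIdHat.comp (P.delta 0 1) = ContinuousAlgHom.id ℂ (FA 1) := by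
  rw [← FA.slotHom_fin_one]
  have hx : FA.eps 1 FA.xpT = 0 := eps_tot _
  have hy : FA.eps 1 FA.xmT = 0 := eps_tot _
  have hF : FA.eps 1 FA.phiT = 1 := eps_vert _
  refine FA.hom_ext_tot
    (FA.comp_degPres (FA.pair_degPres eps_degPres (slotHom_degPres 0)) (P.delta_degPres 0 1))
    (slotHom_degPres 0) ?_ ?_ ?_ ?_ ?_
  all_goals
    change counitIdHat (P.delta 0 1 _) = _
    rw [FA.slotHom_apply]
  · rw [delta_cc, map_add, ← FA.slot_cc 0, ← FA.slot_cc 1, counitIdHat,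
      FA.pairHom_slot_zero, FA.pairHom_slot_one, eps_cc, zero_add]
    simp
  · simp [delta_a, counitIdHat_cu_zero, counitIdHat_cu_one, eps_tot, sh_two_zero, cu_fin_one]
  · simp [delta_b, counitIdHat_cu_zero, counitIdHat_cu_one, eps_tot, sh_two_zero, cu_fin_one]
  · simp [delta_xp, dxp_coe, counitIdHat_cu_zero, counitIdHat_cu_one, hx, hF, sh_two_zero,
      cu_fin_one]
  · simp [delta_xm, dxm_coe, counitIdHat_cu_zero, counitIdHat_cu_one, hy, cu_fin_one]

theorem hat_counit : idCounitHat.comp (P.delta 0 1) = ContinuousAlgHom.id ℂ (FA 1) := by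
  rw [← FA.slotHom_fin_one]
  have hx : FA.eps 1 FA.xpT = 0 := eps_tot _
  have hy : FA.eps 1 FA.xmT = 0 := eps_tot _
  have hG : FA.eps 1 FA.psiT = 1 := eps_vert _
  refine FA.hom_ext_tot
    (FA.comp_degPres (FA.pair_degPres (slotHom_degPres 0) eps_degPres) (P.delta_degPres 0 1))
    (slotHom_degPres 0) ?_ ?_ ?_ ?_ ?_
  all_goals
    change idCounitHat (P.delta 0 1 _) = _
    rw [FA.slotHom_apply]
  · rw [delta_cc, map_add, ← FA.slot_cc 0, ← FA.slot_cc 1, idCounitHat,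
      FA.pairHom_slot_zero, FA.pairHom_slot_one, eps_cc, add_zero]
    simp
  · simp [delta_a, idCounitHat_cu_zero, idCounitHat_cu_one, eps_tot, sh_two_one, cu_fin_one]
  · simp [delta_b, idCounitHat_cu_zero, idCounitHat_cu_one, eps_tot, sh_two_one, cu_fin_one]
  · simp [delta_xp, dxp_coe, idCounitHat_cu_zero, idCounitHat_cu_one, hx, cu_fin_one]
  · simp [delta_xm, dxm_coe, idCounitHat_cu_zero, idCounitHat_cu_one, hy, hG, sh_two_one,
      cu_fin_one]

end Datum

/-! ### Reversal of monomials -/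

theorem add_choose_two (p q : ℕ) : (p + q).choose 2 = p.choose 2 + q.choose 2 + p * q := by
  induction p with
  | zero => simp
  | succ p ih =>
    rw [add_right_comm, Nat.choose_succ_succ', Nat.choose_succ_succ' p, ih, Nat.choose_one_right,
      Nat.choose_one_right]
    ring

namespace FA

variable {N k l : ℕ}

/-- The monomial with the reversed word. -/
def rev (w : Mon 1) : Mon 1 := fun i => ((w i).1, FreeMonoid.reverse (w i).2)

theorem rev_rev (w : Mon 1) : rev (rev w) = w := funext fun _ =>
  Prod.ext rfl FreeMonoid.reverse_reverse

theorem rev_mul (u v : Mon 1) : rev (u * v) = rev v * rev u := funext fun _ =>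
  Prod.ext (mul_comm _ _) FreeMonoid.reverse_mul

theorem rev_one : rev 1 = 1 := rfl

theorem parity_rev (w : Mon 1) : parity (rev w) = parity w := by
  simp only [parity]
  refine Finset.sum_congr rfl fun i _ => ?_
  exact List.countP_reverse

theorem degSlot_rev (n : Multiplicative ℕ) (v : FreeMonoid Letter) :
    degSlot (n, FreeMonoid.reverse v) = degSlot (n, v) := by
  induction v using FreeMonoid.recOn with
  | one => rfl
  | of_mul y v ih =>
    rw [FreeMonoid.reverse_mul, FreeMonoid.reverse_of]
    have h1 : degSlot (n, FreeMonoid.reverse v * FreeMonoid.of y) =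
        degSlot (n, FreeMonoid.reverse v) * degSlot (1, FreeMonoid.of y) := by
      rw [← map_mul, Prod.mk_mul_mk, mul_one]
    have h2 : degSlot (n, FreeMonoid.of y * v) = degSlot (1, FreeMonoid.of y) * degSlot (n, v) := by
      rw [← map_mul, Prod.mk_mul_mk, one_mul]
    rw [h1, h2, ih, mul_comm]

theorem dg_rev (w : Mon 1) : dg (rev w) = dg w := by
  change Multiplicative.toAdd (∏ i, degSlot (rev w i)) = Multiplicative.toAdd (∏ i, degSlot (w i))
  exact congrArg Multiplicative.toAdd (Finset.prod_congr rfl fun i _ => degSlot_rev (w i).1 (w i).2)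

/-- The function underlying `tau`. -/
def tauFun (f : FA 1) : FA 1 := fun w => (-1) ^ (parity w).choose 2 * f (rev w)

theorem tauFun_apply (f : FA 1) (w : Mon 1) :
    tauFun f w = (-1) ^ (parity w).choose 2 * f (rev w) := rfl

/-- The graded reversal. -/
def tau : FA 1 →L[ℂ] FA 1 where
  toFun := tauFun
  map_add' f g := by
    ext w
    simp only [tauFun_apply, add_apply, mul_add]
  map_smul' t f := by
    ext w
    simp only [tauFun_apply, smul_apply, RingHom.id_apply]
    ring
  cont := continuous_iff.2 fun w => continuous_const.mul (coeff (rev w)).cont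

theorem tau_apply (f : FA 1) (w : Mon 1) : tau f w = (-1) ^ (parity w).choose 2 * f (rev w) := rfl

theorem tau_ne {f : FA 1} {w : Mon 1} (h : tau f w ≠ 0) : f (rev w) ≠ 0 := fun h' => h (by
  rw [tau_apply, h', mul_zero])

theorem tau_mono_ne {m w : Mon 1} (h : tau (mono m) w ≠ 0) : m = rev w := by
  by_contra h'
  exact tau_ne h (mono_apply_ne fun e => h' e.symm)

theorem sum_factor_rev {M : Type*} [AddCommMonoid M] (w : Mon 1) (F : Mon 1 → Mon 1 → M) :
    ∑ p ∈ factor (rev w), F p.1 p.2 = ∑ p ∈ factor w, F (rev p.2) (rev p.1) := by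
  refine Finset.sum_nbij' (fun p => (rev p.2, rev p.1)) (fun p => (rev p.2, rev p.1)) ?_ ?_ ?_ ?_ ?_
  · intro p hp
    rw [mem_factor] at hp ⊢
    rw [← rev_mul, hp, rev_rev]
  · intro p hp
    rw [mem_factor] at hp ⊢
    rw [← rev_mul, hp]
  · intro p _
    simp [rev_rev]
  · intro p _
    simp [rev_rev]
  · intro p _
    simp [rev_rev]

theorem tau_mul_left {a : ℕ} {f : FA 1} (hf : HasParity (a : ZMod 2) f) (g : FA 1) :
    tau (f * g) = sg a (tau g) * tau f := by
  ext w
  rw [tau_apply, mul_apply, mul_apply, sum_factor_rev w fun u v => sgn u v * f u * g v,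
    Finset.mul_sum]
  refine Finset.sum_congr rfl fun p hp => ?_
  rw [sg_apply, tau_apply, tau_apply, sgn_fin_one, sgn_fin_one, ← mem_factor.1 hp, parity_mul,
    add_choose_two, pow_add, pow_add]
  by_cases h : f (rev p.2) = 0
  · rw [h]; ring
  · have h1 := hf _ h
    rw [parity_rev] at h1
    rw [neg_one_pow_congr (m := parity p.1 * parity p.2) (n := a * parity p.1)]
    · ring
    · push_cast
      rw [h1, mul_comm]

theorem tau_mul_right {a : ℕ} {g : FA 1} (hg : HasParity (a : ZMod 2) g) (f : FA 1) :
    tau (f * g) = tau g * sg a (tau f) := by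
  ext w
  rw [tau_apply, mul_apply, mul_apply, sum_factor_rev w fun u v => sgn u v * f u * g v,
    Finset.mul_sum]
  refine Finset.sum_congr rfl fun p hp => ?_
  rw [sg_apply, tau_apply, tau_apply, sgn_fin_one, sgn_fin_one, ← mem_factor.1 hp, parity_mul,
    add_choose_two, pow_add, pow_add]
  by_cases h : g (rev p.1) = 0
  · rw [h]; ring
  · have h1 := hg _ h
    rw [parity_rev] at h1
    rw [neg_one_pow_congr (m := parity p.1 * parity p.2) (n := a * parity p.2)]
    · ring
    · push_cast
      rw [h1]

theorem tau_one : tau 1 = 1 := by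
  classical
  ext w
  rw [tau_apply, one_apply, one_apply]
  by_cases h : w = 1
  · subst h
    simp [rev_one, parity_one]
  · rw [if_neg h, if_neg fun h' => h (by rw [← rev_rev w, h', rev_one]), mul_zero]

theorem tau_mono_of_rev {m : Mon 1} (h : rev m = m) (hp : (parity m).choose 2 = 0) :
    tau (mono m) = mono m := by
  ext w
  by_cases hw : w = m
  · rw [tau_apply, hw, h, hp, pow_zero, one_mul]
  · have h' : rev w ≠ m := fun e => hw (by rw [← rev_rev w, e, h])
    rw [tau_apply, mono_apply_ne hw, mono_apply_ne h', mul_zero]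

theorem tau_cc : tau (cc 0) = cc 0 := by
  rw [cc_eq]
  exact tau_mono_of_rev rfl rfl

theorem tau_gen (y : Letter) : tau (gen y) = gen y := by
  rw [gen_eq]
  refine tau_mono_of_rev rfl ?_
  rw [parity_mon1_of]
  split_ifs <;> rfl

theorem tau_degPres : DegPres tau := fun m w h => by rw [tau_mono_ne h, dg_rev]

theorem tau_tot {y : ℤ → Letter} (hy : ∀ n, (y n).deg = -n) : tau (tot y) = tot y := by
  apply Xd_injective deg
  funext r
  rw [← tau_degPres.map_comp, Xd_tot hy, tau_gen]

theorem tau_parPres : ParPres tau := fun m w h => by rw [tau_mono_ne h, parity_rev]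

theorem tau_scalPres : ScalPres tau := fun f hf w hw i hi => by
  have h : FreeMonoid.reverse (w i).2 = 1 := hf _ (tau_ne hw) i hi
  have h2 := congrArg FreeMonoid.reverse h
  rwa [FreeMonoid.reverse_reverse] at h2

/-! ### Maps that are multiplicative for central factors -/

/-- Continuous linear maps that respect degrees and products with series in the central
elements, and that map the central elements as described by `M`. -/
structure Central (A : FA k →L[ℂ] FA l) (M : Fin k → Fin l → ℤ) : Prop where
  deg : DegPres A
  scal : ScalPres A
  one : A 1 = 1
  mul : ∀ f g : FA k, LettersIn ∅ f → A (f * g) = A f * A g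
  cc : ∀ i, A (cc i) = ∑ j, (M i j : ℂ) • FA.cc j

theorem mul_of_mono_scal {A : FA k →L[ℂ] FA l} (h : ∀ u v : Mon k, (∀ i, (u i).2 = 1) →
    A (mono u * mono v) = A (mono u) * A (mono v)) (f g : FA k) (hf : LettersIn ∅ f) :
    A (f * g) = A f * A g := by
  have h1 : ∀ u : Mon k, (∀ i, (u i).2 = 1) → A (mono u * g) = A (mono u) * A g := fun u hu => by
    have e : A.comp (mulLeft (mono u)) = (mulLeft (A (mono u))).comp A := clm_ext fun v => h u v hu
    exact congrArg (fun B => B g) e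
  have h2 := (hasSum_mono f).mapL (A.comp (mulRight g))
  have h3 := (hasSum_mono f).mapL ((mulRight (A g)).comp A)
  refine h2.unique (?_ : HasSum _ (((mulRight (A g)).comp A) f))
  convert h3 using 1
  funext m
  change A ((f m • mono m) * g) = A (f m • mono m) * A g
  by_cases hm : f m = 0
  · simp [hm]
  · rw [smul_mul_assoc, map_smul, map_smul, smul_mul_assoc, h1 m fun i => hf m hm i (by simp)]

theorem Central.pair {A B : FA 1 →L[ℂ] FA l} {M M' : Fin 1 → Fin l → ℤ} (hA : Central A M)
    (hB : Central B M') : Central (pair A B) ![M 0, M' 0] where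
  deg := pair_degPres hA.deg hB.deg
  scal := pair_scalPres hA.scal hB.scal
  one := by
    change FA.pair A B (mono 1) = 1
    rw [pair_mono]
    change A 1 * B 1 = 1
    rw [hA.one, hB.one, one_mul]
  mul := mul_of_mono_scal fun u v hu => by
    have s0 : LettersIn ∅ (mono (mon1 (u 0))) := lettersIn_mono fun _ _ => hu 0
    have s1 : LettersIn ∅ (mono (mon1 (u 1))) := lettersIn_mono fun _ _ => hu 1
    rw [mono_mul, sgn_of_scal_left hu, one_smul, pair_mono, pair_mono, pair_mono, Pi.mul_apply,
      Pi.mul_apply, mono_mon1_mul, mono_mon1_mul, hA.mul _ _ s0, hB.mul _ _ s1, mul_assoc,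
      mul_assoc, ← mul_assoc (A (mono (mon1 (v 0)))), ← (hB.scal _ s1).commuteFA, mul_assoc]
  cc i := by
    rw [← slot_cc i]
    fin_cases i
    · exact (pair_slot_zero A B hB.one _).trans (hA.cc 0)
    · exact (pair_slot_one A B hA.one _).trans (hB.cc 0)

theorem central_id : Central (ContinuousLinearMap.id ℂ (FA 1)) fun _ => 1 where
  deg m w h := by
    by_contra h'
    exact h (mono_apply_ne fun e => h' (by rw [e]))
  scal _ hf := hf
  one := rfl
  mul _ _ _ := rfl
  cc i := by
    rw [Subsingleton.elim i 0]
    simp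

end FA

namespace Datum

variable {P : Datum} {N k l : ℕ}

theorem central_qPow {A : FA k →L[ℂ] FA l} {M : Fin k → Fin l → ℤ} (hA : FA.Central A M)
    (t : Fin k → ℤ) : A (P.qPow t) = P.qPow (∑ i, t i • M i) := map_qPow hA.one hA.mul M hA.cc t

theorem central_Xd_scale {A : FA k →L[ℂ] FA l} {M : Fin k → Fin l → ℤ} (hA : FA.Central A M)
    (s : Fin k → ℤ) (f : FA k) (r : ℤ) :
    A (Xd deg (P.scale s f) r) = P.qPow (r • ∑ i, s i • M i) * A (Xd deg f r) := by
  rw [P.Xd_scale, hA.mul _ _ (P.qPow_scal _), central_qPow hA, Finset.smul_sum]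
  simp only [Pi.smul_apply, smul_eq_mul, mul_smul]

theorem central_scale {A : FA k →L[ℂ] FA l} {M : Fin k → Fin l → ℤ} (hA : FA.Central A M)
    (s : Fin k → ℤ) (f : FA k) : A (P.scale s f) = P.scale (∑ i, s i • M i) (A f) := by
  apply Xd_injective deg
  funext r
  rw [← hA.deg.map_comp, central_Xd_scale hA, P.Xd_scale, hA.deg.map_comp]

/-- The value of `A ⊗ B` on a product of rescaled currents of the two slots. -/
theorem pair_cu_mul_cu {A B : FA 1 →L[ℂ] FA l} {M M' : Fin 1 → Fin l → ℤ} (hA : FA.Central A M)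
    (hB : FA.Central B M') (s t : Fin 2 → ℤ) (f g : FA 1) :
    FA.pair A B (P.cu 0 s f * P.cu 1 t g) =
      P.scale (s 0 • M 0 + s 1 • M' 0) (A f) * P.scale (t 0 • M 0 + t 1 • M' 0) (B g) := by
  have hp := hA.pair hB
  apply Xd_injective deg
  funext p
  rw [← hp.deg.map_comp, ← lmul_Xd, ← lmul_Xd]
  refine ((hasSum_lmul deg _ _ p).mapL (FA.pair A B)).unique ?_
  convert hasSum_lmul deg _ _ p using 1
  funext r
  have e0 : Xd deg (FA.slot 0 f : FA 2) r = FA.slot 0 (Xd deg f r) :=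
    ((slotHom_degPres (0 : Fin 2)).map_comp f r).symm
  have e1 : Xd deg (FA.slot 1 g : FA 2) (p - r) = FA.slot 1 (Xd deg g (p - r)) :=
    ((slotHom_degPres (1 : Fin 2)).map_comp g (p - r)).symm
  rw [P.Xd_scale, P.Xd_scale, cu, cu, P.Xd_scale, P.Xd_scale, e0, e1, mul_assoc,
    hp.mul _ _ (P.qPow_scal _), ← mul_assoc (FA.slot 0 _), ← (P.qPow_scal _).commuteFA, mul_assoc,
    hp.mul _ _ (P.qPow_scal _), FA.pair_mul, central_qPow hp, central_qPow hp, hA.deg.map_comp,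
    hB.deg.map_comp, mul_assoc, ← mul_assoc (Xd deg (A f) r), ← (P.qPow_scal _).commuteFA,
    mul_assoc, Fin.sum_univ_two, Fin.sum_univ_two]
  simp only [Pi.smul_apply, smul_eq_mul, mul_smul, smul_add]
  rfl

theorem pair_cu_zero {A B : FA 1 →L[ℂ] FA l} {M M' : Fin 1 → Fin l → ℤ} (hA : FA.Central A M)
    (hB : FA.Central B M') (s : Fin 2 → ℤ) (f : FA 1) :
    FA.pair A B (P.cu 0 s f) = P.scale (s 0 • M 0 + s 1 • M' 0) (A f) := by
  have := pair_cu_mul_cu (P := P) hA hB s 0 f 1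
  rwa [P.cu_one, mul_one, hB.one, map_one, mul_one] at this

theorem pair_cu_one {A B : FA 1 →L[ℂ] FA l} {M M' : Fin 1 → Fin l → ℤ} (hA : FA.Central A M)
    (hB : FA.Central B M') (s : Fin 2 → ℤ) (f : FA 1) :
    FA.pair A B (P.cu 1 s f) = P.scale (s 0 • M 0 + s 1 • M' 0) (B f) := by
  have := pair_cu_mul_cu (P := P) hA hB 0 s 1 f
  rwa [P.cu_one, one_mul, hA.one, map_one, one_mul] at this

end Datum

namespace Datum

variable (P : Datum)

/-! ### The antipode -/

/-- The value of the antipode on `x⁺`. -/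
def antiXp : P.acts 1 := -(cphiI 0 (-sh 0) * cxp 0 ((-2 : ℤ) • sh 0))

/-- The value of the antipode on `x⁻`. -/
def antiXm : P.acts 1 := -(cxm 0 ((-2 : ℤ) • sh 0) * cpsiI 0 (-sh 0))

theorem antiXp_coe : (P.antiXp : FA 1) =
    -(P.cu 0 (-sh 0) FA.phiIT * P.cu 0 ((-2 : ℤ) • sh 0) FA.xpT) := rfl

theorem antiXm_coe : (P.antiXm : FA 1) =
    -(P.cu 0 ((-2 : ℤ) • sh 0) FA.xmT * P.cu 0 (-sh 0) FA.psiIT) := rfl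

/-- The homomorphism with the values of the antipode on the generators. -/
def antiData : FA.LiftData 1 :=
  .ofTotals (-FA.tot .a) (-FA.tot .b) P.antiXp P.antiXm (-FA.cc 0)
    (FA.neg_one_apply (FA.tot_one _)) (FA.neg_one_apply (FA.tot_one _))
    (FA.neg_one_apply ((FA.mul_apply_one _ _).trans
      (mul_eq_zero_of_right _ (P.cu_one_apply _ _ (FA.tot_one _)))))
    (FA.neg_one_apply ((FA.mul_apply_one _ _).trans
      (mul_eq_zero_of_left (P.cu_one_apply _ _ (FA.tot_one _)) _)))
    (FA.neg_one_apply (FA.cc_one 0)) (FA.lettersIn_neg (FA.cc_scal 0))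

/-- The homomorphism with the values of the antipode on the generators. -/
def antiHom : FA 1 →A[ℂ] FA 1 := P.antiData.hom

/-- The antipode. -/
def anti : FA 1 →L[ℂ] FA 1 := (FA.toCLM P.antiHom).comp FA.tau

theorem anti_apply (f : FA 1) : P.anti f = P.antiHom (FA.tau f) := rfl

theorem antiHom_parPres : FA.ParPres (FA.toCLM P.antiHom) :=
  FA.LiftData.ofTotals_parPres (FA.hasParity_neg tot_a_even) (FA.hasParity_neg tot_b_even)
    (FA.hasParity_neg (zero_add (1 : ZMod 2) ▸ FA.hasParity_mul
      (P.cu_hasParity _ _ FA.IsTotal.phiInv.hasParity) (cxp_odd 0 _)))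
    (FA.hasParity_neg (add_zero (1 : ZMod 2) ▸ FA.hasParity_mul (cxm_odd 0 _)
      (P.cu_hasParity _ _ FA.IsTotal.psiInv.hasParity)))

theorem anti_degPres : FA.DegPres P.anti := fun m w h => by
  obtain ⟨v, hv, h'⟩ := FA.exists_of_apply_ne_zero (FA.toCLM P.antiHom) (f := FA.tau (FA.mono m)) h
  rw [P.antiData.degPres v w h', FA.tau_degPres m v hv]

theorem anti_parPres : FA.ParPres P.anti := fun m w h => by
  obtain ⟨v, hv, h'⟩ := FA.exists_of_apply_ne_zero (FA.toCLM P.antiHom) (f := FA.tau (FA.mono m)) h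
  rw [P.antiHom_parPres v w h', FA.tau_parPres m v hv]

theorem anti_scalPres : FA.ScalPres P.anti := fun _ hf =>
  P.antiData.scalPres _ (FA.tau_scalPres _ hf)

theorem anti_mul_left {a : ℕ} {f : FA 1} (hf : HasParity (a : ZMod 2) f) (g : FA 1) :
    P.anti (f * g) = FA.sg a (P.anti g) * P.anti f := by
  rw [anti_apply, FA.tau_mul_left hf, map_mul]
  exact congrArg (· * _) (P.antiHom_parPres.map_sg a _)

theorem anti_mul_right {a : ℕ} {g : FA 1} (hg : HasParity (a : ZMod 2) g) (f : FA 1) :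
    P.anti (f * g) = P.anti g * FA.sg a (P.anti f) := by
  rw [anti_apply, FA.tau_mul_right hg, map_mul]
  exact congrArg (_ * ·) (P.antiHom_parPres.map_sg a _)

theorem anti_mul_even {f : FA 1} (hf : HasParity 0 f) (g : FA 1) :
    P.anti (f * g) = P.anti g * P.anti f := by
  rw [P.anti_mul_left (a := 0) (FA.hasParity_cast Nat.cast_zero hf), FA.sg_zero]

theorem anti_even_mul {g : FA 1} (hg : HasParity 0 g) (f : FA 1) :
    P.anti (f * g) = P.anti g * P.anti f := by
  rw [P.anti_mul_right (a := 0) (FA.hasParity_cast Nat.cast_zero hg), FA.sg_zero]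

theorem anti_one : P.anti 1 = 1 := by
  rw [anti_apply, FA.tau_one, map_one]

theorem anti_cc : P.anti (FA.cc 0) = -FA.cc 0 := by
  rw [anti_apply, FA.tau_cc]
  exact FA.LiftData.ofTotals_cc

theorem anti_a : P.anti (FA.tot .a) = -FA.tot .a := by
  rw [anti_apply, FA.tau_tot fun _ => rfl]
  exact FA.LiftData.ofTotals_a

theorem anti_b : P.anti (FA.tot .b) = -FA.tot .b := by
  rw [anti_apply, FA.tau_tot fun _ => rfl]
  exact FA.LiftData.ofTotals_b

theorem anti_xp : P.anti FA.xpT = P.antiXp := by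
  rw [anti_apply, FA.xpT, FA.tau_tot fun _ => rfl]
  exact FA.LiftData.ofTotals_xp

theorem anti_xm : P.anti FA.xmT = P.antiXm := by
  rw [anti_apply, FA.xmT, FA.tau_tot fun _ => rfl]
  exact FA.LiftData.ofTotals_xm

theorem central_anti : FA.Central P.anti fun _ => -1 where
  deg := P.anti_degPres
  scal := P.anti_scalPres
  one := P.anti_one
  mul f g hf := by
    rw [P.anti_mul_even hf.hasParity, (P.anti_scalPres f hf).commuteFA]
  cc i := by
    rw [Subsingleton.elim i 0, anti_cc]
    simp

theorem anti_fexp {f : FA 1} (hf : HasParity 0 f) (h1 : f 1 = 0) (h2 : P.anti f 1 = 0) :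
    P.anti (FA.fexp f) = FA.fexp (P.anti f) := by
  refine FA.map_fexp P.anti h1 h2 fun n => ?_
  induction n with
  | zero => rw [pow_zero, pow_zero, anti_one]
  | succ n ih => rw [pow_succ, P.anti_even_mul hf, ih, ← pow_succ']

theorem anti_vert {f : FA 1} (hf : HasParity 0 f) (h1 : f 1 = 0) (h : P.anti f = -f) :
    P.anti (FA.vert f) = FA.vertInv f := by
  have hp : ∀ S, P.anti (FA.part S f) = -FA.part S f := fun S => by
    rw [P.anti_degPres.map_part, h, FA.part_neg]
  have h0 := fun S => FA.part_one_apply S h1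
  have e : ∀ S, P.anti (FA.fexp (FA.part S f)) = FA.fexp (-FA.part S f) := fun S => by
    rw [P.anti_fexp (FA.part_hasParity S hf) (h0 S) (by rw [hp]; exact FA.neg_one_apply (h0 S)), hp]
  rw [FA.vert, P.anti_mul_even (FA.hasParity_fexp (FA.part_hasParity _ hf)), e, e, FA.vertInv]

theorem anti_phi : P.anti FA.phiT = FA.phiIT := P.anti_vert tot_a_even (FA.tot_one _) P.anti_a

theorem anti_psi : P.anti FA.psiT = FA.psiIT := P.anti_vert tot_b_even (FA.tot_one _) P.anti_b

theorem anti_phiI : P.anti FA.phiIT = FA.phiT := by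
  refine left_inv_eq_right_inv (a := FA.phiIT) ?_ FA.phiIT_mul_phiT
  have h := P.anti_mul_even FA.IsTotal.phi.hasParity FA.phiIT
  rwa [FA.phiT_mul_phiIT, anti_one, anti_phi, eq_comm] at h

theorem anti_psiI : P.anti FA.psiIT = FA.psiT := by
  refine left_inv_eq_right_inv (a := FA.psiIT) ?_ FA.psiIT_mul_psiT
  have h := P.anti_mul_even FA.IsTotal.psi.hasParity FA.psiIT
  rwa [FA.psiT_mul_psiIT, anti_one, anti_psi, eq_comm] at h

end Datum

/-! ### The antipode and the coproduct -/

theorem FA.mono_mon1_induction_right {p : (Multiplicative ℕ × FreeMonoid Letter) → Prop} (h1 : p 1)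
    (hc : ∀ m, p m → p (m * (Multiplicative.ofAdd 1, 1)))
    (hy : ∀ y m, p m → p (m * (1, FreeMonoid.of y))) (m) : p m := by
  obtain ⟨n, w⟩ := m
  have h0 : ∀ w : List Letter, p (1, FreeMonoid.ofList w) := fun w => by
    induction w using List.reverseRecOn with
    | nil => exact h1
    | append_singleton m y ih => exact hy y _ ih
  have : ∀ n : ℕ, p (Multiplicative.ofAdd n, w) := fun n => by
    induction n with
    | zero => exact h0 (FreeMonoid.toList w)
    | succ n ih =>
      have := hc _ ih
      rwa [Prod.mk_mul_mk, mul_one, ← ofAdd_add] at this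
  exact this (Multiplicative.toAdd n)

namespace Datum

variable (P : Datum)

/-- `m ∘ (a ⊗ id)` -/
def antiId : FA 2 →L[ℂ] FA 1 := FA.pair P.anti (.id ℂ (FA 1))

/-- `m ∘ (id ⊗ a)` -/
def idAnti : FA 2 →L[ℂ] FA 1 := FA.pair (.id ℂ (FA 1)) P.anti

theorem sg_mono {N : ℕ} (a : ℕ) (m : Mon N) :
    FA.sg a (FA.mono m) = ((-1 : ℂ) ^ (a * parity m)) • FA.mono m :=
  FA.sg_of_hasParity (FA.hasParity_mono m)

theorem parity_mon1 (m : Multiplicative ℕ × FreeMonoid Letter) : parity (FA.mon1 m) = par m := by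
  simp [parity, FA.mon1]

theorem antiId_mul_mono (T : FA 2) (n : Mon 2) : P.antiId (T * FA.mono n) =
    P.anti (FA.mono (FA.mon1 (n 0))) * P.antiId (FA.sg (parity (FA.mon1 (n 0))) T) *
      FA.mono (FA.mon1 (n 1)) := by
  have e : P.antiId.comp (FA.mulRight (FA.mono n)) =
      ((FA.mulRight (FA.mono (FA.mon1 (n 1)))).comp
        (FA.mulLeft (P.anti (FA.mono (FA.mon1 (n 0)))))).comp
          (P.antiId.comp (FA.toCLM (FA.sg (parity (FA.mon1 (n 0)))))) := FA.clm_ext fun m => by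
    change P.antiId (FA.mono m * FA.mono n) = P.anti (FA.mono (FA.mon1 (n 0))) *
      P.antiId (FA.sg (parity (FA.mon1 (n 0))) (FA.mono m)) * FA.mono (FA.mon1 (n 1))
    rw [sg_mono, FA.mono_mul, map_smul, map_smul, antiId, FA.pair_mono, FA.pair_mono, Pi.mul_apply,
      Pi.mul_apply, FA.mono_mon1_mul, FA.mono_mon1_mul, P.anti_mul_right (FA.hasParity_mono _),
      FA.sg_of_hasParity (P.anti_parPres.map (FA.hasParity_mono (FA.mon1 (m 0)))), FA.sgn_fin_two,
      FA.parity_fin_two m, parity_mon1, parity_mon1, parity_mon1, mul_add, pow_add,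
      mul_comm (par (m 1))]
    simp only [ContinuousLinearMap.id_apply, mul_smul_comm, smul_mul_assoc, smul_smul, mul_assoc]
    rw [mul_comm ((-1 : ℂ) ^ (par (n 0) * par (m 1)))]
  exact congrArg (fun A => A T) e

theorem idAnti_mono_mul (T : FA 2) (n : Mon 2) : P.idAnti (FA.mono n * T) =
    FA.mono (FA.mon1 (n 0)) * P.idAnti (FA.sg (parity (FA.mon1 (n 1))) T) *
      P.anti (FA.mono (FA.mon1 (n 1))) := by
  have e : P.idAnti.comp (FA.mulLeft (FA.mono n)) =
      ((FA.mulRight (P.anti (FA.mono (FA.mon1 (n 1))))).comp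
        (FA.mulLeft (FA.mono (FA.mon1 (n 0))))).comp
          (P.idAnti.comp (FA.toCLM (FA.sg (parity (FA.mon1 (n 1)))))) := FA.clm_ext fun m => by
    change P.idAnti (FA.mono n * FA.mono m) = FA.mono (FA.mon1 (n 0)) *
      P.idAnti (FA.sg (parity (FA.mon1 (n 1))) (FA.mono m)) * P.anti (FA.mono (FA.mon1 (n 1)))
    rw [sg_mono, FA.mono_mul, map_smul, map_smul, idAnti, FA.pair_mono, FA.pair_mono, Pi.mul_apply,
      Pi.mul_apply, FA.mono_mon1_mul, FA.mono_mon1_mul, P.anti_mul_left (FA.hasParity_mono _),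
      FA.sg_of_hasParity (P.anti_parPres.map (FA.hasParity_mono (FA.mon1 (m 1)))), FA.sgn_fin_two,
      FA.parity_fin_two m, parity_mon1, parity_mon1, parity_mon1, mul_add, pow_add]
    simp only [ContinuousLinearMap.id_apply, mul_smul_comm, smul_mul_assoc, smul_smul, mul_assoc]
  exact congrArg (fun A => A T) e

theorem antiId_mul_eq_zero {T : FA 2} (h : ∀ a, P.antiId (FA.sg a T) = 0) (E : FA 2) :
    P.antiId (T * E) = 0 := by
  have e : P.antiId.comp (FA.mulLeft T) = 0 := FA.clm_ext fun n => by
    change P.antiId (T * FA.mono n) = 0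
    rw [antiId_mul_mono, h, mul_zero, zero_mul]
  exact congrArg (fun A => A E) e

theorem idAnti_mul_eq_zero {T : FA 2} (h : ∀ a, P.idAnti (FA.sg a T) = 0) (E : FA 2) :
    P.idAnti (E * T) = 0 := by
  have e : P.idAnti.comp (FA.mulRight T) = 0 := FA.clm_ext fun n => by
    change P.idAnti (FA.mono n * T) = 0
    rw [idAnti_mono_mul, h, mul_zero, zero_mul]
  exact congrArg (fun A => A E) e

theorem sg_delta_mono (a : ℕ) (m : Mon 1) : FA.sg a (P.delta (0 : Fin 2) 1 (FA.mono m)) =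
    ((-1 : ℂ) ^ (a * parity m)) • P.delta 0 1 (FA.mono m) :=
  FA.sg_of_hasParity ((P.delta_parPres 0 1).map (FA.hasParity_mono m))

theorem eq_zero_on_generators {B : FA 2 →L[ℂ] FA 1} (hB : FA.DegPres B)
    (ha : B (P.delta 0 1 (FA.tot .a)) = 0) (hb : B (P.delta 0 1 (FA.tot .b)) = 0)
    (hx : B (P.delta 0 1 FA.xpT) = 0) (hy : B (P.delta 0 1 FA.xmT) = 0) (y : Letter) :
    B (P.delta 0 1 (FA.gen y)) = 0 := by
  have key : ∀ {y : ℤ → Letter}, (∀ n, (y n).deg = -n) → B (P.delta 0 1 (FA.tot y)) = 0 →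
      ∀ n, B (P.delta 0 1 (FA.gen (y n))) = 0 := fun {y} hy h n => by
    have h1 := (P.delta_degPres (0 : Fin 2) 1).map_comp (FA.tot y) (-n)
    rw [FA.toCLM_apply, FA.toCLM_apply, FA.Xd_tot hy, neg_neg] at h1
    rw [h1, hB.map_comp, h]
    ext w
    by_contra hw
    exact (FA.Xd_deg_ne hw).1 rfl
  cases y with
  | a n => exact key (fun _ => rfl) ha n
  | b n => exact key (fun _ => rfl) hb n
  | xp n => exact key (fun _ => rfl) hx n
  | xm n => exact key (fun _ => rfl) hy n

theorem eq_counit {B : FA 2 →L[ℂ] FA 1} (h1 : B 1 = 1)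
    (h : ∀ m, m = 1 ∨ B (P.delta 0 1 (FA.mono (FA.mon1 m))) = 0) (f : FA 1) :
    B (P.delta 0 1 f) = algebraMap ℂ (FA 1) (FA.counitHat f) := by
  rw [← FA.eps_apply]
  have e : B.comp (FA.toCLM (P.delta 0 1)) = FA.toCLM (FA.eps 1) := FA.clm_ext fun m => by
    change B (P.delta 0 1 (FA.mono m)) = FA.eps 1 (FA.mono m)
    rw [FA.mon1_zero m]
    rcases h (m 0) with hm | hm
    · rw [hm]
      change B (P.delta 0 1 1) = FA.eps 1 1
      rw [map_one (P.delta 0 1), map_one (FA.eps 1), h1]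
    · by_cases h0 : m = 1
      · subst h0
        change B (P.delta 0 1 1) = FA.eps 1 1
        rw [map_one (P.delta 0 1), map_one (FA.eps 1), h1]
      · rw [hm, ← FA.mon1_zero, FA.eps_apply, FA.counitHat_apply,
          FA.mono_apply_ne fun e => h0 e.symm, map_zero]
  exact congrArg (fun A => A f) e

theorem scale_fin_one (s : Fin 1 → ℤ) (f : FA 1) : P.scale s f = P.cu 0 s f := by
  rw [cu, FA.slot_fin_one]

theorem antiId_delta (f : FA 1) :
    P.antiId (P.delta 0 1 f) = algebraMap ℂ (FA 1) (FA.counitHat f) := by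
  have hA := P.central_anti
  have hp := hA.pair FA.central_id
  have h0 : ∀ s f, P.antiId (P.cu 0 s f) = P.scale (s 0 • -1 + s 1 • 1) (P.anti f) := fun s f => by
    rw [antiId, pair_cu_zero hA FA.central_id]
  have h1 : ∀ s f, P.antiId (P.cu 1 s f) = P.scale (s 0 • -1 + s 1 • 1) f := fun s f => by
    rw [antiId, pair_cu_one hA FA.central_id]
    rfl
  have h2 : ∀ s t f g, P.antiId (P.cu 0 s f * P.cu 1 t g) =
      P.scale (s 0 • -1 + s 1 • 1) (P.anti f) * P.scale (t 0 • -1 + t 1 • 1) g := fun s t f g => by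
    rw [antiId, pair_cu_mul_cu hA FA.central_id]
    rfl
  have e1 : sh (0 : Fin 1) = 1 := by ext x; fin_cases x; rfl
  have e2 : (2 + -1 : Fin 1 → ℤ) = 1 := by ext x; fin_cases x; rfl
  have hy : ∀ y, P.antiId (P.delta 0 1 (FA.gen y)) = 0 := by
    refine P.eq_zero_on_generators hp.deg ?_ ?_ ?_ ?_
    · simp [delta_a, h0, h1, anti_a, sh_two_zero, sh_two_one]
    · simp [delta_b, h0, h1, anti_b, sh_two_zero, sh_two_one]
    · rw [delta_xp, dxp_coe, map_add, h0, h2, anti_xp, antiXp_coe, anti_phi, scale_fin_one,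
        scale_fin_one, scale_fin_one]
      simp [sh_two_zero, e1, P.cu_fin_one]
    · rw [delta_xm, dxm_coe, map_add, h1, h2, anti_xm, antiXm_coe, scale_fin_one _ _ FA.psiT,
        scale_fin_one _ _ FA.xmT]
      simp only [map_neg, map_mul, scale_cu, sh_two_one, e1]
      simp [mul_assoc, e2, ← P.cu_mul, FA.psiIT_mul_psiT, P.cu_one, P.cu_fin_one]
  have hc : P.antiId (P.delta 0 1 (FA.cc 0)) = 0 := by
    rw [delta_cc, map_add, ← FA.slot_cc 0, ← FA.slot_cc 1, antiId,
      FA.pair_slot_zero _ _ rfl, FA.pair_slot_one _ _ P.anti_one, anti_cc]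
    exact neg_add_cancel _
  refine P.eq_counit hp.one (fun m => ?_) f
  have step : ∀ m g, (m = 1 ∨ P.antiId (P.delta 0 1 (FA.mono (FA.mon1 m))) = 0) →
      P.antiId (P.delta 0 1 (FA.mono (FA.mon1 g))) = 0 →
      m * g = 1 ∨ P.antiId (P.delta 0 1 (FA.mono (FA.mon1 (m * g)))) = 0 := by
    rintro m g (rfl | hm) hg
    · rw [one_mul]; exact .inr hg
    · rw [FA.mono_mon1_mul, map_mul]
      exact .inr (P.antiId_mul_eq_zero (fun a => by rw [sg_delta_mono, map_smul, hm, smul_zero]) _)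
  induction m using FA.mono_mon1_induction_right with
  | h1 => exact .inl rfl
  | hc m ih => exact step m _ ih (by rw [← FA.cc_eq]; exact hc)
  | hy y m ih => exact step m _ ih (by rw [← FA.gen_eq]; exact hy y)

theorem idAnti_delta (f : FA 1) :
    P.idAnti (P.delta 0 1 f) = algebraMap ℂ (FA 1) (FA.counitHat f) := by
  have hA := P.central_anti
  have hp := FA.central_id.pair hA
  have h0 : ∀ s f, P.idAnti (P.cu 0 s f) = P.scale (s 0 • 1 + s 1 • -1) f := fun s f => by
    rw [idAnti, pair_cu_zero FA.central_id hA]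
    rfl
  have h1 : ∀ s f, P.idAnti (P.cu 1 s f) = P.scale (s 0 • 1 + s 1 • -1) (P.anti f) := fun s f => by
    rw [idAnti, pair_cu_one FA.central_id hA]
  have h2 : ∀ s t f g, P.idAnti (P.cu 0 s f * P.cu 1 t g) =
      P.scale (s 0 • 1 + s 1 • -1) f * P.scale (t 0 • 1 + t 1 • -1) (P.anti g) := fun s t f g => by
    rw [idAnti, pair_cu_mul_cu FA.central_id hA]
    rfl
  have e1 : sh (0 : Fin 1) = 1 := by ext x; fin_cases x; rfl
  have e2 : (2 + -1 : Fin 1 → ℤ) = 1 := by ext x; fin_cases x; rfl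
  have hy : ∀ y, P.idAnti (P.delta 0 1 (FA.gen y)) = 0 := by
    refine P.eq_zero_on_generators hp.deg ?_ ?_ ?_ ?_
    · simp [delta_a, h0, h1, anti_a, sh_two_zero, sh_two_one]
    · simp [delta_b, h0, h1, anti_b, sh_two_zero, sh_two_one]
    · rw [delta_xp, dxp_coe, map_add, h0, h2, anti_xp, antiXp_coe, scale_fin_one _ _ FA.phiT,
        scale_fin_one _ _ FA.xpT]
      simp only [map_neg, map_mul, scale_cu, sh_two_zero, e1]
      simp [← mul_assoc, e2, ← P.cu_mul, FA.phiT_mul_phiIT, P.cu_one, P.cu_fin_one]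
    · rw [delta_xm, dxm_coe, map_add, h1, h2, anti_xm, antiXm_coe, anti_psi, scale_fin_one,
        scale_fin_one, scale_fin_one]
      simp [sh_two_one, e1, P.cu_fin_one]
  have hc : P.idAnti (P.delta 0 1 (FA.cc 0)) = 0 := by
    rw [delta_cc, map_add, ← FA.slot_cc 0, ← FA.slot_cc 1, idAnti,
      FA.pair_slot_zero _ _ P.anti_one, FA.pair_slot_one _ _ rfl, anti_cc]
    exact add_neg_cancel _
  refine P.eq_counit hp.one (fun m => ?_) f
  have step : ∀ m g, (m = 1 ∨ P.idAnti (P.delta 0 1 (FA.mono (FA.mon1 m))) = 0) →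
      P.idAnti (P.delta 0 1 (FA.mono (FA.mon1 g))) = 0 →
      g * m = 1 ∨ P.idAnti (P.delta 0 1 (FA.mono (FA.mon1 (g * m)))) = 0 := by
    rintro m g (rfl | hm) hg
    · rw [mul_one]; exact .inr hg
    · rw [FA.mono_mon1_mul, map_mul]
      exact .inr (P.idAnti_mul_eq_zero (fun a => by rw [sg_delta_mono, map_smul, hm, smul_zero]) _)
  induction m using FA.mono_mon1_induction with
  | h1 => exact .inl rfl
  | hc m ih => exact step m _ ih (by rw [← FA.cc_eq]; exact hc)
  | hy y m ih =>
    have := step (1, m) (1, FreeMonoid.of y) ih (by rw [← FA.gen_eq]; exact hy y)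
    rwa [Prod.mk_mul_mk, one_mul] at this

end Datum

namespace Datum

variable {P : Datum} {N : ℕ}

/-! ### Quadratic relations of products -/

theorem ev_mul_swap {x x' y y' : P.R N} (hx : (fun p => ev x p.swap) = ev x')
    (hy : (fun p => ev y p.swap) = ev y') : (fun p => ev (x * y) p.swap) = ev (x' * y') := by
  simp only [ev_mul]
  rw [conv_swap, hx, hy]

theorem quad_of_swap {γ γ' δ δ' : P.LS} (h : IsSwap γ δ) (h' : IsSwap γ' δ') {X : P.acts N}
    {m m' : P.idl N} {s : P.Q N} (hm : (fun p => ev (m : P.R N) p.swap) = ev (m' : P.R N))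
    (hX : P.qw N X * P.qz N X = s * P.toQ N m) (h1 : qs 0 γ * s = qs 0 γ')
    (h2 : qs 0 δ' * s = qs 0 δ)
    (hN : P.Nl (ev (sc 0 γ * (m' : P.R N) + sc 0 γ' * (m : P.R N)))) :
    P.Nl (ev (quad γ' γ (X : FA N))) := by
  have e1 : P.toQ N (tc 0 γ * (wc X * zc X)) = P.toQ N (tc 0 γ' * m) := by
    simp only [map_mul, ← qz_eq, ← qw_eq, ← qs_eq]
    rw [hX, ← mul_assoc, h1]
  have e2 : P.toQ N (tc 0 δ' * (wc X * zc X)) = P.toQ N (tc 0 δ * m) := by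
    simp only [map_mul, ← qz_eq, ← qw_eq, ← qs_eq]
    rw [hX, ← mul_assoc, h2]
  have n1 := nl_of_mem_nul (toQ_eq_iff.1 e1)
  have n2 := (nl_of_mem_nul (toQ_eq_iff.1 e2)).swap
  have s1 := ev_mul_swap (ev_sc_swap (N := N) h')
    (ev_mul_swap (ev_zeta_swap (P := P) (X : FA N)) (ev_omega_swap (P := P) (X : FA N)))
  have hm' : (fun p => ev (m' : P.R N) p.swap) = ev (m : P.R N) := by
    rw [← hm]
    simp only [Prod.swap_swap]
  have s2 := ev_mul_swap (ev_sc_swap (N := N) h) hm'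
  have e3 : (fun p => ev ((tc 0 δ' * (wc X * zc X) : P.idl N) - (tc 0 δ * m : P.idl N) : P.R N)
      p.swap) = ev (sc 0 γ' * (zeta (X : FA N) * omega (X : FA N)) - sc 0 γ * (m' : P.R N)) := by
    rw [ev_sub, ev_sub]
    funext p
    have a1 := congrFun s1 p.swap
    have a2 := congrFun s2 p.swap
    simp only [Prod.swap_swap] at a1 a2
    rw [Pi.sub_apply, Pi.sub_apply, a1, a2]
    rfl
  rw [e3] at n2
  have := (n1.add n2).add hN
  rw [← ev_add, ← ev_add] at this
  convert this using 2
  change quad γ' γ (X : FA N) = sc 0 γ * (omega (X : FA N) * zeta (X : FA N)) - sc 0 γ' * (m : P.R N)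
    + (sc 0 γ' * (zeta (X : FA N) * omega (X : FA N)) - sc 0 γ * (m' : P.R N)) + _
  rw [quad]
  abel

theorem quad_mul_left {γ γ' δ δ' : P.LS} (h : IsSwap γ δ) (h' : IsSwap γ' δ') {A B : P.acts N}
    (hB : P.Nl (ev (quad γ γ' (B : FA N)))) (hA : Ex (P.qz N A) (P.qw N A) 1) {s : P.Q N}
    (hs : ∀ x, s * x = x * s) (hAB : Ex (P.qw N B) (P.qz N A) s) (h1 : qs 0 γ * s = qs 0 γ')
    (h2 : qs 0 δ' * s = qs 0 δ) : P.Nl (ev (quad γ' γ ((A * B : P.acts N) : FA N))) := by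
  refine quad_of_swap h h' (X := A * B) (m := wc A * zc A * (wc B * zc B))
    (m' := zc A * wc A * (zc B * wc B)) (s := s)
    (ev_mul_swap (ev_mul_swap (ev_omega_swap _) (ev_zeta_swap _))
      (ev_mul_swap (ev_omega_swap _) (ev_zeta_swap _))) ?_ h1 h2 ?_
  · simp only [map_mul, ← qz_eq, ← qw_eq]
    rw [mul_assoc, ← mul_assoc (P.qw N B), show _ * _ = _ from hAB, ← mul_assoc, ← mul_assoc, ← hs]
    simp only [mul_assoc]
  · have hN := (hB.lmulZ A.2).lmulW A.2
    rw [← ev_zeta_mul, ← ev_omega_mul] at hN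
    refine nl_of_toQ
      (a := tc 0 γ * (zc A * wc A * (zc B * wc B)) + tc 0 γ' * (wc A * zc A * (wc B * zc B)))
      (b := wc A * (zc A * (tc 0 γ * (zc B * wc B) + tc 0 γ' * (wc B * zc B)))) ?_ hN
    simp only [map_add, map_mul, ← qz_eq, ← qw_eq, ← qs_eq]
    have c : P.qz N A * P.qw N A = P.qw N A * P.qz N A := by
      rw [Ex, one_mul] at hA
      exact hA
    have hc := qs_commute (P := P) (N := N) 0
    rw [c, ← mul_assoc (P.qw N A) (P.qz N A), mul_add, ← mul_assoc _ (qs 0 γ), ← hc,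
      ← mul_assoc _ (qs 0 γ'), ← hc]
    simp only [mul_assoc]

theorem quad_mul_right {γ γ' δ δ' : P.LS} (h : IsSwap γ δ) (h' : IsSwap γ' δ') {A B : P.acts N}
    (hB : P.Nl (ev (quad γ γ' (B : FA N)))) (hA : Ex (P.qz N A) (P.qw N A) 1) {s : P.Q N}
    (hs : ∀ x, s * x = x * s) (hAB : Ex (P.qw N A) (P.qz N B) s) (h1 : qs 0 γ * s = qs 0 γ')
    (h2 : qs 0 δ' * s = qs 0 δ) : P.Nl (ev (quad γ' γ ((B * A : P.acts N) : FA N))) := by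
  refine quad_of_swap h h' (X := B * A) (m := wc B * zc B * (wc A * zc A))
    (m' := zc B * wc B * (zc A * wc A)) (s := s)
    (ev_mul_swap (ev_mul_swap (ev_omega_swap _) (ev_zeta_swap _))
      (ev_mul_swap (ev_omega_swap _) (ev_zeta_swap _))) ?_ h1 h2 ?_
  · simp only [map_mul, ← qz_eq, ← qw_eq]
    rw [mul_assoc, ← mul_assoc (P.qw N A), show _ * _ = _ from hAB, ← mul_assoc, ← mul_assoc, ← hs]
    simp only [mul_assoc]
  · have hN := (hB.rmulW A.2).rmulZ A.2
    rw [← ev_mul_omega, ← ev_mul_zeta] at hN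
    refine nl_of_toQ
      (a := tc 0 γ * (zc B * wc B * (zc A * wc A)) + tc 0 γ' * (wc B * zc B * (wc A * zc A)))
      (b := (tc 0 γ * (zc B * wc B) + tc 0 γ' * (wc B * zc B)) * wc A * zc A) ?_ hN
    simp only [map_add, map_mul, ← qz_eq, ← qw_eq, ← qs_eq]
    have c : P.qz N A * P.qw N A = P.qw N A * P.qz N A := by
      rw [Ex, one_mul] at hA
      exact hA
    rw [c, add_mul, add_mul]
    simp only [mul_assoc]

/-! ### Exchange relations of the images under the antipode -/

theorem qz_cancel {f g : P.acts N} (h : f * g = 1) : P.qz N f * P.qz N g = 1 := by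
  rw [← map_mul, h, map_one]

theorem qw_cancel {f g : P.acts N} (h : f * g = 1) : P.qw N f * P.qw N g = 1 := by
  rw [← map_mul, h, map_one]

theorem slot_phiI_phiI (i : Fin N) (s t : Fin N → ℤ) :
    Ex (P.qz N (cphiI i s)) (P.qw N (cphiI i t)) 1 :=
  ((slot_phi_phi i s t).inv_left one_commute (qz_cancel (cphi_mul_cphiI i s))
    (qz_cancel (cphiI_mul_cphi i s)) (one_mul 1)).inv_right one_commute one_commute
      (qw_cancel (cphi_mul_cphiI i t)) (qw_cancel (cphiI_mul_cphi i t)) (one_mul 1)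

theorem slot_psiI_psiI (i : Fin N) (s t : Fin N → ℤ) :
    Ex (P.qz N (cpsiI i s)) (P.qw N (cpsiI i t)) 1 :=
  ((slot_psi_psi i s t).inv_left one_commute (qz_cancel (cpsi_mul_cpsiI i s))
    (qz_cancel (cpsiI_mul_cpsi i s)) (one_mul 1)).inv_right one_commute one_commute
      (qw_cancel (cpsi_mul_cpsiI i t)) (qw_cancel (cpsiI_mul_cpsi i t)) (one_mul 1)

theorem qs_ratio_cancel (s t : Fin N → ℤ) :
    qs s P.giS * qs t P.gS * (qs s P.gS * qs t P.giS) = 1 := by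
  rw [mul_assoc, ← mul_assoc (qs t P.gS), qs_commute t P.gS, mul_assoc, qs_g_mul_gi, mul_one,
    qs_gi_mul_g]

theorem slot_phi_psiI (i : Fin N) (s t : Fin N → ℤ) :
    Ex (P.qz N (cphi i s)) (P.qw N (cpsiI i t))
      (qs (s - t + (-2 : ℤ) • sh i) P.giS * qs (s - t + (2 : ℤ) • sh i) P.gS) :=
  (slot_phi_psi i s t).inv_right (mul_commute_of (qs_commute _ _) (qs_commute _ _))
    (mul_commute_of (qs_commute _ _) (qs_commute _ _)) (qw_cancel (cpsi_mul_cpsiI i t))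
    (qw_cancel (cpsiI_mul_cpsi i t)) (qs_ratio_cancel _ _)

theorem slot_psi_phi (i : Fin N) (s t : Fin N → ℤ) :
    Ex (P.qw N (cpsi i t)) (P.qz N (cphi i s))
      (qs (s - t + (-2 : ℤ) • sh i) P.giS * qs (s - t + (2 : ℤ) • sh i) P.gS) :=
  (slot_phi_psi i s t).symm (qs_ratio_cancel _ _)

theorem slot_psi_phiI (i : Fin N) (s t : Fin N → ℤ) :
    Ex (P.qw N (cpsi i t)) (P.qz N (cphiI i s))
      (qs (s - t + (2 : ℤ) • sh i) P.giS * qs (s - t + (-2 : ℤ) • sh i) P.gS) := by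
  refine (slot_psi_phi i s t).inv_right (mul_commute_of (qs_commute _ _) (qs_commute _ _))
    (mul_commute_of (qs_commute _ _) (qs_commute _ _)) (qz_cancel (cphi_mul_cphiI i s))
    (qz_cancel (cphiI_mul_cphi i s)) ?_
  rw [qs_commute (s - t + (-2 : ℤ) • sh i) P.giS (qs (s - t + (2 : ℤ) • sh i) P.gS)]
  exact qs_ratio_cancel _ _

theorem slot_psiI_phiI (i : Fin N) (s t : Fin N → ℤ) :
    Ex (P.qw N (cpsiI i t)) (P.qz N (cphiI i s))
      (qs (s - t + (-2 : ℤ) • sh i) P.giS * qs (s - t + (2 : ℤ) • sh i) P.gS) := by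
  refine (slot_psi_phiI i s t).inv_left (mul_commute_of (qs_commute _ _) (qs_commute _ _))
    (qw_cancel (cpsi_mul_cpsiI i t)) (qw_cancel (cpsiI_mul_cpsi i t)) ?_
  rw [qs_commute (s - t + (2 : ℤ) • sh i) P.giS (qs (s - t + (-2 : ℤ) • sh i) P.gS)]
  exact qs_ratio_cancel _ _

theorem slot_xp_phiI (i : Fin N) (s t : Fin N → ℤ) :
    Ex (P.qw N (cxp i t)) (P.qz N (cphiI i s)) (qs (s - t + (-1 : ℤ) • sh i) P.gS) :=
  ((slot_phi_xp i s t).inv_left (qs_commute _ _) (qz_cancel (cphi_mul_cphiI i s))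
    (qz_cancel (cphiI_mul_cphi i s)) (qs_gi_mul_g _)).symm (qs_g_mul_gi _)

theorem slot_xm_phiI (i : Fin N) (s t : Fin N → ℤ) :
    Ex (P.qw N (cxm i t)) (P.qz N (cphiI i s)) (qs (s - t + (1 : ℤ) • sh i) P.giS) :=
  ((slot_phi_xm i s t).inv_left (qs_commute _ _) (qz_cancel (cphi_mul_cphiI i s))
    (qz_cancel (cphiI_mul_cphi i s)) (qs_g_mul_gi _)).symm (qs_gi_mul_g _)

theorem slot_psiI_xp (i : Fin N) (s t : Fin N → ℤ) :
    Ex (P.qw N (cpsiI i t)) (P.qz N (cxp i s)) (qs (s - t + (-1 : ℤ) • sh i) P.gS) :=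
  (slot_psi_xp i s t).inv_left (qs_commute _ _) (qw_cancel (cpsi_mul_cpsiI i t))
    (qw_cancel (cpsiI_mul_cpsi i t)) (qs_g_mul_gi _)

theorem slot_psiI_xm (i : Fin N) (s t : Fin N → ℤ) :
    Ex (P.qw N (cpsiI i t)) (P.qz N (cxm i s)) (qs (s - t + (1 : ℤ) • sh i) P.giS) :=
  (slot_psi_xm i s t).inv_left (qs_commute _ _) (qw_cancel (cpsi_mul_cpsiI i t))
    (qw_cancel (cpsiI_mul_cpsi i t)) (qs_gi_mul_g _)

theorem anti_fx : Ex (P.qz 1 (cphi 0 0)) (P.qw 1 P.antiXp) (qs (sh 0) P.gS) := by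
  rw [antiXp, map_neg, map_mul]
  refine (Ex.mul_right (qs_commute _ _) ((slot_phi_phi 0 0 _).inv_right one_commute one_commute
    (qw_cancel (cphi_mul_cphiI 0 _)) (qw_cancel (cphiI_mul_cphi 0 _)) (one_mul 1))
    (slot_phi_xp 0 0 _)).neg_right.congr ?_
  rw [one_mul]
  congr 2
  module

theorem anti_fy : Ex (P.qz 1 (cphi 0 0)) (P.qw 1 P.antiXm) (qs (-sh 0) P.giS) := by
  rw [antiXm, map_neg, map_mul]
  refine (Ex.mul_right (mul_commute_of (qs_commute _ _) (qs_commute _ _)) (slot_phi_xm 0 0 _)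
    (slot_phi_psiI 0 0 _)).neg_right.congr ?_
  have e1 : (0 - (-2 : ℤ) • sh 0 + (1 : ℤ) • sh 0 : Fin 1 → ℤ) = 0 - -sh 0 + (2 : ℤ) • sh 0 := by
    module
  have e2 : (0 - -sh 0 + (-2 : ℤ) • sh 0 : Fin 1 → ℤ) = -sh 0 := by module
  rw [e1, e2, qs_commute (-sh 0), ← mul_assoc, qs_gi_mul_g, one_mul]

theorem anti_gx : Ex (P.qw 1 (cpsi 0 0)) (P.qz 1 P.antiXp) (qs (sh 0) P.giS) := by
  rw [antiXp, map_neg, map_mul]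
  refine (Ex.mul_right (qs_commute _ _) (slot_psi_phiI 0 _ 0)
    (slot_psi_xp 0 _ 0)).neg_right.congr ?_
  have e1 : ((-2 : ℤ) • sh 0 - 0 + (-1 : ℤ) • sh 0 : Fin 1 → ℤ) = -sh 0 - 0 + (-2 : ℤ) • sh 0 := by
    module
  have e2 : (-sh 0 - 0 + (2 : ℤ) • sh 0 : Fin 1 → ℤ) = sh 0 := by module
  rw [e1, e2, mul_assoc, qs_g_mul_gi, mul_one]

theorem anti_gy : Ex (P.qw 1 (cpsi 0 0)) (P.qz 1 P.antiXm) (qs (-sh 0) P.gS) := by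
  rw [antiXm, map_neg, map_mul]
  refine (Ex.mul_right one_commute (slot_psi_xm 0 _ 0)
    (((slot_psi_psi 0 _ 0).inv_left one_commute (qz_cancel (cpsi_mul_cpsiI 0 _))
      (qz_cancel (cpsiI_mul_cpsi 0 _)) (one_mul 1)).symm (one_mul 1))).neg_right.congr ?_
  rw [mul_one]
  congr 2
  module

theorem anti_xx : P.Nl (ev (quad P.GpS P.GmS (P.antiXp : FA 1))) := by
  have h := quad_mul_left isSwap_Gm isSwap_Gp (slot_quad_xp (P := P) (0 : Fin 1) ((-2 : ℤ) • sh 0))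
    (A := cphiI 0 (-sh 0)) (B := cxp 0 ((-2 : ℤ) • sh 0)) (slot_phiI_phiI 0 _ _)
    (qs_commute 0 P.gS) ((slot_xp_phiI 0 _ _).congr ?_) ?_ ?_
  · rw [← quad_neg] at h
    exact h
  · congr 2
    module
  · rw [← map_mul, P.GmS_mul_gS]
  · rw [← map_mul, P.GpInvS_mul_gS]

theorem anti_yy : P.Nl (ev (quad P.GmS P.GpS (P.antiXm : FA 1))) := by
  have h := quad_mul_right isSwap_Gp isSwap_Gm (slot_quad_xm (P := P) (0 : Fin 1) ((-2 : ℤ) • sh 0))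
    (A := cpsiI 0 (-sh 0)) (B := cxm 0 ((-2 : ℤ) • sh 0)) (slot_psiI_psiI 0 _ _)
    (qs_commute 0 P.giS) ((slot_psiI_xm 0 _ _).congr ?_) ?_ ?_
  · rw [← quad_neg] at h
    exact h
  · congr 2
    module
  · rw [← map_mul, P.GpS_mul_giS]
  · rw [← map_mul, P.GmInvS_mul_giS]

end Datum

namespace Datum

variable {P : Datum}

theorem anti_xy : P.Nl (ev (zeta (P.antiXp : FA 1) * omega (P.antiXm : FA 1) +
    omega (P.antiXm : FA 1) * zeta (P.antiXp : FA 1) : P.R 1) + (P.q - P.q⁻¹)⁻¹ •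
      (rmul degW (P.fn ((2 : ℤ) • sh 0) fun _ => 1) (P.cu 0 (-sh 0) FA.psiIT) -
        rmul degZ (P.fn ((-2 : ℤ) • sh 0) fun _ => 1) (P.cu 0 (-sh 0) FA.phiIT))) := by
  set A : P.acts 1 := cphiI 0 (-sh 0) with hA
  set B : P.acts 1 := cxp 0 ((-2 : ℤ) • sh 0) with hB
  set C : P.acts 1 := cxm 0 ((-2 : ℤ) • sh 0) with hC
  set D : P.acts 1 := cpsiI 0 (-sh 0) with hD
  have h1 := ((slot_xpxm (P := P) (0 : Fin 1) ((-2 : ℤ) • sh 0) ((-2 : ℤ) • sh 0)).lmulZ A.2).rmulW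
    D.2
  have h2 : P.Nl (ev (omega (C : FA 1) * omega (D : FA 1) * (zeta (A : FA 1) * zeta (B : FA 1)) -
      zeta (A : FA 1) * (omega (C : FA 1) * zeta (B : FA 1)) * omega (D : FA 1) : P.R 1)) := by
    refine nl_of_mem_nul ((toQ_eq_iff (a := wc C * wc D * (zc A * zc B))
      (b := zc A * (wc C * zc B) * wc D)).1 ?_)
    simp only [map_mul, ← qz_eq, ← qw_eq]
    have c1 : P.qw 1 D * P.qz 1 A = _ * (P.qz 1 A * P.qw 1 D) := slot_psiI_phiI 0 _ _
    have c2 : P.qw 1 C * P.qz 1 A = _ * (P.qz 1 A * P.qw 1 C) := slot_xm_phiI 0 _ _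
    have c3 : P.qw 1 D * P.qz 1 B = _ * (P.qz 1 B * P.qw 1 D) := slot_psiI_xp 0 _ _
    have e1 : (-sh 0 - (-2 : ℤ) • sh 0 + (1 : ℤ) • sh 0 : Fin 1 → ℤ) = (2 : ℤ) • sh 0 := by module
    have e2 : ((-2 : ℤ) • sh 0 - -sh 0 + (-1 : ℤ) • sh 0 : Fin 1 → ℤ) = (-2 : ℤ) • sh 0 := by module
    have e3 : (-sh 0 - -sh 0 + (2 : ℤ) • sh 0 : Fin 1 → ℤ) = (2 : ℤ) • sh 0 := by module
    have e4 : (-sh 0 - -sh 0 + (-2 : ℤ) • sh 0 : Fin 1 → ℤ) = (-2 : ℤ) • sh 0 := by module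
    rw [e3, e4] at c1
    rw [e1] at c2
    rw [e2] at c3
    set γ : P.Q 1 := qs ((-2 : ℤ) • sh 0) P.giS * qs ((2 : ℤ) • sh 0) P.gS
    have hg : ∀ x, γ * x = x * γ := mul_commute_of (qs_commute _ _) (qs_commute _ _)
    have hg2 := qs_commute (P := P) ((-2 : ℤ) • sh (0 : Fin 1)) P.gS
    calc P.qw 1 C * P.qw 1 D * (P.qz 1 A * P.qz 1 B)
        = P.qw 1 C * (P.qw 1 D * P.qz 1 A) * P.qz 1 B := by simp only [mul_assoc]
      _ = γ * (P.qw 1 C * P.qz 1 A * (P.qw 1 D * P.qz 1 B)) := by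
        rw [c1, ← mul_assoc (P.qw 1 C), ← hg]
        simp only [mul_assoc]
      _ = γ * (qs ((2 : ℤ) • sh 0) P.giS * qs ((-2 : ℤ) • sh 0) P.gS) *
          (P.qz 1 A * P.qw 1 C * (P.qz 1 B * P.qw 1 D)) := by
        rw [c2, c3, ← mul_assoc _ (qs ((-2 : ℤ) • sh 0) P.gS), ← hg2,
          ← mul_assoc (qs ((-2 : ℤ) • sh 0) P.gS), hg2 (qs _ P.giS)]
        simp only [mul_assoc]
      _ = _ := by
        rw [← hg2 (qs _ P.giS), qs_ratio_cancel, one_mul]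
        simp only [mul_assoc]
  have E : (zeta (P.antiXp : FA 1) * omega (P.antiXm : FA 1) +
      omega (P.antiXm : FA 1) * zeta (P.antiXp : FA 1) : P.R 1) =
      zeta (A : FA 1) * (zeta (B : FA 1) * omega (C : FA 1) + omega (C : FA 1) * zeta (B : FA 1)) *
        omega (D : FA 1) +
      (omega (C : FA 1) * omega (D : FA 1) * (zeta (A : FA 1) * zeta (B : FA 1)) -
        zeta (A : FA 1) * (omega (C : FA 1) * zeta (B : FA 1)) * omega (D : FA 1)) := by
    have a1 : (P.antiXp : FA 1) = -(A * B) := rfl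
    have a2 : (P.antiXm : FA 1) = -(C * D) := rfl
    rw [a1, a2, map_neg, map_neg, map_mul, map_mul]
    noncomm_ring
  have s1 : P.scale ((-2 : ℤ) • sh 0 + sh 0) (FA.slot (0 : Fin 1) FA.phiT) = P.cu 0 (-sh 0) FA.phiT := by
    rw [cu]
    congr 1
  have s2 : P.scale ((-2 : ℤ) • sh 0 + sh 0) (FA.slot (0 : Fin 1) FA.psiT) = P.cu 0 (-sh 0) FA.psiT := by
    rw [cu]
    congr 1
  have i1 : (A : FA 1) * P.cu 0 (-sh 0) FA.phiT = 1 := congrArg Subtype.val (cphiI_mul_cphi 0 (-sh 0))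
  have i2 : P.cu 0 (-sh 0) FA.psiT * (D : FA 1) = 1 := congrArg Subtype.val (cpsi_mul_cpsiI 0 (-sh 0))
  have key := h1.add h2
  convert key using 1
  have b1 : P.cu 0 ((-2 : ℤ) • sh 0) FA.xpT = (B : FA 1) := rfl
  have b2 : P.cu 0 ((-2 : ℤ) • sh 0) FA.xmT = (C : FA 1) := rfl
  rw [b1, b2, E, ev_add, ev_mul_omega, ev_zeta_mul, xpxm, lmul_sub_right, lmul_smul_right, lmul_sub_right,
    rmul_sub_left, rmul_smul_left, rmul_sub_left, s1, s2, lmul_rmul degZ degW, ← rmul_mul, i2,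
    rmul_one, rmul_eq_lmul_of_scal degZ (P.cu 0 (-sh 0) FA.phiT) _ (fn_scal _ _), ← lmul_mul, i1,
    lmul_one, sub_self, zero_add, zero_add,
    ← rmul_eq_lmul_of_scal degZ (A : FA 1) _ (fn_scal _ _)]
  change _ + _ + _ • (rmul degW _ (D : FA 1) - rmul degZ _ (A : FA 1)) = _
  simp only [smul_sub]
  abel

/-! ### The antipode respects the relations -/

theorem mapR_anti_even {x : P.R 1} (hx : HasParity 0 x) (y : P.R 1) :
    mapR P.anti (x * y) = mapR P.anti y * mapR P.anti x := by
  rw [mapR_mul_anti P.anti_degPres 1 fun r s => ?_, one_smul]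
  rw [one_smul]
  exact P.anti_mul_even (ev_hasParity hx r) _

theorem mapR_even_anti {y : P.R 1} (hy : HasParity 0 y) (x : P.R 1) :
    mapR P.anti (x * y) = mapR P.anti y * mapR P.anti x := by
  rw [mapR_mul_anti P.anti_degPres 1 fun r s => ?_, one_smul]
  rw [one_smul]
  exact P.anti_even_mul (ev_hasParity hy s) _

theorem mapR_anti_odd {x y : P.R 1} (hx : HasParity 1 x) (hy : HasParity 1 y) :
    mapR P.anti (x * y) = -(mapR P.anti y * mapR P.anti x) := by
  rw [mapR_mul_anti P.anti_degPres (-1) fun r s => ?_, neg_one_smul]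
  rw [P.anti_mul_left (a := 1) (FA.hasParity_cast Nat.cast_one (ev_hasParity hx r)),
    FA.sg_one_odd (P.anti_parPres.map (ev_hasParity hy s)), neg_mul, neg_one_smul]

theorem anti_qPow (t : Fin 1 → ℤ) : P.anti (P.qPow t) = P.qPow (-t) := by
  rw [central_qPow P.central_anti]
  congr 1
  ext i
  simp [Subsingleton.elim i 0]

theorem mapR_anti_sc (t : Fin 1 → ℤ) (γ : P.LS) :
    mapR P.anti (sc t γ : P.R 1) = sc (-t) γ :=
  mapR_sc P.anti_degPres (fun n => by rw [anti_qPow, smul_neg]) γ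

theorem anti_fn (t : Fin 1 → ℤ) (γ : ℤ → ℂ) : (fun p => P.anti (P.fn t γ p)) = P.fn (-t) γ := by
  funext p
  rw [fn, fn]
  by_cases hp : p.1 + p.2 = 0
  · rw [ratio_of_eq hp, ratio_of_eq hp, map_smul, anti_qPow, smul_neg]
  · rw [ratio_of_ne hp, ratio_of_ne hp, map_zero]

theorem anti_scale (s : Fin 1 → ℤ) (f : FA 1) : P.anti (P.scale s f) = P.scale (-s) (P.anti f) := by
  rw [central_scale P.central_anti]
  refine congrArg (fun s => P.scale s (P.anti f)) ?_
  ext i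
  simp [Subsingleton.elim i 0]

theorem Xd_hasParity {Γ : Type} [AddCommGroup Γ] (χ : Mon 1 →* Multiplicative Γ) {d : ZMod 2}
    {f : FA 1} (hf : HasParity d f) (r : Γ) : HasParity d (Xd χ f r) := fun w hw =>
  hf w fun h => hw (by rw [Xd, h, ite_self])

theorem anti_lmul {Γ : Type} [AddCommGroup Γ] (ψ : Multiplicative ℤ →* Multiplicative Γ) {a : ℕ}
    {f : FA 1} (hf : HasParity (a : ZMod 2) f) (D : Γ → FA 1) :
    (fun p => P.anti (lmul (ψ.comp deg) f D p)) =
      rmul (ψ.comp deg) (fun p => FA.sg a (P.anti (D p))) (P.anti f) := by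
  funext p
  refine HasSum.unique ((hasSum_lmul (ψ.comp deg) f D p).mapL P.anti) ?_
  rw [← (Equiv.subLeft p).hasSum_iff]
  convert hasSum_rmul (ψ.comp deg) (P.anti f) (fun p => FA.sg a (P.anti (D p))) p using 1
  funext r
  simp only [Function.comp_apply, Equiv.subLeft_apply, sub_sub_cancel]
  rw [P.anti_mul_left (Xd_hasParity _ hf _), P.anti_degPres.map_Xd]

theorem anti_rmul {Γ : Type} [AddCommGroup Γ] (ψ : Multiplicative ℤ →* Multiplicative Γ) {a : ℕ}
    {f : FA 1} (hf : HasParity (a : ZMod 2) f) (D : Γ → FA 1) :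
    (fun p => P.anti (rmul (ψ.comp deg) D f p)) =
      lmul (ψ.comp deg) (P.anti f) (fun p => FA.sg a (P.anti (D p))) := by
  funext p
  refine HasSum.unique ((hasSum_rmul (ψ.comp deg) f D p).mapL P.anti) ?_
  rw [← (Equiv.subLeft p).hasSum_iff]
  convert hasSum_lmul (ψ.comp deg) (P.anti f) (fun p => FA.sg a (P.anti (D p))) p using 1
  funext r
  simp only [Function.comp_apply, Equiv.subLeft_apply, sub_sub_cancel]
  rw [P.anti_mul_right (Xd_hasParity _ hf _), P.anti_degPres.map_Xd]

theorem anti_rmul_fn (ψ : Multiplicative ℤ →* Multiplicative (ℤ × ℤ)) {f : FA 1}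
    (hf : HasParity 0 f) (t : Fin 1 → ℤ) (γ : ℤ → ℂ) :
    (fun p => P.anti (rmul (ψ.comp deg) (P.fn t γ) f p)) =
      rmul (ψ.comp deg) (P.fn (-t) γ) (P.anti f) := by
  rw [anti_rmul ψ (a := 0) (FA.hasParity_cast Nat.cast_zero hf)]
  simp only [FA.sg_zero]
  rw [anti_fn, rmul_eq_lmul_of_scal _ _ _ (fn_scal _ _)]

end Datum

namespace Datum

variable {P : Datum}

theorem anti_exchange_of {F FI G GI X Y : P.acts 1} (hF : P.anti FA.phiT = FI)
    (hFI : P.anti FA.phiIT = F) (hG : P.anti FA.psiT = GI) (hGI : P.anti FA.psiIT = G)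
    (hX : P.anti FA.xpT = X) (hY : P.anti FA.xmT = Y) (iF : F * FI = 1) (iG : G * GI = 1)
    (ff : Ex (P.qz 1 FI) (P.qw 1 FI) 1) (gg : Ex (P.qz 1 GI) (P.qw 1 GI) 1)
    (gf : Ex (P.qw 1 G) (P.qz 1 F) (qs (-![2]) P.giS * qs (-![-2]) P.gS))
    (fx : Ex (P.qz 1 F) (P.qw 1 X) (qs (-![-1]) P.gS))
    (fy : Ex (P.qz 1 F) (P.qw 1 Y) (qs (-![1]) P.giS))
    (gx : Ex (P.qw 1 G) (P.qz 1 X) (qs (-![-1]) P.giS))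
    (gy : Ex (P.qw 1 G) (P.qz 1 Y) (qs (-![1]) P.gS)) {r : P.R 1} (hr : ExchangeSer r) :
    mapR P.anti r ∈ P.nul 1 := by
  have hd := P.anti_degPres
  have zF : HasParity 0 (zeta FA.phiT : P.R 1) := zeta_hasParity FA.IsTotal.phi.hasParity
  have zFI : HasParity 0 (zeta FA.phiIT : P.R 1) := zeta_hasParity FA.IsTotal.phiInv.hasParity
  have wF : HasParity 0 (omega FA.phiT : P.R 1) := omega_hasParity FA.IsTotal.phi.hasParity
  have zG : HasParity 0 (zeta FA.psiT : P.R 1) := zeta_hasParity FA.IsTotal.psi.hasParity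
  have wG : HasParity 0 (omega FA.psiT : P.R 1) := omega_hasParity FA.IsTotal.psi.hasParity
  have wGI : HasParity 0 (omega FA.psiIT : P.R 1) := omega_hasParity FA.IsTotal.psiInv.hasParity
  have sE : ∀ t γ, HasParity 0 (sc t γ : P.R 1) := fun t γ => (sc_scal t γ).hasParity
  have jF := qz_cancel iF
  have jG := qw_cancel iG
  cases hr with
  | phi_phi =>
    rw [mapR_sub hd, mapR_anti_even zF, mapR_anti_even wF, mapR_zeta hd, mapR_omega hd, hF]
    rw [Ex, one_mul] at ff
    exact (toQ_eq_iff (a := wc FI * zc FI) (b := zc FI * wc FI)).1 ff.symm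
  | psi_psi =>
    rw [mapR_sub hd, mapR_anti_even zG, mapR_anti_even wG, mapR_zeta hd, mapR_omega hd, hG]
    rw [Ex, one_mul] at gg
    exact (toQ_eq_iff (a := wc GI * zc GI) (b := zc GI * wc GI)).1 gg.symm
  | phi_psi =>
    rw [mapR_sub hd, mapR_even_anti wGI, mapR_even_anti zFI, mapR_even_anti wG,
      mapR_anti_even (sE _ _), mapR_anti_sc, mapR_anti_sc, mapR_zeta hd, mapR_omega hd,
      mapR_zeta hd, mapR_omega hd, hF, hG, hFI, hGI]
    refine (toQ_eq_iff (a := wc G * (zc F * (wc GI * zc FI)))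
      (b := tc (-![2]) P.giS * tc (-![-2]) P.gS)).1 ?_
    simp only [map_mul, ← qz_eq, ← qw_eq, ← qs_eq]
    rw [← mul_assoc, show _ * _ = _ from gf]
    simp only [mul_assoc]
    rw [← mul_assoc (P.qw 1 _), jG, one_mul, jF, mul_one]
  | phi_xp =>
    rw [mapR_sub hd, mapR_even_anti zFI, mapR_anti_even zF, mapR_anti_even (sE _ _), mapR_anti_sc,
      mapR_zeta hd, mapR_omega hd, mapR_zeta hd, hF, hFI, hX]
    refine (toQ_eq_iff (a := zc F * (wc X * zc FI)) (b := wc X * tc (-![-1]) P.gS)).1 ?_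
    simp only [map_mul, ← qz_eq, ← qw_eq, ← qs_eq]
    rw [← mul_assoc, fx.conj jF, qs_commute]
  | phi_xm =>
    rw [mapR_sub hd, mapR_even_anti zFI, mapR_anti_even zF, mapR_anti_even (sE _ _), mapR_anti_sc,
      mapR_zeta hd, mapR_omega hd, mapR_zeta hd, hF, hFI, hY]
    refine (toQ_eq_iff (a := zc F * (wc Y * zc FI)) (b := wc Y * tc (-![1]) P.giS)).1 ?_
    simp only [map_mul, ← qz_eq, ← qw_eq, ← qs_eq]
    rw [← mul_assoc, fy.conj jF, qs_commute]
  | psi_xp =>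
    rw [mapR_sub hd, mapR_even_anti wGI, mapR_anti_even wG, mapR_anti_even (sE _ _), mapR_anti_sc,
      mapR_zeta hd, mapR_omega hd, mapR_omega hd, hG, hGI, hX]
    refine (toQ_eq_iff (a := wc G * (zc X * wc GI)) (b := zc X * tc (-![-1]) P.giS)).1 ?_
    simp only [map_mul, ← qz_eq, ← qw_eq, ← qs_eq]
    rw [← mul_assoc, gx.conj jG, qs_commute]
  | psi_xm =>
    rw [mapR_sub hd, mapR_even_anti wGI, mapR_anti_even wG, mapR_anti_even (sE _ _), mapR_anti_sc,
      mapR_zeta hd, mapR_omega hd, mapR_omega hd, hG, hGI, hY]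
    refine (toQ_eq_iff (a := wc G * (zc Y * wc GI)) (b := zc Y * tc (-![1]) P.gS)).1 ?_
    simp only [map_mul, ← qz_eq, ← qw_eq, ← qs_eq]
    rw [← mul_assoc, gy.conj jG, qs_commute]

theorem anti_exchange {r : P.R 1} (hr : ExchangeSer r) : mapR P.anti r ∈ P.nul 1 := by
  have n : ∀ n : ℤ, -(![n] : Fin 1 → ℤ) = (-n) • sh 0 := fun n => by
    ext i
    simp [Subsingleton.elim i 0]
  refine anti_exchange_of (F := cphi 0 0) (FI := cphiI 0 0) (G := cpsi 0 0) (GI := cpsiI 0 0)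
    (P.anti_phi.trans (P.cu_fin_one _).symm) (P.anti_phiI.trans (P.cu_fin_one _).symm)
    (P.anti_psi.trans (P.cu_fin_one _).symm) (P.anti_psiI.trans (P.cu_fin_one _).symm)
    P.anti_xp P.anti_xm (cphi_mul_cphiI 0 0) (cpsi_mul_cpsiI 0 0) (slot_phiI_phiI 0 0 0)
    (slot_psiI_psiI 0 0 0) ?_ ?_ ?_ ?_ ?_ hr
  · refine (slot_psi_phi 0 0 0).congr ?_
    rw [n, n, sub_self, zero_add, zero_add, neg_neg]
  · exact anti_fx.congr (by rw [n, neg_neg, one_smul])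
  · exact anti_fy.congr (by rw [n, neg_smul, one_smul])
  · exact anti_gx.congr (by rw [n, neg_neg, one_smul])
  · exact anti_gy.congr (by rw [n, neg_smul, one_smul])

theorem anti_quad {γ γ' : P.LS} {X : FA 1} (hX : HasParity 1 X) :
    mapR P.anti (quad γ γ' X) = -quad γ' γ (P.anti X) := by
  have hd := P.anti_degPres
  have hz : HasParity 1 (zeta X : P.R 1) := zeta_hasParity hX
  have hw : HasParity 1 (omega X : P.R 1) := omega_hasParity hX
  rw [quad, mapR_add hd, mapR_anti_even (sc_scal _ _).hasParity,
    mapR_anti_even (sc_scal _ _).hasParity, mapR_anti_odd hz hw, mapR_anti_odd hw hz, mapR_anti_sc,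
    mapR_anti_sc, mapR_zeta hd, mapR_omega hd, neg_zero, ← (sc_scal 0 γ).commute,
    ← (sc_scal 0 γ').commute, quad]
  noncomm_ring

theorem anti_other {R : Dist 1} (hR : P.OtherSer R) : P.Nl fun p => P.anti (R p) := by
  have hd := P.anti_degPres
  have quad_case : ∀ {γ γ' : P.LS} {X : FA 1}, HasParity 1 X → P.Nl (ev (quad γ' γ (P.anti X))) →
      P.Nl fun p => P.anti (ev (quad γ γ' X) p) := fun {γ γ' X} hX h => by
    have e : (fun p => P.anti (ev (quad γ γ' X) p)) = -ev (quad γ' γ (P.anti X)) := by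
      rw [← ev_neg, ← anti_quad hX]
      exact funext fun p => (ev_mapR hd _ p).symm
    rw [e]
    exact h.neg
  cases hR with
  | xp_xm =>
    have hz : HasParity 1 (zeta FA.xpT : P.R 1) := zeta_hasParity FA.IsTotal.xp.hasParity
    have hw : HasParity 1 (omega FA.xmT : P.R 1) := omega_hasParity FA.IsTotal.xm.hasParity
    have h1 := mapR_add hd (zeta FA.xpT * omega FA.xmT : P.R 1) (omega FA.xmT * zeta FA.xpT)
    rw [mapR_anti_odd hz hw, mapR_anti_odd hw hz, mapR_zeta hd, mapR_omega hd, anti_xp, anti_xm]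
      at h1
    have e1 : (1 : Fin 1 → ℤ) = sh 0 := by ext i; simp [Subsingleton.elim i 0]
    have h2 : (fun p => P.anti (rmul degW (P.fn ((-2 : ℤ) • 1) fun _ => 1) (P.scale 1 FA.psiT) p)) =
        rmul degW (P.fn ((2 : ℤ) • sh 0) fun _ => 1) (P.cu 0 (-sh 0) FA.psiIT) := by
      refine (anti_rmul_fn _ (P.scale_hasParity FA.IsTotal.psi.hasParity 1) _ _).trans ?_
      rw [anti_scale, anti_psi, scale_fin_one, e1, ← neg_smul, neg_neg]
      rfl
    have h3 : (fun p => P.anti (rmul degZ (P.fn ((2 : ℤ) • 1) fun _ => 1) (P.scale 1 FA.phiT) p)) =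
        rmul degZ (P.fn ((-2 : ℤ) • sh 0) fun _ => 1) (P.cu 0 (-sh 0) FA.phiIT) := by
      refine (anti_rmul_fn _ (P.scale_hasParity FA.IsTotal.phi.hasParity 1) _ _).trans ?_
      rw [anti_scale, anti_phi, scale_fin_one, e1, ← neg_smul]
      rfl
    convert (anti_xy (P := P)).neg using 1
    rw [← h2, ← h3]
    funext p
    have h1' := congrFun (congrArg ev h1) p
    rw [ev_mapR hd, ← neg_add, ev_neg, Pi.neg_apply, add_comm (omega _ * _)] at h1'
    simp only [xpxm, Pi.sub_apply, Pi.smul_apply, Pi.neg_apply, Pi.add_apply, map_sub, map_smul,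
      sub_self, zero_add]
    rw [h1']
    abel
  | xp_xp =>
    refine quad_case FA.IsTotal.xp.hasParity ?_
    rw [anti_xp]
    exact anti_xx
  | xm_xm =>
    refine quad_case FA.IsTotal.xm.hasParity ?_
    rw [anti_xm]
    exact anti_yy

theorem anti_mem_acts (s : Fin 1 → ℤ) {f : FA 1} {d : ZMod 2} (hf : FA.IsTotal f d) :
    P.anti (P.cu 0 s f) ∈ P.acts 1 := by
  rw [← scale_fin_one, anti_scale]
  refine scale_mem_acts ?_ _
  have h : ∀ {f d}, FA.IsTotal f d → f ∈ P.acts 1 := fun {f d} hf => by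
    have := cu_mem_acts (P := P) (0 : Fin 1) 0 hf
    rwa [P.cu_fin_one] at this
  cases hf with
  | xp => rw [anti_xp]; exact P.antiXp.2
  | xm => rw [anti_xm]; exact P.antiXm.2
  | phi => rw [anti_phi]; exact h .phiInv
  | phiInv => rw [anti_phiI]; exact h .phi
  | psi => rw [anti_psi]; exact h .psiInv
  | psiInv => rw [anti_psiI]; exact h .psi

theorem nl_anti {D : Dist 1} (hD : P.Null 1 D) : P.Nl fun p => P.anti (D p) := by
  have hd := P.anti_degPres
  have hs := P.anti_scalPres
  induction hD with
  | exchange i R hR F hF =>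
    obtain ⟨r, hr, rfl⟩ := exists_exchangeSer hR
    have h := anti_exchange hr (mapR P.anti (scalR F hF)) (mapR_scal hd hs (scalR_scal F hF))
    convert h using 1
    have e2 : (fun p => FA.slot i (ev r p)) = ev r := funext fun p => by
      rw [Subsingleton.elim i 0, FA.slot_fin_one]
    rw [e2, (mapR_scal hd hs (scalR_scal F hF)).commute, ← mapR_anti_even (scalR_scal F hF).hasParity,
      ← ev_scalR F hF, ← ev_mul]
    exact funext fun p => (ev_mapR hd _ p).symm
  | other i R hR =>
    have e : (fun p => P.anti (FA.slot i (R p))) = fun p => P.anti (R p) := funext fun p => by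
      rw [Subsingleton.elim i 0, FA.slot_fin_one]
    rw [e]
    exact anti_other (otherSer hR)
  | add D E _ _ hD hE =>
    have := hD.add hE
    convert this using 1
    funext p
    simp only [Pi.add_apply, map_add]
  | swap D _ hD => exact hD.swap
  | rescale D _ s t hD =>
    have := hD.rescale (-s) (-t)
    convert this using 1
    funext p
    rw [P.central_anti.mul _ _ (P.qPow_scal _), anti_qPow]
    congr 2
    module
  | scalar D _ F hF hsum hD =>
    have e : ∀ r, ratio (fun n => P.anti (F n)) r = P.anti (ratio F r) := fun r => by
      by_cases hr : r.1 + r.2 = 0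
      · rw [ratio_of_eq hr, ratio_of_eq hr]
      · rw [ratio_of_ne hr, ratio_of_ne hr, map_zero]
    have hF' : ∀ r, LettersIn ∅ (ratio F r) := fun r => by
      by_cases hr : r.1 + r.2 = 0
      · rw [ratio_of_eq hr]
        exact fun w hw i _ => hF.1 _ w hw i
      · rw [ratio_of_ne hr]
        exact fun w hw => absurd rfl hw
    have h1 : ∀ p, HasSum (fun r => ratio (fun n => P.anti (F n)) r * P.anti (D (p - r)))
        (P.anti (conv (ratio F) D p)) := fun p => by
      simp only [e, ← P.central_anti.mul _ _ (hF' _)]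
      exact (hsum p).hasSum.mapL P.anti
    have := hD.scalar (isScalarSeries_map hs (fun r hr => hr) hF) fun p => (h1 p).summable
    convert this using 1
    exact funext fun p => (h1 p).tsum_eq.symm
  | left D _ i s X hX hD =>
    obtain ⟨f, d, hf, rfl⟩ := FA.exists_isTotal hX
    obtain rfl := Subsingleton.elim i 0
    rw [P.curZ_Xd, conv_Xd_left]
    have hp : HasParity ((d.val : ℕ) : ZMod 2) (P.cu 0 s f) :=
      FA.hasParity_cast (ZMod.natCast_zmod_val d) (P.cu_hasParity 0 s hf.hasParity)
    have h := (nl_sg hD d.val).rmulZ (anti_mem_acts s hf)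
    convert h using 1
    exact anti_lmul _ hp D
  | right D _ i s X hX hD =>
    obtain ⟨f, d, hf, rfl⟩ := FA.exists_isTotal hX
    obtain rfl := Subsingleton.elim i 0
    rw [P.curZ_Xd, conv_Xd_right]
    have hp : HasParity ((d.val : ℕ) : ZMod 2) (P.cu 0 s f) :=
      FA.hasParity_cast (ZMod.natCast_zmod_val d) (P.cu_hasParity 0 s hf.hasParity)
    have h := (nl_sg hD d.val).lmulZ (anti_mem_acts s hf)
    convert h using 1
    exact anti_rmul _ hp D

end Datum

namespace FA

variable {N : ℕ}

/-- The homogeneous components of an element. -/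
def parityPart (d : ZMod 2) (f : FA N) : FA N := (2⁻¹ : ℂ) • (f + ((-1 : ℂ) ^ d.val) • sg 1 f)

theorem parityPart_hasParity (d : ZMod 2) (f : FA N) : HasParity d (parityPart d f) := fun w hw => by
  by_contra h
  refine hw ?_
  rw [parityPart, smul_apply, add_apply, smul_apply, sg_apply, one_mul, ← mul_assoc, ← pow_add]
  have h1 : (((d.val + parity w : ℕ)) : ZMod 2) = (1 : ℕ) := by
    push_cast
    rw [ZMod.natCast_zmod_val]
    have : ∀ d e : ZMod 2, ¬e = d → d + e = 1 := by decide
    exact this d _ h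
  rw [neg_one_pow_congr h1]
  ring

theorem parityPart_add (f : FA N) : parityPart 0 f + parityPart 1 f = f := by
  have h0 : (0 : ZMod 2).val = 0 := rfl
  have h1 : (1 : ZMod 2).val = 1 := rfl
  rw [parityPart, parityPart, h0, h1]
  module

end FA

namespace Datum

variable (P : Datum) {N k l : ℕ}

variable {P} in
theorem anti_mem_relIdeal {a : FA 1} (ha : a ∈ P.relIdeal 1) : P.anti a ∈ P.relIdeal 1 := by
  let K : TwoSidedIdeal (FA 1) := .mk' {a | P.anti a ∈ P.relIdeal 1}
    (by
      rw [Set.mem_ofPred_eq, map_zero]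
      exact zero_mem _)
    (fun {x y} hx hy => by
      rw [Set.mem_ofPred_eq] at hx hy ⊢
      rw [map_add]
      exact add_mem hx hy)
    (fun {x} hx => by
      rw [Set.mem_ofPred_eq] at hx ⊢
      rw [map_neg]
      exact neg_mem hx)
    (fun {x y} hy => by
      rw [Set.mem_ofPred_eq] at hy ⊢
      rw [← FA.parityPart_add x, add_mul, map_add,
        P.anti_mul_even (FA.parityPart_hasParity 0 x),
        P.anti_mul_left (a := 1) (FA.hasParity_cast Nat.cast_one (FA.parityPart_hasParity 1 x))]
      exact add_mem (TwoSidedIdeal.mul_mem_right _ _ _ hy)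
        (TwoSidedIdeal.mul_mem_right _ _ _ (sg_mem_relIdeal hy)))
    (fun {x y} hx => by
      rw [Set.mem_ofPred_eq] at hx ⊢
      rw [← FA.parityPart_add y, mul_add, map_add,
        P.anti_even_mul (FA.parityPart_hasParity 0 y),
        P.anti_mul_right (a := 1) (FA.hasParity_cast Nat.cast_one (FA.parityPart_hasParity 1 y))]
      exact add_mem (TwoSidedIdeal.mul_mem_left _ _ _ hx)
        (TwoSidedIdeal.mul_mem_left _ _ _ (sg_mem_relIdeal hx)))
  have h : P.relIdeal 1 ≤ K := by
    rw [relIdeal, TwoSidedIdeal.span_le]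
    rintro _ ⟨D, hD, p, rfl⟩
    exact (TwoSidedIdeal.mem_mk' _ _ _ _ _ _ _).2 (by
      rw [Set.mem_ofPred_eq]
      exact mem_relIdeal_of_nl (nl_anti hD) p)
  have h' := (TwoSidedIdeal.mem_mk' _ _ _ _ _ _ _).1 (h ha)
  rwa [Set.mem_ofPred_eq] at h'

/-! ### The grading -/

variable {P} in
theorem proj_eq_iff {a b : FA N} : P.proj N a = P.proj N b ↔ a - b ∈ P.relIdeal N :=
  ((P.relIdeal N).ringCon.eq).trans ((P.relIdeal N).rel_iff a b)

theorem proj_surjective (u : P.U N) : ∃ a, P.proj N a = u :=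
  RingCon.mk'_surjective (P.relIdeal N).ringCon u

variable {P} in
theorem proj_mem_grade {d : ZMod 2} {a : FA N} (ha : HasParity d a) : P.proj N a ∈ P.grade N d :=
  ⟨a, ha, rfl⟩

variable {P} in
theorem exists_of_mem_grade {d : ZMod 2} {u : P.U N} (hu : u ∈ P.grade N d) :
    ∃ a : FA N, HasParity d a ∧ P.proj N a = u := by
  obtain ⟨a, ha, rfl⟩ := hu
  exact ⟨a, ha, rfl⟩

theorem isCompl_grade : IsCompl (P.grade N 0) (P.grade N 1) := by
  refine IsCompl.of_eq (Submodule.eq_bot_iff _ |>.2 fun u hu => ?_) (Submodule.eq_top_iff'.2 fun u => ?_)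
  · obtain ⟨a, ha, rfl⟩ := exists_of_mem_grade hu.1
    obtain ⟨b, hb, hab⟩ := exists_of_mem_grade hu.2
    have h1 := proj_eq_iff.1 hab.symm
    have h2 := sg_mem_relIdeal h1
    rw [map_sub, FA.sg_even ha, FA.sg_one_odd hb] at h2
    have h3 := TwoSidedIdeal.mul_mem_left _ (algebraMap ℂ (FA N) 2⁻¹) _ (add_mem h1 h2)
    have e : algebraMap ℂ (FA N) 2⁻¹ * (a - b + (a - -b)) = a - 0 := by
      rw [← Algebra.smul_def]
      module
    rw [e] at h3
    exact (proj_eq_iff.2 h3).trans (map_zero _)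
  · obtain ⟨a, rfl⟩ := P.proj_surjective u
    rw [← FA.parityPart_add a, map_add]
    exact Submodule.add_mem_sup (proj_mem_grade (FA.parityPart_hasParity 0 a))
      (proj_mem_grade (FA.parityPart_hasParity 1 a))

theorem gradedMonoid_grade : SetLike.GradedMonoid (P.grade N) where
  one_mem := by
    rw [← map_one (P.proj N)]
    exact proj_mem_grade FA.hasParity_one
  mul_mem i j u v hu hv := by
    obtain ⟨a, ha, rfl⟩ := exists_of_mem_grade hu
    obtain ⟨b, hb, rfl⟩ := exists_of_mem_grade hv
    rw [← map_mul]
    exact proj_mem_grade (FA.hasParity_mul ha hb)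

theorem nonempty_gradedAlgebra : Nonempty (GradedAlgebra (P.grade N)) := by
  have h : DirectSum.IsInternal (P.grade N) :=
    (DirectSum.isInternal_submodule_iff_isCompl _ (i := 0) (j := 1) (by decide) (by
      ext d
      revert d
      decide)).2 P.isCompl_grade
  exact ⟨{ P.gradedMonoid_grade, h.chooseDecomposition with }⟩

/-! ### The Hopf algebra -/

/-- The homomorphism induced on the quotients. -/
def homOf (Φ : FA k →A[ℂ] FA l) (h : ∀ a ∈ P.relIdeal k, Φ a ∈ P.relIdeal l) : P.Hom k l where
  toAlgHom := RingCon.liftₐ _ ((P.proj l).comp Φ.toAlgHom) fun a b hab => by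
    refine proj_eq_iff.2 ?_
    change Φ a - Φ b ∈ _
    rw [← map_sub]
    exact h _ ((TwoSidedIdeal.rel_iff _ a b).1 hab)
  hat := Φ
  toAlgHom_proj _ := rfl

/-- The coproduct. -/
def comulHom : P.Hom 1 2 := P.homOf (P.delta 0 1) fun a ha =>
  map_mem_relIdeal (M := fun _ => sh 0 + sh 1) (P.delta_degPres 0 1) (P.delta_scalPres 0 1)
    (fun i => by
      have e : (P.delta (0 : Fin 2) 1).comp (FA.slotHom i) = P.delta 0 1 := by
        rw [Subsingleton.elim i 0, FA.slotHom_fin_one]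
        rfl
      rw [e]
      exact P.isGood_delta (by decide)) ha

theorem slotHom_scalPres (i : Fin N) : FA.ScalPres (FA.toCLM (FA.slotHom i)) := fun f hf w hw j _ => by
  change FA.slot i f w ≠ 0 at hw
  rw [FA.slot, FA.incl] at hw
  split_ifs at hw with h
  · by_cases hj : j = i
    · subst hj
      exact hf _ hw 0 (by simp)
    · rw [h j (by rintro ⟨_, rfl⟩; exact hj rfl)]
      rfl
  · exact absurd rfl hw

/-- The antipode, on the quotient. -/
def antipodeLin : P.U 1 →ₗ[ℂ] P.U 1 where
  toFun := Quotient.lift (fun a => P.proj 1 (P.anti a)) fun a b hab => proj_eq_iff.2 (by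
    rw [← map_sub]
    exact anti_mem_relIdeal ((TwoSidedIdeal.rel_iff _ a b).1 hab))
  map_add' u v := by
    obtain ⟨a, rfl⟩ := P.proj_surjective u
    obtain ⟨b, rfl⟩ := P.proj_surjective v
    change P.proj 1 (P.anti (a + b)) = P.proj 1 (P.anti a) + P.proj 1 (P.anti b)
    rw [map_add, map_add]
  map_smul' t u := by
    obtain ⟨a, rfl⟩ := P.proj_surjective u
    change P.proj 1 (P.anti (t • a)) = t • P.proj 1 (P.anti a)
    rw [map_smul, map_smul]

theorem antipodeLin_proj (a : FA 1) : P.antipodeLin (P.proj 1 a) = P.proj 1 (P.anti a) := rfl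

/-- The counit, on the quotient. -/
def counitHom : P.U 1 →ₐ[ℂ] ℂ := RingCon.liftₐ _ FA.counitHat.toAlgHom fun a b hab => by
  change FA.counitHat a = FA.counitHat b
  rw [← sub_eq_zero, ← map_sub]
  exact counitHat_eq_zero ((TwoSidedIdeal.rel_iff _ a b).1 hab)

theorem counitHom_proj (a : FA 1) : P.counitHom (P.proj 1 a) = FA.counitHat a := rfl

theorem algebraMap_proj (t : ℂ) : P.proj N (algebraMap ℂ (FA N) t) = algebraMap ℂ (P.U N) t :=
  (P.proj N).commutes t

theorem comulIdHat_slot_zero (a : FA 1) :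
    P.comulIdHat (FA.slot 0 a) = FA.incl ![0, 1] (P.delta 0 1 a) := by
  have he : StrictMono (![0, 1] : Fin 2 → Fin 3) := by decide
  have h := P.incl_delta ![0, 1] he (i := 0) (j := 1) (by decide) a
  simp only [Matrix.cons_val_zero, Matrix.cons_val_one] at h
  rw [h, comulIdHat, FA.pairHom_slot_zero]

theorem idComulHat_slot_one (a : FA 1) :
    P.idComulHat (FA.slot 1 a) = FA.incl ![1, 2] (P.delta 0 1 a) := by
  have he : StrictMono (![1, 2] : Fin 2 → Fin 3) := by decide
  have h := P.incl_delta ![1, 2] he (i := 0) (j := 1) (by decide) a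
  simp only [Matrix.cons_val_zero, Matrix.cons_val_one] at h
  rw [h, idComulHat, FA.pairHom_slot_one]

/-- The structure of graded Hopf algebra. -/
def hopf : P.GradedHopfStructure where
  comul := P.comulHom
  comulId := P.homOf P.comulIdHat fun _ ha => P.pairHom_mem_relIdeal _
    (P.isGood_delta (by decide)) (isGood_slot 2) (P.delta_scalPres 0 1) (slotHom_scalPres 2) ha
  idComul := P.homOf P.idComulHat fun _ ha => P.pairHom_mem_relIdeal _
    (isGood_slot 0) (P.isGood_delta (by decide)) (slotHom_scalPres 0) (P.delta_scalPres 1 2) ha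
  counit := P.counitHom
  counitHat := FA.counitHat
  counitId := P.homOf counitIdHat fun _ ha => P.pairHom_mem_relIdeal _
    isGood_eps (isGood_slot 0) eps_scalPres (slotHom_scalPres 0) ha
  idCounit := P.homOf idCounitHat fun _ ha => P.pairHom_mem_relIdeal _
    (isGood_slot 0) isGood_eps (slotHom_scalPres 0) eps_scalPres ha
  antipode := P.antipodeLin
  antipodeHat := P.anti
  mulAntipodeId := P.antiId
  mulIdAntipode := P.idAnti
  counit_proj _ := rfl
  antipode_proj _ := rfl
  comulId_slot_zero := P.comulIdHat_slot_zero
  comulId_slot_one a := by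
    change P.comulIdHat (FA.slot 1 a) = _
    rw [comulIdHat, FA.pairHom_slot_one]
    rfl
  idComul_slot_zero a := by
    change P.idComulHat (FA.slot 0 a) = _
    rw [idComulHat, FA.pairHom_slot_zero]
    rfl
  idComul_slot_one := P.idComulHat_slot_one
  counitId_slot_zero a := by
    change counitIdHat (FA.slot 0 a) = _
    rw [counitIdHat, FA.pairHom_slot_zero, FA.eps_apply]
  counitId_slot_one a := by
    change counitIdHat (FA.slot 1 a) = _
    rw [counitIdHat, FA.pairHom_slot_one, FA.slotHom_apply, FA.slot_fin_one]
  idCounit_slot_zero a := by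
    change idCounitHat (FA.slot 0 a) = _
    rw [idCounitHat, FA.pairHom_slot_zero, FA.slotHom_apply, FA.slot_fin_one]
  idCounit_slot_one a := by
    change idCounitHat (FA.slot 1 a) = _
    rw [idCounitHat, FA.pairHom_slot_one, FA.eps_apply]
  mulAntipodeId_mul a b := FA.pair_mul _ _ a b
  mulIdAntipode_mul a b := FA.pair_mul _ _ a b
  comul_grade d u hu := by
    obtain ⟨a, ha, rfl⟩ := exists_of_mem_grade hu
    exact proj_mem_grade ((P.delta_parPres 0 1).map ha)
  counit_odd u hu := by
    obtain ⟨a, ha, rfl⟩ := exists_of_mem_grade hu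
    rw [counitHom_proj, FA.counitHat_apply]
    by_contra h
    have := ha 1 h
    rw [parity_one] at this
    exact absurd this (by decide)
  antipode_grade d u hu := by
    obtain ⟨a, ha, rfl⟩ := exists_of_mem_grade hu
    exact proj_mem_grade (P.anti_parPres.map ha)
  coassoc := by
    refine AlgHom.ext fun u => ?_
    obtain ⟨a, rfl⟩ := P.proj_surjective u
    exact congrArg (fun Φ : FA 1 →A[ℂ] FA 3 => P.proj 3 (Φ a)) P.coassoc_hat
  counit_comul := by
    refine AlgHom.ext fun u => ?_
    obtain ⟨a, rfl⟩ := P.proj_surjective u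
    exact congrArg (fun Φ : FA 1 →A[ℂ] FA 1 => P.proj 1 (Φ a)) P.counit_hat
  comul_counit := by
    refine AlgHom.ext fun u => ?_
    obtain ⟨a, rfl⟩ := P.proj_surjective u
    exact congrArg (fun Φ : FA 1 →A[ℂ] FA 1 => P.proj 1 (Φ a)) P.hat_counit
  antipode_comul a := by
    rw [counitHom_proj, ← algebraMap_proj, ← P.antiId_delta]
    rfl
  comul_antipode a := by
    rw [counitHom_proj, ← algebraMap_proj, ← P.idAnti_delta]
    rfl
  antipode_one := by
    rw [← map_one (P.proj 1), antipodeLin_proj, anti_one]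
  antipode_mul d e u hu v hv := by
    obtain ⟨a, ha, rfl⟩ := exists_of_mem_grade hu
    obtain ⟨b, hb, rfl⟩ := exists_of_mem_grade hv
    rw [← map_mul, antipodeLin_proj, antipodeLin_proj, antipodeLin_proj,
      P.anti_mul_left (FA.hasParity_cast (ZMod.natCast_zmod_val d) ha),
      FA.sg_of_hasParity (P.anti_parPres.map (FA.hasParity_cast (ZMod.natCast_zmod_val e) hb)),
      smul_mul_assoc, map_smul, map_mul]

end Datum

namespace Datum

variable (P : Datum)

/-! ### The structure maps on the generators -/

theorem comul_proj (f : FA 1) : P.hopf.comul.toAlgHom (P.proj 1 f) = P.proj 2 (P.delta 0 1 f) := rfl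

theorem counit_proj (f : FA 1) : P.hopf.counit (P.proj 1 f) = FA.counitHat f := rfl

theorem antipode_proj (f : FA 1) : P.hopf.antipode (P.proj 1 f) = P.proj 1 (P.anti f) := rfl

theorem delta_Xd (f : FA 1) (k : ℤ) :
    P.delta (0 : Fin 2) 1 (Xd deg f k) = Xd deg (P.delta 0 1 f) k :=
  (P.delta_degPres 0 1).map_comp f k

theorem conv_cur {N : ℕ} (i j : Fin N) (s t : Fin N → ℤ) (f g : FA 1) :
    conv (P.cur i s (Xd deg f)) (P.cur j t (Xd deg g)) = Xd deg (P.cu i s f * P.cu j t g) := by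
  rw [cur_Xd, cur_Xd, conv_Xd_Xd]

theorem Xd_slot {N : ℕ} (i : Fin N) (f : FA 1) (k : ℤ) :
    FA.slot i (Xd deg f k) = Xd deg (P.cu i 0 f) k := by
  rw [← cur_Xd, cur, smul_zero, P.qPow_zero, one_mul]

theorem comul_xp (k : ℤ) : P.delta 0 1 (xp k) =
    FA.slot 0 (xp k) + conv (P.cur 0 ![1, 0] phi) (P.cur 1 ![2, 0] xp) k := by
  have e : (2 : ℤ) • sh (0 : Fin 2) = ![2, 0] := by ext x; fin_cases x <;> rfl
  rw [FA.xp_eq, FA.phi_eq, conv_cur, P.Xd_slot, delta_Xd, delta_xp, dxp_coe, e, sh_two_zero, Xd_add]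
  rfl

theorem comul_xm (k : ℤ) : P.delta 0 1 (xm k) =
    FA.slot 1 (xm k) + conv (P.cur 0 ![0, 2] xm) (P.cur 1 ![0, 1] psi) k := by
  have e : (2 : ℤ) • sh (1 : Fin 2) = ![0, 2] := by ext x; fin_cases x <;> rfl
  rw [FA.xm_eq, FA.psi_eq, conv_cur, P.Xd_slot, delta_Xd, delta_xm, dxm_coe, e, sh_two_one, Xd_add,
    add_comm]
  rfl

theorem comul_phi (k : ℤ) : P.delta 0 1 (phi k) =
    conv (P.cur 0 ![0, -1] phi) (P.cur 1 ![1, 0] phi) k := by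
  have e : -sh (1 : Fin 2) = ![0, -1] := by ext x; fin_cases x <;> rfl
  rw [FA.phi_eq, conv_cur, delta_Xd, P.delta_phi (by decide), dphi_coe, e, sh_two_zero]

theorem comul_psi (k : ℤ) : P.delta 0 1 (psi k) =
    conv (P.cur 0 ![0, 1] psi) (P.cur 1 ![-1, 0] psi) k := by
  have e : -sh (0 : Fin 2) = ![-1, 0] := by ext x; fin_cases x <;> rfl
  rw [FA.psi_eq, conv_cur, delta_Xd, P.delta_psi (by decide), dpsi_coe, e, sh_two_one]

theorem comul_qPow : P.delta (0 : Fin 2) 1 (P.qPow ![2]) =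
    FA.slot 0 (P.qPow ![2]) * FA.slot 1 (P.qPow ![2]) := by
  have h := fun i => hom_qPow (P := P) (Φ := FA.slotHom i) (M := fun _ => sh i) (fun j => by
    rw [Subsingleton.elim j 0]; exact slotHom_cc (N := 2) i) ![2]
  have h0 : FA.slot 0 (P.qPow ![2]) = P.qPow ![2, 0] := (h 0).trans (congrArg P.qPow (by
    ext x; fin_cases x <;> simp))
  have h1 : FA.slot 1 (P.qPow ![2]) = P.qPow ![0, 2] := (h 1).trans (congrArg P.qPow (by
    ext x; fin_cases x <;> simp))
  rw [h0, h1, ← P.qPow_add, hom_qPow (P := P) (Φ := P.delta 0 1) (M := fun _ => sh 0 + sh 1) fun j => by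
    rw [Subsingleton.elim j 0]
    exact (P.isGood_delta (by decide)).c]
  congr 1
  ext x
  fin_cases x <;> simp

theorem counit_Xd (f : FA 1) (k : ℤ) :
    FA.counitHat (Xd deg f k) = if k = 0 then FA.counitHat f else 0 := by
  rw [FA.counitHat_apply, FA.counitHat_apply, Xd, map_one, toAdd_one]
  congr

theorem counit_vert (y : ℤ → Letter) : FA.counitHat (FA.vert (FA.tot y)) = 1 := by
  have h := eps_vert (l := 0) y
  rw [FA.eps_apply, Algebra.algebraMap_eq_smul_one] at h
  have h2 := congrArg (fun f : FA 0 => f 1) h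
  simpa [FA.smul_apply, FA.one_apply] using h2

theorem counit_qPow (t : Fin 1 → ℤ) : FA.counitHat (P.qPow t) = 1 := by
  rw [FA.counitHat_apply, qPow, FA.cexp]
  simp

theorem anti_Xd (f : FA 1) (k : ℤ) : P.anti (Xd deg f k) = Xd deg (P.anti f) k :=
  P.anti_degPres.map_comp f k

theorem antipode_xp (k : ℤ) : P.anti (xp k) =
    -conv (P.cur 0 ![-1] phiInv) (P.cur 0 ![-2] xp) k := by
  have e1 : -sh (0 : Fin 1) = ![-1] := by ext x; fin_cases x; rfl
  have e2 : (-2 : ℤ) • sh (0 : Fin 1) = ![-2] := by ext x; fin_cases x; rfl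
  rw [FA.xp_eq, FA.phiInv_eq, conv_cur, anti_Xd, anti_xp, antiXp_coe, e1, e2, Xd_neg]
  rfl

theorem antipode_xm (k : ℤ) : P.anti (xm k) =
    -conv (P.cur 0 ![-2] xm) (P.cur 0 ![-1] psiInv) k := by
  have e1 : -sh (0 : Fin 1) = ![-1] := by ext x; fin_cases x; rfl
  have e2 : (-2 : ℤ) • sh (0 : Fin 1) = ![-2] := by ext x; fin_cases x; rfl
  rw [FA.xm_eq, FA.psiInv_eq, conv_cur, anti_Xd, anti_xm, antiXm_coe, e1, e2, Xd_neg]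
  rfl

theorem antipode_phi (k : ℤ) : P.anti (phi k) = phiInv k := by
  rw [FA.phi_eq, FA.phiInv_eq, anti_Xd, anti_phi]

theorem antipode_psi (k : ℤ) : P.anti (psi k) = psiInv k := by
  rw [FA.psi_eq, FA.psiInv_eq, anti_Xd, anti_psi]

end Datum

end SuperCurrent

end

theorem mainTheorem2 (P : Datum) :
    (∀ N, Nonempty (GradedAlgebra (P.grade N))) ∧
    ∃ H : P.GradedHopfStructure,
      -- coproduct
      (H.comul.toAlgHom (P.proj 1 (P.qPow ![2])) =
          P.proj 2 (FA.slot 0 (P.qPow ![2]) * FA.slot 1 (P.qPow ![2])) ∧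
        H.comul.toAlgHom (P.proj 1 (FA.cc 0)) = P.proj 2 (FA.cc 0 + FA.cc 1) ∧
        ∀ k : ℤ,
          H.comul.toAlgHom (P.proj 1 (xp k)) =
              P.proj 2 (FA.slot 0 (xp k) + conv (P.cur 0 ![1, 0] phi) (P.cur 1 ![2, 0] xp) k) ∧
          H.comul.toAlgHom (P.proj 1 (xm k)) =
              P.proj 2 (FA.slot 1 (xm k) + conv (P.cur 0 ![0, 2] xm) (P.cur 1 ![0, 1] psi) k) ∧
          H.comul.toAlgHom (P.proj 1 (phi k)) =
              P.proj 2 (conv (P.cur 0 ![0, -1] phi) (P.cur 1 ![1, 0] phi) k) ∧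
          H.comul.toAlgHom (P.proj 1 (psi k)) =
              P.proj 2 (conv (P.cur 0 ![0, 1] psi) (P.cur 1 ![-1, 0] psi) k)) ∧
      -- counit
      (H.counit (P.proj 1 (P.qPow ![2])) = 1 ∧
        H.counit (P.proj 1 (FA.cc 0)) = 0 ∧
        ∀ k : ℤ,
          H.counit (P.proj 1 (phi k)) = (if k = 0 then 1 else 0) ∧
          H.counit (P.proj 1 (psi k)) = (if k = 0 then 1 else 0) ∧
          H.counit (P.proj 1 (xp k)) = 0 ∧
          H.counit (P.proj 1 (xm k)) = 0) ∧
      -- antipode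
      (H.antipode (P.proj 1 (P.qPow ![2])) = P.proj 1 (P.qPow ![-2]) ∧
        H.antipode (P.proj 1 (FA.cc 0)) = - P.proj 1 (FA.cc 0) ∧
        ∀ k : ℤ,
          H.antipode (P.proj 1 (xp k)) =
              - P.proj 1 (conv (P.cur 0 ![-1] phiInv) (P.cur 0 ![-2] xp) k) ∧
          H.antipode (P.proj 1 (xm k)) =
              - P.proj 1 (conv (P.cur 0 ![-2] xm) (P.cur 0 ![-1] psiInv) k) ∧
          H.antipode (P.proj 1 (phi k)) = P.proj 1 (phiInv k) ∧
          H.antipode (P.proj 1 (psi k)) = P.proj 1 (psiInv k)) := by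
  refine ⟨fun N => P.nonempty_gradedAlgebra, P.hopf,
    ⟨?_, ?_, fun k => ⟨?_, ?_, ?_, ?_⟩⟩, ⟨?_, ?_, fun k => ⟨?_, ?_, ?_, ?_⟩⟩,
    ⟨?_, ?_, fun k => ⟨?_, ?_, ?_, ?_⟩⟩⟩
  · rw [P.comul_proj, P.comul_qPow]
  · rw [P.comul_proj, P.delta_cc]
  · rw [P.comul_proj, P.comul_xp]
  · rw [P.comul_proj, P.comul_xm]
  · rw [P.comul_proj, P.comul_phi]
  · rw [P.comul_proj, P.comul_psi]
  · rw [P.counit_proj, P.counit_qPow]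
  · rw [P.counit_proj, FA.counitHat_apply, FA.cc_one]
  · rw [P.counit_proj, FA.phi_eq, Datum.counit_Xd, FA.phiT, Datum.counit_vert]
  · rw [P.counit_proj, FA.psi_eq, Datum.counit_Xd, FA.psiT, Datum.counit_vert]
  · rw [P.counit_proj, FA.xp_eq, Datum.counit_Xd, FA.counitHat_apply, FA.xpT, FA.tot_one, ite_self]
  · rw [P.counit_proj, FA.xm_eq, Datum.counit_Xd, FA.counitHat_apply, FA.xmT, FA.tot_one, ite_self]
  · rw [P.antipode_proj, Datum.anti_qPow]
    congr 2
  · rw [P.antipode_proj, P.anti_cc, map_neg]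
  · rw [P.antipode_proj, P.antipode_xp, map_neg]
  · rw [P.antipode_proj, P.antipode_xm, map_neg]
  · rw [P.antipode_proj, P.antipode_phi]
  · rw [P.antipode_proj, P.antipode_psi]
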